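/- **Setting.** Let $A$ be a closed linear operator with domain $D(A)$ in a complex Banach space $X$, let $G\subset\mathbb C$ be open, and write $A_\zeta=A-\zeta I$. For $\zeta\in\mathbb C$, $\nu>0$ let $E_{\zeta,\nu}$ be the Banach space of all $v\in\bigcap_k D(A^k)$ for which there is $C>0$ with $\|A_\zeta^k v\|\le C\nu^k\|v\|$ $(k\ge 1)$, with norm $\sup_{k\ge0}\nu^{-k}\|A_\zeta^kv\|$. For a finite set $\sigma$ of pairs $(\zeta,\nu)$ with $\zeta\in G$, $0<\nu<\mathrm{dist}(\zeta,\partial G)$ (the distance being $\infty$ if $\partial G=\emptyset$) let $E_\sigma=\sum_{(\zeta,\nu)\in\sigma}E_{\zeta,\nu}\subset X$ with the sum norm, and let $Exp_{A,G}(X)=\bigcup_\sigma E_\sigma$ be their inductive limit: a function on a compact interval is continuous, $C^k$ or absolutely continuous with values in $Exp_{A,G}(X)$ if it is so as a function into some $E_\sigma$; on a non-compact interval, $C$ and $C^k$ mean that this holds on every compact subinterval. For $g$ analytic on $G$ and $u=\sum_\zeta u_\zeta$ (a finite sum over points $\zeta\in G$, with $u_\zeta\in E_{\zeta,\nu_\zeta}$,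 $0<\nu_\zeta<\mathrm{dist}(\zeta,\partial G)$) put $$g(A)u=\sum_\zeta\sum_{n\ge0}\frac{g^{(n)}(\zeta)}{n!}A_\zeta^n u_\zeta .$$ So that this does not depend on the representation of $u$, assume: on no connected open set $W$ containing a bounded connected component of $\mathbb C\setminus G$ is there a nonzero holomorphic $x:W\to X$ with $x(\zeta)\in D(A)$ and $Ax(\zeta)=\zeta x(\zeta)$ for all $\zeta\in W$ (this is no condition if $\mathbb C\setminus G$ has no bounded component, and it always holds if the eigenvalues of $A$ have no interior point). Let $m\ge1$ be an integer, $\mu\in(m-1,m]$, $\lambda$ a finite positive Borel measure on $[0,m-1]$, and $f:[0,m-1]\times G\to\mathbb C$ jointly continuous and, for each $\alpha$, analytic in $z\in G$. For $\beta>0$ let $J^\beta g(t)=\frac1{\Gamma(\beta)}\int_0^t(t-s)^{\beta-1}g(s)\,ds$, and $J^0g=g$. For $\alpha\ge 0$ and $n=\lceil\alpha\rceil$ let $D_*^\alpha g=J^{n-\alpha}g^{(n)}$ (Caputo–Djrbashian) and $D_+^\alpha g=\frac{d^n}{dt^n}J^{n-\alpha}g$ (Riemann–Liouville). Consider $$L^\Lambda[u](t)\equiv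 D_*^\mu u(t)+\int_{[0,m-1]}f(\alpha,A)D_*^\alpha u(t)\,\lambda(d\alpha)=h(t)\quad(t>0),\qquad u^{(k)}(0)=\varphi_k\quad(k=0,\dots,m-1).$$ A solution is a function $u\in C^{(m)}[t>0;Exp_{A,G}(X)]\cap C^{(m-1)}[t\ge0;Exp_{A,G}(X)]$ for which all these expressions are defined (the integrals converging as Bochner integrals in $X$) and which satisfies the equation and the initial conditions. Let $$\Delta(s,z)=s^\mu+\int_{[0,m-1]}f(\alpha,z)s^\alpha\,\lambda(d\alpha),\qquad c_\beta(t,z)=\mathcal L^{-1}\Big[\frac{s^\beta}{\Delta(s,z)}\Big](t),$$ $$S_k(t,z)=c_{\mu-k-1}(t,z)+\int_{(k,m-1]}f(\alpha,z)\,c_{\alpha-k-1}(t,z)\,\lambda(d\alpha),$$ where $\mathcal L^{-1}[F]$ is the continuous function of exponential growth on $[0,\infty)$ whose Laplace transform equals $F$ on some half-plane $\mathrm{Re}\,s>\gamma$. **Theorem.** Let $\varphi_k\in Exp_{A,G}(X)$ for $k=0,\dots,m-1$, let $h\in AC[0\le t\le T;Exp_{A,G}(X)]$ for every $T>0$, and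 let $D_+^{m-\mu}h$ exist and be continuous on $[0,\infty)$ with values in $Exp_{A,G}(X)$. Then, for $k=0,\dots,m-1$, $z\in G$ and $t\ge 0$, the inverse Laplace transforms and the integral in the definition of $S_k(t,z)$ exist, and $S_k(t,\cdot)$ is analytic on $G$; and the Cauchy problem has a solution $u$ on $[0,\infty)$, and only one. It is given by $$u(t)=\sum_{k=0}^{m-1}S_k(t,A)\varphi_k+\int_0^tS_{m-1}(t-\tau,A)\,D_+^{m-\mu}h(\tau)\,d\tau ,\qquad t\ge0,$$ where the integral converges as a Bochner integral in $X$. -/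

import Mathlib

open Set Filter Topology MeasureTheory

noncomputable section

namespace FracDuhamel

/-! ### Fractional integrals and derivatives -/

section Fractional

variable {X : Type*} [NormedAddCommGroup X] [NormedSpace ℂ X]

/-- The fractional integral `J^β g (t) = 1/Γ(β) ∫₀ᵗ (t-s)^(β-1) g(s) ds`, with `J^0 g = g`. -/
def fracInt (β : ℝ) (g : ℝ → X) (t : ℝ) : X :=
  if β = 0 then g t
  else (1 / Real.Gamma β) • ∫ s in (0 : ℝ)..t, (t - s) ^ (β - 1) • g s

/-- The `n`-th derivative of a function on `[0, ∞)` (one-sided at `0`). -/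
def nthDeriv (n : ℕ) (g : ℝ → X) (t : ℝ) : X :=
  iteratedDerivWithin n g (Ici 0) t

/-- The Caputo-Djrbashian derivative `D_*^α g = J^(n-α) g^(n)`, where `n - 1 < α ≤ n`. -/
def caputo (α : ℝ) (g : ℝ → X) (t : ℝ) : X :=
  fracInt ((⌈α⌉₊ : ℝ) - α) (nthDeriv ⌈α⌉₊ g) t

/-- The Riemann-Liouville derivative `D_+^α g = (d/dt)^n J^(n-α) g`, where `n - 1 < α ≤ n`. -/
def riemannLiouville (α : ℝ) (g : ℝ → X) (t : ℝ) : X :=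
  nthDeriv ⌈α⌉₊ (fracInt ((⌈α⌉₊ : ℝ) - α) g) t

end Fractional

/-! ### Vectors of exponential type and the operator calculus -/

section Calculus

variable {X : Type*} [NormedAddCommGroup X] [NormedSpace ℂ X]

open Classical in
/-- The operator `A_ζ = A - ζ I` on `D(A)` (the value outside `D(A)` is never used). -/
def shiftOp (A : X →ₗ.[ℂ] X) (ζ : ℂ) (v : X) : X :=
  if h : v ∈ A.domain then A ⟨v, h⟩ - ζ • v else 0

/-- The powers `A_ζ^n v`. -/
def shiftPow (A : X →ₗ.[ℂ] X) (ζ : ℂ) (n : ℕ) (v : X) : X :=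
  (shiftOp A ζ)^[n] v

/-- The vectors of exponential type `ν` for `A_ζ`: those `v` in the domains of all powers of
`A_ζ` with `‖A_ζ^n v‖ ≤ C ν^n ‖v‖` for all `n ≥ 1`. -/
def ExpType (A : X →ₗ.[ℂ] X) (ζ : ℂ) (ν : ℝ) : Set X :=
  {v | (∀ n : ℕ, shiftPow A ζ n v ∈ A.domain) ∧
    ∃ C : ℝ, 0 < C ∧ ∀ n : ℕ, 1 ≤ n → ‖shiftPow A ζ n v‖ ≤ C * ν ^ n * ‖v‖}

/-- The Banach norm `sup_n ν^(-n) ‖A_ζ^n v‖` of the space of vectors of type `ν` for `A_ζ`. -/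
def expNorm (A : X →ₗ.[ℂ] X) (ζ : ℂ) (ν : ℝ) (v : X) : ℝ :=
  ⨆ n : ℕ, ‖shiftPow A ζ n v‖ / ν ^ n

/-- The pairs `(ζ, ν)` with `ζ ∈ G` and `0 < ν < dist(ζ, ∂G)` (the distance is `∞` if `∂G = ∅`). -/
def Admissible (G : Set ℂ) (p : ℂ × ℝ) : Prop :=
  p.1 ∈ G ∧ 0 < p.2 ∧ ENNReal.ofReal p.2 < Metric.infEDist p.1 (frontier G)

/-- `u = ∑_{ζ ∈ s} v ζ` is a finite sum of vectors `v ζ` of exponential type less than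
`dist(ζ, ∂G)` for `A_ζ`, with all `ζ ∈ G`. -/
def IsRepr (A : X →ₗ.[ℂ] X) (G : Set ℂ) (u : X) (r : Finset ℂ × (ℂ → X)) : Prop :=
  (∀ ζ ∈ r.1, ∃ ν : ℝ, Admissible G (ζ, ν) ∧ r.2 ζ ∈ ExpType A ζ ν) ∧ u = ∑ ζ ∈ r.1, r.2 ζ

/-- The space `Exp_{A,G}(X)`. -/
def ExpSpace (A : X →ₗ.[ℂ] X) (G : Set ℂ) : Set X :=
  {u | ∃ r, IsRepr A G u r}

/-- `g_ζ(A) v = ∑ₙ g^(n)(ζ)/n! A_ζ^n v`. -/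
def localCalc (A : X →ₗ.[ℂ] X) (g : ℂ → ℂ) (ζ : ℂ) (v : X) : X :=
  ∑' n : ℕ, (iteratedDeriv n g ζ / (n.factorial : ℂ)) • shiftPow A ζ n v

open Classical in
/-- `g(A) u = ∑_ζ g_ζ(A) u_ζ` for `u = ∑_ζ u_ζ` in `Exp_{A,G}(X)`. -/
def funCalc (A : X →ₗ.[ℂ] X) (G : Set ℂ) (g : ℂ → ℂ) (u : X) : X :=
  if h : ∃ r, IsRepr A G u r then
    ∑ ζ ∈ h.choose.1, localCalc A g ζ (h.choose.2 ζ)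
  else 0

/-- There is no nonzero holomorphic field of eigenvectors, `A x(ζ) = ζ x(ζ)`, on a connected
open set that contains a hole of `G` (a bounded component of `ℂ ∖ G`). -/
def NoEigenfieldOnHoles (A : X →ₗ.[ℂ] X) (G : Set ℂ) : Prop :=
  ∀ W : Set ℂ, IsOpen W → IsConnected W →
    (∃ z ∈ Gᶜ, Bornology.IsBounded (connectedComponentIn Gᶜ z) ∧
      connectedComponentIn Gᶜ z ⊆ W) →
    ∀ x : ℂ → X, DifferentiableOn ℂ x W →
      (∀ ζ ∈ W, ∃ h : x ζ ∈ A.domain, A ⟨x ζ, h⟩ = ζ • x ζ) →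
      ∀ ζ ∈ W, x ζ = 0

end Calculus

/-! ### Functions with values in `Exp_{A,G}(X)`

`Exp_{A,G}(X)` is the inductive limit of the Banach spaces `E_σ`, the sums of finitely many spaces
of vectors of exponential type `ν` for `A_ζ`, `(ζ, ν) ∈ σ`.  Convergence in it is convergence
in one of the `E_σ`, and regularity of functions on a compact interval is regularity as a function
into one of the `E_σ`. -/

section Functions

variable {X : Type*} [NormedAddCommGroup X] [NormedSpace ℂ X]

/-- The space `E_σ`. -/
def stepSpace (A : X →ₗ.[ℂ] X) (σ : Finset (ℂ × ℝ)) : Set X :=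
  {v | ∃ w : ℂ × ℝ → X, (∀ p ∈ σ, w p ∈ ExpType A p.1 p.2) ∧ v = ∑ p ∈ σ, w p}

/-- The sum norm of `E_σ`. -/
def stepNorm (A : X →ₗ.[ℂ] X) (σ : Finset (ℂ × ℝ)) (v : X) : ℝ :=
  sInf {r : ℝ | ∃ w : ℂ × ℝ → X, (∀ p ∈ σ, w p ∈ ExpType A p.1 p.2) ∧ v = ∑ p ∈ σ, w p ∧
    r = ∑ p ∈ σ, expNorm A p.1 p.2 (w p)}

/-- `u` is a continuous function from `J` to `E_σ`. -/
def StepContinuousOn (A : X →ₗ.[ℂ] X) (σ : Finset (ℂ × ℝ)) (J : Set ℝ) (u : ℝ → X) : Prop :=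
  ∀ t ∈ J, u t ∈ stepSpace A σ ∧
    Tendsto (fun s => stepNorm A σ (u s - u t)) (𝓝[J] t) (𝓝 0)

/-- `u'` is the derivative of `u : J → E_σ`, in the norm of `E_σ`. -/
def StepHasDerivOn (A : X →ₗ.[ℂ] X) (σ : Finset (ℂ × ℝ)) (J : Set ℝ) (u u' : ℝ → X) : Prop :=
  ∀ t ∈ J, Tendsto (fun s => stepNorm A σ ((s - t)⁻¹ • (u s - u t) - u' t)) (𝓝[J \ {t}] t) (𝓝 0)

/-- `u ∈ C^(k)[I; Exp_{A,G}(X)]`, for an interval `I` in `[0, ∞)`. -/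
def ExpContDiffOn (A : X →ₗ.[ℂ] X) (G : Set ℂ) (k : ℕ) (I : Set ℝ) (u : ℝ → X) : Prop :=
  ∀ a b : ℝ, a ≤ b → Icc a b ⊆ I → ∃ σ : Finset (ℂ × ℝ), (∀ p ∈ σ, Admissible G p) ∧
    (∀ j ≤ k, StepContinuousOn A σ (Icc a b) (nthDeriv j u)) ∧
    (∀ j < k, StepHasDerivOn A σ (Icc a b) (nthDeriv j u) (nthDeriv (j + 1) u))

/-- `u ∈ AC[0 ≤ t ≤ T; Exp_{A,G}(X)]`. -/
def ExpAbsContOn (A : X →ₗ.[ℂ] X) (G : Set ℂ) (T : ℝ) (u : ℝ → X) : Prop :=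
  ∃ σ : Finset (ℂ × ℝ), (∀ p ∈ σ, Admissible G p) ∧
    (∀ t ∈ Icc 0 T, u t ∈ stepSpace A σ) ∧
    ∀ ε : ℝ, 0 < ε → ∃ δ : ℝ, 0 < δ ∧ ∀ (n : ℕ) (a b : Fin n → ℝ),
      (∀ i, 0 ≤ a i ∧ a i ≤ b i ∧ b i ≤ T) →
      (∀ i j, i ≠ j → Disjoint (Ioo (a i) (b i)) (Ioo (a j) (b j))) →
      ∑ i, (b i - a i) < δ → ∑ i, stepNorm A σ (u (b i) - u (a i)) < ε

end Functions

/-! ### Solution operators -/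

section Symbols

/-- `c` is the inverse Laplace transform of `F`: `c` is continuous on `[0, ∞)`, of exponential
growth, and `∫₀^∞ e^(-st) c(t) dt = F(s)` in some half-plane `Re s > γ`. -/
def IsInverseLaplace (F : ℂ → ℂ) (c : ℝ → ℂ) : Prop :=
  ContinuousOn c (Ici 0) ∧ ∃ C γ : ℝ, (∀ t : ℝ, 0 ≤ t → ‖c t‖ ≤ C * Real.exp (γ * t)) ∧
    ∀ s : ℂ, γ < s.re → ∫ t in Ioi (0 : ℝ), Complex.exp (-(s * t)) * c t = F s

open Classical in
/-- The inverse Laplace transform (its values on `[0, ∞)` are determined by `F`). -/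
def inverseLaplace (F : ℂ → ℂ) : ℝ → ℂ :=
  if h : ∃ c, IsInverseLaplace F c then h.choose else 0

/-- The characteristic function `Δ(s, z) = s^μ + ∫ f(α, z) s^α lam(dα)`. -/
def charSymbol (μ : ℝ) (lam : Measure ℝ) (f : ℝ → ℂ → ℂ) (s z : ℂ) : ℂ :=
  s ^ (μ : ℂ) + ∫ α, f α z * s ^ (α : ℂ) ∂lam

/-- The function `s^β / Δ(s, z)`. -/
def resolventSymbol (μ : ℝ) (lam : Measure ℝ) (f : ℝ → ℂ → ℂ) (β : ℝ) (z s : ℂ) : ℂ :=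
  s ^ (β : ℂ) / charSymbol μ lam f s z

/-- `c_β(t, z) = 𝓛⁻¹[s^β / Δ(s, z)](t)`. -/
def cSymbol (μ : ℝ) (lam : Measure ℝ) (f : ℝ → ℂ → ℂ) (β t : ℝ) (z : ℂ) : ℂ :=
  inverseLaplace (resolventSymbol μ lam f β z) t

/-- `S_k(t, z) = c_{μ-k-1}(t, z) + ∫_{(k, m-1]} f(α, z) c_{α-k-1}(t, z) lam(dα)`. -/
def solSymbol (m : ℕ) (μ : ℝ) (lam : Measure ℝ) (f : ℝ → ℂ → ℂ) (k : ℕ) (t : ℝ) (z : ℂ) : ℂ :=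
  cSymbol μ lam f (μ - k - 1) t z +
    ∫ α in Ioc (k : ℝ) ((m : ℝ) - 1), f α z * cSymbol μ lam f (α - k - 1) t z ∂lam

end Symbols

section Problem

variable {X : Type*} [NormedAddCommGroup X] [NormedSpace ℂ X]

/-- The solution operator `S_k(t, A)` on `Exp_{A,G}(X)`. -/
def solOp (A : X →ₗ.[ℂ] X) (G : Set ℂ) (m : ℕ) (μ : ℝ) (lam : Measure ℝ) (f : ℝ → ℂ → ℂ)
    (k : ℕ) (t : ℝ) (v : X) : X :=
  funCalc A G (solSymbol m μ lam f k t) v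

/-- `u` solves `D_*^μ u + ∫ f(α, A) D_*^α u lam(dα) = h` for `t > 0`, `u^(k)(0) = φ_k` for `k < m`,
in `C^(m)[t > 0; Exp_{A,G}(X)] ∩ C^(m-1)[t ≥ 0; Exp_{A,G}(X)]`. -/
structure IsSolution (A : X →ₗ.[ℂ] X) (G : Set ℂ) (m : ℕ) (μ : ℝ) (lam : Measure ℝ)
    (f : ℝ → ℂ → ℂ) (φ : Fin m → X) (h : ℝ → X) (u : ℝ → X) : Prop where
  contDiff_pos : ExpContDiffOn A G m (Ioi 0) u
  contDiff_nonneg : ExpContDiffOn A G (m - 1) (Ici 0) u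
  /-- The integral in `D_*^μ u(t)` converges. -/
  caputo_top : μ < m → ∀ t : ℝ, 0 < t → IntervalIntegrable
    (fun s => (t - s) ^ ((m : ℝ) - μ - 1) • nthDeriv m u s) volume 0 t
  /-- `D_*^α u(t)` lies in the domain of `f(α, A)`. -/
  caputo_mem : ∀ t : ℝ, 0 < t → ∀ α ∈ Icc (0 : ℝ) ((m : ℝ) - 1), caputo α u t ∈ ExpSpace A G
  /-- The integral over the orders `α` converges. -/
  integrable : ∀ t : ℝ, 0 < t → Integrable (fun α => funCalc A G (f α) (caputo α u t)) lam
  equation : ∀ t : ℝ, 0 < t →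
    caputo μ u t + ∫ α, funCalc A G (f α) (caputo α u t) ∂lam = h t
  initial : ∀ k : Fin m, nthDeriv k u 0 = φ k

/-- `∑_k S_k(t, A) φ_k + ∫₀ᵗ S_{m-1}(t-τ, A) D_+^(m-μ) h(τ) dτ`. -/
def duhamelSol (A : X →ₗ.[ℂ] X) (G : Set ℂ) (m : ℕ) (μ : ℝ) (lam : Measure ℝ)
    (f : ℝ → ℂ → ℂ) (φ : Fin m → X) (h : ℝ → X) (t : ℝ) : X :=
  (∑ k : Fin m, solOp A G m μ lam f k t (φ k)) +
    ∫ τ in (0 : ℝ)..t, solOp A G m μ lam f (m - 1) (t - τ) (riemannLiouville ((m : ℝ) - μ) h τ)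

end Problem

end FracDuhamel

end

/-! Two things have to be shown: that `g(A)` does not depend on the representation, and that the
equation with the operators `f(α, A)` can then be solved as a Volterra equation in Banach spaces.

Independence. The vectors of type `ν` for `A_ζ` form a Banach space on which `A_ζ` is a bounded
operator `N` with `‖N‖ ≤ ν`, and `g(A)` is there a Cauchy integral of `g` against the resolvent of
`ζ + N`. If finitely many such vectors add up to zero, the sum `x(w)` of their local resolvents
satisfies `A x(w) = w x(w)` off the union `K` of the discs. It vanishes near infinity, since its
coefficients there are `A^n` applied to the zero sum. It vanishes on each bounded component of `Kᶜ`
that leaves `G`, since such a component contains a hole of `G` and the assumption on eigenfields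
applies (`localRes_eq_zero`). The bounded components inside `G` are added to `K`. For a cutoff `χ`
that is 1 near the filled set, the Cauchy-Pompeiu formula turns the sum of the `g(A)`-images into an
area integral of `∂̄χ · g · x`, where at every point `∂̄χ` or `x` is zero (`sum_powerCalc_eq_zero`).
Hence the `f(α, A)` act on each `E_σ` as commuting bounded operators that depend continuously on
`α`.

Resolvent functions. The order of fractional integration is taken as the variable. For bounded
coefficients `a(α)` consider `F(b) + ∫ a(α) F(b + μ - α) lam(dα) = J^b v`. The delays `μ - α` are at
least `δ = μ - (m - 1) > 0`, and `J^b v(t)` decays like `ω^(-b)` in `b` at the price of a factor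
`e^(2ωt)`. For large `ω` the integral operator is therefore a contraction, and the Neumann series
`delaySol` is the only solution with this decay. Uniqueness (`IsDelay.eq_delaySol`) produces every
identity needed: `J^x F(y) = F(x + y)` (`IsDelay.fracInt_delayFrac`), the Laplace transform
`s^(μ-x-1)/Δ` for `v = 1` (`IsDelay.laplace_delayFrac`), and compatibility with bounded maps that
intertwine the coefficients (`IsDelay.map_delaySol`). The last one, used for point evaluations on
disc algebras and for the operator calculus, gives analyticity of `S_k(t, ·)` and the action of
`S_k(t, A)` on `E_σ` (`stepCalc_solSymbol`).

Existence. On a bounded time interval all data lie in one `E_σ`. The derivative of order `β` of the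
proposed solution is the explicit `derivTerm`: polynomial terms `J^(k-β) φ_k`, corrected by the
solution for a memory source that cancels their lower order terms, plus the solution for `D_+^(m-μ)
h` at order `m - β`. The equation is the delay equation at order `m - μ`
(`IsBoundedModel.derivTerm_add`) together with `h = J^(m-μ) D_+^(m-μ) h`
(`fracInt_riemannLiouville`).

Uniqueness. The `(m-1)`-st derivative `v` of a difference of two solutions satisfies `v = -J^δ
(lower order terms in v)`. This map is a contraction for the weight `e^(ωt)`, so `v = 0`
(`IsBoundedModel.eq_zero`). -/

open Set Filter Topology MeasureTheory

noncomputable section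

namespace FracDuhamel

/-! ### Power series of an operator -/

section PowerCalculus

variable {E : Type*} [NormedAddCommGroup E] [NormedSpace ℂ E]

/-- The Taylor coefficients `g^(n)(ζ)/n!`. -/
def taylorCoeff (g : ℂ → ℂ) (ζ : ℂ) (n : ℕ) : ℂ := iteratedDeriv n g ζ / (n.factorial : ℂ)

/-- The power series `∑ g^(n)(ζ)/n! N^n`. -/
def powerCalc (N : E →L[ℂ] E) (ζ : ℂ) (g : ℂ → ℂ) : E →L[ℂ] E :=
  ∑' n : ℕ, taylorCoeff g ζ n • N ^ n

/-- The exponent 0 is the reason for a separate proof: on the zero space the identity has norm 0,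
and `E` is not assumed nontrivial. -/
theorem opNorm_pow_le_pow {N : E →L[ℂ] E} {ν : ℝ} (hN : ‖N‖ ≤ ν) (n : ℕ) : ‖N ^ n‖ ≤ ν ^ n := by
  induction n with
  | zero => rw [pow_zero, pow_zero]; exact ContinuousLinearMap.norm_id_le
  | succ k ih =>
    rw [pow_succ, pow_succ]
    exact (norm_mul_le _ _).trans
      (mul_le_mul ih hN (norm_nonneg _) (pow_nonneg ((norm_nonneg _).trans hN) _))

theorem norm_taylorCoeff_le {g : ℂ → ℂ} {ζ : ℂ} {ρ C : ℝ} (hρ : 0 < ρ)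
    (hg : DiffContOnCl ℂ g (Metric.ball ζ ρ)) (hC : ∀ z ∈ Metric.sphere ζ ρ, ‖g z‖ ≤ C) (n : ℕ) :
    ‖taylorCoeff g ζ n‖ ≤ C / ρ ^ n := by
  have h := Complex.norm_iteratedDeriv_le_of_forall_mem_sphere_norm_le n hρ hg hC
  have hn : (0 : ℝ) < n.factorial := by exact_mod_cast n.factorial_pos
  rw [taylorCoeff, norm_div, Complex.norm_natCast, div_le_iff₀ hn]
  calc _ ≤ _ := h
    _ = _ := by ring

theorem exists_bound_sphere {g : ℂ → ℂ} {ζ : ℂ} {ρ : ℝ}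
    (hg : DiffContOnCl ℂ g (Metric.ball ζ ρ)) : ∃ C, ∀ z ∈ Metric.sphere ζ ρ, ‖g z‖ ≤ C := by
  refine (isCompact_sphere ζ ρ).exists_bound_of_continuousOn ?_
  exact hg.continuousOn_ball.mono Metric.sphere_subset_closedBall

/-- Cauchy's estimates on the circle of radius `ρ` meet the bound `ν` for `‖N‖`. The room between
`ν` and `ρ` makes the series geometric, which is all the convergence that is ever used. -/
theorem norm_taylorCoeff_smul_le {N : E →L[ℂ] E} {g : ℂ → ℂ} {ζ : ℂ} {ν ρ C : ℝ} (hρ : 0 < ρ)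
    (hN : ‖N‖ ≤ ν) (hg : DiffContOnCl ℂ g (Metric.ball ζ ρ))
    (hC : ∀ z ∈ Metric.sphere ζ ρ, ‖g z‖ ≤ C) (n : ℕ) :
    ‖taylorCoeff g ζ n • N ^ n‖ ≤ C * (ν / ρ) ^ n := by
  rw [norm_smul, div_pow]
  have h1 := norm_taylorCoeff_le hρ hg hC n
  calc _ ≤ C / ρ ^ n * ν ^ n :=
        mul_le_mul h1 (opNorm_pow_le_pow hN n) (norm_nonneg _) ((norm_nonneg _).trans h1)
    _ = _ := by ring

theorem summable_norm_powerCalc {N : E →L[ℂ] E} {g : ℂ → ℂ} {ζ : ℂ} {ν ρ : ℝ}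
    (hN : ‖N‖ ≤ ν) (hνρ : ν < ρ) (hg : DiffContOnCl ℂ g (Metric.ball ζ ρ)) :
    Summable fun n => ‖taylorCoeff g ζ n • N ^ n‖ := by
  have hν : 0 ≤ ν := (norm_nonneg _).trans hN
  have hρ : 0 < ρ := hν.trans_lt hνρ
  obtain ⟨C, hC⟩ := exists_bound_sphere hg
  refine Summable.of_nonneg_of_le (fun _ => norm_nonneg _)
    (norm_taylorCoeff_smul_le hρ hN hg hC) (Summable.mul_left _ ?_)
  exact summable_geometric_of_lt_one (by positivity) ((div_lt_one hρ).2 hνρ)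

theorem norm_powerCalc_le {N : E →L[ℂ] E} {g : ℂ → ℂ} {ζ : ℂ} {ν ρ C : ℝ}
    (hN : ‖N‖ ≤ ν) (hνρ : ν < ρ) (hg : DiffContOnCl ℂ g (Metric.ball ζ ρ))
    (hC : ∀ z ∈ Metric.sphere ζ ρ, ‖g z‖ ≤ C) :
    ‖powerCalc N ζ g‖ ≤ C * (1 - ν / ρ)⁻¹ := by
  have hν : 0 ≤ ν := (norm_nonneg _).trans hN
  have hρ : 0 < ρ := hν.trans_lt hνρ
  exact tsum_of_norm_bounded
    ((hasSum_geometric_of_lt_one (by positivity) ((div_lt_one hρ).2 hνρ)).mul_left C)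
    (norm_taylorCoeff_smul_le hρ hN hg hC)

variable [CompleteSpace E]

theorem hasSum_powerCalc {N : E →L[ℂ] E} {g : ℂ → ℂ} {ζ : ℂ} {ν ρ : ℝ}
    (hN : ‖N‖ ≤ ν) (hνρ : ν < ρ) (hg : DiffContOnCl ℂ g (Metric.ball ζ ρ)) :
    HasSum (fun n => taylorCoeff g ζ n • N ^ n) (powerCalc N ζ g) :=
  (summable_norm_powerCalc hN hνρ hg).of_norm.hasSum

theorem contDiffAt_of_diffContOnCl {g : ℂ → ℂ} {ζ : ℂ} {ρ : ℝ} (hρ : 0 < ρ)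
    (hg : DiffContOnCl ℂ g (Metric.ball ζ ρ)) (n : WithTop ℕ∞) : ContDiffAt ℂ n g ζ :=
  (hg.differentiableOn.analyticAt (Metric.ball_mem_nhds ζ hρ)).contDiffAt

theorem taylorCoeff_mul {g h : ℂ → ℂ} {ζ : ℂ} {ρ : ℝ} (hρ : 0 < ρ)
    (hg : DiffContOnCl ℂ g (Metric.ball ζ ρ)) (hh : DiffContOnCl ℂ h (Metric.ball ζ ρ)) (n : ℕ) :
    taylorCoeff (fun z => g z * h z) ζ n =
      ∑ k ∈ Finset.range (n + 1), taylorCoeff g ζ k * taylorCoeff h ζ (n - k) := by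
  simp only [taylorCoeff]
  rw [iteratedDeriv_fun_mul (contDiffAt_of_diffContOnCl hρ hg n) (contDiffAt_of_diffContOnCl hρ hh n),
    Finset.sum_div]
  refine Finset.sum_congr rfl fun k hk => ?_
  have hk' : k ≤ n := Nat.lt_succ_iff.1 (Finset.mem_range.1 hk)
  have h1 : ((n.choose k : ℕ) : ℂ) * (k.factorial * (n - k).factorial) = n.factorial := by
    rw [← Nat.choose_mul_factorial_mul_factorial hk']; push_cast; ring
  have h2 : (n.factorial : ℂ) ≠ 0 := by exact_mod_cast n.factorial_ne_zero
  have h3 : (k.factorial : ℂ) ≠ 0 := by exact_mod_cast k.factorial_ne_zero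
  have h4 : ((n - k).factorial : ℂ) ≠ 0 := by exact_mod_cast (n - k).factorial_ne_zero
  rw [div_mul_div_comm, div_eq_div_iff h2 (mul_ne_zero h3 h4), ← h1]
  ring

/-- The Leibniz rule for Taylor coefficients is the Cauchy product of two absolutely convergent
series. -/
theorem powerCalc_mul {N : E →L[ℂ] E} {g h : ℂ → ℂ} {ζ : ℂ} {ν ρ : ℝ}
    (hN : ‖N‖ ≤ ν) (hνρ : ν < ρ) (hg : DiffContOnCl ℂ g (Metric.ball ζ ρ))
    (hh : DiffContOnCl ℂ h (Metric.ball ζ ρ)) :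
    powerCalc N ζ (fun z => g z * h z) = powerCalc N ζ g * powerCalc N ζ h := by
  have hρ : 0 < ρ := ((norm_nonneg _).trans hN).trans_lt hνρ
  rw [powerCalc, powerCalc, powerCalc, tsum_mul_tsum_eq_tsum_sum_range_of_summable_norm
    (summable_norm_powerCalc hN hνρ hg) (summable_norm_powerCalc hN hνρ hh)]
  refine tsum_congr fun n => ?_
  rw [taylorCoeff_mul hρ hg hh, Finset.sum_smul]
  refine Finset.sum_congr rfl fun k hk => ?_
  have hk' : k ≤ n := Nat.lt_succ_iff.1 (Finset.mem_range.1 hk)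
  rw [smul_mul_smul_comm, ← pow_add, Nat.add_sub_cancel' hk']

theorem powerCalc_add {N : E →L[ℂ] E} {g h : ℂ → ℂ} {ζ : ℂ} {ν ρ : ℝ}
    (hN : ‖N‖ ≤ ν) (hνρ : ν < ρ) (hg : DiffContOnCl ℂ g (Metric.ball ζ ρ))
    (hh : DiffContOnCl ℂ h (Metric.ball ζ ρ)) :
    powerCalc N ζ (fun z => g z + h z) = powerCalc N ζ g + powerCalc N ζ h := by
  have hρ : 0 < ρ := ((norm_nonneg _).trans hN).trans_lt hνρ
  rw [powerCalc]
  refine HasSum.tsum_eq ?_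
  convert (hasSum_powerCalc hN hνρ hg).add (hasSum_powerCalc hN hνρ hh) using 2 with n
  rw [← add_smul, taylorCoeff, taylorCoeff, taylorCoeff, iteratedDeriv_fun_add
    (contDiffAt_of_diffContOnCl hρ hg n) (contDiffAt_of_diffContOnCl hρ hh n), add_div]

theorem powerCalc_const_mul {N : E →L[ℂ] E} {g : ℂ → ℂ} {ζ : ℂ} {ν ρ : ℝ} (c : ℂ)
    (hN : ‖N‖ ≤ ν) (hνρ : ν < ρ) (hg : DiffContOnCl ℂ g (Metric.ball ζ ρ)) :
    powerCalc N ζ (fun z => c * g z) = c • powerCalc N ζ g := by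
  rw [powerCalc]
  refine HasSum.tsum_eq ?_
  convert (hasSum_powerCalc hN hνρ hg).const_smul c using 2 with n
  rw [smul_smul, taylorCoeff, taylorCoeff, iteratedDeriv_const_mul_field, mul_div_assoc]

omit [CompleteSpace E] in
theorem powerCalc_one (N : E →L[ℂ] E) (ζ : ℂ) : powerCalc N ζ (fun _ => 1) = 1 := by
  rw [powerCalc, tsum_eq_single 0]
  · simp [taylorCoeff]
  · intro n hn
    simp [taylorCoeff, iteratedDeriv_const, hn]

theorem taylorCoeff_congr {g h : ℂ → ℂ} {ζ : ℂ} (hgh : g =ᶠ[𝓝 ζ] h) (n : ℕ) :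
    taylorCoeff g ζ n = taylorCoeff h ζ n := by
  rw [taylorCoeff, taylorCoeff, hgh.iteratedDeriv_eq]

omit [CompleteSpace E] in
theorem powerCalc_congr {N : E →L[ℂ] E} {g h : ℂ → ℂ} {ζ : ℂ} (hgh : g =ᶠ[𝓝 ζ] h) :
    powerCalc N ζ g = powerCalc N ζ h := by
  simp only [powerCalc, taylorCoeff_congr hgh]

/-! ### The resolvent and the circle integral -/

/-- The resolvent `(w - ζ - N)⁻¹`. -/
def resAt (N : E →L[ℂ] E) (ζ w : ℂ) : E →L[ℂ] E := resolvent N (w - ζ)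

theorem sub_mem_resolventSet {N : E →L[ℂ] E} {ζ w : ℂ} {ν : ℝ} (hN : ‖N‖ ≤ ν)
    (hw : ν < ‖w - ζ‖) : w - ζ ∈ resolventSet ℂ N := by
  refine spectrum.mem_resolventSet_of_norm_lt_mul ?_
  refine lt_of_le_of_lt ?_ hw
  calc ‖N‖ * ‖(1 : E →L[ℂ] E)‖ ≤ ‖N‖ * 1 := by
        gcongr; exact ContinuousLinearMap.norm_id_le
    _ ≤ ν := by simpa using hN

theorem mul_resAt {N : E →L[ℂ] E} {ζ w : ℂ} {ν : ℝ} (hN : ‖N‖ ≤ ν) (hw : ν < ‖w - ζ‖) :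
    N * resAt N ζ w = (w - ζ) • resAt N ζ w - 1 := by
  have h := Ring.mul_inverse_cancel _ (sub_mem_resolventSet hN hw : IsUnit _)
  have h2 : (w - ζ) • resAt N ζ w - N * resAt N ζ w = 1 := by
    rw [← h, sub_mul, Algebra.algebraMap_eq_smul_one, smul_mul_assoc, one_mul]
    rfl
  rw [← h2]; abel

theorem hasSum_resAt {N : E →L[ℂ] E} {ζ w : ℂ} {ν : ℝ} (hN : ‖N‖ ≤ ν) (hw : ν < ‖w - ζ‖) :
    HasSum (fun n : ℕ => ((w - ζ)⁻¹) ^ (n + 1) • N ^ n) (resAt N ζ w) := by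
  have hν : 0 ≤ ν := (norm_nonneg _).trans hN
  have hw0 : 0 < ‖w - ζ‖ := hν.trans_lt hw
  have hb : ∀ n : ℕ, ‖((w - ζ)⁻¹) ^ (n + 1) • N ^ n‖ ≤ ‖w - ζ‖⁻¹ * (ν / ‖w - ζ‖) ^ n := fun n => by
    rw [norm_smul, norm_pow, norm_inv, div_eq_mul_inv, mul_pow, pow_succ]
    calc _ ≤ ‖w - ζ‖⁻¹ ^ n * ‖w - ζ‖⁻¹ * ν ^ n := by gcongr; exact opNorm_pow_le_pow hN n
      _ = _ := by ring
  have hs : Summable (fun n : ℕ => ((w - ζ)⁻¹) ^ (n + 1) • N ^ n) :=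
    Summable.of_norm_bounded ((summable_geometric_of_lt_one (by positivity)
      ((div_lt_one hw0).2 hw)).mul_left _) hb
  have hne : w - ζ ≠ 0 := norm_pos_iff.1 hw0
  -- Telescoping: multiplication by `w - ζ` lowers the exponent of the scalar, multiplication by `N`
  -- raises that of `N`, and only the term of index 0 survives. The series is thus a right inverse,
  -- and it equals the resolvent because the latter is a left inverse.
  have key : ((w - ζ) • (1 : E →L[ℂ] E) - N) * (∑' n : ℕ, ((w - ζ)⁻¹) ^ (n + 1) • N ^ n) = 1 := by
    have h1 := hs.hasSum.const_smul (w - ζ)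
    have h2 := hs.hasSum.mul_left N
    have h3 : HasSum (fun n : ℕ => ((w - ζ)⁻¹) ^ n • N ^ n)
        ((w - ζ) • ∑' n : ℕ, ((w - ζ)⁻¹) ^ (n + 1) • N ^ n) := by
      convert h1 using 2 with n
      rw [smul_smul, pow_succ', ← mul_assoc, mul_inv_cancel₀ hne, one_mul]
    have h4 : HasSum (fun n : ℕ => ((w - ζ)⁻¹) ^ (n + 1) • N ^ (n + 1))
        (N * ∑' n : ℕ, ((w - ζ)⁻¹) ^ (n + 1) • N ^ n) := by
      have e : (fun n : ℕ => ((w - ζ)⁻¹) ^ (n + 1) • N ^ (n + 1)) =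
          fun n : ℕ => N * (((w - ζ)⁻¹) ^ (n + 1) • N ^ n) := by
        funext n; rw [mul_smul_comm, pow_succ' N]
      rw [e]; exact h2
    have h5 := (hasSum_nat_add_iff' 1).2 h3
    have h6 := h5.unique h4
    rw [sub_mul, smul_mul_assoc, one_mul, ← h6]
    simp
  have hu := Ring.inverse_mul_cancel _ (sub_mem_resolventSet hN hw : IsUnit _)
  have : resAt N ζ w = ∑' n : ℕ, ((w - ζ)⁻¹) ^ (n + 1) • N ^ n := by
    calc resAt N ζ w = resAt N ζ w * 1 := (mul_one _).symm
      _ = _ := by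
        rw [← key, ← mul_assoc, ← Algebra.algebraMap_eq_smul_one]
        erw [hu]
        rw [one_mul]
  rw [this]; exact hs.hasSum

theorem differentiableAt_resAt {N : E →L[ℂ] E} {ζ w : ℂ} {ν : ℝ} (hN : ‖N‖ ≤ ν)
    (hw : ν < ‖w - ζ‖) : DifferentiableAt ℂ (resAt N ζ) w := by
  have h := (spectrum.hasDerivAt_resolvent_const_left (sub_mem_resolventSet hN hw)).differentiableAt
  exact h.comp w (f := fun w : ℂ => w - ζ) (by fun_prop)

/-- Insert the Neumann series of the resolvent under the integral; the scalar factor of `N ^ n` is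
Cauchy's integral for the `n`-th Taylor coefficient. -/
theorem circleIntegral_smul_resAt {N : E →L[ℂ] E} {g : ℂ → ℂ} {ζ : ℂ} {ν ρ : ℝ}
    (hN : ‖N‖ ≤ ν) (hνρ : ν < ρ) (hg : DiffContOnCl ℂ g (Metric.ball ζ ρ)) :
    (∮ w in C(ζ, ρ), g w • resAt N ζ w) = (2 * Real.pi * Complex.I : ℂ) • powerCalc N ζ g := by
  have hν : 0 ≤ ν := (norm_nonneg _).trans hN
  have hρ : 0 < ρ := hν.trans_lt hνρ
  obtain ⟨C, hC⟩ := exists_bound_sphere hg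
  have hcm : ∀ θ, circleMap ζ ρ θ ∈ Metric.sphere ζ ρ := fun θ => circleMap_mem_sphere ζ hρ.le θ
  have hgc : Continuous fun θ => g (circleMap ζ ρ θ) :=
    (hg.continuousOn_ball.mono Metric.sphere_subset_closedBall).comp_continuous
      (continuous_circleMap ζ ρ) hcm
  have hnorm : ∀ θ, ‖circleMap ζ ρ θ - ζ‖ = ρ := fun θ => mem_sphere_iff_norm.1 (hcm θ)
  have hne : ∀ θ, circleMap ζ ρ θ - ζ ≠ 0 := fun θ => norm_pos_iff.1 (by rw [hnorm]; exact hρ)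
  set F : ℕ → ℝ → (E →L[ℂ] E) := fun n θ => deriv (circleMap ζ ρ) θ •
    (g (circleMap ζ ρ θ) • ((circleMap ζ ρ θ - ζ)⁻¹) ^ (n + 1) • N ^ n) with hF
  have hFc : ∀ n, Continuous (F n) := fun n => by
    have : Continuous fun θ => (circleMap ζ ρ θ - ζ)⁻¹ :=
      ((continuous_circleMap ζ ρ).sub continuous_const).inv₀ hne
    have h2 : Continuous (deriv (circleMap ζ ρ)) := by
      have : deriv (circleMap ζ ρ) = fun θ => circleMap 0 ρ θ * Complex.I := by
        ext θ; simp
      rw [this]; fun_prop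
    exact h2.smul (hgc.smul ((this.pow _).smul continuous_const))
  have hFb : ∀ n θ, ‖F n θ‖ ≤ C * (ν / ρ) ^ n := fun n θ => by
    have h0 : 0 ≤ C := (norm_nonneg _).trans (hC _ (hcm θ))
    simp only [hF, norm_smul, norm_pow, norm_inv, hnorm]
    have h1 : ‖deriv (circleMap ζ ρ) θ‖ = ρ := by simp [abs_of_pos hρ]
    rw [h1]
    calc _ ≤ ρ * (C * (ρ⁻¹ ^ (n + 1) * ν ^ n)) := by
          gcongr
          · exact hC _ (hcm θ)
          · exact opNorm_pow_le_pow hN n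
      _ = _ := by
          rw [pow_succ, div_eq_mul_inv, mul_pow]; field_simp
  have hgeo : Summable fun n : ℕ => C * (ν / ρ) ^ n :=
    (summable_geometric_of_lt_one (by positivity) ((div_lt_one hρ).2 hνρ)).mul_left C
  have hsum := intervalIntegral.hasSum_integral_of_dominated_convergence (a := 0) (b := 2 * Real.pi)
    (μ := volume) (F := F) (f := fun θ => deriv (circleMap ζ ρ) θ •
      (g (circleMap ζ ρ θ) • resAt N ζ (circleMap ζ ρ θ)))
    (fun n _ => C * (ν / ρ) ^ n) (fun n => (hFc n).aestronglyMeasurable)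
    (fun n => Eventually.of_forall fun θ _ => hFb n θ) (Eventually.of_forall fun _ _ => hgeo)
    (by simp) (Eventually.of_forall fun θ _ => by
      have := hasSum_resAt hN (w := circleMap ζ ρ θ) (ζ := ζ) (by rw [hnorm]; exact hνρ)
      exact (this.const_smul _).const_smul _)
  refine hsum.unique ?_
  have e : (fun n => ∫ θ in (0 : ℝ)..2 * Real.pi, F n θ) =
      fun n => (2 * Real.pi * Complex.I : ℂ) • taylorCoeff g ζ n • N ^ n := by
    funext n
    have h1 := hg.circleIntegral_one_div_sub_center_pow_smul hρ n
    have h2 : (∫ θ in (0 : ℝ)..2 * Real.pi, F n θ) =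
        (∮ z in C(ζ, ρ), (1 / (z - ζ) ^ (n + 1)) • g z) • N ^ n := by
      rw [circleIntegral]
      refine Eq.trans ?_ (intervalIntegral.integral_smul_const (𝕜 := ℂ)
        (fun θ => deriv (circleMap ζ ρ) θ • (1 / (circleMap ζ ρ θ - ζ) ^ (n + 1)) •
          g (circleMap ζ ρ θ)) (N ^ n))
      refine intervalIntegral.integral_congr fun θ _ => ?_
      simp only [hF, smul_smul, smul_eq_mul]
      congr 1
      rw [inv_pow]; ring
    rw [h2, h1, smul_smul, taylorCoeff]
    congr 1
    rw [smul_eq_mul]; ring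
  rw [e]
  exact (hasSum_powerCalc hN hνρ hg).const_smul (2 * Real.pi * Complex.I : ℂ)

end PowerCalculus

/-! ### The Cauchy-Pompeiu formula for operators -/

section Dbar

variable {V : Type*} [NormedAddCommGroup V] [NormedSpace ℂ V]

/-- The Wirtinger derivative `∂χ/∂w̄` of a real function. -/
def dbar (χ : ℂ → ℝ) (w : ℂ) : ℂ :=
  (1 / 2 : ℂ) * ((fderiv ℝ χ w 1 : ℝ) + Complex.I * (fderiv ℝ χ w Complex.I : ℝ))

theorem dbar_of_eventuallyEq_const {χ : ℂ → ℝ} {w : ℂ} {c : ℝ} (h : χ =ᶠ[𝓝 w] fun _ => c) :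
    dbar χ w = 0 := by
  rw [dbar, h.fderiv_eq]
  simp

theorem dbar_sub {χ ψ : ℂ → ℝ} {w : ℂ} (hχ : DifferentiableAt ℝ χ w)
    (hψ : DifferentiableAt ℝ ψ w) : dbar (fun z => χ z - ψ z) w = dbar χ w - dbar ψ w := by
  simp only [dbar]
  rw [fderiv_fun_sub hχ hψ]
  simp only [sub_apply]
  push_cast
  ring

/-- Integration by parts against the constant function 1. -/
theorem integral_fderiv_eq_zero {u : ℂ → V} (hu : ContDiff ℝ 1 u) (hc : HasCompactSupport u)
    (v : ℂ) : ∫ w, fderiv ℝ u w v = 0 := by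
  have h1 : Continuous fun w => fderiv ℝ u w v :=
    (hu.continuous_fderiv one_ne_zero).clm_apply continuous_const
  have h2 : HasCompactSupport fun w => fderiv ℝ u w v := hc.fderiv_apply (𝕜 := ℝ) v
  have := integral_smul_fderiv_eq_neg_fderiv_smul_of_integrable (μ := (volume : Measure ℂ))
    (f := fun _ : ℂ => (1 : ℝ)) (g := u) (v := v) (by simp)
    (by simpa using h1.integrable_of_hasCompactSupport h2)
    (by simpa using hu.continuous.integrable_of_hasCompactSupport hc)
    (fun _ _ => differentiableAt_const _) (fun w _ => hu.differentiable one_ne_zero w)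
  simpa using this

/-- Since `F` is holomorphic, the integrand is `∂̄(χF)`, a combination of derivatives of a compactly
supported `C¹` function. Nothing is needed of `F` outside `U`, as `χ` vanishes there. -/
theorem integral_dbar_smul_eq_zero [CompleteSpace V] {χ : ℂ → ℝ} {U : Set ℂ} {F : ℂ → V}
    (hχ : ContDiff ℝ 1 χ)
    (hc : HasCompactSupport χ) (hU : IsOpen U) (hsub : tsupport χ ⊆ U)
    (hF : DifferentiableOn ℂ F U) :
    Integrable (fun w => dbar χ w • F w) ∧ ∫ w, dbar χ w • F w = 0 := by
  set u : ℂ → V := fun w => χ w • F w with hu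
  have hucs : HasCompactSupport u := hc.smul_right
  have hFat : ∀ w ∈ tsupport χ, ContDiffAt ℝ 1 F w := fun w hw =>
    ((hF.contDiffOn hU).contDiffAt (hU.mem_nhds (hsub hw))).restrict_scalars ℝ
  have hoff : ∀ w ∉ tsupport χ, u =ᶠ[𝓝 w] fun _ => 0 := fun w hw => by
    filter_upwards [notMem_tsupport_iff_eventuallyEq.1 hw] with z hz
    simp [hu, hz]
  have hucd : ContDiff ℝ 1 u := by
    rw [contDiff_iff_contDiffAt]
    intro w
    by_cases hw : w ∈ tsupport χ
    · exact hχ.contDiffAt.smul (hFat w hw)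
    · exact contDiffAt_const.congr_of_eventuallyEq (hoff w hw)
  have key : ∀ w, dbar χ w • F w =
      (1 / 2 : ℂ) • (fderiv ℝ u w 1 + Complex.I • fderiv ℝ u w Complex.I) := by
    intro w
    by_cases hw : w ∈ tsupport χ
    · have hFc : DifferentiableAt ℂ F w := hF.differentiableAt (hU.mem_nhds (hsub hw))
      have h1 : HasFDerivAt u (χ w • fderiv ℝ F w + (fderiv ℝ χ w).smulRight (F w)) w :=
        (hχ.differentiable one_ne_zero w).hasFDerivAt.smul
          (hFc.restrictScalars ℝ).hasFDerivAt
      have h2 : fderiv ℝ F w = (fderiv ℂ F w).restrictScalars ℝ := hFc.fderiv_restrictScalars ℝ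
      have h3 : fderiv ℂ F w Complex.I = Complex.I • fderiv ℂ F w 1 := by
        rw [← map_smul, smul_eq_mul, mul_one]
      rw [h1.fderiv, h2]
      simp only [add_apply, smul_apply,
        ContinuousLinearMap.smulRight_apply, ContinuousLinearMap.coe_restrictScalars', h3]
      rw [smul_add Complex.I, smul_comm Complex.I (χ w), smul_smul Complex.I Complex.I,
        Complex.I_mul_I, neg_one_smul, smul_neg, dbar]
      rw [← Complex.coe_smul (fderiv ℝ χ w 1), ← Complex.coe_smul (fderiv ℝ χ w Complex.I),
        smul_smul Complex.I, mul_smul, add_smul]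
      congr 1
      abel
    · rw [dbar_of_eventuallyEq_const (c := 0) (notMem_tsupport_iff_eventuallyEq.1 hw),
        (hoff w hw).fderiv_eq]
      simp
  have hcont : ∀ v, Integrable fun w => fderiv ℝ u w v := fun v =>
    ((hucd.continuous_fderiv one_ne_zero).clm_apply
      continuous_const).integrable_of_hasCompactSupport (hucs.fderiv_apply (𝕜 := ℝ) v)
  simp only [key]
  have hcI : Integrable fun w => Complex.I • fderiv ℝ u w Complex.I :=
    (hcont Complex.I).smul Complex.I
  refine ⟨((hcont 1).add hcI).smul _, ?_⟩
  rw [integral_smul, integral_add (hcont 1) hcI, integral_smul,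
    integral_fderiv_eq_zero hucd hucs, integral_fderiv_eq_zero hucd hucs]
  simp

/-- The radial function `η(|w - ζ|²)`. -/
def radial (η : ℝ → ℝ) (ζ w : ℂ) : ℝ := η (Complex.normSq (w - ζ))

theorem contDiff_radial {η : ℝ → ℝ} (hη : ContDiff ℝ 1 η) (ζ : ℂ) :
    ContDiff ℝ 1 (radial η ζ) := by
  have : ContDiff ℝ 1 fun w : ℂ => Complex.normSq (w - ζ) := by
    have h : (fun w : ℂ => Complex.normSq (w - ζ)) = fun w : ℂ =>
        Complex.reCLM (w - ζ) * Complex.reCLM (w - ζ) +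
          Complex.imCLM (w - ζ) * Complex.imCLM (w - ζ) := by
      ext w; simp [Complex.normSq_apply]
    rw [h]
    fun_prop
  exact hη.comp this

/-- The factor `w - ζ` is the one in `dw = i (w - ζ) dθ`; it lets the area integral be sliced into
circle integrals. -/
theorem dbar_radial {η : ℝ → ℝ} (hη : ContDiff ℝ 1 η) (ζ w : ℂ) :
    dbar (radial η ζ) w = ((deriv η (Complex.normSq (w - ζ)) : ℝ) : ℂ) * (w - ζ) := by
  have hre : HasFDerivAt (fun w : ℂ => Complex.reCLM (w - ζ)) Complex.reCLM w :=
    Complex.reCLM.hasFDerivAt.comp w ((hasFDerivAt_id w).sub_const ζ)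
  have him : HasFDerivAt (fun w : ℂ => Complex.imCLM (w - ζ)) Complex.imCLM w :=
    Complex.imCLM.hasFDerivAt.comp w ((hasFDerivAt_id w).sub_const ζ)
  have h1 : HasFDerivAt (fun w : ℂ => Complex.normSq (w - ζ)) _ w :=
    ((hre.mul hre).add (him.mul him)).congr_of_eventuallyEq
      (Eventually.of_forall fun z => by simp [Complex.normSq_apply])
  have h2 := ((hη.differentiable one_ne_zero _).hasDerivAt.comp_hasFDerivAt w h1).fderiv
  rw [dbar]
  have : fderiv ℝ (radial η ζ) w = _ := h2
  rw [this]
  apply Complex.ext <;> simp <;> ring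

end Dbar

section Area

variable {E : Type*} [NormedAddCommGroup E] [NormedSpace ℂ E] [CompleteSpace E]

/-- The circle integral with the factor `i` of `dw = i (w - ζ) dθ` removed, and moved by periodicity
to the angular range of polar coordinates. -/
theorem setIntegral_circle {N : E →L[ℂ] E} {g : ℂ → ℂ} {ζ : ℂ} {ν r : ℝ}
    (hN : ‖N‖ ≤ ν) (hνr : ν < r) (hg : DiffContOnCl ℂ g (Metric.ball ζ r)) :
    (∫ θ in Ioo (-Real.pi) Real.pi,
      circleMap 0 r θ • (g (circleMap ζ r θ) • resAt N ζ (circleMap ζ r θ))) =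
      (2 * Real.pi : ℝ) • powerCalc N ζ g := by
  have h := circleIntegral_smul_resAt hN hνr hg
  rw [circleIntegral] at h
  have hper : Function.Periodic (fun θ => circleMap 0 r θ •
      (g (circleMap ζ r θ) • resAt N ζ (circleMap ζ r θ))) (2 * Real.pi) := fun θ => by
    simp only [periodic_circleMap 0 r θ, periodic_circleMap ζ r θ]
  have h2 := hper.intervalIntegral_add_eq (-Real.pi) 0
  rw [show -Real.pi + 2 * Real.pi = Real.pi by ring, zero_add] at h2
  rw [← integral_Ioc_eq_integral_Ioo, ← intervalIntegral.integral_of_le (by linarith [Real.pi_pos]),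
    h2]
  simp only [deriv_circleMap] at h
  have h3 : (∫ θ in (0 : ℝ)..2 * Real.pi, (circleMap 0 r θ * Complex.I) •
      (g (circleMap ζ r θ) • resAt N ζ (circleMap ζ r θ))) = Complex.I •
      ∫ θ in (0 : ℝ)..2 * Real.pi, circleMap 0 r θ •
      (g (circleMap ζ r θ) • resAt N ζ (circleMap ζ r θ)) := by
    refine Eq.trans ?_ (intervalIntegral.integral_smul (𝕜 := ℂ) Complex.I _)
    refine intervalIntegral.integral_congr fun θ _ => ?_
    simp only [smul_smul]
    congr 1
    ring
  rw [h3, show (2 * Real.pi * Complex.I : ℂ) = Complex.I * ((2 * Real.pi : ℝ) : ℂ) by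
    push_cast; ring, mul_smul] at h
  have h4 := smul_right_injective _ Complex.I_ne_zero h
  rw [h4]
  exact Complex.coe_smul _ _

/-- In polar coordinates the angular integral is the constant `2πc` for every radius in `(r₁, r₂)`,
and the radial factor integrates to `∫ r η'(r²) dr = -1/2`. Outside the annulus `η'` vanishes, so
`F` may be arbitrary there. -/
theorem integral_dbar_radial {V : Type*} [NormedAddCommGroup V] [NormedSpace ℂ V] [CompleteSpace V]
    {F : ℂ → V} {c : V} {ζ : ℂ} {r₁ r₂ : ℝ} (hr₁ : 0 < r₁) (h12 : r₁ < r₂)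
    (hF : ContinuousOn F (Metric.closedBall ζ r₂ \ Metric.ball ζ r₁))
    (hc : ∀ r ∈ Ioo r₁ r₂, (∫ θ in Ioo (-Real.pi) Real.pi,
      circleMap 0 r θ • F (circleMap ζ r θ)) = (2 * Real.pi : ℝ) • c)
    {η : ℝ → ℝ} (hη : ContDiff ℝ 1 η) (hη1 : ∀ x ≤ r₁ ^ 2, η x = 1)
    (hη0 : ∀ x ≥ r₂ ^ 2, η x = 0) :
    ∫ w, dbar (radial η ζ) w • F w = -(Real.pi • c) := by
  have hd1 : ∀ x ≤ r₁ ^ 2, deriv η x = 0 := fun x hx => by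
    have hc : IsClosed {x | deriv η x = 0} :=
      isClosed_eq (hη.continuous_deriv le_rfl) continuous_const
    have : Iio (r₁ ^ 2) ⊆ {x | deriv η x = 0} := fun y hy => by
      have : η =ᶠ[𝓝 y] fun _ => 1 := by
        filter_upwards [Iio_mem_nhds hy] with z hz using hη1 z (le_of_lt hz)
      simpa using this.deriv_eq
    have := closure_minimal this hc
    rw [closure_Iio] at this
    exact this hx
  have hd0 : ∀ x ≥ r₂ ^ 2, deriv η x = 0 := fun x hx => by
    have hc : IsClosed {x | deriv η x = 0} :=
      isClosed_eq (hη.continuous_deriv le_rfl) continuous_const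
    have : Ioi (r₂ ^ 2) ⊆ {x | deriv η x = 0} := fun y hy => by
      have : η =ᶠ[𝓝 y] fun _ => 0 := by
        filter_upwards [Ioi_mem_nhds hy] with z hz using hη0 z (le_of_lt hz)
      simpa using this.deriv_eq
    have := closure_minimal this hc
    rw [closure_Ioi] at this
    exact this hx
  set P : ℝ × ℝ → V := fun p => (p.1 * deriv η (p.1 ^ 2)) •
    (circleMap 0 p.1 p.2 • F (circleMap ζ p.1 p.2)) with hP
  have e1 : ∫ w, dbar (radial η ζ) w • F w =
      ∫ p in polarCoord.target, P p := by
    rw [← integral_add_left_eq_self _ ζ, ← Complex.integral_comp_polarCoord_symm]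
    refine setIntegral_congr_fun polarCoord.open_target.measurableSet fun p hp => ?_
    have hz : Complex.polarCoord.symm p = circleMap 0 p.1 p.2 := by
      simp [circleMap, Complex.exp_mul_I]
    have hz2 : ζ + Complex.polarCoord.symm p = circleMap ζ p.1 p.2 := by
      rw [hz]; simp [circleMap]
    have hz3 : Complex.normSq (Complex.polarCoord.symm p) = p.1 ^ 2 := by
      rw [Complex.normSq_eq_norm_sq, Complex.norm_polarCoord_symm, sq_abs]
    simp only [hP]
    rw [dbar_radial hη, add_sub_cancel_left, hz3, hz2, hz, mul_smul, mul_smul, Complex.coe_smul]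
  have hzero : ∀ p : ℝ × ℝ, 0 < p.1 → p.1 ∉ Ioo r₁ r₂ → P p = 0 := fun p hp hp' => by
    have : deriv η (p.1 ^ 2) = 0 := by
      rcases le_or_gt p.1 r₁ with h | h
      · exact hd1 _ (by gcongr)
      · have : r₂ ≤ p.1 := not_lt.1 fun h' => hp' ⟨h, h'⟩
        exact hd0 _ (by gcongr; linarith)
    simp [hP, this]
  have hint : IntegrableOn P (Ioi 0 ×ˢ Ioo (-Real.pi) Real.pi) (volume.prod volume) := by
    have hK : IsCompact (Icc r₁ r₂ ×ˢ Icc (-Real.pi) Real.pi) := isCompact_Icc.prod isCompact_Icc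
    have hcm : Continuous fun p : ℝ × ℝ => circleMap ζ p.1 p.2 := by
      simp only [circleMap]; fun_prop
    have hcm0 : Continuous fun p : ℝ × ℝ => circleMap 0 p.1 p.2 := by
      simp only [circleMap]; fun_prop
    have hnorm : ∀ p ∈ Icc r₁ r₂ ×ˢ Icc (-Real.pi) Real.pi, ‖circleMap ζ p.1 p.2 - ζ‖ = p.1 :=
      fun p hp => by
        have : 0 ≤ p.1 := hr₁.le.trans hp.1.1
        simp [abs_of_nonneg this]
    have hc : ContinuousOn P (Icc r₁ r₂ ×ˢ Icc (-Real.pi) Real.pi) := by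
      have hd := hη.continuous_deriv le_rfl
      have hd' : Continuous fun p : ℝ × ℝ => p.1 * deriv η (p.1 ^ 2) := by fun_prop
      refine hd'.continuousOn.smul
        (hcm0.continuousOn.smul (hF.comp hcm.continuousOn fun p hp => ?_))
      rw [Set.mem_sdiff, mem_closedBall_iff_norm, mem_ball_iff_norm, hnorm p hp]
      exact ⟨hp.1.2, not_lt.2 hp.1.1⟩
    have hi : IntegrableOn P (Icc r₁ r₂ ×ˢ Icc (-Real.pi) Real.pi) (volume.prod volume) :=
      hc.integrableOn_compact hK
    refine hi.of_forall_sdiff_eq_zero (measurableSet_Ioi.prod measurableSet_Ioo) ?_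
    rintro p ⟨hp, hp'⟩
    refine hzero p hp.1 fun h => hp' ⟨Ioo_subset_Icc_self h, Ioo_subset_Icc_self hp.2⟩
  have e2 : ∫ p in polarCoord.target, P p =
      ∫ r in Ioi (0 : ℝ), ∫ θ in Ioo (-Real.pi) Real.pi, P (r, θ) := by
    have : polarCoord.target = Ioi (0 : ℝ) ×ˢ Ioo (-Real.pi) Real.pi := rfl
    rw [this]
    exact setIntegral_prod P hint
  have e3 : ∀ r ∈ Ioi (0 : ℝ), ∫ θ in Ioo (-Real.pi) Real.pi, P (r, θ) =
      (r * deriv η (r ^ 2)) • ((2 * Real.pi) • c) := fun r hr => by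
    by_cases h : r ∈ Ioo r₁ r₂
    · rw [← hc r h]
      exact integral_smul (𝕜 := ℝ) (r * deriv η (r ^ 2))
        fun θ => circleMap 0 r θ • F (circleMap ζ r θ)
    · have : deriv η (r ^ 2) = 0 := by
        rcases le_or_gt r r₁ with h' | h'
        · exact hd1 _ (by have : (0:ℝ) < r := hr; gcongr)
        · have h'' : r₂ ≤ r := not_lt.1 fun h'' => h ⟨h', h''⟩
          exact hd0 _ (by gcongr; linarith)
      simp [hP, this]
  have e4 : ∫ r in Ioi (0 : ℝ), r * deriv η (r ^ 2) = -(1 / 2) := by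
    have hder : ∀ r ∈ Ici (0 : ℝ), HasDerivAt (fun r => η (r ^ 2) / 2) (r * deriv η (r ^ 2)) r :=
      fun r _ => by
        have := ((hη.differentiable one_ne_zero (r ^ 2)).hasDerivAt.comp r
          (hasDerivAt_pow 2 r)).div_const 2
        refine this.congr_deriv ?_
        push_cast; ring
    have hcs : HasCompactSupport fun r : ℝ => r * deriv η (r ^ 2) := by
      refine HasCompactSupport.intro (isCompact_Icc (a := -r₂) (b := r₂)) fun r hr => ?_
      have : r₂ ^ 2 ≤ r ^ 2 := by
        refine sq_le_sq' ?_ ?_ |>.trans (le_of_eq (sq_abs r))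
        · linarith [abs_nonneg r]
        · by_contra h
          exact hr (abs_le.1 (not_le.1 h).le)
      rw [hd0 _ this, mul_zero]
    have hci : Continuous fun r : ℝ => r * deriv η (r ^ 2) := by
      have := hη.continuous_deriv le_rfl
      fun_prop
    have ht : Tendsto (fun r : ℝ => η (r ^ 2) / 2) atTop (𝓝 0) := by
      refine tendsto_const_nhds.congr' ?_
      filter_upwards [eventually_ge_atTop r₂] with r hr
      have : r₂ ^ 2 ≤ r ^ 2 := by
        have : 0 ≤ r₂ := by linarith
        gcongr
      rw [hη0 _ this, zero_div]
    rw [integral_Ioi_of_hasDerivAt_of_tendsto' hder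
      (hci.integrable_of_hasCompactSupport hcs).integrableOn ht]
    rw [hη1 _ (by rw [zero_pow two_ne_zero]; positivity)]
    norm_num
  rw [e1, e2, setIntegral_congr_fun measurableSet_Ioi e3]
  refine (integral_smul_const (𝕜 := ℝ) _ _).trans ?_
  rw [e4, smul_smul, ← neg_smul]
  congr 1
  ring

/-- The Cauchy-Pompeiu formula: `g(ζ + N)` as an area integral of the resolvent against `∂̄χ`. -/
theorem integral_dbar_smul_resAt {N : E →L[ℂ] E} {g : ℂ → ℂ} {G : Set ℂ} {ζ : ℂ} {ν : ℝ}
    (hN : ‖N‖ ≤ ν) (hG : IsOpen G) (hg : DifferentiableOn ℂ g G)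
    {χ : ℂ → ℝ} (hχ : ContDiff ℝ 1 χ) (hc : HasCompactSupport χ) (hsub : tsupport χ ⊆ G)
    (hone : ∀ᶠ w in 𝓝ˢ (Metric.closedBall ζ ν), χ w = 1) :
    Integrable (fun w => dbar χ w • (g w • resAt N ζ w)) ∧
      ∫ w, dbar χ w • (g w • resAt N ζ w) = -(Real.pi • powerCalc N ζ g) := by
  have hν : 0 ≤ ν := (norm_nonneg _).trans hN
  obtain ⟨O, hO, hKO, hOone⟩ := eventually_nhdsSet_iff_exists.1 hone
  have hOG : O ⊆ G := fun w hw => hsub (subset_tsupport _ (by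
    rw [Function.mem_support, hOone w hw]; exact one_ne_zero))
  obtain ⟨ε, hε, hεO⟩ := (isCompact_closedBall ζ ν).exists_cthickening_subset_open hO hKO
  rw [cthickening_closedBall hε.le hν] at hεO
  set r₂ := ε + ν with hr₂
  set r₁ := ε / 2 + ν with hr₁
  have h12 : r₁ ^ 2 < r₂ ^ 2 := by
    have : r₁ < r₂ := by rw [hr₁, hr₂]; linarith
    have : 0 ≤ r₁ := by positivity
    gcongr
  set η : ℝ → ℝ := fun x => Real.smoothTransition ((r₂ ^ 2 - x) / (r₂ ^ 2 - r₁ ^ 2)) with hη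
  have hpos : 0 < r₂ ^ 2 - r₁ ^ 2 := by linarith
  have hηc : ContDiff ℝ 1 η := Real.smoothTransition.contDiff.comp (by fun_prop)
  have hη1 : ∀ x ≤ r₁ ^ 2, η x = 1 := fun x hx =>
    Real.smoothTransition.one_of_one_le (by rw [le_div_iff₀ hpos]; linarith)
  have hη0 : ∀ x ≥ r₂ ^ 2, η x = 0 := fun x hx =>
    Real.smoothTransition.zero_of_nonpos (div_nonpos_of_nonpos_of_nonneg (by linarith) hpos.le)
  have hrad := integral_dbar_radial (F := fun w => g w • resAt N ζ w) (c := powerCalc N ζ g)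
    (r₁ := r₁) (r₂ := r₂) (by linarith) (by linarith)
    ((hg.continuousOn.mono (sdiff_subset.trans (hεO.trans hOG))).smul fun w hw =>
      (differentiableAt_resAt hN (by
        have := hw.2
        rw [mem_ball_iff_norm, not_lt] at this
        linarith)).continuousAt.continuousWithinAt)
    (fun r hr => setIntegral_circle hN (by linarith [hr.1]) (DifferentiableOn.diffContOnCl
      (hg.mono ((Metric.closure_ball_subset_closedBall.trans
          (Metric.closedBall_subset_closedBall hr.2.le)).trans (hεO.trans hOG)))))
    hηc hη1 hη0
  have hrs : tsupport (radial η ζ) ⊆ Metric.closedBall ζ r₂ := by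
    refine closure_minimal (fun w hw => ?_) Metric.isClosed_closedBall
    by_contra h
    rw [mem_closedBall_iff_norm, not_le] at h
    refine hw (hη0 _ ?_)
    rw [Complex.normSq_eq_norm_sq]
    have : 0 ≤ r₂ := by positivity
    gcongr
  have hψc := contDiff_radial hηc ζ
  have hψs : HasCompactSupport (radial η ζ) :=
    HasCompactSupport.of_support_subset_isCompact (isCompact_closedBall ζ r₂)
      ((subset_tsupport _).trans hrs)
  have hF : DifferentiableOn ℂ (fun w => g w • resAt N ζ w) (G \ Metric.closedBall ζ ν) := by
    refine (hg.mono sdiff_subset).smul fun w hw => ?_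
    refine (differentiableAt_resAt hN ?_).differentiableWithinAt
    rw [← not_le, ← mem_closedBall_iff_norm]; exact hw.2
  have hGo : IsOpen (G \ Metric.closedBall ζ ν) := hG.sdiff Metric.isClosed_closedBall
  have hone' : ∀ w ∈ Metric.closedBall ζ ν, χ =ᶠ[𝓝 w] fun _ => 1 := fun w hw =>
    Filter.eventually_of_mem (hO.mem_nhds (hKO hw)) hOone
  have hradone : ∀ w ∈ Metric.closedBall ζ ν, radial η ζ =ᶠ[𝓝 w] fun _ => 1 := fun w hw => by
    filter_upwards [Metric.isOpen_ball.mem_nhds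
      (Metric.closedBall_subset_ball (show ν < r₁ by linarith) hw)] with z hz
    refine hη1 _ ?_
    rw [Complex.normSq_eq_norm_sq]
    have := (mem_ball_iff_norm.1 hz).le
    gcongr
  -- Both cutoffs are 1 near the disc, so their difference is supported where `g` times the
  -- resolvent is holomorphic. Hence `χ` may be replaced by the radial cutoff, for which the
  -- integral has been computed.
  obtain ⟨hi0, h0⟩ := integral_dbar_smul_eq_zero (χ := fun w => χ w - radial η ζ w)
    (hχ.sub hψc) (hc.sub hψs) hGo (fun w hw => by
      refine ⟨?_, fun hw' => ?_⟩
      · rcases tsupport_sub _ _ hw with h | h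
        · exact hsub h
        · exact hOG (hεO (hrs h))
      · refine (notMem_tsupport_iff_eventuallyEq.2 ?_) hw
        filter_upwards [hone' w hw', hradone w hw'] with z h1 h2
        simp [h1, h2]) hF
  -- The resolvent is not controlled on the disc, but the radial cutoff is locally constant there,
  -- so the product is continuous on the whole plane.
  have hi1 : Integrable (fun w => dbar (radial η ζ) w • (g w • resAt N ζ w)) := by
    have hcont : Continuous (fun w => dbar (radial η ζ) w • (g w • resAt N ζ w)) := by
      rw [continuous_iff_continuousAt]
      intro w
      have hdc : Continuous (dbar (radial η ζ)) := by
        have := hψc.continuous_fderiv one_ne_zero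
        unfold dbar; fun_prop
      by_cases hw : w ∈ Metric.closedBall ζ ν
      · have : (fun w => dbar (radial η ζ) w • (g w • resAt N ζ w)) =ᶠ[𝓝 w] fun _ => 0 := by
          filter_upwards [(hradone w hw).eventuallyEq_nhds] with z hz
          rw [dbar_of_eventuallyEq_const hz, zero_smul]
        exact continuousAt_const.congr this.symm
      · by_cases hw' : w ∈ tsupport (radial η ζ)
        · exact hdc.continuousAt.smul
            (hF.continuousOn.continuousAt (hGo.mem_nhds ⟨hOG (hεO (hrs hw')), hw⟩))
        · have : (fun w => dbar (radial η ζ) w • (g w • resAt N ζ w)) =ᶠ[𝓝 w] fun _ => 0 := by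
            filter_upwards [(notMem_tsupport_iff_eventuallyEq.1 hw').eventuallyEq_nhds] with z hz
            rw [dbar_of_eventuallyEq_const (c := 0) hz, zero_smul]
          exact continuousAt_const.congr this.symm
    refine hcont.integrable_of_hasCompactSupport
      (HasCompactSupport.intro hψs fun w hw => ?_)
    rw [dbar_of_eventuallyEq_const (c := 0) (notMem_tsupport_iff_eventuallyEq.1 hw), zero_smul]
  have hsplit : (fun w => dbar χ w • (g w • resAt N ζ w)) = fun w =>
      dbar (fun w => χ w - radial η ζ w) w • (g w • resAt N ζ w) +
        dbar (radial η ζ) w • (g w • resAt N ζ w) := by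
    funext w
    rw [dbar_sub (hχ.differentiable one_ne_zero w) (hψc.differentiable one_ne_zero w), ← add_smul,
      sub_add_cancel]
  rw [hsplit]
  refine ⟨hi0.add hi1, ?_⟩
  rw [integral_add hi0 hi1, h0, hrad, zero_add]

end Area

/-! ### Independence of the representation -/

/-- The compact set `K` together with the bounded components of its complement contained in `G`. -/
def fillIn (K G : Set ℂ) : Set ℂ :=
  K ∪ {w | w ∈ Kᶜ ∧ Bornology.IsBounded (connectedComponentIn Kᶜ w) ∧
    connectedComponentIn Kᶜ w ⊆ G}

theorem fillIn_subset {K G : Set ℂ} (hKG : K ⊆ G) : fillIn K G ⊆ G := by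
  rintro w (hw | ⟨hw, -, h⟩)
  · exact hKG hw
  · exact h (mem_connectedComponentIn hw)

/-- The complement is a union of components of the open set `Kᶜ`, hence open. A point beyond a ball
containing `K` escapes to infinity along its ray, so its component is unbounded and is not filled
in. -/
theorem isCompact_fillIn {K G : Set ℂ} (hK : IsCompact K) : IsCompact (fillIn K G) := by
  have hKo : IsOpen Kᶜ := hK.isClosed.isOpen_compl
  refine Metric.isCompact_of_isClosed_isBounded ?_ ?_
  · rw [← isOpen_compl_iff, isOpen_iff_mem_nhds]
    intro w hw
    have hwK : w ∈ Kᶜ := fun h => hw (Or.inl h)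
    filter_upwards [hKo.connectedComponentIn.mem_nhds (mem_connectedComponentIn hwK)] with z hz
    rintro (h | ⟨h1, h2, h3⟩)
    · exact connectedComponentIn_subset _ _ hz h
    · have := connectedComponentIn_eq hz
      exact hw (Or.inr ⟨hwK, by rwa [this], by rwa [this]⟩)
  · obtain ⟨r, hr⟩ := hK.isBounded.subset_closedBall 0
    refine (Metric.isBounded_closedBall (x := (0 : ℂ)) (r := max r 0)).subset ?_
    rintro w (hw | ⟨hw, hb, -⟩)
    · exact Metric.closedBall_subset_closedBall (le_max_left _ _) (hr hw)
    · by_contra h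
      rw [mem_closedBall_zero_iff, not_le] at h
      have hray : (fun s : ℝ => s • w) '' Ici 1 ⊆ Kᶜ := by
        rintro _ ⟨s, hs, rfl⟩ hK'
        have h1 := mem_closedBall_zero_iff.1 (hr hK')
        have hs' : (1 : ℝ) ≤ s := hs
        rw [norm_smul, Real.norm_eq_abs, abs_of_nonneg (by linarith)] at h1
        have h2 : r < ‖w‖ := (le_max_left _ _).trans_lt h
        nlinarith [norm_nonneg w]
      have hpre : IsPreconnected ((fun s : ℝ => s • w) '' Ici 1) :=
        isPreconnected_Ici.image _ (by fun_prop)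
      have hsub := hpre.subset_connectedComponentIn (x := w) ⟨1, by simp, by simp⟩ hray
      obtain ⟨C, hC⟩ := (hb.subset hsub).exists_norm_le
      have hw0 : 0 < ‖w‖ := (le_max_right _ _).trans_lt h
      have h3 := hC ((max 1 ((C + 1) / ‖w‖)) • w) ⟨_, mem_Ici.2 (le_max_left _ _), rfl⟩
      rw [norm_smul, Real.norm_eq_abs, abs_of_nonneg (by positivity)] at h3
      have : (C + 1) / ‖w‖ * ‖w‖ = C + 1 := div_mul_cancel₀ _ hw0.ne'
      nlinarith [le_max_right 1 ((C + 1) / ‖w‖)]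

section SingleValued

variable {X : Type*} [NormedAddCommGroup X] [NormedSpace ℂ X] [CompleteSpace X]
  {ι : Type*} [Fintype ι] {E : ι → Type*} [∀ i, NormedAddCommGroup (E i)]
  [∀ i, NormedSpace ℂ (E i)] [∀ i, CompleteSpace (E i)]
  {A : X →ₗ.[ℂ] X} {N : ∀ i, E i →L[ℂ] E i} {ζ : ι → ℂ} {ν : ι → ℝ} {J : ∀ i, E i →L[ℂ] X}

/-- The sum of the local resolvents of the vectors `v i`. -/
def localRes (N : ∀ i, E i →L[ℂ] E i) (ζ : ι → ℂ) (J : ∀ i, E i →L[ℂ] X) (v : ∀ i, E i)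
    (w : ℂ) : X := ∑ i, J i (resAt (N i) (ζ i) w (v i))

-- Because `N R = (w - ζ) R - 1` for the local resolvent `R`, applying `A` multiplies each summand
-- by `w` up to the error `J i (v i)`, and the errors add up to zero.
omit [CompleteSpace X] in
theorem localRes_mem_graph (hN : ∀ i, ‖N i‖ ≤ ν i)
    (hJ : ∀ i x, (J i x, ζ i • J i x + J i (N i x)) ∈ A.graph) {v : ∀ i, E i}
    (hv : ∑ i, J i (v i) = 0) {w : ℂ} (hw : ∀ i, w ∉ Metric.closedBall (ζ i) (ν i)) :
    (localRes N ζ J v w, w • localRes N ζ J v w) ∈ A.graph := by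
  have h := Submodule.sum_mem A.graph fun i (_ : i ∈ Finset.univ) =>
    hJ i (resAt (N i) (ζ i) w (v i))
  rw [← prod_mk_sum] at h
  have : ∀ i, ζ i • J i (resAt (N i) (ζ i) w (v i)) + J i (N i (resAt (N i) (ζ i) w (v i))) =
      w • J i (resAt (N i) (ζ i) w (v i)) - J i (v i) := fun i => by
    have hw' : ν i < ‖w - ζ i‖ := by
      rw [← not_le, ← mem_closedBall_iff_norm]; exact hw i
    have e : N i (resAt (N i) (ζ i) w (v i)) = (N i * resAt (N i) (ζ i) w) (v i) := rfl
    rw [e, mul_resAt (hN i) hw']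
    simp only [sub_apply, smul_apply, one_apply_eq_self, map_sub, map_smul]
    rw [sub_smul]; abel
  rw [Finset.sum_congr rfl fun i _ => this i, Finset.sum_sub_distrib, hv, sub_zero,
    ← Finset.smul_sum] at h
  exact h

omit [CompleteSpace X] in
theorem differentiableAt_localRes (hN : ∀ i, ‖N i‖ ≤ ν i) (v : ∀ i, E i) {w : ℂ}
    (hw : ∀ i, w ∉ Metric.closedBall (ζ i) (ν i)) :
    DifferentiableAt ℂ (localRes N ζ J v) w := by
  have : ∀ i ∈ Finset.univ, DifferentiableAt ℂ (fun w => J i (resAt (N i) (ζ i) w (v i))) w :=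
    fun i _ => by
      have hw' : ν i < ‖w - ζ i‖ := by
        rw [← not_le, ← mem_closedBall_iff_norm]; exact hw i
      have h1 := differentiableAt_resAt (hN i) hw'
      exact (J i).differentiableAt.comp w
        (h1.clm_apply (differentiableAt_const (v i)))
  exact DifferentiableAt.fun_sum this

-- Expand at infinity in powers of `T i = ζ i + N i`. Each `J i` intertwines `T i` with `A`, so the
-- `n`-th coefficient is `A^n` of the zero vector.
omit [CompleteSpace X] in
theorem localRes_eq_zero_of_large (hJ : ∀ i x, (J i x, ζ i • J i x + J i (N i x)) ∈ A.graph)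
    {v : ∀ i, E i} (hv : ∑ i, J i (v i) = 0) :
    ∃ r : ℝ, ∀ w : ℂ, r < ‖w‖ → localRes N ζ J v w = 0 := by
  set T : ∀ i, E i →L[ℂ] E i := fun i => ζ i • 1 + N i with hT
  have hpow : ∀ n : ℕ, ∑ i, J i ((T i ^ n) (v i)) = 0 := by
    intro n
    induction n with
    | zero => simpa using hv
    | succ n ih =>
      have h := Submodule.sum_mem A.graph fun i (_ : i ∈ Finset.univ) => hJ i ((T i ^ n) (v i))
      rw [← prod_mk_sum, ih] at h
      have h2 := LinearPMap.graph_fst_eq_zero_snd A h rfl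
      rw [← h2]
      refine Finset.sum_congr rfl fun i _ => ?_
      have e : (T i ^ (n + 1)) (v i) = T i ((T i ^ n) (v i)) := by rw [pow_succ']; rfl
      rw [e, ← map_smul, ← map_add]
      rfl
  refine ⟨∑ i, ‖T i‖, fun w hw => ?_⟩
  have hs : ∀ i, HasSum (fun n : ℕ => J i ((w⁻¹ ^ (n + 1) • T i ^ n) (v i)))
      (J i (resAt (N i) (ζ i) w (v i))) := fun i => by
    have h0 : ‖T i‖ < ‖w - 0‖ := by
      rw [sub_zero]
      exact (Finset.single_le_sum (f := fun i => ‖T i‖) (fun _ _ => norm_nonneg _)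
        (Finset.mem_univ i)).trans_lt hw
    have h1 := hasSum_resAt (N := T i) (ζ := 0) le_rfl h0
    have e : resAt (T i) 0 w = resAt (N i) (ζ i) w := by
      simp only [resAt, resolvent, hT, sub_zero, map_sub, Algebra.algebraMap_eq_smul_one,
        sub_add_eq_sub_sub]
    rw [e, sub_zero] at h1
    have h2 := ((ContinuousLinearMap.apply ℂ (E i) (v i)).hasSum h1)
    exact (J i).hasSum h2
  have h3 := hasSum_sum fun i (_ : i ∈ Finset.univ) => hs i
  have h4 : (fun n : ℕ => ∑ i, J i ((w⁻¹ ^ (n + 1) • T i ^ n) (v i))) = fun _ => 0 := by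
    funext n
    simp only [smul_apply, map_smul]
    rw [← Finset.smul_sum, hpow, smul_zero]
  rw [h4] at h3
  exact h3.unique hasSum_zero

/-- Let `W` be the component of `Kᶜ` through `w`. If `W` is unbounded, the zeros near infinity
spread over `W` by the identity theorem. If `W` is bounded, then `w ∉ fillIn K G` means that `W`
meets `Gᶜ`; the component of `Gᶜ` met there is connected and avoids `K`, so it is a hole inside `W`,
and `NoEigenfieldOnHoles` applies. -/
theorem localRes_eq_zero {G : Set ℂ} (hAG : NoEigenfieldOnHoles A G) (hN : ∀ i, ‖N i‖ ≤ ν i)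
    (hsub : ∀ i, Metric.closedBall (ζ i) (ν i) ⊆ G)
    (hJ : ∀ i x, (J i x, ζ i • J i x + J i (N i x)) ∈ A.graph) {v : ∀ i, E i}
    (hv : ∑ i, J i (v i) = 0) {w : ℂ}
    (hw : w ∉ fillIn (⋃ i, Metric.closedBall (ζ i) (ν i)) G) : localRes N ζ J v w = 0 := by
  set K := ⋃ i, Metric.closedBall (ζ i) (ν i) with hKdef
  have hKc : IsCompact K := isCompact_iUnion fun i => isCompact_closedBall _ _
  have hKG : K ⊆ G := iUnion_subset hsub
  have hKo : IsOpen Kᶜ := hKc.isClosed.isOpen_compl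
  have hout : ∀ z ∈ Kᶜ, ∀ i, z ∉ Metric.closedBall (ζ i) (ν i) := fun z hz i hi =>
    hz (mem_iUnion_of_mem i hi)
  have hwK : w ∈ Kᶜ := fun h => hw (Or.inl h)
  set W := connectedComponentIn Kᶜ w with hW
  have hWK : W ⊆ Kᶜ := connectedComponentIn_subset _ _
  have hWo : IsOpen W := hKo.connectedComponentIn
  have hwW : w ∈ W := mem_connectedComponentIn hwK
  have hdiff : DifferentiableOn ℂ (localRes N ζ J v) W := fun z hz =>
    (differentiableAt_localRes hN v (hout z (hWK hz))).differentiableWithinAt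
  by_cases hb : Bornology.IsBounded W
  · have hWG : ¬ W ⊆ G := fun h => hw (Or.inr ⟨hwK, hb, h⟩)
    obtain ⟨z, hzW, hzG⟩ := not_subset.1 hWG
    have hcomp : connectedComponentIn Gᶜ z ⊆ W := by
      rw [hW, connectedComponentIn_eq hzW]
      exact connectedComponentIn_mono z (compl_subset_compl.2 hKG)
    refine hAG W hWo ⟨⟨w, hwW⟩, isPreconnected_connectedComponentIn⟩
      ⟨z, hzG, hb.subset hcomp, hcomp⟩ _ hdiff (fun z' hz' => ?_) w hwW
    have hg := localRes_mem_graph hN hJ hv (hout z' (hWK hz'))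
    rw [LinearPMap.mem_graph_iff] at hg
    obtain ⟨y, hy1, hy2⟩ := hg
    simp only at hy1 hy2
    refine ⟨hy1 ▸ y.2, ?_⟩
    rw [← hy2]
    congr 1
    exact Subtype.ext hy1.symm
  · obtain ⟨r, hr⟩ := localRes_eq_zero_of_large hJ hv
    have : ∃ z ∈ W, r < ‖z‖ := by
      by_contra h
      push Not at h
      exact hb (isBounded_iff_forall_norm_le.2 ⟨r, h⟩)
    obtain ⟨z, hzW, hz⟩ := this
    have han : AnalyticOnNhd ℂ (localRes N ζ J v) W := hdiff.analyticOnNhd hWo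
    refine han.eqOn_zero_of_preconnected_of_eventuallyEq_zero isPreconnected_connectedComponentIn
      hzW ?_ hwW
    filter_upwards [(isOpen_lt continuous_const continuous_norm).mem_nhds hz] with z' hz'
    exact hr z' hz'

/-- The independence of the representation. Cauchy-Pompeiu with one cutoff for all `i` gives an
integrand containing `∂̄χ` times `localRes`: the first factor is zero on the filled set, the second
off it. -/
theorem sum_powerCalc_eq_zero {G : Set ℂ} (hG : IsOpen G) (hAG : NoEigenfieldOnHoles A G)
    (hN : ∀ i, ‖N i‖ ≤ ν i) (hsub : ∀ i, Metric.closedBall (ζ i) (ν i) ⊆ G)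
    (hJ : ∀ i x, (J i x, ζ i • J i x + J i (N i x)) ∈ A.graph) {v : ∀ i, E i}
    (hv : ∑ i, J i (v i) = 0) {g : ℂ → ℂ} (hg : DifferentiableOn ℂ g G) :
    ∑ i, J i (powerCalc (N i) (ζ i) g (v i)) = 0 := by
  set K := ⋃ i, Metric.closedBall (ζ i) (ν i) with hKdef
  have hKc : IsCompact K := isCompact_iUnion fun i => isCompact_closedBall _ _
  have hKG : K ⊆ G := iUnion_subset hsub
  have hF := isCompact_fillIn (G := G) hKc
  obtain ⟨O, hOo, hFO, hOG, hOc⟩ := exists_open_between_and_isCompact_closure hF hG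
    (fillIn_subset hKG)
  obtain ⟨χ, hχ1, hχ0, -⟩ := exists_contMDiffMap_one_nhds_of_subset_interior
    (n := 1) (modelWithCornersSelf ℝ ℂ) hF.isClosed (hFO.trans hOo.interior_eq.symm.subset)
  have hχd : ContDiff ℝ 1 χ := χ.contMDiff.contDiff
  have hts : tsupport χ ⊆ closure O := closure_mono fun w hw => by
    by_contra h; exact hw (hχ0 w h)
  have hcs : HasCompactSupport χ := hOc.of_isClosed_subset (isClosed_tsupport _) hts
  have key := fun i => integral_dbar_smul_resAt (hN i) hG hg hχd hcs (hts.trans hOG)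
    (hχ1.filter_mono (nhdsSet_mono (fun w hw => Or.inl (mem_iUnion_of_mem i hw))) :
      ∀ᶠ w in 𝓝ˢ (Metric.closedBall (ζ i) (ν i)), χ w = 1)
  have h1 : ∀ i, Integrable (fun w => dbar χ w • (g w • J i (resAt (N i) (ζ i) w (v i)))) ∧
      ∫ w, dbar χ w • (g w • J i (resAt (N i) (ζ i) w (v i))) =
        -(Real.pi • J i (powerCalc (N i) (ζ i) g (v i))) := fun i => by
    set P : (E i →L[ℂ] E i) →L[ℂ] X := (J i).comp (ContinuousLinearMap.apply ℂ (E i) (v i))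
    obtain ⟨a, b⟩ := key i
    have h2 := P.integrable_comp a
    have h3 := P.integral_comp_comm a
    rw [b] at h3
    have e : (fun w => P (dbar χ w • (g w • resAt (N i) (ζ i) w))) =
      fun w => dbar χ w • (g w • J i (resAt (N i) (ζ i) w (v i))) := by
      funext w; simp [P]
    have e2 : P (-(Real.pi • powerCalc (N i) (ζ i) g)) =
        -(Real.pi • J i (powerCalc (N i) (ζ i) g (v i))) := by
      rw [map_neg, ← Complex.coe_smul, map_smul, Complex.coe_smul]; rfl
    rw [e] at h2
    rw [e2] at h3
    exact ⟨h2, by rw [← h3, ← e]⟩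
  have h2 : ∑ i, ∫ w, dbar χ w • (g w • J i (resAt (N i) (ζ i) w (v i))) = 0 := by
    rw [← integral_finsetSum _ fun i _ => (h1 i).1]
    refine integral_eq_zero_of_ae (Eventually.of_forall fun w => ?_)
    simp only [← Finset.smul_sum, Pi.zero_apply]
    by_cases hw : w ∈ fillIn K G
    · rw [dbar_of_eventuallyEq_const (c := 1) ((eventually_nhdsSet_iff_forall.1 hχ1) w hw),
        zero_smul]
    · have := localRes_eq_zero hAG hN hsub hJ hv hw
      rw [localRes] at this
      rw [this, smul_zero, smul_zero]
  rw [Finset.sum_congr rfl fun i _ => (h1 i).2, Finset.sum_neg_distrib, ← Finset.smul_sum,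
    neg_eq_zero, smul_eq_zero] at h2
  exact h2.resolve_left Real.pi_ne_zero

end SingleValued

/-! ### The Banach spaces `E_{ζ,ν}` -/

section ExpSeq

open scoped BoundedContinuousFunction

variable {X : Type*} [NormedAddCommGroup X] [NormedSpace ℂ X]

/-- The space of vectors `v` of type `ν` for `A_ζ`, realized by the sequences
`ν^(-n) A_ζ^n v`. -/
def expSeq (A : X →ₗ.[ℂ] X) (p : ℂ × ℝ) : Submodule ℂ (ℕ →ᵇ X) where
  carrier := {x | ∀ n, (x n, (p.2 : ℂ) • x (n + 1) + p.1 • x n) ∈ A.graph}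
  zero_mem' := fun n => by simp
  add_mem' := fun {x y} hx hy n => by
    have := A.graph.add_mem (hx n) (hy n)
    simp only [Prod.mk_add_mk] at this
    change (x n + y n, (p.2 : ℂ) • (x (n + 1) + y (n + 1)) + p.1 • (x n + y n)) ∈ A.graph
    rwa [smul_add, smul_add, add_add_add_comm]
  smul_mem' := fun c x hx n => by
    have := A.graph.smul_mem c (hx n)
    simp only [Prod.smul_mk] at this
    change (c • x n, (p.2 : ℂ) • c • x (n + 1) + p.1 • c • x n) ∈ A.graph
    rwa [smul_comm _ c, smul_comm _ c, ← smul_add]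

/-- Closedness of `A` is what makes the spaces of vectors of given type complete. -/
theorem isClosed_expSeq {A : X →ₗ.[ℂ] X} (hA : A.IsClosed) (p : ℂ × ℝ) :
    IsClosed (expSeq A p : Set (ℕ →ᵇ X)) := by
  have : (expSeq A p : Set (ℕ →ᵇ X)) = ⋂ n : ℕ,
      (fun x : ℕ →ᵇ X => (x n, (p.2 : ℂ) • x (n + 1) + p.1 • x n)) ⁻¹' (A.graph : Set (X × X)) := by
    ext x
    simp only [mem_iInter, mem_preimage]
    rfl
  rw [this]
  refine isClosed_iInter fun n => IsClosed.preimage ?_ hA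
  have h : ∀ n : ℕ, Continuous fun x : ℕ →ᵇ X => x n := fun n =>
    (BoundedContinuousFunction.lipschitz_eval_const n).continuous
  exact (h n).prodMk (((h (n + 1)).const_smul _).add ((h n).const_smul _))

theorem completeSpace_expSeq [CompleteSpace X] {A : X →ₗ.[ℂ] X} (hA : A.IsClosed) (p : ℂ × ℝ) :
    CompleteSpace (expSeq A p) := (isClosed_expSeq hA p).completeSpace_coe

/-- The operator `A_ζ` on the space of vectors of type `ν`. -/
def expShift (A : X →ₗ.[ℂ] X) (p : ℂ × ℝ) : expSeq A p →L[ℂ] expSeq A p :=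
  LinearMap.mkContinuous
    { toFun := fun x => ⟨(p.2 : ℂ) • x.1.compContinuous ⟨Nat.succ, continuous_of_discreteTopology⟩,
        fun n => by
          have := A.graph.smul_mem (p.2 : ℂ) (x.2 (n + 1))
          rw [Prod.smul_mk, smul_add] at this
          have e : ∀ k, ((p.2 : ℂ) • x.1.compContinuous
            ⟨Nat.succ, continuous_of_discreteTopology⟩ : ℕ →ᵇ X) k = (p.2 : ℂ) • x.1 (k + 1) :=
            fun k => rfl
          rw [e, e, smul_comm p.1]
          exact this⟩
      map_add' := fun x y => Subtype.ext (by
        ext n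
        exact smul_add _ _ _)
      map_smul' := fun c x => Subtype.ext (by
        ext n
        exact smul_comm _ _ _) } |p.2| (fun x => by
    refine (BoundedContinuousFunction.norm_le (by positivity)).2 fun n => ?_
    calc ‖(p.2 : ℂ) • x.1 (n + 1)‖ = |p.2| * ‖x.1 (n + 1)‖ := by
          rw [norm_smul, Complex.norm_real, Real.norm_eq_abs]
      _ ≤ |p.2| * ‖x‖ := by gcongr; exact x.1.norm_coe_le_norm _)

theorem expShift_apply (A : X →ₗ.[ℂ] X) (p : ℂ × ℝ) (x : expSeq A p) (n : ℕ) :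
    (expShift A p x).1 n = (p.2 : ℂ) • x.1 (n + 1) := rfl

theorem norm_expShift_le (A : X →ₗ.[ℂ] X) {p : ℂ × ℝ} (hp : 0 < p.2) : ‖expShift A p‖ ≤ p.2 :=
  (LinearMap.mkContinuous_norm_le _ (abs_nonneg _) _).trans (abs_of_pos hp).le

/-- The embedding of the space of vectors of type `ν` in `X`. -/
def expEmb (A : X →ₗ.[ℂ] X) (p : ℂ × ℝ) : expSeq A p →L[ℂ] X :=
  LinearMap.mkContinuous
    { toFun := fun x => x.1 0, map_add' := fun _ _ => rfl, map_smul' := fun _ _ => rfl } 1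
    fun x => by rw [one_mul]; exact x.1.norm_coe_le_norm 0

theorem expEmb_apply (A : X →ₗ.[ℂ] X) (p : ℂ × ℝ) (x : expSeq A p) : expEmb A p x = x.1 0 := rfl

theorem expEmb_mem_graph (A : X →ₗ.[ℂ] X) (p : ℂ × ℝ) (x : expSeq A p) :
    (expEmb A p x, p.1 • expEmb A p x + expEmb A p (expShift A p x)) ∈ A.graph := by
  have := x.2 0
  rw [add_comm] at this
  exact this

theorem shiftOp_of_mem_graph {A : X →ₗ.[ℂ] X} {y z : X} (h : (y, z) ∈ A.graph) (ζ : ℂ) :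
    shiftOp A ζ y = z - ζ • y := by
  rw [LinearPMap.mem_graph_iff] at h
  obtain ⟨w, hw1, hw2⟩ := h
  simp only at hw1 hw2
  have hy : y ∈ A.domain := hw1 ▸ w.2
  rw [shiftOp, dif_pos hy, ← hw2]
  congr 2
  exact Subtype.ext hw1.symm

theorem shiftPow_expSeq (A : X →ₗ.[ℂ] X) (p : ℂ × ℝ) (x : expSeq A p) (n : ℕ) :
    shiftPow A p.1 n (x.1 0) = (p.2 : ℂ) ^ n • x.1 n := by
  induction n with
  | zero => simp [shiftPow]
  | succ n ih =>
    rw [shiftPow, Function.iterate_succ_apply']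
    have h := A.graph.smul_mem ((p.2 : ℂ) ^ n) (x.2 n)
    rw [Prod.smul_mk] at h
    have e := shiftOp_of_mem_graph h p.1
    rw [← ih] at e
    refine e.trans ?_
    rw [ih, smul_add, smul_smul, smul_comm p.1, add_sub_cancel_right, pow_succ]

theorem expShift_pow_apply (A : X →ₗ.[ℂ] X) (p : ℂ × ℝ) (x : expSeq A p) (n : ℕ) :
    expEmb A p ((expShift A p ^ n) x) = shiftPow A p.1 n (x.1 0) := by
  rw [shiftPow_expSeq]
  have : ∀ k, ((expShift A p ^ n) x).1 k = (p.2 : ℂ) ^ n • x.1 (k + n) := by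
    induction n with
    | zero => intro k; simp
    | succ n ih =>
      intro k
      rw [pow_succ']
      change (expShift A p ((expShift A p ^ n) x)).1 k = _
      rw [expShift_apply, ih, smul_smul, ← pow_succ']
      congr 2
      ring
  rw [expEmb_apply, this, zero_add]

theorem mem_domain_shiftPow (A : X →ₗ.[ℂ] X) (p : ℂ × ℝ) (x : expSeq A p) (n : ℕ) :
    shiftPow A p.1 n (x.1 0) ∈ A.domain := by
  rw [shiftPow_expSeq]
  refine A.domain.smul_mem _ ?_
  exact LinearPMap.mem_domain_of_mem_graph (x.2 n)

/-- The operator `A` is single-valued and `p.2 ≠ 0`, so each entry of the sequence determines the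
next one. -/
theorem expEmb_injective (A : X →ₗ.[ℂ] X) {p : ℂ × ℝ} (hp : 0 < p.2) :
    Function.Injective (expEmb A p) := by
  rw [injective_iff_map_eq_zero]
  intro x hx
  have h : ∀ n, x.1 n = 0 := by
    intro n
    induction n with
    | zero => exact hx
    | succ n ih =>
      have := x.2 n
      rw [ih, smul_zero, add_zero] at this
      have h2 := LinearPMap.graph_fst_eq_zero_snd A this rfl
      exact (smul_eq_zero.1 h2).resolve_left (by exact_mod_cast hp.ne')
  exact Subtype.ext (BoundedContinuousFunction.ext h)

theorem expEmb_mem_ExpType (A : X →ₗ.[ℂ] X) {p : ℂ × ℝ} (hp : 0 < p.2) (x : expSeq A p) :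
    expEmb A p x ∈ ExpType A p.1 p.2 := by
  refine ⟨mem_domain_shiftPow A p x, ?_⟩
  -- The bound in `ExpType` is relative to `‖v‖`, so a sequence starting with 0 has to be shown to
  -- vanish altogether.
  by_cases hx : x.1 0 = 0
  · have h0 : x = 0 := expEmb_injective A hp (by rw [expEmb_apply, hx, map_zero])
    refine ⟨1, one_pos, fun n _ => ?_⟩
    rw [expEmb_apply, shiftPow_expSeq, h0]
    simp
  · have hx' : 0 < ‖x.1 0‖ := norm_pos_iff.2 hx
    refine ⟨(‖x‖ + 1) / ‖x.1 0‖, by positivity, fun n _ => ?_⟩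
    rw [expEmb_apply, shiftPow_expSeq, norm_smul, norm_pow, Complex.norm_real, Real.norm_eq_abs,
      abs_of_pos hp]
    have : ‖x.1 n‖ ≤ ‖x‖ + 1 := (x.1.norm_coe_le_norm n).trans (by
      change ‖x‖ ≤ _; linarith)
    calc p.2 ^ n * ‖x.1 n‖ ≤ p.2 ^ n * (‖x‖ + 1) := by gcongr
      _ = _ := by field_simp

theorem exists_expEmb_eq {A : X →ₗ.[ℂ] X} {p : ℂ × ℝ} (hp : 0 < p.2) {v : X}
    (hv : v ∈ ExpType A p.1 p.2) : ∃ x : expSeq A p, expEmb A p x = v := by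
  obtain ⟨hd, C, hC, hb⟩ := hv
  have hp' : (p.2 : ℂ) ≠ 0 := by exact_mod_cast hp.ne'
  have hbound : ∀ n, ‖((p.2 : ℂ) ^ n)⁻¹ • shiftPow A p.1 n v‖ ≤ max 1 C * ‖v‖ := fun n => by
    rw [norm_smul, norm_inv, norm_pow, Complex.norm_real, Real.norm_eq_abs, abs_of_pos hp]
    rcases Nat.eq_zero_or_pos n with rfl | hn
    · simp only [pow_zero, inv_one, one_mul]
      change ‖v‖ ≤ _
      exact le_mul_of_one_le_left (norm_nonneg _) (le_max_left _ _)
    · rw [inv_mul_le_iff₀ (by positivity)]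
      calc _ ≤ C * p.2 ^ n * ‖v‖ := hb n hn
        _ ≤ max 1 C * p.2 ^ n * ‖v‖ := by gcongr; exact le_max_right _ _
        _ = _ := by ring
  refine ⟨⟨BoundedContinuousFunction.ofNormedAddCommGroup
    (fun n => ((p.2 : ℂ) ^ n)⁻¹ • shiftPow A p.1 n v) continuous_of_discreteTopology _ hbound,
    fun n => ?_⟩, ?_⟩
  · have h1 := A.mem_graph ⟨_, hd n⟩
    have h2 := A.graph.smul_mem (((p.2 : ℂ) ^ n)⁻¹) h1
    rw [Prod.smul_mk] at h2
    have h3 : shiftPow A p.1 (n + 1) v = A ⟨_, hd n⟩ - p.1 • shiftPow A p.1 n v := by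
      rw [shiftPow, Function.iterate_succ_apply']
      exact shiftOp_of_mem_graph h1 p.1
    change (((p.2 : ℂ) ^ n)⁻¹ • shiftPow A p.1 n v,
      (p.2 : ℂ) • (((p.2 : ℂ) ^ (n + 1))⁻¹ • shiftPow A p.1 (n + 1) v) +
      p.1 • (((p.2 : ℂ) ^ n)⁻¹ • shiftPow A p.1 n v)) ∈ A.graph
    have e : (p.2 : ℂ) * ((p.2 : ℂ) ^ (n + 1))⁻¹ = ((p.2 : ℂ) ^ n)⁻¹ := by
      rw [pow_succ, mul_inv, mul_comm, mul_assoc, inv_mul_cancel₀ hp', mul_one]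
    rw [h3, smul_smul, e, smul_comm p.1, ← smul_add, sub_add_cancel]
    exact h2
  · rw [expEmb_apply]
    simp [shiftPow]

theorem expNorm_expEmb (A : X →ₗ.[ℂ] X) {p : ℂ × ℝ} (hp : 0 < p.2) (x : expSeq A p) :
    expNorm A p.1 p.2 (expEmb A p x) = ‖x‖ := by
  have h1 : ‖x‖ = ⨆ n, ‖x.1 n‖ := BoundedContinuousFunction.norm_eq_iSup_norm x.1
  rw [expNorm, h1]
  congr 1
  funext n
  rw [expEmb_apply, shiftPow_expSeq, norm_smul, norm_pow, Complex.norm_real, Real.norm_eq_abs,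
    abs_of_pos hp, mul_div_assoc, mul_div_cancel₀]
  positivity

theorem localCalc_expEmb [CompleteSpace X] {A : X →ₗ.[ℂ] X} (hA : A.IsClosed) {p : ℂ × ℝ}
    (hp : 0 < p.2) {ρ : ℝ} (hρ : p.2 < ρ) {g : ℂ → ℂ}
    (hg : DiffContOnCl ℂ g (Metric.ball p.1 ρ)) (x : expSeq A p) :
    localCalc A g p.1 (expEmb A p x) = expEmb A p (powerCalc (expShift A p) p.1 g x) := by
  have := completeSpace_expSeq hA p
  have h := hasSum_powerCalc (norm_expShift_le A hp) hρ hg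
  have h2 := ((expEmb A p).comp (ContinuousLinearMap.apply ℂ (expSeq A p) x)).hasSum h
  refine Eq.trans ?_ h2.tsum_eq
  rw [localCalc]
  refine tsum_congr fun n => ?_
  simp only [ContinuousLinearMap.comp_apply, ContinuousLinearMap.apply_apply, map_smul, expShift_pow_apply]
  rfl

end ExpSeq

/-! ### Representations of vectors and the value of `g(A)` -/

section Representation

variable {X : Type*} [NormedAddCommGroup X] [NormedSpace ℂ X]

/-- Choose a radius strictly between `ν` and the distance to the frontier (possibly infinite). A
ball of that radius is connected and contains a point of `G`; if it left `G` it would meet the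
frontier. -/
theorem Admissible.exists_closedBall {G : Set ℂ} {p : ℂ × ℝ} (hp : Admissible G p) :
    ∃ ρ, p.2 < ρ ∧ Metric.closedBall p.1 ρ ⊆ G := by
  obtain ⟨h1, h2, h3⟩ := hp
  obtain ⟨r, hr1, hr2⟩ := ENNReal.lt_iff_exists_nnreal_btwn.1 h3
  refine ⟨r, ?_, ?_⟩
  · have := (ENNReal.ofReal_lt_iff_lt_toReal h2.le ENNReal.coe_ne_top).1 hr1
    simpa using this
  · have hr : p.2 < (r : ℝ) := by
      have := (ENNReal.ofReal_lt_iff_lt_toReal h2.le ENNReal.coe_ne_top).1 hr1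
      simpa using this
    by_contra h
    obtain ⟨z, hz1, hz2⟩ := not_subset.1 h
    have hpre : IsPreconnected (Metric.closedBall p.1 (r : ℝ)) :=
      (convex_closedBall p.1 (r : ℝ)).isPreconnected
    have hfr : ∃ w ∈ Metric.closedBall p.1 (r : ℝ), w ∈ frontier G := by
      by_contra hno
      push Not at hno
      obtain ⟨w, -, hw1, hw2⟩ := hpre (interior G) (closure G)ᶜ isOpen_interior
        isClosed_closure.isOpen_compl (fun w hw => by
          by_contra h'
          rw [mem_union, not_or, mem_compl_iff, not_not] at h'
          exact hno w hw ⟨h'.2, h'.1⟩)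
        ⟨p.1, Metric.mem_closedBall_self r.2, by
          by_contra h'
          exact hno p.1 (Metric.mem_closedBall_self r.2) ⟨subset_closure h1, h'⟩⟩
        ⟨z, hz1, fun h' => hno z hz1 ⟨h', fun h'' => hz2 (interior_subset h'')⟩⟩
      exact hw2 (subset_closure (interior_subset hw1))
    obtain ⟨w, hw1, hw2⟩ := hfr
    have h4 := Metric.infEDist_le_edist_of_mem (x := p.1) hw2
    have h5 : edist p.1 w ≤ r := by
      rw [edist_comm, edist_nndist, ENNReal.coe_le_coe]
      exact_mod_cast Metric.mem_closedBall.1 hw1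
    exact absurd (h4.trans h5) (not_le.2 hr2)

theorem Admissible.closedBall_subset {G : Set ℂ} {p : ℂ × ℝ} (hp : Admissible G p) :
    Metric.closedBall p.1 p.2 ⊆ G := by
  obtain ⟨ρ, h1, h2⟩ := hp.exists_closedBall
  exact (Metric.closedBall_subset_closedBall h1.le).trans h2

theorem diffContOnCl_of_closedBall_subset {G : Set ℂ} {ζ : ℂ} {ρ : ℝ}
    (h : Metric.closedBall ζ ρ ⊆ G) {g : ℂ → ℂ} (hg : DifferentiableOn ℂ g G) :
    DiffContOnCl ℂ g (Metric.ball ζ ρ) :=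
  (hg.mono (Metric.closure_ball_subset_closedBall.trans h)).diffContOnCl

theorem ExpType.mono {A : X →ₗ.[ℂ] X} {ζ : ℂ} {ν ν' : ℝ} (hν : 0 < ν) (h : ν ≤ ν') {v : X}
    (hv : v ∈ ExpType A ζ ν) : v ∈ ExpType A ζ ν' := by
  obtain ⟨hd, C, hC, hb⟩ := hv
  exact ⟨hd, C, hC, fun n hn => (hb n hn).trans (by gcongr)⟩

theorem ExpType.add {A : X →ₗ.[ℂ] X} {ζ : ℂ} {ν : ℝ} (hν : 0 < ν) {v w : X}
    (hv : v ∈ ExpType A ζ ν) (hw : w ∈ ExpType A ζ ν) : v + w ∈ ExpType A ζ ν := by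
  obtain ⟨x, rfl⟩ := exists_expEmb_eq (p := (ζ, ν)) hν hv
  obtain ⟨y, rfl⟩ := exists_expEmb_eq (p := (ζ, ν)) hν hw
  rw [← map_add]
  exact expEmb_mem_ExpType A (p := (ζ, ν)) hν _

theorem ExpType.neg {A : X →ₗ.[ℂ] X} {ζ : ℂ} {ν : ℝ} (hν : 0 < ν) {v : X}
    (hv : v ∈ ExpType A ζ ν) : -v ∈ ExpType A ζ ν := by
  obtain ⟨x, rfl⟩ := exists_expEmb_eq (p := (ζ, ν)) hν hv
  rw [← map_neg]
  exact expEmb_mem_ExpType A (p := (ζ, ν)) hν _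

theorem ExpType.zero {A : X →ₗ.[ℂ] X} {ζ : ℂ} {ν : ℝ} (hν : 0 < ν) :
    (0 : X) ∈ ExpType A ζ ν := by
  rw [← map_zero (expEmb A (ζ, ν))]
  exact expEmb_mem_ExpType A (p := (ζ, ν)) hν _

theorem expNorm_zero {A : X →ₗ.[ℂ] X} {ζ : ℂ} {ν : ℝ} (hν : 0 < ν) :
    expNorm A ζ ν 0 = 0 := by
  have := expNorm_expEmb A (p := (ζ, ν)) hν 0
  simpa using this

-- `IsRepr` is indexed by centres, not by pairs, so the vectors with a common centre are merged.
-- Their sum has the largest of the types involved.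
open Classical in
theorem exists_isRepr {A : X →ₗ.[ℂ] X} {G : Set ℂ} {σ : Finset (ℂ × ℝ)}
    (hσ : ∀ p ∈ σ, Admissible G p) {w : ℂ × ℝ → X} (hw : ∀ p ∈ σ, w p ∈ ExpType A p.1 p.2) :
    ∃ r, IsRepr A G (∑ p ∈ σ, w p) r := by
  refine ⟨(σ.image Prod.fst, fun ζ => ∑ p ∈ σ with p.1 = ζ, w p), fun ζ hζ => ?_, ?_⟩
  · obtain ⟨p, hp, hpζ⟩ := Finset.mem_image.1 hζ
    refine Finset.sum_induction_nonempty w (fun v => ∃ ν, Admissible G (ζ, ν) ∧ v ∈ ExpType A ζ ν)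
      ?_ ⟨p, Finset.mem_filter.2 ⟨hp, hpζ⟩⟩ ?_
    · rintro v v' ⟨ν, h1, h2⟩ ⟨ν', h1', h2'⟩
      rcases le_total ν ν' with h | h
      · exact ⟨ν', h1', ExpType.add h1'.2.1 (ExpType.mono h1.2.1 h h2) h2'⟩
      · exact ⟨ν, h1, ExpType.add h1.2.1 h2 (ExpType.mono h1'.2.1 h h2')⟩
    · intro q hq
      obtain ⟨hq1, hq2⟩ := Finset.mem_filter.1 hq
      subst hq2
      exact ⟨q.2, hσ q hq1, hw q hq1⟩
  · exact (Finset.sum_fiberwise_of_maps_to (fun p hp => Finset.mem_image_of_mem _ hp) w).symm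

variable [CompleteSpace X] {A : X →ₗ.[ℂ] X} {G : Set ℂ}



theorem localCalc_neg (hA : A.IsClosed) {p : ℂ × ℝ} (hp : Admissible G p) {g : ℂ → ℂ}
    (hg : DifferentiableOn ℂ g G) {v : X} (hv : v ∈ ExpType A p.1 p.2) :
    localCalc A g p.1 (-v) = -localCalc A g p.1 v := by
  obtain ⟨ρ, h1, h2⟩ := hp.exists_closedBall
  have hg' := diffContOnCl_of_closedBall_subset h2 hg
  obtain ⟨x, rfl⟩ := exists_expEmb_eq hp.2.1 hv
  rw [← map_neg, localCalc_expEmb hA hp.2.1 h1 hg', localCalc_expEmb hA hp.2.1 h1 hg', map_neg,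
    map_neg]



theorem sum_localCalc_eq_zero (hA : A.IsClosed) (hG : IsOpen G)
    (hAG : NoEigenfieldOnHoles A G) {ι : Type*} [Fintype ι] {q : ι → ℂ × ℝ}
    (hq : ∀ i, Admissible G (q i)) {v : ι → X} (hv : ∀ i, v i ∈ ExpType A (q i).1 (q i).2)
    (hsum : ∑ i, v i = 0) {g : ℂ → ℂ} (hg : DifferentiableOn ℂ g G) :
    ∑ i, localCalc A g (q i).1 (v i) = 0 := by
  have : ∀ i, CompleteSpace (expSeq A (q i)) := fun i => completeSpace_expSeq hA (q i)
  choose x hx using fun i => exists_expEmb_eq (hq i).2.1 (hv i)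
  have h := sum_powerCalc_eq_zero (A := A) (N := fun i => expShift A (q i))
    (ζ := fun i => (q i).1) (ν := fun i => (q i).2) (J := fun i => expEmb A (q i)) hG hAG
    (fun i => norm_expShift_le A (hq i).2.1) (fun i => (hq i).closedBall_subset)
    (fun i x => expEmb_mem_graph A (q i) x) (v := x)
    ((Finset.sum_congr rfl fun i _ => hx i).trans hsum) hg
  rw [← h]
  refine Finset.sum_congr rfl fun i _ => ?_
  obtain ⟨ρ, h1, h2⟩ := (hq i).exists_closedBall
  rw [← hx i, localCalc_expEmb hA (hq i).2.1 h1 (diffContOnCl_of_closedBall_subset h2 hg)]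

/-- The given family and the negatives of the representation chosen in `funCalc`, indexed by a
disjoint sum, form a representation of zero. -/
theorem funCalc_sum (hA : A.IsClosed) (hG : IsOpen G)
    (hAG : NoEigenfieldOnHoles A G) {σ : Finset (ℂ × ℝ)} (hσ : ∀ p ∈ σ, Admissible G p) {w : ℂ × ℝ → X}
    (hw : ∀ p ∈ σ, w p ∈ ExpType A p.1 p.2) {g : ℂ → ℂ} (hg : DifferentiableOn ℂ g G) :
    funCalc A G g (∑ p ∈ σ, w p) = ∑ p ∈ σ, localCalc A g p.1 (w p) := by
  have hr := exists_isRepr hσ hw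
  rw [funCalc, dif_pos hr]
  set r := hr.choose
  obtain ⟨h1, h2⟩ : IsRepr A G (∑ p ∈ σ, w p) r := hr.choose_spec
  choose ν hν1 hν2 using h1
  have key := sum_localCalc_eq_zero hA hG hAG (ι := σ ⊕ r.1)
    (q := Sum.elim (fun p => p.1) (fun ζ => (ζ.1, ν ζ.1 ζ.2)))
    (v := Sum.elim (fun p => w p.1) (fun ζ => -r.2 ζ.1))
    (Sum.rec (fun p => hσ p.1 p.2) fun ζ => hν1 ζ.1 ζ.2)
    (Sum.rec (fun p => hw p.1 p.2) fun ζ => ExpType.neg (hν1 ζ.1 ζ.2).2.1 (hν2 ζ.1 ζ.2))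
    (by
      rw [Fintype.sum_sum_type]
      simp only [Sum.elim_inl, Sum.elim_inr, Finset.sum_neg_distrib]
      rw [Finset.sum_coe_sort σ w, Finset.sum_coe_sort r.1 r.2, ← h2, add_neg_cancel]) hg
  rw [Fintype.sum_sum_type] at key
  simp only [Sum.elim_inl, Sum.elim_inr] at key
  have h3 : ∀ ζ : r.1, localCalc A g ζ.1 (-r.2 ζ.1) = -localCalc A g ζ.1 (r.2 ζ.1) := fun ζ =>
    localCalc_neg (p := (ζ.1, ν ζ.1 ζ.2)) hA (hν1 ζ.1 ζ.2) hg (hν2 ζ.1 ζ.2)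
  rw [Finset.sum_congr rfl fun ζ _ => h3 ζ, Finset.sum_neg_distrib,
    Finset.sum_coe_sort σ (fun p => localCalc A g p.1 (w p)),
    Finset.sum_coe_sort r.1 (fun ζ => localCalc A g ζ (r.2 ζ)), add_neg_eq_zero] at key
  exact key.symm

end Representation

/-! ### The Banach space `E_σ` -/

section StepQuot

variable {X : Type*} [NormedAddCommGroup X] [NormedSpace ℂ X]

/-- The product of the spaces `E_{ζ,ν}`, `(ζ, ν) ∈ σ`. -/
abbrev StepProd (A : X →ₗ.[ℂ] X) (σ : Finset (ℂ × ℝ)) : Type _ := ∀ p : σ, expSeq A p.1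

/-- The sum map from the product of the spaces `E_{ζ,ν}` to `X`. -/
def stepSum (A : X →ₗ.[ℂ] X) (σ : Finset (ℂ × ℝ)) : StepProd A σ →L[ℂ] X :=
  ∑ p : σ, (expEmb A p.1).comp (ContinuousLinearMap.proj p)

theorem stepSum_apply (A : X →ₗ.[ℂ] X) (σ : Finset (ℂ × ℝ)) (x : StepProd A σ) :
    stepSum A σ x = ∑ p : σ, expEmb A p.1 (x p) := by
  simp [stepSum]

/-- The kernel of the sum map. -/
def stepKer (A : X →ₗ.[ℂ] X) (σ : Finset (ℂ × ℝ)) : Submodule ℂ (StepProd A σ) :=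
  (stepSum A σ).ker

instance isClosed_stepKer (A : X →ₗ.[ℂ] X) (σ : Finset (ℂ × ℝ)) :
    IsClosed (stepKer A σ : Set (StepProd A σ)) := ContinuousLinearMap.isClosed_ker _

/-- The Banach space `E_σ`. -/
def StepQuot (A : X →ₗ.[ℂ] X) (σ : Finset (ℂ × ℝ)) : Type _ :=
  StepProd A σ ⧸ stepKer A σ

instance (A : X →ₗ.[ℂ] X) (σ : Finset (ℂ × ℝ)) : NormedAddCommGroup (StepQuot A σ) :=
  inferInstanceAs (NormedAddCommGroup (StepProd A σ ⧸ stepKer A σ))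

instance (A : X →ₗ.[ℂ] X) (σ : Finset (ℂ × ℝ)) : NormedSpace ℂ (StepQuot A σ) :=
  inferInstanceAs (NormedSpace ℂ (StepProd A σ ⧸ stepKer A σ))

theorem completeSpace_stepQuot [CompleteSpace X] {A : X →ₗ.[ℂ] X} (hA : A.IsClosed)
    (σ : Finset (ℂ × ℝ)) : CompleteSpace (StepQuot A σ) := by
  have : ∀ p : σ, CompleteSpace (expSeq A p.1) := fun p => completeSpace_expSeq hA p.1
  exact inferInstanceAs (CompleteSpace (StepProd A σ ⧸ stepKer A σ))

/-- The quotient map onto `E_σ`. -/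
def stepMk (A : X →ₗ.[ℂ] X) (σ : Finset (ℂ × ℝ)) : StepProd A σ →L[ℂ] StepQuot A σ :=
  LinearMap.mkContinuous (stepKer A σ).mkQ 1 fun x => by
    rw [one_mul]; exact Submodule.Quotient.norm_mk_le (S := stepKer A σ) x

theorem stepMk_surjective (A : X →ₗ.[ℂ] X) (σ : Finset (ℂ × ℝ)) :
    Function.Surjective (stepMk A σ) := Submodule.mkQ_surjective _

theorem norm_stepMk_le (A : X →ₗ.[ℂ] X) (σ : Finset (ℂ × ℝ)) (x : StepProd A σ) :
    ‖stepMk A σ x‖ ≤ ‖x‖ := Submodule.Quotient.norm_mk_le (S := stepKer A σ) x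

theorem exists_stepMk_eq (A : X →ₗ.[ℂ] X) (σ : Finset (ℂ × ℝ)) (e : StepQuot A σ) {ε : ℝ}
    (hε : 0 < ε) : ∃ x, stepMk A σ x = e ∧ ‖x‖ < ‖e‖ + ε :=
  Submodule.Quotient.norm_mk_lt (S := stepKer A σ) e hε

/-- A bounded linear map on the product that vanishes on the kernel of the sum map, as a map on
`E_σ`. -/
def stepLift (A : X →ₗ.[ℂ] X) (σ : Finset (ℂ × ℝ)) {Y : Type*} [NormedAddCommGroup Y]
    [NormedSpace ℂ Y] (F : StepProd A σ →L[ℂ] Y) (hF : ∀ x, stepSum A σ x = 0 → F x = 0) :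
    StepQuot A σ →L[ℂ] Y :=
  LinearMap.mkContinuous ((stepKer A σ).liftQ (F : StepProd A σ →ₗ[ℂ] Y) hF) ‖F‖ fun e => by
    refine le_of_forall_pos_le_add fun ε hε => ?_
    obtain ⟨x, rfl, hx⟩ := exists_stepMk_eq A σ e (show 0 < ε / (‖F‖ + 1) by positivity)
    have h1 : ‖F‖ * (ε / (‖F‖ + 1)) ≤ ε := by
      rw [mul_div_assoc', div_le_iff₀ (by positivity)]
      nlinarith
    calc ‖F x‖ ≤ ‖F‖ * ‖x‖ := F.le_opNorm x
      _ ≤ ‖F‖ * (‖stepMk A σ x‖ + ε / (‖F‖ + 1)) := by gcongr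
      _ ≤ _ := by rw [mul_add]; gcongr

theorem stepLift_stepMk (A : X →ₗ.[ℂ] X) (σ : Finset (ℂ × ℝ)) {Y : Type*} [NormedAddCommGroup Y]
    [NormedSpace ℂ Y] (F : StepProd A σ →L[ℂ] Y) (hF : ∀ x, stepSum A σ x = 0 → F x = 0)
    (x : StepProd A σ) : stepLift A σ F hF (stepMk A σ x) = F x := rfl

theorem norm_stepLift_le (A : X →ₗ.[ℂ] X) (σ : Finset (ℂ × ℝ)) {Y : Type*} [NormedAddCommGroup Y]
    [NormedSpace ℂ Y] (F : StepProd A σ →L[ℂ] Y) (hF : ∀ x, stepSum A σ x = 0 → F x = 0) :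
    ‖stepLift A σ F hF‖ ≤ ‖F‖ :=
  LinearMap.mkContinuous_norm_le _ (norm_nonneg F) _

/-- The embedding of `E_σ` in `X`. -/
def stepEmb (A : X →ₗ.[ℂ] X) (σ : Finset (ℂ × ℝ)) : StepQuot A σ →L[ℂ] X :=
  stepLift A σ (stepSum A σ) fun _ h => h

theorem stepEmb_stepMk (A : X →ₗ.[ℂ] X) (σ : Finset (ℂ × ℝ)) (x : StepProd A σ) :
    stepEmb A σ (stepMk A σ x) = stepSum A σ x := rfl

/-- `ι` identifies the Banach space `E` with the space `E_σ` and its sum norm, up to a constant. -/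
structure StepModel (A : X →ₗ.[ℂ] X) (σ : Finset (ℂ × ℝ)) {E : Type*} [NormedAddCommGroup E]
    [NormedSpace ℂ E] (ι : E →L[ℂ] X) : Prop where
  inj : Function.Injective ι
  range_eq : range ι = stepSpace A σ
  norm_le : ∀ e, ‖e‖ ≤ stepNorm A σ (ι e)
  le_norm : ∃ C : ℝ, ∀ e, stepNorm A σ (ι e) ≤ C * ‖e‖

theorem stepNorm_nonneg {A : X →ₗ.[ℂ] X} {σ : Finset (ℂ × ℝ)} (hσ : ∀ p ∈ σ, 0 < p.2) (v : X) :
    0 ≤ stepNorm A σ v := by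
  refine Real.sInf_nonneg ?_
  rintro _ ⟨w, -, -, rfl⟩
  refine Finset.sum_nonneg fun p hp => Real.iSup_nonneg fun n => ?_
  have := hσ p hp
  positivity

theorem bddBelow_stepNorm {A : X →ₗ.[ℂ] X} {σ : Finset (ℂ × ℝ)} (hσ : ∀ p ∈ σ, 0 < p.2) (v : X) :
    BddBelow {r : ℝ | ∃ w : ℂ × ℝ → X, (∀ p ∈ σ, w p ∈ ExpType A p.1 p.2) ∧ v = ∑ p ∈ σ, w p ∧
    r = ∑ p ∈ σ, expNorm A p.1 p.2 (w p)} := by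
  refine ⟨0, ?_⟩
  rintro _ ⟨w, -, -, rfl⟩
  refine Finset.sum_nonneg fun p hp => Real.iSup_nonneg fun n => ?_
  have := hσ p hp
  positivity

theorem exists_stepProd {A : X →ₗ.[ℂ] X} {σ : Finset (ℂ × ℝ)} (hσ : ∀ p ∈ σ, 0 < p.2)
    {w : ℂ × ℝ → X} (hw : ∀ p ∈ σ, w p ∈ ExpType A p.1 p.2) :
    ∃ x : StepProd A σ, (∀ p : σ, expEmb A p.1 (x p) = w p.1) ∧
      stepSum A σ x = ∑ p ∈ σ, w p ∧ ‖x‖ ≤ ∑ p ∈ σ, expNorm A p.1 p.2 (w p) := by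
  choose x hx using fun p : σ => exists_expEmb_eq (hσ p.1 p.2) (hw p.1 p.2)
  refine ⟨x, hx, ?_, ?_⟩
  · rw [stepSum_apply, Finset.sum_congr rfl fun p _ => hx p]
    exact Finset.sum_coe_sort σ w
  · have h1 : ∑ p ∈ σ, expNorm A p.1 p.2 (w p) = ∑ p : σ, ‖x p‖ := by
      rw [← Finset.sum_coe_sort σ (fun p => expNorm A p.1 p.2 (w p))]
      exact Finset.sum_congr rfl fun p _ => by rw [← hx p, expNorm_expEmb A (hσ p.1 p.2)]
    rw [h1]
    refine (pi_norm_le_iff_of_nonneg (Finset.sum_nonneg fun _ _ => norm_nonneg _)).2 fun p => ?_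
    exact Finset.single_le_sum (f := fun p => ‖x p‖) (fun _ _ => norm_nonneg _) (Finset.mem_univ p)

open Classical in
/-- The family of vectors in `X` given by an element of the product. -/
def stepVec (A : X →ₗ.[ℂ] X) (σ : Finset (ℂ × ℝ)) (x : StepProd A σ) (p : ℂ × ℝ) : X :=
  if hp : p ∈ σ then expEmb A p (x ⟨p, hp⟩) else 0

theorem stepVec_mem {A : X →ₗ.[ℂ] X} {σ : Finset (ℂ × ℝ)} (hσ : ∀ p ∈ σ, 0 < p.2)
    (x : StepProd A σ) (p : ℂ × ℝ) (hp : p ∈ σ) : stepVec A σ x p ∈ ExpType A p.1 p.2 := by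
  rw [stepVec, dif_pos hp]
  exact expEmb_mem_ExpType A (hσ p hp) _

theorem stepVec_coe (A : X →ₗ.[ℂ] X) (σ : Finset (ℂ × ℝ)) (x : StepProd A σ) (p : σ) :
    stepVec A σ x p.1 = expEmb A p.1 (x p) := by
  rw [stepVec, dif_pos p.2]

theorem sum_stepVec (A : X →ₗ.[ℂ] X) (σ : Finset (ℂ × ℝ)) (x : StepProd A σ) :
    ∑ p ∈ σ, stepVec A σ x p = stepSum A σ x := by
  rw [stepSum_apply, ← Finset.sum_coe_sort σ (stepVec A σ x)]
  exact Finset.sum_congr rfl fun p _ => stepVec_coe A σ x p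

theorem stepEmb_injective (A : X →ₗ.[ℂ] X) (σ : Finset (ℂ × ℝ)) :
    Function.Injective (stepEmb A σ) := by
  rw [injective_iff_map_eq_zero]
  intro e he
  obtain ⟨x, rfl⟩ := stepMk_surjective A σ e
  exact (Submodule.Quotient.mk_eq_zero (stepKer A σ)).2 he

/-- The finite product carries the maximum norm while `stepNorm` is a sum, so the quotient norm is
at most `stepNorm`, and conversely up to the factor `σ.card`. -/
theorem stepModel_stepEmb (A : X →ₗ.[ℂ] X) {σ : Finset (ℂ × ℝ)} (hσ : ∀ p ∈ σ, 0 < p.2) :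
    StepModel A σ (stepEmb A σ) where
  inj := stepEmb_injective A σ
  range_eq := by
    ext v
    constructor
    · rintro ⟨e, rfl⟩
      obtain ⟨x, rfl⟩ := stepMk_surjective A σ e
      exact ⟨stepVec A σ x, stepVec_mem hσ x, (sum_stepVec A σ x).symm⟩
    · rintro ⟨w, hw, rfl⟩
      obtain ⟨x, -, hx, -⟩ := exists_stepProd hσ hw
      exact ⟨stepMk A σ x, hx⟩
  norm_le := fun e => by
    obtain ⟨x, rfl⟩ := stepMk_surjective A σ e
    refine le_csInf ⟨_, stepVec A σ x, stepVec_mem hσ x, (sum_stepVec A σ x).symm, rfl⟩ ?_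
    rintro _ ⟨w, hw, hw2, rfl⟩
    obtain ⟨y, -, hy, hyn⟩ := exists_stepProd hσ hw
    have : stepMk A σ x = stepMk A σ y :=
      stepEmb_injective A σ (hw2.trans hy.symm)
    rw [this]
    exact (norm_stepMk_le A σ y).trans hyn
  le_norm := by
    refine ⟨σ.card, fun e => ?_⟩
    refine le_of_forall_pos_le_add fun ε hε => ?_
    obtain ⟨x, hx, hxn⟩ := exists_stepMk_eq A σ e
      (show 0 < ε / (σ.card + 1) by positivity)
    subst hx
    have h1 : stepNorm A σ (stepSum A σ x) ≤ ∑ p ∈ σ, expNorm A p.1 p.2 (stepVec A σ x p) :=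
      csInf_le (bddBelow_stepNorm hσ _)
        ⟨stepVec A σ x, stepVec_mem hσ x, (sum_stepVec A σ x).symm, rfl⟩
    have h2 : ∑ p ∈ σ, expNorm A p.1 p.2 (stepVec A σ x p) ≤ ∑ p ∈ σ, ‖x‖ := by
      refine Finset.sum_le_sum fun p hp => ?_
      rw [stepVec, dif_pos hp, expNorm_expEmb A (hσ p hp)]
      exact norm_le_pi_norm x ⟨p, hp⟩
    rw [Finset.sum_const, nsmul_eq_mul] at h2
    refine (h1.trans h2).trans ?_
    have h3 : (σ.card : ℝ) * (ε / (σ.card + 1)) ≤ ε := by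
      rw [mul_div_assoc', div_le_iff₀ (by positivity)]
      nlinarith
    nlinarith [mul_le_mul_of_nonneg_left hxn.le (Nat.cast_nonneg (α := ℝ) σ.card)]

theorem stepSpace_mono {A : X →ₗ.[ℂ] X} {σ σ' : Finset (ℂ × ℝ)} (h : σ ⊆ σ')
    (hσ' : ∀ p ∈ σ', 0 < p.2) : stepSpace A σ ⊆ stepSpace A σ' := by
  classical
  rintro _ ⟨w, hw, rfl⟩
  refine ⟨fun p => if p ∈ σ then w p else 0, fun p hp => ?_, ?_⟩
  · by_cases hpσ : p ∈ σ
    · simp only [if_pos hpσ]; exact hw p hpσ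
    · simp only [if_neg hpσ]; exact ExpType.zero (hσ' p hp)
  · rw [Finset.sum_ite_mem, Finset.inter_eq_right.2 h]

/-- Membership of `v` matters: for a vector outside `E_σ` the infimum is taken over the empty set
and has the value 0. -/
theorem stepNorm_mono {A : X →ₗ.[ℂ] X} {σ σ' : Finset (ℂ × ℝ)} (h : σ ⊆ σ')
    (hσ' : ∀ p ∈ σ', 0 < p.2) {v : X} (hv : v ∈ stepSpace A σ) :
    stepNorm A σ' v ≤ stepNorm A σ v := by
  classical
  obtain ⟨w₀, hw₀, hv₀⟩ := hv
  refine csInf_le_csInf (bddBelow_stepNorm hσ' v) ⟨_, w₀, hw₀, hv₀, rfl⟩ ?_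
  rintro _ ⟨w, hw, hv, rfl⟩
  refine ⟨fun p => if p ∈ σ then w p else 0, fun p hp => ?_, ?_, ?_⟩
  · by_cases hpσ : p ∈ σ
    · simp only [if_pos hpσ]; exact hw p hpσ
    · simp only [if_neg hpσ]; exact ExpType.zero (hσ' p hp)
  · rw [Finset.sum_ite_mem, Finset.inter_eq_right.2 h]; exact hv
  · rw [← Finset.sum_subset h (fun p hp hpσ => by
      simp only [if_neg hpσ]; exact expNorm_zero (hσ' p hp))]
    exact Finset.sum_congr rfl fun p hp => by simp only [if_pos hp]

theorem stepSpace_subset_ExpSpace {A : X →ₗ.[ℂ] X} {G : Set ℂ} {σ : Finset (ℂ × ℝ)}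
    (hσ : ∀ p ∈ σ, Admissible G p) : stepSpace A σ ⊆ ExpSpace A G := by
  rintro _ ⟨w, hw, rfl⟩
  exact exists_isRepr hσ hw

theorem exists_stepSpace_of_mem_ExpSpace {A : X →ₗ.[ℂ] X} {G : Set ℂ} {u : X}
    (hu : u ∈ ExpSpace A G) :
    ∃ σ : Finset (ℂ × ℝ), (∀ p ∈ σ, Admissible G p) ∧ u ∈ stepSpace A σ := by
  classical
  obtain ⟨r, h1, h2⟩ := hu
  choose! ν hν1 hν2 using h1
  refine ⟨r.1.image fun ζ => (ζ, ν ζ), ?_, fun p => r.2 p.1, ?_, ?_⟩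
  · intro p hp
    obtain ⟨ζ, hζ, rfl⟩ := Finset.mem_image.1 hp
    exact hν1 ζ hζ
  · intro p hp
    obtain ⟨ζ, hζ, rfl⟩ := Finset.mem_image.1 hp
    exact hν2 ζ hζ
  · rw [Finset.sum_image (fun _ _ _ _ h => (Prod.mk.inj h).1), h2]

namespace StepModel

variable {A : X →ₗ.[ℂ] X} {σ : Finset (ℂ × ℝ)} {E : Type*} [NormedAddCommGroup E]
    [NormedSpace ℂ E] {ι : E →L[ℂ] X} (hι : StepModel A σ ι) (hσ : ∀ p ∈ σ, 0 < p.2)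

theorem exists_eq (hι : StepModel A σ ι) {v : X} (hv : v ∈ stepSpace A σ) : ∃ e, ι e = v := by
  rw [← hι.range_eq] at hv
  exact hv

theorem mem (hι : StepModel A σ ι) (e : E) : ι e ∈ stepSpace A σ := by
  rw [← hι.range_eq]; exact mem_range_self e

theorem tendsto_stepNorm (hι : StepModel A σ ι) (hσ : ∀ p ∈ σ, 0 < p.2) {α : Type*} {l : Filter α}
    {e : α → E} (he : Tendsto e l (𝓝 0)) : Tendsto (fun a => stepNorm A σ (ι (e a))) l (𝓝 0) := by
  obtain ⟨C, hC⟩ := hι.le_norm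
  refine squeeze_zero (fun a => stepNorm_nonneg hσ _) (fun a => hC (e a)) ?_
  simpa using he.norm.const_mul C

theorem tendsto_of_stepNorm (hι : StepModel A σ ι) {α : Type*} {l : Filter α}
    {e : α → E} (he : Tendsto (fun a => stepNorm A σ (ι (e a))) l (𝓝 0)) : Tendsto e l (𝓝 0) :=
  squeeze_zero_norm (fun a => hι.norm_le (e a)) he

theorem stepContinuousOn (hι : StepModel A σ ι) (hσ : ∀ p ∈ σ, 0 < p.2) {J : Set ℝ} {u : ℝ → X}
    {û : ℝ → E} (hû : ContinuousOn û J) (hu : ∀ t ∈ J, u t = ι (û t)) :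
    StepContinuousOn A σ J u := by
  intro t ht
  refine ⟨by rw [hu t ht]; exact hι.mem _, ?_⟩
  have h1 : Tendsto (fun s => û s - û t) (𝓝[J] t) (𝓝 0) := by
    have := (hû t ht).tendsto.sub_const (û t)
    rwa [sub_self] at this
  refine (hι.tendsto_stepNorm hσ h1).congr' ?_
  filter_upwards [self_mem_nhdsWithin] with s hs
  rw [hu s hs, hu t ht, map_sub]

theorem exists_lift (hι : StepModel A σ ι) {J : Set ℝ} {u : ℝ → X}
    (hu : StepContinuousOn A σ J u) : ∃ û : ℝ → E, ContinuousOn û J ∧ ∀ t ∈ J, u t = ι (û t) := by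
  choose! û hû using fun t (ht : t ∈ J) => hι.exists_eq (hu t ht).1
  refine ⟨û, fun t ht => ?_, fun t ht => (hû t ht).symm⟩
  have h1 : Tendsto (fun s => û s - û t) (𝓝[J] t) (𝓝 0) := by
    refine hι.tendsto_of_stepNorm ((hu t ht).2.congr' ?_)
    filter_upwards [self_mem_nhdsWithin] with s hs
    rw [map_sub, hû s hs, hû t ht]
  have := h1.add_const (û t)
  simpa [ContinuousWithinAt] using this

theorem map_slope (ι : E →L[ℂ] X) (c : ℝ) (a b d : E) :
    c • (ι a - ι b) - ι d = ι (c • (a - b) - d) := by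
  rw [map_sub, ← Complex.coe_smul, ← Complex.coe_smul, map_smul, map_sub]

theorem stepHasDerivOn (hι : StepModel A σ ι) (hσ : ∀ p ∈ σ, 0 < p.2) {J : Set ℝ} {u u' : ℝ → X}
    {û û' : ℝ → E} (hu : ∀ t ∈ J, u t = ι (û t)) (hu' : ∀ t ∈ J, u' t = ι (û' t))
    (hd : ∀ t ∈ J, HasDerivWithinAt û (û' t) J t) : StepHasDerivOn A σ J u u' := by
  intro t ht
  have h1 := hasDerivWithinAt_iff_tendsto_slope.1 (hd t ht)
  have h2 : Tendsto (fun s => (s - t)⁻¹ • (û s - û t) - û' t) (𝓝[J \ {t}] t) (𝓝 0) := by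
    have := h1.sub_const (û' t)
    rw [sub_self] at this
    exact this
  refine (hι.tendsto_stepNorm hσ h2).congr' ?_
  filter_upwards [self_mem_nhdsWithin] with s hs
  rw [hu s hs.1, hu t ht, hu' t ht, map_slope]

theorem hasDerivWithinAt (hι : StepModel A σ ι) {J : Set ℝ} {u u' : ℝ → X}
    {û û' : ℝ → E} (hu : ∀ t ∈ J, u t = ι (û t)) (hu' : ∀ t ∈ J, u' t = ι (û' t))
    (hd : StepHasDerivOn A σ J u u') {t : ℝ} (ht : t ∈ J) : HasDerivWithinAt û (û' t) J t := by
  rw [hasDerivWithinAt_iff_tendsto_slope]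
  have h2 : Tendsto (fun s => (s - t)⁻¹ • (û s - û t) - û' t) (𝓝[J \ {t}] t) (𝓝 0) := by
    refine hι.tendsto_of_stepNorm ((hd t ht).congr' ?_)
    filter_upwards [self_mem_nhdsWithin] with s hs
    rw [hu s hs.1, hu t ht, hu' t ht, map_slope]
  have := h2.add_const (û' t)
  simpa [slope, slope_fun_def] using this

end StepModel

/-- The function is lifted to the model space in order to know that differences of its values lie in
`E_σ`, as `stepNorm_mono` requires. -/
theorem StepContinuousOn.mono {A : X →ₗ.[ℂ] X} {σ σ' : Finset (ℂ × ℝ)} (h : σ ⊆ σ')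
    (hσ' : ∀ p ∈ σ', 0 < p.2) {J : Set ℝ} {u : ℝ → X} (hu : StepContinuousOn A σ J u) :
    StepContinuousOn A σ' J u := by
  have hι := stepModel_stepEmb A (σ := σ) fun p hp => hσ' p (h hp)
  obtain ⟨û, -, hu2⟩ := hι.exists_lift hu
  intro t ht
  refine ⟨stepSpace_mono h hσ' (hu t ht).1, ?_⟩
  refine squeeze_zero' (Eventually.of_forall fun s => stepNorm_nonneg hσ' _) ?_ (hu t ht).2
  filter_upwards [self_mem_nhdsWithin] with s hs
  refine stepNorm_mono h hσ' ?_
  rw [hu2 s hs, hu2 t ht, ← map_sub]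
  exact hι.mem _

theorem StepHasDerivOn.mono {A : X →ₗ.[ℂ] X} {σ σ' : Finset (ℂ × ℝ)} (h : σ ⊆ σ')
    (hσ' : ∀ p ∈ σ', 0 < p.2) {J : Set ℝ} {u u' : ℝ → X} (hu : StepContinuousOn A σ J u)
    (hu' : StepContinuousOn A σ J u') (hd : StepHasDerivOn A σ J u u') :
    StepHasDerivOn A σ' J u u' := by
  have hι := stepModel_stepEmb A (σ := σ) fun p hp => hσ' p (h hp)
  obtain ⟨û, -, hu2⟩ := hι.exists_lift hu
  obtain ⟨û', -, hu2'⟩ := hι.exists_lift hu'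
  intro t ht
  refine squeeze_zero' (Eventually.of_forall fun s => stepNorm_nonneg hσ' _) ?_ (hd t ht)
  filter_upwards [self_mem_nhdsWithin] with s hs
  refine stepNorm_mono h hσ' ?_
  rw [hu2 s hs.1, hu2 t ht, hu2' t ht, StepModel.map_slope]
  exact hι.mem _

end StepQuot

/-! ### The operator calculus on `E_σ` -/

section StepCalc

variable {X : Type*} [NormedAddCommGroup X] [NormedSpace ℂ X]

/-- The operator calculus on the product of the spaces `E_{ζ,ν}`. -/
def prodCalc (A : X →ₗ.[ℂ] X) (σ : Finset (ℂ × ℝ)) (g : ℂ → ℂ) :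
    StepProd A σ →L[ℂ] StepProd A σ :=
  ContinuousLinearMap.pi fun p =>
    (powerCalc (expShift A p.1) p.1.1 g).comp (ContinuousLinearMap.proj p)

theorem prodCalc_apply (A : X →ₗ.[ℂ] X) (σ : Finset (ℂ × ℝ)) (g : ℂ → ℂ) (x : StepProd A σ)
    (p : σ) : prodCalc A σ g x p = powerCalc (expShift A p.1) p.1.1 g (x p) := rfl

open Classical in
/-- The operator `g(A)` on `E_σ`. -/
def stepCalc (A : X →ₗ.[ℂ] X) (σ : Finset (ℂ × ℝ)) (g : ℂ → ℂ) :
    StepQuot A σ →L[ℂ] StepQuot A σ :=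
  if h : ∀ x, stepSum A σ x = 0 → ((stepMk A σ).comp (prodCalc A σ g)) x = 0 then
    stepLift A σ ((stepMk A σ).comp (prodCalc A σ g)) h
  else 0

theorem stepMk_eq_zero_iff (A : X →ₗ.[ℂ] X) (σ : Finset (ℂ × ℝ)) (x : StepProd A σ) :
    stepMk A σ x = 0 ↔ stepSum A σ x = 0 :=
  ⟨fun h => by rw [← stepEmb_stepMk, h, map_zero],
    fun h => stepEmb_injective A σ (by rw [stepEmb_stepMk, h, map_zero])⟩

variable [CompleteSpace X] {A : X →ₗ.[ℂ] X} {G : Set ℂ}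

/-- This lets the diagonal calculus on the product descend to the quotient, so `stepCalc` is not its
default value 0 when `g` is holomorphic on `G`. -/
theorem stepSum_prodCalc_eq_zero (hA : A.IsClosed) (hG : IsOpen G)
    (hAG : NoEigenfieldOnHoles A G) {σ : Finset (ℂ × ℝ)} (hσ : ∀ p ∈ σ, Admissible G p) {g : ℂ → ℂ}
    (hg : DifferentiableOn ℂ g G) (x : StepProd A σ) (hx : stepSum A σ x = 0) :
    stepSum A σ (prodCalc A σ g x) = 0 := by
  have : ∀ p : σ, CompleteSpace (expSeq A p.1) := fun p => completeSpace_expSeq hA p.1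
  rw [stepSum_apply] at hx ⊢
  exact sum_powerCalc_eq_zero (A := A) (N := fun p : σ => expShift A p.1)
    (ζ := fun p : σ => p.1.1) (ν := fun p => p.1.2) (J := fun p => expEmb A p.1) hG hAG
    (fun p => norm_expShift_le A (hσ p.1 p.2).2.1) (fun p => (hσ p.1 p.2).closedBall_subset)
    (fun p x => expEmb_mem_graph A p.1 x) (v := x) hx hg

theorem stepCalc_stepMk (hA : A.IsClosed) (hG : IsOpen G)
    (hAG : NoEigenfieldOnHoles A G) {σ : Finset (ℂ × ℝ)} (hσ : ∀ p ∈ σ, Admissible G p) {g : ℂ → ℂ}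
    (hg : DifferentiableOn ℂ g G) (x : StepProd A σ) :
    stepCalc A σ g (stepMk A σ x) = stepMk A σ (prodCalc A σ g x) := by
  have h : ∀ x, stepSum A σ x = 0 → ((stepMk A σ).comp (prodCalc A σ g)) x = 0 := fun x hx =>
    (stepMk_eq_zero_iff A σ _).2 (stepSum_prodCalc_eq_zero hA hG hAG hσ hg x hx)
  rw [stepCalc, dif_pos h, stepLift_stepMk]
  rfl

theorem funCalc_stepEmb (hA : A.IsClosed) (hG : IsOpen G)
    (hAG : NoEigenfieldOnHoles A G) {σ : Finset (ℂ × ℝ)} (hσ : ∀ p ∈ σ, Admissible G p) {g : ℂ → ℂ}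
    (hg : DifferentiableOn ℂ g G) (e : StepQuot A σ) :
    funCalc A G g (stepEmb A σ e) = stepEmb A σ (stepCalc A σ g e) := by
  obtain ⟨x, rfl⟩ := stepMk_surjective A σ e
  rw [stepCalc_stepMk hA hG hAG hσ hg, stepEmb_stepMk, stepEmb_stepMk, ← sum_stepVec,
    funCalc_sum hA hG hAG hσ (stepVec_mem (fun p hp => (hσ p hp).2.1) x) hg, stepSum_apply,
    ← Finset.sum_coe_sort σ (fun p => localCalc A g p.1 (stepVec A σ x p))]
  refine Finset.sum_congr rfl fun p _ => ?_
  obtain ⟨ρ, h1, h2⟩ := (hσ p.1 p.2).exists_closedBall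
  rw [stepVec_coe, localCalc_expEmb hA (hσ p.1 p.2).2.1 h1 (diffContOnCl_of_closedBall_subset h2 hg),
    prodCalc_apply]

omit [CompleteSpace X] in
theorem stepCalc_ext {σ : Finset (ℂ × ℝ)} {S T : StepQuot A σ →L[ℂ] StepQuot A σ}
    (h : ∀ x, S (stepMk A σ x) = T (stepMk A σ x)) : S = T := by
  ext1 e
  obtain ⟨x, rfl⟩ := stepMk_surjective A σ e
  exact h x

theorem stepCalc_mul (hA : A.IsClosed) (hG : IsOpen G)
    (hAG : NoEigenfieldOnHoles A G) {σ : Finset (ℂ × ℝ)} (hσ : ∀ p ∈ σ, Admissible G p) {g h : ℂ → ℂ}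
    (hg : DifferentiableOn ℂ g G) (hh : DifferentiableOn ℂ h G) :
    stepCalc A σ (fun z => g z * h z) = stepCalc A σ g * stepCalc A σ h := by
  refine stepCalc_ext fun x => ?_
  rw [mul_apply_eq_comp, stepCalc_stepMk hA hG hAG hσ hh, stepCalc_stepMk hA hG hAG hσ hg,
    stepCalc_stepMk (g := fun z => g z * h z) hA hG hAG hσ (hg.mul hh)]
  congr 1
  funext p
  have := completeSpace_expSeq hA p.1
  obtain ⟨ρ, h1, h2⟩ := (hσ p.1 p.2).exists_closedBall
  rw [prodCalc_apply, prodCalc_apply, prodCalc_apply,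
    powerCalc_mul (norm_expShift_le A (hσ p.1 p.2).2.1) h1 (diffContOnCl_of_closedBall_subset h2 hg)
    (diffContOnCl_of_closedBall_subset h2 hh)]
  rfl

theorem stepCalc_commute (hA : A.IsClosed) (hG : IsOpen G)
    (hAG : NoEigenfieldOnHoles A G) {σ : Finset (ℂ × ℝ)} (hσ : ∀ p ∈ σ, Admissible G p) {g h : ℂ → ℂ}
    (hg : DifferentiableOn ℂ g G) (hh : DifferentiableOn ℂ h G) (e : StepQuot A σ) :
    stepCalc A σ g (stepCalc A σ h e) = stepCalc A σ h (stepCalc A σ g e) := by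
  have h1 := stepCalc_mul hA hG hAG hσ hg hh
  have h2 := stepCalc_mul hA hG hAG hσ hh hg
  simp_rw [mul_comm] at h1 h2
  rw [← mul_apply_eq_comp, ← mul_apply_eq_comp, ← h1, ← h2]

theorem stepCalc_sub (hA : A.IsClosed) (hG : IsOpen G)
    (hAG : NoEigenfieldOnHoles A G) {σ : Finset (ℂ × ℝ)} (hσ : ∀ p ∈ σ, Admissible G p) {g h : ℂ → ℂ}
    (hg : DifferentiableOn ℂ g G) (hh : DifferentiableOn ℂ h G) :
    stepCalc A σ (fun z => g z - h z) = stepCalc A σ g - stepCalc A σ h := by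
  rw [eq_sub_iff_add_eq]
  refine stepCalc_ext fun x => ?_
  rw [add_apply, stepCalc_stepMk hA hG hAG hσ hh, stepCalc_stepMk hA hG hAG hσ hg,
    stepCalc_stepMk (g := fun z => g z - h z) hA hG hAG hσ (hg.sub hh), ← map_add]
  congr 1
  funext p
  have := completeSpace_expSeq hA p.1
  obtain ⟨ρ, h1, h2⟩ := (hσ p.1 p.2).exists_closedBall
  have := powerCalc_add (norm_expShift_le A (hσ p.1 p.2).2.1) h1
    (diffContOnCl_of_closedBall_subset h2 (hg.sub hh)) (diffContOnCl_of_closedBall_subset h2 hh)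
  simp only [Pi.sub_apply, sub_add_cancel] at this
  rw [Pi.add_apply, prodCalc_apply, prodCalc_apply, prodCalc_apply, ← add_apply]
  exact congrArg (fun T => T (x p)) this.symm

-- One compact set serves all `g`: the union of closed discs slightly larger than those of `σ`. The
-- uniformity turns joint continuity of `f` into norm continuity of `α ↦ f(α, A)`. In the default
-- branch of `stepCalc` the bound is trivial.
omit [CompleteSpace X] in
theorem exists_norm_stepCalc_le {σ : Finset (ℂ × ℝ)} (hσ : ∀ p ∈ σ, Admissible G p) :
    ∃ K ⊆ G, IsCompact K ∧ ∃ B : ℝ, 0 ≤ B ∧ ∀ g : ℂ → ℂ, DifferentiableOn ℂ g G → ∀ C : ℝ, 0 ≤ C →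
      (∀ z ∈ K, ‖g z‖ ≤ C) → ‖stepCalc A σ g‖ ≤ B * C := by
  choose ρ h1 h2 using fun p : σ => (hσ p.1 p.2).exists_closedBall
  have hpos : ∀ p : σ, 0 ≤ (1 - p.1.2 / ρ p)⁻¹ := fun p => by
    have h3 := (hσ p.1 p.2).2.1
    have h4 := h3.trans (h1 p)
    have : p.1.2 / ρ p ≤ 1 := (div_le_one h4).2 (h1 p).le
    exact inv_nonneg.2 (by linarith)
  have hB : 0 ≤ ∑ p : σ, (1 - p.1.2 / ρ p)⁻¹ := Finset.sum_nonneg fun p _ => hpos p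
  refine ⟨⋃ p : σ, Metric.closedBall p.1.1 (ρ p), iUnion_subset h2,
    isCompact_iUnion fun p => isCompact_closedBall _ _, _, hB, fun g hg C hC hgC => ?_⟩
  have h3 : ‖prodCalc A σ g‖ ≤ (∑ p : σ, (1 - p.1.2 / ρ p)⁻¹) * C := by
    refine ContinuousLinearMap.opNorm_le_bound _ (by positivity) fun x => ?_
    refine (pi_norm_le_iff_of_nonneg (by positivity)).2 fun p => ?_
    rw [prodCalc_apply]
    have h4 := norm_powerCalc_le (norm_expShift_le A (hσ p.1 p.2).2.1) (h1 p)
      (diffContOnCl_of_closedBall_subset (h2 p) hg) (C := C) fun z hz =>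
        hgC z (mem_iUnion_of_mem p (Metric.sphere_subset_closedBall hz))
    calc _ ≤ ‖powerCalc (expShift A p.1) p.1.1 g‖ * ‖x p‖ := ContinuousLinearMap.le_opNorm _ _
      _ ≤ (C * (1 - p.1.2 / ρ p)⁻¹) * ‖x‖ := by
        gcongr
        · exact mul_nonneg hC (hpos p)
        · exact norm_le_pi_norm x p
      _ ≤ _ := by
        rw [mul_comm C]
        gcongr
        exact Finset.single_le_sum (f := fun p : σ => (1 - p.1.2 / ρ p)⁻¹) (fun p _ => hpos p)
          (Finset.mem_univ p)
  rw [stepCalc]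
  split_ifs with h
  · refine (norm_stepLift_le A σ _ _).trans ?_
    refine (ContinuousLinearMap.opNorm_comp_le _ _).trans ?_
    have h4 : ‖stepMk A σ‖ ≤ 1 := ContinuousLinearMap.opNorm_le_bound _ zero_le_one fun x => by
      rw [one_mul]; exact norm_stepMk_le A σ x
    nlinarith [norm_nonneg (prodCalc A σ g)]
  · rw [norm_zero]; positivity

end StepCalc

/-! ### The disc algebra -/

section DiscAlgebra

open Classical in
/-- The extension by zero of a function on a closed disc. -/
def discExt {ζ : ℂ} {ρ : ℝ} (g : C(Metric.closedBall ζ ρ, ℂ)) (z : ℂ) : ℂ :=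
  if h : z ∈ Metric.closedBall ζ ρ then g ⟨z, h⟩ else 0

theorem discExt_of_mem {ζ : ℂ} {ρ : ℝ} (g : C(Metric.closedBall ζ ρ, ℂ)) {z : ℂ}
    (h : z ∈ Metric.closedBall ζ ρ) : discExt g z = g ⟨z, h⟩ := dif_pos h

/-- The disc algebra: continuous functions on a closed disc that are holomorphic inside. -/
def discAlg (ζ : ℂ) (ρ : ℝ) : Subalgebra ℂ C(Metric.closedBall ζ ρ, ℂ) where
  carrier := {g | DifferentiableOn ℂ (discExt g) (Metric.ball ζ ρ)}
  mul_mem' {g h} hg hh := (DifferentiableOn.mul hg hh).congr fun z hz => by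
    have hz := Metric.ball_subset_closedBall hz
    simp [discExt_of_mem _ hz]
  add_mem' {g h} hg hh := (DifferentiableOn.add hg hh).congr fun z hz => by
    have hz := Metric.ball_subset_closedBall hz
    simp [discExt_of_mem _ hz]
  algebraMap_mem' c := (differentiableOn_const (c := c)).congr fun z hz => by
    have hz := Metric.ball_subset_closedBall hz
    simp [discExt_of_mem _ hz]

/-- Uniform limits of holomorphic functions are holomorphic. Completeness allows the Neumann series
of the symbols to be summed inside the disc algebra. -/
theorem isClosed_discAlg (ζ : ℂ) (ρ : ℝ) :
    IsClosed (discAlg ζ ρ : Set C(Metric.closedBall ζ ρ, ℂ)) := by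
  refine isClosed_of_closure_subset fun g hg => ?_
  obtain ⟨F, hF, hlim⟩ := mem_closure_iff_seq_limit.1 hg
  refine TendstoLocallyUniformlyOn.differentiableOn (F := fun n => discExt (F n)) (φ := atTop)
    (TendstoUniformlyOn.tendstoLocallyUniformlyOn ?_) (Eventually.of_forall hF) Metric.isOpen_ball
  rw [Metric.tendstoUniformlyOn_iff]
  intro ε hε
  filter_upwards [Metric.tendsto_nhds.1 hlim ε hε] with n hn z hz
  have hz := Metric.ball_subset_closedBall hz
  rw [discExt_of_mem _ hz, discExt_of_mem _ hz, dist_comm]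
  exact (ContinuousMap.dist_apply_le_dist _).trans_lt hn

instance (ζ : ℂ) (ρ : ℝ) : CompleteSpace (discAlg ζ ρ) :=
  (isClosed_discAlg ζ ρ).completeSpace_coe

theorem diffContOnCl_discExt {ζ : ℂ} {ρ : ℝ} (g : discAlg ζ ρ) :
    DiffContOnCl ℂ (discExt g.1) (Metric.ball ζ ρ) := by
  refine ⟨g.2, ContinuousOn.mono ?_ Metric.closure_ball_subset_closedBall⟩
  rw [continuousOn_iff_continuous_domRestrict]
  convert g.1.continuous using 1
  funext z
  exact discExt_of_mem _ z.2

/-- The restriction to a closed disc of a function that is holomorphic near it. -/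
def discRestr {G : Set ℂ} {ζ : ℂ} {ρ : ℝ} (hsub : Metric.closedBall ζ ρ ⊆ G) {g : ℂ → ℂ}
    (hg : DifferentiableOn ℂ g G) : discAlg ζ ρ :=
  ⟨⟨fun z => g z, (hg.continuousOn.mono hsub).domRestrict⟩,
    (hg.mono (Metric.ball_subset_closedBall.trans hsub)).congr fun _ hz =>
      discExt_of_mem _ (Metric.ball_subset_closedBall hz)⟩

/-- Evaluation at a point of the disc. -/
def discEval {ζ : ℂ} {ρ : ℝ} {z : ℂ} (hz : z ∈ Metric.closedBall ζ ρ) : discAlg ζ ρ →L[ℂ] ℂ :=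
  (ContinuousMap.evalCLM ℂ (⟨z, hz⟩ : Metric.closedBall ζ ρ)).comp
    (discAlg ζ ρ).toSubmodule.subtypeL

theorem discEval_apply {ζ : ℂ} {ρ : ℝ} {z : ℂ} (hz : z ∈ Metric.closedBall ζ ρ)
    (g : discAlg ζ ρ) : discEval hz g = discExt g.1 z := (discExt_of_mem _ hz).symm

/-- The operator calculus on the disc algebra. -/
def discCalc {E : Type*} [NormedAddCommGroup E] [NormedSpace ℂ E] [CompleteSpace E]
    {N : E →L[ℂ] E} {ζ : ℂ} {ν ρ : ℝ} (hN : ‖N‖ ≤ ν) (hνρ : ν < ρ) :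
    discAlg ζ ρ →L[ℂ] E →L[ℂ] E :=
  LinearMap.mkContinuous
    { toFun := fun g => powerCalc N ζ (discExt g.1)
      map_add' := fun g h => by
        rw [← powerCalc_add hN hνρ (diffContOnCl_discExt g) (diffContOnCl_discExt h)]
        refine powerCalc_congr ?_
        filter_upwards [Metric.closedBall_mem_nhds ζ (((norm_nonneg _).trans hN).trans_lt hνρ)]
          with z hz
        simp [discExt_of_mem _ hz]
      map_smul' := fun c g => by
        rw [RingHom.id_apply, ← powerCalc_const_mul c hN hνρ (diffContOnCl_discExt g)]
        refine powerCalc_congr ?_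
        filter_upwards [Metric.closedBall_mem_nhds ζ (((norm_nonneg _).trans hN).trans_lt hνρ)]
          with z hz
        simp [discExt_of_mem _ hz] } ((1 - ν / ρ)⁻¹) fun g => by
    rw [mul_comm]
    refine norm_powerCalc_le hN hνρ (diffContOnCl_discExt g) fun z hz => ?_
    rw [discExt_of_mem _ (Metric.sphere_subset_closedBall hz)]
    exact g.1.norm_coe_le_norm _

end DiscAlgebra

/-! ### Equations `F(b) + ∫ a(α) F(b + μ - α) lam(dα) = G(b)` -/

section Delay

variable {M : Type*} [NormedAddCommGroup M] [NormedSpace ℂ M]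

/-- The operator `G ↦ (b ↦ ∫ a(α) G(b + μ - α) lam(dα))`. -/
def delayOp (lam : Measure ℝ) (μ : ℝ) (a : ℝ → M →L[ℂ] M) (G : ℝ → M) (b : ℝ) : M :=
  ∫ α, a α (G (b + μ - α)) ∂lam

/-- The Neumann series for the equation `F + delayOp F = G`. -/
def delaySol (lam : Measure ℝ) (μ : ℝ) (a : ℝ → M →L[ℂ] M) (G : ℝ → M) (b : ℝ) : M :=
  ∑' n : ℕ, ((fun F b => -delayOp lam μ a F b)^[n] G) b

/-- The coefficients `a` are bounded by `B` and the delays `μ - α` are at least `δ`, so that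
`delayOp` is a contraction for the weight `ω ^ (-b)`. -/
structure IsDelay (lam : Measure ℝ) (μ B δ ω : ℝ) (a : ℝ → M →L[ℂ] M) : Prop where
  meas : StronglyMeasurable a
  bound : ∀ α, ‖a α‖ ≤ B
  delay : ∀ᵐ α ∂lam, δ ≤ μ - α
  one_le : 1 ≤ ω
  small : B * lam.real univ * ω ^ (-δ) ≤ 1 / 2

variable {lam : Measure ℝ} [IsFiniteMeasure lam] {μ B δ ω : ℝ} {a : ℝ → M →L[ℂ] M}

-- A delay of at least `δ` gains the factor `ω ^ (-δ)` in the weight. The shifted argument is never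
-- below `b`, so only values of `G` on `[b₁, ∞)` enter.
omit [IsFiniteMeasure lam] in
theorem IsDelay.norm_le (h : IsDelay lam μ B δ ω a) {G : ℝ → M} {C b₁ : ℝ} (hC : 0 ≤ C)
    (hG : ∀ b, b₁ ≤ b → ‖G b‖ ≤ C * ω ^ (-b)) (hδ : 0 ≤ δ) {b : ℝ} (hb : b₁ ≤ b) :
    ∀ᵐ α ∂lam, ‖a α (G (b + μ - α))‖ ≤ B * ω ^ (-δ) * (C * ω ^ (-b)) := by
  have hω : 0 < ω := zero_lt_one.trans_le h.one_le
  filter_upwards [h.delay] with α hα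
  have hB : 0 ≤ B := (norm_nonneg _).trans (h.bound α)
  calc ‖a α (G (b + μ - α))‖ ≤ ‖a α‖ * ‖G (b + μ - α)‖ := (a α).le_opNorm _
    _ ≤ B * (C * ω ^ (-(b + μ - α))) := by
      gcongr
      · exact h.bound α
      · exact hG _ (by linarith)
    _ ≤ B * (C * ω ^ (-δ + -b)) := by
      gcongr
      · exact h.one_le
      · linarith
    _ = _ := by rw [Real.rpow_add hω]; ring

theorem IsDelay.norm_delayOp_le (h : IsDelay lam μ B δ ω a) {G : ℝ → M} {C b₁ : ℝ} (hC : 0 ≤ C)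
    (hG : ∀ b, b₁ ≤ b → ‖G b‖ ≤ C * ω ^ (-b)) (hδ : 0 ≤ δ) {b : ℝ} (hb : b₁ ≤ b) :
    ‖delayOp lam μ a G b‖ ≤ 1 / 2 * C * ω ^ (-b) := by
  have hω : 0 < ω := zero_lt_one.trans_le h.one_le
  refine (norm_integral_le_of_norm_le_const (h.norm_le hC hG hδ hb)).trans ?_
  calc _ = (B * lam.real univ * ω ^ (-δ)) * (C * ω ^ (-b)) := by ring
    _ ≤ 1 / 2 * (C * ω ^ (-b)) := by gcongr; exact h.small
    _ = _ := by ring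

theorem stronglyMeasurable_clm_apply {S : Type*} [MeasurableSpace S] {T : S → M →L[ℂ] M} {v : S → M}
    (hT : StronglyMeasurable T) (hv : StronglyMeasurable v) :
    StronglyMeasurable fun s => T s (v s) :=
  isBoundedBilinearMap_apply.continuous.comp_stronglyMeasurable (hT.prodMk hv)

omit [IsFiniteMeasure lam] in
theorem IsDelay.stronglyMeasurable_integrand (h : IsDelay lam μ B δ ω a) {S : Type*}
    [MeasurableSpace S] {G : S → ℝ → M} (hG : StronglyMeasurable (Function.uncurry G)) :
    StronglyMeasurable fun p : (S × ℝ) × ℝ => a p.2 (G p.1.1 (p.1.2 + μ - p.2)) :=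
  stronglyMeasurable_clm_apply (h.meas.comp_measurable measurable_snd)
    (hG.comp_measurable (measurable_fst.fst.prodMk
      ((measurable_fst.snd.add_const μ).sub measurable_snd)))

theorem IsDelay.stronglyMeasurable_delayOp (h : IsDelay lam μ B δ ω a) {S : Type*}
    [MeasurableSpace S] {G : S → ℝ → M} (hG : StronglyMeasurable (Function.uncurry G)) :
    StronglyMeasurable (Function.uncurry fun s => delayOp lam μ a (G s)) :=
  (h.stronglyMeasurable_integrand hG).integral_prod_right

omit [NormedSpace ℂ M] in
theorem stronglyMeasurable_uncurry_const {G : ℝ → M} (hG : StronglyMeasurable G) :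
    StronglyMeasurable (Function.uncurry fun _ : Unit => G) :=
  hG.comp_measurable measurable_snd

omit [IsFiniteMeasure lam] in
theorem IsDelay.aestronglyMeasurable (h : IsDelay lam μ B δ ω a) {G : ℝ → M}
    (hG : StronglyMeasurable G) (b : ℝ) :
    AEStronglyMeasurable (fun α => a α (G (b + μ - α))) lam :=
  (stronglyMeasurable_clm_apply h.meas
    (hG.comp_measurable (measurable_const.sub measurable_id))).aestronglyMeasurable

theorem IsDelay.integrable (h : IsDelay lam μ B δ ω a) {G : ℝ → M} (hGm : StronglyMeasurable G)
    {C b₁ : ℝ} (hC : 0 ≤ C) (hG : ∀ b, b₁ ≤ b → ‖G b‖ ≤ C * ω ^ (-b)) (hδ : 0 ≤ δ) {b : ℝ}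
    (hb : b₁ ≤ b) : Integrable (fun α => a α (G (b + μ - α))) lam :=
  Integrable.of_bound (h.aestronglyMeasurable hGm b) _ (h.norm_le hC hG hδ hb)

theorem IsDelay.norm_iterate_le (h : IsDelay lam μ B δ ω a) {G : ℝ → M} {C b₁ : ℝ} (hC : 0 ≤ C)
    (hG : ∀ b, b₁ ≤ b → ‖G b‖ ≤ C * ω ^ (-b)) (hδ : 0 ≤ δ) (n : ℕ) : ∀ b, b₁ ≤ b →
    ‖((fun F b => -delayOp lam μ a F b)^[n] G) b‖ ≤ (1 / 2) ^ n * C * ω ^ (-b) := by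
  induction n with
  | zero => simpa using hG
  | succ n ih =>
    intro b hb
    rw [Function.iterate_succ_apply', norm_neg]
    refine (h.norm_delayOp_le (by positivity) ih hδ hb).trans_eq ?_
    rw [pow_succ]; ring

theorem IsDelay.stronglyMeasurable_iterate (h : IsDelay lam μ B δ ω a) {S : Type*}
    [MeasurableSpace S] {G : S → ℝ → M} (hG : StronglyMeasurable (Function.uncurry G)) (n : ℕ) :
    StronglyMeasurable (Function.uncurry fun s => (fun F b => -delayOp lam μ a F b)^[n] (G s)) := by
  induction n with
  | zero => exact hG
  | succ n ih =>
    have := (h.stronglyMeasurable_delayOp ih).neg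
    simp_rw [Function.iterate_succ_apply']
    exact this

theorem summable_half_pow_mul (C : ℝ) : Summable fun n : ℕ => (1 / 2 : ℝ) ^ n * C :=
  (summable_geometric_of_lt_one (by norm_num) (by norm_num)).mul_right C

theorem tsum_half_pow_mul (C : ℝ) : ∑' n : ℕ, (1 / 2 : ℝ) ^ n * C = 2 * C := by
  rw [tsum_mul_right, tsum_geometric_of_lt_one (by norm_num) (by norm_num)]; norm_num

variable [CompleteSpace M]

theorem IsDelay.hasSum_delaySol (h : IsDelay lam μ B δ ω a) {G : ℝ → M} {C b₁ : ℝ} (hC : 0 ≤ C)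
    (hG : ∀ b, b₁ ≤ b → ‖G b‖ ≤ C * ω ^ (-b)) (hδ : 0 ≤ δ) {b : ℝ} (hb : b₁ ≤ b) :
    HasSum (fun n : ℕ => ((fun F b => -delayOp lam μ a F b)^[n] G) b) (delaySol lam μ a G b) := by
  refine (Summable.of_norm_bounded (summable_half_pow_mul (C * ω ^ (-b))) fun n => ?_).hasSum
  refine (h.norm_iterate_le hC hG hδ n b hb).trans_eq (by ring)

omit [CompleteSpace M] in
theorem IsDelay.norm_delaySol_le (h : IsDelay lam μ B δ ω a) {G : ℝ → M} {C b₁ : ℝ} (hC : 0 ≤ C)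
    (hG : ∀ b, b₁ ≤ b → ‖G b‖ ≤ C * ω ^ (-b)) (hδ : 0 ≤ δ) {b : ℝ} (hb : b₁ ≤ b) :
    ‖delaySol lam μ a G b‖ ≤ 2 * C * ω ^ (-b) := by
  rw [mul_assoc, ← tsum_half_pow_mul]
  refine tsum_of_norm_bounded (summable_half_pow_mul (C * ω ^ (-b))).hasSum fun n => ?_
  exact (h.norm_iterate_le hC hG hδ n b hb).trans_eq (by ring)

theorem IsDelay.stronglyMeasurable_delaySol (h : IsDelay lam μ B δ ω a) {S : Type*}
    [MeasurableSpace S] {G : S → ℝ → M} (hG : StronglyMeasurable (Function.uncurry G)) {C : S → ℝ}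
    (hC : ∀ s, 0 ≤ C s) (hGC : ∀ s b, ‖G s b‖ ≤ C s * ω ^ (-b)) (hδ : 0 ≤ δ) :
    StronglyMeasurable (Function.uncurry fun s => delaySol lam μ a (G s)) := by
  refine stronglyMeasurable_of_tendsto atTop
    (f := fun N : ℕ => fun p : S × ℝ =>
      ∑ n ∈ Finset.range N, ((fun F b => -delayOp lam μ a F b)^[n] (G p.1)) p.2) (fun N => ?_) ?_
  · exact Finset.stronglyMeasurable_fun_sum _ fun n _ => h.stronglyMeasurable_iterate hG n
  · rw [tendsto_pi_nhds]
    intro p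
    exact (h.hasSum_delaySol (hC p.1) (fun b _ => hGC p.1 b) hδ
      (le_refl p.2)).tendsto_sum_nat

theorem IsDelay.stronglyMeasurable_delaySol_const (h : IsDelay lam μ B δ ω a) {G : ℝ → M}
    (hG : StronglyMeasurable G) {C : ℝ} (hC : 0 ≤ C) (hGC : ∀ b, ‖G b‖ ≤ C * ω ^ (-b))
    (hδ : 0 ≤ δ) : StronglyMeasurable (delaySol lam μ a G) :=
  (h.stronglyMeasurable_delaySol (stronglyMeasurable_uncurry_const hG) (fun _ => hC)
    (fun _ => hGC) hδ).comp_measurable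
      (measurable_const.prodMk measurable_id : Measurable fun b : ℝ => ((), b))

/-- Applying the operator to the Neumann series shifts the index by one; the sum and the integral
over `α` may be exchanged because the terms are dominated by a geometric series. -/
theorem IsDelay.delaySol_add_delayOp (h : IsDelay lam μ B δ ω a) {G : ℝ → M}
    (hGm : StronglyMeasurable G) {C : ℝ} (hC : 0 ≤ C) (hG : ∀ b, ‖G b‖ ≤ C * ω ^ (-b))
    (hδ : 0 ≤ δ) (b : ℝ) :
    delaySol lam μ a G b + delayOp lam μ a (delaySol lam μ a G) b = G b := by
  have hG' : ∀ b', b ≤ b' → ‖G b'‖ ≤ C * ω ^ (-b') := fun b' _ => hG b'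
  have hS := fun b' (hb' : b ≤ b') => h.hasSum_delaySol hC hG' hδ hb'
  have h1 := (hasSum_nat_add_iff' 1).2 (hS b le_rfl)
  simp only [Finset.range_one, Finset.sum_singleton, Function.iterate_zero, id_eq,
    Function.iterate_succ_apply'] at h1
  have hm : ∀ n : ℕ, StronglyMeasurable ((fun F b => -delayOp lam μ a F b)^[n] G) := fun n =>
    (h.stronglyMeasurable_iterate (stronglyMeasurable_uncurry_const hGm) n).comp_measurable
      (measurable_const.prodMk measurable_id : Measurable fun b : ℝ => ((), b))
  have h2 := hasSum_integral_of_summable_integral_norm (μ := lam)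
    (F := fun (n : ℕ) α => a α (((fun F b => -delayOp lam μ a F b)^[n] G) (b + μ - α)))
    (fun n => h.integrable (hm n) (by positivity) (h.norm_iterate_le hC hG' hδ n) hδ le_rfl) ?_
  · have h3 : ∫ α, ∑' n, a α (((fun F b => -delayOp lam μ a F b)^[n] G) (b + μ - α)) ∂lam =
        delayOp lam μ a (delaySol lam μ a G) b := by
      refine integral_congr_ae ?_
      filter_upwards [h.delay] with α hα
      exact ((a α).hasSum (hS _ (by linarith))).tsum_eq
    rw [h3] at h2
    have h4 := h1.unique h2.neg
    rw [sub_eq_iff_eq_add] at h4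
    rw [h4]; abel_nf
  · have hω : 0 < ω := zero_lt_one.trans_le h.one_le
    refine Summable.of_nonneg_of_le (fun n => integral_nonneg fun _ => norm_nonneg _)
      (fun n => ?_) (summable_half_pow_mul (lam.real univ * (B * ω ^ (-δ) * (C * ω ^ (-b)))))
    have h5 := norm_integral_le_of_norm_le_const (μ := lam)
      (f := fun α => ‖a α (((fun F b => -delayOp lam μ a F b)^[n] G) (b + μ - α))‖)
      (by simpa only [norm_norm] using
        h.norm_le (by positivity) (h.norm_iterate_le hC hG' hδ n) hδ le_rfl)
    refine ((le_abs_self _).trans h5).trans_eq ?_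
    ring

-- Each use of the equation halves the bound of a homogeneous solution.
omit [CompleteSpace M] in
theorem IsDelay.eq_zero (h : IsDelay lam μ B δ ω a) {F : ℝ → M} {C b₁ : ℝ} (hC : 0 ≤ C)
    (hF : ∀ b, b₁ ≤ b → ‖F b‖ ≤ C * ω ^ (-b)) (hδ : 0 ≤ δ)
    (heq : ∀ b, b₁ ≤ b → F b + delayOp lam μ a F b = 0) {b : ℝ} (hb : b₁ ≤ b) : F b = 0 := by
  have h1 : ∀ n : ℕ, ∀ b, b₁ ≤ b → ‖F b‖ ≤ (1 / 2) ^ n * C * ω ^ (-b) := by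
    intro n
    induction n with
    | zero => simpa using hF
    | succ n ih =>
      intro b hb
      rw [eq_neg_of_add_eq_zero_left (heq b hb), norm_neg]
      refine (h.norm_delayOp_le (by positivity) ih hδ hb).trans_eq ?_
      rw [pow_succ]; ring
  have h2 : Tendsto (fun n : ℕ => (1 / 2 : ℝ) ^ n * C * ω ^ (-b)) atTop (𝓝 0) := by
    have := ((tendsto_pow_atTop_nhds_zero_of_lt_one (r := (1 / 2 : ℝ)) (by norm_num)
      (by norm_num)).mul_const C).mul_const (ω ^ (-b))
    simpa using this
  exact norm_le_zero_iff.1 (ge_of_tendsto' h2 fun n => h1 n b hb)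

/-- The source of the later identities: any measurable candidate with the right decay that satisfies
the equation on a half-line of orders is the Neumann series there. -/
theorem IsDelay.eq_delaySol (h : IsDelay lam μ B δ ω a) {F G : ℝ → M} (hFm : StronglyMeasurable F)
    (hGm : StronglyMeasurable G) {C C' b₁ : ℝ} (hC : 0 ≤ C) (hC' : 0 ≤ C')
    (hF : ∀ b, b₁ ≤ b → ‖F b‖ ≤ C * ω ^ (-b)) (hG : ∀ b, ‖G b‖ ≤ C' * ω ^ (-b)) (hδ : 0 ≤ δ)
    (heq : ∀ b, b₁ ≤ b → F b + delayOp lam μ a F b = G b) {b : ℝ} (hb : b₁ ≤ b) :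
    F b = delaySol lam μ a G b := by
  have hS : ∀ b, b₁ ≤ b → ‖delaySol lam μ a G b‖ ≤ 2 * C' * ω ^ (-b) := fun b hb =>
    h.norm_delaySol_le hC' (fun b _ => hG b) hδ hb
  rw [← sub_eq_zero]
  refine h.eq_zero (F := fun b => F b - delaySol lam μ a G b) (C := C + 2 * C') (b₁ := b₁)
    (by positivity) (fun b hb => ?_) hδ (fun b hb => ?_) hb
  · exact (norm_sub_le _ _).trans ((add_le_add (hF b hb) (hS b hb)).trans_eq (by ring))
  · have h1 : delayOp lam μ a (fun b => F b - delaySol lam μ a G b) b =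
        delayOp lam μ a F b - delayOp lam μ a (delaySol lam μ a G) b := by
      simp only [delayOp, map_sub]
      exact integral_sub (h.integrable hFm hC hF hδ hb)
        (h.integrable (h.stronglyMeasurable_delaySol_const hGm hC' hG hδ) (by positivity) hS hδ hb)
    rw [h1, ← sub_eq_zero.2 (heq b hb), ← h.delaySol_add_delayOp hGm hC' hG hδ b]
    abel_nf

/-- Uniqueness for the solution with a source that is only known on `[b₁, ∞)`. -/
theorem IsDelay.delaySol_shift (h : IsDelay lam μ B δ ω a) {G G' : ℝ → M}
    (hGm : StronglyMeasurable G) (hGm' : StronglyMeasurable G') {C C' b₁ x : ℝ} (hC : 0 ≤ C)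
    (hC' : 0 ≤ C') (hG : ∀ b, ‖G b‖ ≤ C * ω ^ (-b)) (hG' : ∀ b, ‖G' b‖ ≤ C' * ω ^ (-b))
    (hδ : 0 ≤ δ) (heq : ∀ b, b₁ ≤ b → G (b + x) = G' b) {b : ℝ} (hb : b₁ ≤ b) :
    delaySol lam μ a G (b + x) = delaySol lam μ a G' b := by
  have hω : 0 < ω := zero_lt_one.trans_le h.one_le
  refine h.eq_delaySol (F := fun b => delaySol lam μ a G (b + x)) (C := 2 * C * ω ^ (-x))
    ((h.stronglyMeasurable_delaySol_const hGm hC hG hδ).comp_measurable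
      (measurable_id.add_const x)) hGm' (by positivity) hC' (fun b _ => ?_) hG' hδ
    (fun b hb => ?_) hb
  · refine (h.norm_delaySol_le hC (fun b _ => hG b) hδ (le_refl (b + x))).trans_eq ?_
    rw [neg_add, Real.rpow_add hω]; ring
  · rw [← heq b hb, ← h.delaySol_add_delayOp hGm hC hG hδ (b + x)]
    simp only [delayOp]
    congr 2
    funext α
    ring_nf

/-- The image of the solution under an intertwining map solves the image equation, so uniqueness
applies. The same `ω` has to serve both families of coefficients. -/
theorem IsDelay.map_delaySol {M' : Type*} [NormedAddCommGroup M'] [NormedSpace ℂ M']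
    [CompleteSpace M'] {B' : ℝ} {a' : ℝ → M' →L[ℂ] M'} (h : IsDelay lam μ B δ ω a)
    (h' : IsDelay lam μ B' δ ω a') (j : M →L[ℂ] M') (hj : ∀ᵐ α ∂lam, ∀ x, j (a α x) = a' α (j x))
    {G : ℝ → M} (hGm : StronglyMeasurable G) {C : ℝ} (hC : 0 ≤ C)
    (hG : ∀ b, ‖G b‖ ≤ C * ω ^ (-b)) (hδ : 0 ≤ δ) (b : ℝ) :
    j (delaySol lam μ a G b) = delaySol lam μ a' (fun b => j (G b)) b := by
  have hω : 0 < ω := zero_lt_one.trans_le h.one_le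
  have hS : ∀ b', b ≤ b' → ‖delaySol lam μ a G b'‖ ≤ 2 * C * ω ^ (-b') := fun b' hb' =>
    h.norm_delaySol_le hC (fun b _ => hG b) hδ hb'
  have hSm := h.stronglyMeasurable_delaySol_const hGm hC hG hδ
  refine h'.eq_delaySol (F := fun b => j (delaySol lam μ a G b)) (C := ‖j‖ * (2 * C))
    (C' := ‖j‖ * C) (b₁ := b) (j.continuous.comp_stronglyMeasurable hSm)
    (j.continuous.comp_stronglyMeasurable hGm)
    (by positivity) (by positivity) (fun b' hb' => ?_) (fun b => ?_) hδ (fun b' hb' => ?_) le_rfl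
  · rw [mul_assoc]; exact j.le_opNorm_of_le (hS b' hb')
  · rw [mul_assoc]; exact j.le_opNorm_of_le (hG b)
  · rw [← h.delaySol_add_delayOp hGm hC hG hδ b', map_add, delayOp, delayOp,
      ← j.integral_comp_comm (h.integrable hSm (by positivity) hS hδ hb')]
    congr 1
    refine integral_congr_ae ?_
    filter_upwards [hj] with α hα
    exact (hα _).symm

/-- By Fubini a superposition of solutions solves the equation with the superposed source. The
integrable weight `w` keeps the superposition in the uniqueness class. -/
theorem IsDelay.integral_delaySol (h : IsDelay lam μ B δ ω a) {S : Type*} [MeasurableSpace S]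
    {ν : Measure S} [SFinite ν] {G : S → ℝ → M} (hGm : StronglyMeasurable (Function.uncurry G))
    {w : S → ℝ} (hw0 : ∀ s, 0 ≤ w s) (hw : Integrable w ν)
    (hG : ∀ s b, ‖G s b‖ ≤ w s * ω ^ (-b)) (hδ : 0 ≤ δ) (b : ℝ) :
    ∫ s, delaySol lam μ a (G s) b ∂ν = delaySol lam μ a (fun b => ∫ s, G s b ∂ν) b := by
  have hω : 0 < ω := zero_lt_one.trans_le h.one_le
  have hSm := h.stronglyMeasurable_delaySol hGm hw0 hG hδ
  have hS : ∀ s b, ‖delaySol lam μ a (G s) b‖ ≤ 2 * w s * ω ^ (-b) := fun s b =>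
    h.norm_delaySol_le (hw0 s) (fun b _ => hG s b) hδ le_rfl
  have hSi : ∀ b, Integrable (fun s => delaySol lam μ a (G s) b) ν := fun b =>
    ((hw.const_mul 2).mul_const (ω ^ (-b))).mono'
      (hSm.comp_measurable (measurable_id.prodMk measurable_const)).aestronglyMeasurable
      (Eventually.of_forall fun s => hS s b)
  have hGs : ∀ s, StronglyMeasurable (G s) := fun s =>
    hGm.comp_measurable (measurable_const.prodMk measurable_id)
  have hswap : Measurable (Prod.swap : ℝ × S → S × ℝ) := measurable_swap
  refine h.eq_delaySol (F := fun b => ∫ s, delaySol lam μ a (G s) b ∂ν) (b₁ := b)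
    (C := 2 * ∫ s, w s ∂ν) (C' := ∫ s, w s ∂ν)
    (hSm.comp_measurable hswap).integral_prod_right'
    (hGm.comp_measurable hswap).integral_prod_right'
    (mul_nonneg zero_le_two (integral_nonneg fun s => hw0 s)) (integral_nonneg fun s => hw0 s)
    (fun b' _ => ?_) (fun b' => ?_) hδ (fun b' _ => ?_) le_rfl
  · rw [← integral_const_mul, ← integral_mul_const]
    exact norm_integral_le_of_norm_le ((hw.const_mul 2).mul_const _)
      (Eventually.of_forall fun s => hS s b')
  · rw [← integral_mul_const]
    exact norm_integral_le_of_norm_le (hw.mul_const _) (Eventually.of_forall fun s => hG s b')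
  · have hp : Integrable (Function.uncurry fun (s : S) (α : ℝ) =>
        a α (delaySol lam μ a (G s) (b' + μ - α))) (ν.prod lam) := by
      have hm : StronglyMeasurable (Function.uncurry fun (s : S) (α : ℝ) =>
          a α (delaySol lam μ a (G s) (b' + μ - α))) :=
        (h.stronglyMeasurable_integrand hSm).comp_measurable
          ((measurable_fst.prodMk measurable_const).prodMk measurable_snd :
            Measurable fun p : S × ℝ => ((p.1, b'), p.2))
      refine ((integrable_prod_iff hm.aestronglyMeasurable).2 ⟨Eventually.of_forall fun s =>
        h.integrable (hSm.comp_measurable (measurable_const.prodMk measurable_id))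
          (mul_nonneg zero_le_two (hw0 s)) (fun b _ => hS s b) hδ le_rfl, ?_⟩)
      refine (((hw.const_mul 2).mul_const (ω ^ (-b'))).const_mul
        (lam.real univ * (B * ω ^ (-δ)))).mono'
        hm.norm.integral_prod_right'.aestronglyMeasurable (Eventually.of_forall fun s => ?_)
      rw [Real.norm_of_nonneg (integral_nonneg fun _ => norm_nonneg _)]
      have h5 := norm_integral_le_of_norm_le_const (μ := lam)
        (f := fun α => ‖a α (delaySol lam μ a (G s) (b' + μ - α))‖)
        (by simpa only [norm_norm] using
          h.norm_le (mul_nonneg zero_le_two (hw0 s)) (fun b _ => hS s b) hδ (le_refl b'))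
      exact ((le_abs_self _).trans h5).trans_eq (by ring)
    have h1 : delayOp lam μ a (fun b => ∫ s, delaySol lam μ a (G s) b ∂ν) b' =
        ∫ s, delayOp lam μ a (delaySol lam μ a (G s)) b' ∂ν := by
      simp only [delayOp]
      rw [integral_integral_swap hp]
      exact integral_congr_ae (Eventually.of_forall fun α =>
        ((a α).integral_comp_comm (hSi _)).symm)
    have h2 : Integrable (fun s => delayOp lam μ a (delaySol lam μ a (G s)) b') ν :=
      hp.integral_prod_left
    rw [h1, ← integral_add (hSi b') h2]
    exact integral_congr_ae (Eventually.of_forall fun s =>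
      h.delaySol_add_delayOp (hGs s) (hw0 s) (hG s) hδ b')

/-- Dominated convergence twice: over `α` for each iterate, by induction, and then over the series.
-/
theorem IsDelay.tendsto_delaySol (h : IsDelay lam μ B δ ω a) {S : Type*} {l : Filter S}
    [l.IsCountablyGenerated]
    {G : S → ℝ → M} {G₀ : ℝ → M} (hGm : ∀ s, StronglyMeasurable (G s)) {C : ℝ} (hC : 0 ≤ C)
    (hG : ∀ᶠ s in l, ∀ b, ‖G s b‖ ≤ C * ω ^ (-b)) (hδ : 0 ≤ δ)
    (hlim : ∀ b, Tendsto (fun s => G s b) l (𝓝 (G₀ b))) (b : ℝ) :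
    Tendsto (fun s => delaySol lam μ a (G s) b) l (𝓝 (delaySol lam μ a G₀ b)) := by
  have h1 : ∀ n : ℕ, ∀ b, Tendsto (fun s => ((fun F b => -delayOp lam μ a F b)^[n] (G s)) b) l
      (𝓝 (((fun F b => -delayOp lam μ a F b)^[n] G₀) b)) := by
    intro n
    induction n with
    | zero => exact hlim
    | succ n ih =>
      intro b
      simp_rw [Function.iterate_succ_apply']
      refine Tendsto.neg ?_
      refine tendsto_integral_filter_of_dominated_convergence
        (fun _ => B * ω ^ (-δ) * ((1 / 2) ^ n * C * ω ^ (-b))) (Eventually.of_forall fun s => ?_)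
        ?_ (integrable_const _) (Eventually.of_forall fun α => ?_)
      · refine h.aestronglyMeasurable ?_ b
        exact (h.stronglyMeasurable_iterate (stronglyMeasurable_uncurry_const (hGm s))
          n).comp_measurable (measurable_const.prodMk measurable_id : Measurable fun b : ℝ => ((), b))
      · filter_upwards [hG] with s hs
        exact h.norm_le (by positivity) (h.norm_iterate_le hC (fun b _ => hs b) hδ n) hδ (le_refl b)
      · exact ((a α).continuous.tendsto _).comp (ih _)
  refine tendsto_tsum_of_dominated_convergence (bound := fun n : ℕ => (1 / 2) ^ n * (C * ω ^ (-b)))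
    (summable_half_pow_mul _) (fun n => h1 n b) ?_
  filter_upwards [hG] with s hs n
  exact (h.norm_iterate_le hC (fun b _ => hs b) hδ n b le_rfl).trans_eq (by ring)

end Delay

/-! ### The kernel of the fractional integral -/

section Kernel

/-- The kernel `s ^ (b - 1) / Γ(b)`, `s > 0`, of the fractional integral of order `b`. -/
def rlKer (b s : ℝ) : ℝ := if 0 < s then s ^ (b - 1) * (Real.Gamma b)⁻¹ else 0

theorem rlKer_of_pos {b s : ℝ} (hs : 0 < s) : rlKer b s = s ^ (b - 1) * (Real.Gamma b)⁻¹ :=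
  if_pos hs

theorem rlKer_of_nonpos {b s : ℝ} (hs : s ≤ 0) : rlKer b s = 0 := if_neg hs.not_gt

theorem rlKer_nonneg {b : ℝ} (hb : 0 < b) (s : ℝ) : 0 ≤ rlKer b s := by
  rw [rlKer]
  split_ifs with hs
  · have := Real.Gamma_pos_of_pos hb
    positivity
  · exact le_rfl

/-- The reciprocal of the Gamma function is entire. This makes the kernel jointly measurable in
order and time, as the later uses of Fubini require. -/
theorem continuous_inv_Gamma : Continuous fun b : ℝ => (Real.Gamma b)⁻¹ := by
  have h : (fun b : ℝ => (Real.Gamma b)⁻¹) = fun b : ℝ => ((Complex.Gamma b)⁻¹).re := by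
    funext b
    rw [Complex.Gamma_ofReal, ← Complex.ofReal_inv, Complex.ofReal_re]
  rw [h]
  exact Complex.continuous_re.comp
    (Complex.differentiable_one_div_Gamma.continuous.comp Complex.continuous_ofReal)

theorem measurable_rlKer : Measurable fun p : ℝ × ℝ => rlKer p.1 p.2 :=
  Measurable.ite (measurableSet_lt measurable_const measurable_snd)
    ((measurable_snd.pow (measurable_fst.sub_const 1)).mul
      (continuous_inv_Gamma.measurable.comp measurable_fst)) measurable_const

theorem measurable_rlKer_comp {S : Type*} [MeasurableSpace S] {b s : S → ℝ} (hb : Measurable b)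
    (hs : Measurable s) : Measurable fun x => rlKer (b x) (s x) :=
  measurable_rlKer.comp (hb.prodMk hs)

theorem rlKer_mul {b t : ℝ} (ht : 0 < t) (s : ℝ) : rlKer b (t * s) = t ^ (b - 1) * rlKer b s := by
  rcases le_or_gt s 0 with hs | hs
  · rw [rlKer_of_nonpos hs, rlKer_of_nonpos (mul_nonpos_of_nonneg_of_nonpos ht.le hs), mul_zero]
  · rw [rlKer_of_pos hs, rlKer_of_pos (mul_pos ht hs), Real.mul_rpow ht.le hs.le, mul_assoc]

/-- Up to a constant the integrand is a beta density, so the beta integral comes from its total mass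
being 1. -/
theorem rlKer_beta_one {x y : ℝ} (hx : 0 < x) (hy : 0 < y) (s : ℝ) :
    rlKer x (1 - s) * rlKer y s = rlKer (x + y) 1 * ProbabilityTheory.betaPDFReal y x s := by
  rw [ProbabilityTheory.betaPDFReal]
  split_ifs with hs
  · have h1 := Real.Gamma_pos_of_pos hx
    have h2 := Real.Gamma_pos_of_pos hy
    have h3 := Real.Gamma_pos_of_pos (add_pos hx hy)
    rw [rlKer_of_pos hs.1, rlKer_of_pos (sub_pos.2 hs.2), rlKer_of_pos one_pos, Real.one_rpow,
      ProbabilityTheory.beta, add_comm y x]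
    field_simp
  · rw [mul_zero]
    rcases le_or_gt s 0 with h | h
    · rw [rlKer_of_nonpos h, mul_zero]
    · rw [rlKer_of_nonpos (s := 1 - s) (by by_contra h'; exact hs ⟨h, by linarith⟩), zero_mul]

theorem integral_betaPDFReal {x y : ℝ} (hx : 0 < x) (hy : 0 < y) :
    Integrable (ProbabilityTheory.betaPDFReal x y) ∧
      ∫ s, ProbabilityTheory.betaPDFReal x y s = 1 := by
  have h0 : ∀ s, 0 ≤ ProbabilityTheory.betaPDFReal x y s := fun s => by
    by_cases hs : 0 < s ∧ s < 1
    · exact (ProbabilityTheory.betaPDFReal_pos hs.1 hs.2 hx hy).le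
    · rw [ProbabilityTheory.betaPDFReal, if_neg hs]
  have hm := (ProbabilityTheory.measurable_betaPDFReal x y).aestronglyMeasurable (μ := volume)
  have h1 : ∫⁻ s, ENNReal.ofReal (ProbabilityTheory.betaPDFReal x y s) = 1 :=
    ProbabilityTheory.lintegral_betaPDF_eq_one hx hy
  refine ⟨⟨hm, (hasFiniteIntegral_iff_ofReal (Eventually.of_forall h0)).2 ?_⟩, ?_⟩
  · rw [h1]; exact ENNReal.one_lt_top
  · rw [integral_eq_lintegral_of_nonneg_ae (Eventually.of_forall h0) hm, h1, ENNReal.toReal_one]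

/-- The kernels form a convolution semigroup: scaling by `t` reduces to `t = 1`, where the product
is a multiple of a beta density. -/
theorem integral_rlKer_mul_rlKer {x y : ℝ} (hx : 0 < x) (hy : 0 < y) (t : ℝ) :
    Integrable (fun s => rlKer x (t - s) * rlKer y s) ∧
      ∫ s, rlKer x (t - s) * rlKer y s = rlKer (x + y) t := by
  rcases le_or_gt t 0 with ht | ht
  · have : (fun s => rlKer x (t - s) * rlKer y s) = fun _ => 0 := by
      funext s
      rcases le_or_gt s 0 with hs | hs
      · rw [rlKer_of_nonpos hs, mul_zero]
      · rw [rlKer_of_nonpos (s := t - s) (by linarith), zero_mul]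
    rw [this, rlKer_of_nonpos ht]
    exact ⟨integrable_zero _ _ _, integral_zero _ _⟩
  · obtain ⟨h1, h2⟩ := integral_betaPDFReal hy hx
    have h3 : ∀ s, rlKer x (t - s) * rlKer y s =
        t ^ (x - 1) * t ^ (y - 1) * rlKer (x + y) 1 *
          ProbabilityTheory.betaPDFReal y x (t⁻¹ * s) := by
      intro s
      rw [mul_assoc, ← rlKer_beta_one hx hy]
      have e1 : t - s = t * (1 - t⁻¹ * s) := by field_simp
      have e2 : s = t * (t⁻¹ * s) := by field_simp
      conv_lhs => rw [e1, e2, rlKer_mul ht, rlKer_mul ht]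
      rw [← e2]
      ring
    simp_rw [h3]
    refine ⟨(h1.comp_mul_left' (inv_pos.2 ht).ne').const_mul _, ?_⟩
    rw [integral_const_mul, Measure.integral_comp_mul_left (ProbabilityTheory.betaPDFReal y x), h2,
      inv_inv, abs_of_pos ht, smul_eq_mul, mul_one, rlKer_of_pos ht, rlKer_of_pos one_pos,
      Real.one_rpow, one_mul]
    have : t ^ (x + y - 1) = t ^ (x - 1) * t ^ (y - 1) * t := by
      rw [← Real.rpow_add ht, ← Real.rpow_add_one ht.ne']
      congr 1; ring
    rw [this]; ring

theorem rpow_le_exp_of_nonneg {y p : ℝ} (hy : 0 ≤ y) (hp : 0 ≤ p) (hp1 : p ≤ 1) :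
    y ^ p ≤ Real.exp y := by
  rcases le_or_gt y 1 with h | h
  · exact (Real.rpow_le_one hy h hp).trans (Real.one_le_exp hy)
  · refine (Real.rpow_le_rpow_of_exponent_le h.le hp1).trans ?_
    rw [Real.rpow_one]
    linarith [Real.add_one_le_exp y]

/-- Restrict Euler's integral to an interval of length 1. -/
theorem le_Gamma {b y m : ℝ} (hb : 0 < b) (hy : 0 < y) (hm : 0 ≤ m)
    (h : ∀ x ∈ Ioc y (y + 1), m ≤ x ^ (b - 1)) : m * Real.exp (-(y + 1)) ≤ Real.Gamma b := by
  rw [Real.Gamma_eq_integral hb]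
  have hi := Real.GammaIntegral_convergent hb
  have hsub : Ioc y (y + 1) ⊆ Ioi 0 := fun x hx => hy.trans hx.1
  have h1 : ∫ x in Ioc y (y + 1), Real.exp (-x) * x ^ (b - 1) ≤
      ∫ x in Ioi 0, Real.exp (-x) * x ^ (b - 1) := by
    refine setIntegral_mono_set hi ?_ hsub.eventuallyLE
    filter_upwards [ae_restrict_mem measurableSet_Ioi] with x hx
    have : (0 : ℝ) < x := hx
    simp only [Pi.zero_apply]
    positivity
  refine le_trans ?_ h1
  have h2 : ∫ _ in Ioc y (y + 1), m * Real.exp (-(y + 1)) = m * Real.exp (-(y + 1)) := by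
    rw [setIntegral_const]; simp
  rw [← h2]
  refine setIntegral_mono_on (integrable_const _) (hi.mono_set hsub) measurableSet_Ioc
    fun x hx => ?_
  rw [mul_comm]
  gcongr
  · exact hx.2
  · exact h x hx

/-- The decay of the kernel in the order. -/
theorem rlKer_le {b c ω s : ℝ} (hc : 0 < c) (hc1 : c ≤ 1) (hcb : c ≤ b) (hω : 0 < ω)
    (hs : 0 < s) :
    rlKer b s ≤ Real.exp 1 * s ^ (c - 1) * Real.exp (2 * ω * s) * ω ^ (-(b - c)) := by
  have hb : 0 < b := hc.trans_le hcb
  have hΓ := Real.Gamma_pos_of_pos hb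
  have hy : 0 < ω * s := mul_pos hω hs
  set y := ω * s with hydef
  -- With `y = ω s` the claim is a lower bound for `Γ(b)`. The monotonicity of `x ^ (b - 1)` changes
  -- at `b = 1`, so the left endpoint of `(y, y + 1]` is used for `b ≥ 1` and the right endpoint for
  -- `b < 1`.
  have key : y ^ (b - c) * Real.exp (-(2 * y + 1)) ≤ Real.Gamma b := by
    rcases le_or_gt 1 b with hb1 | hb1
    · refine le_trans ?_ (le_Gamma (m := y ^ (b - 1)) hb hy (by positivity) fun x hx =>
        Real.rpow_le_rpow hy.le hx.1.le (by linarith))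
      have h1 : y ^ (b - c) = y ^ (b - 1) * y ^ (1 - c) := by
        rw [← Real.rpow_add hy]; congr 1; ring
      have h2 : Real.exp (-(y + 1)) = Real.exp y * Real.exp (-(2 * y + 1)) := by
        rw [← Real.exp_add]; congr 1; ring
      have h3 : y ^ (1 - c) ≤ Real.exp y :=
        rpow_le_exp_of_nonneg hy.le (by linarith) (by linarith)
      rw [h1, h2, ← mul_assoc (y ^ (b - 1))]
      gcongr
    · refine le_trans ?_ (le_Gamma (m := (y + 1) ^ (b - 1)) hb hy (by positivity) fun x hx =>
        Real.rpow_le_rpow_of_nonpos (hy.trans hx.1) hx.2 (by linarith))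
      have h2 : Real.exp (-(y + 1)) = Real.exp y * Real.exp (-(2 * y + 1)) := by
        rw [← Real.exp_add]; congr 1; ring
      rw [h2, ← mul_assoc ((y + 1) ^ (b - 1))]
      refine mul_le_mul_of_nonneg_right ?_ (Real.exp_pos _).le
      have h3 : y ^ (b - c) ≤ (y + 1) ^ (b - c) :=
        Real.rpow_le_rpow hy.le (by linarith) (by linarith)
      have h4 : (y + 1) ^ (b - c) = (y + 1) ^ (b - 1) * (y + 1) ^ (1 - c) := by
        rw [← Real.rpow_add (by linarith)]; congr 1; ring
      have h5 : (y + 1) ^ (1 - c) ≤ (y + 1) ^ (1 : ℝ) :=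
        Real.rpow_le_rpow_of_exponent_le (by linarith) (by linarith)
      rw [Real.rpow_one] at h5
      rw [h4] at h3
      refine h3.trans ?_
      gcongr
      exact h5.trans (Real.add_one_le_exp y)
  rw [rlKer_of_pos hs, ← div_eq_mul_inv, div_le_iff₀ hΓ]
  have e1 : s ^ (b - 1) = s ^ (c - 1) * s ^ (b - c) := by
    rw [← Real.rpow_add hs]; congr 1; ring
  have e2 : y ^ (b - c) = ω ^ (b - c) * s ^ (b - c) := Real.mul_rpow hω.le hs.le
  have e3 : ω ^ (-(b - c)) * ω ^ (b - c) = 1 := by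
    rw [← Real.rpow_add hω, neg_add_cancel, Real.rpow_zero]
  have e4 : Real.exp 1 * Real.exp (2 * ω * s) * Real.exp (-(2 * y + 1)) = 1 := by
    rw [← Real.exp_add, ← Real.exp_add, hydef, ← Real.exp_zero]; congr 1; ring
  calc s ^ (b - 1) = s ^ (c - 1) * (Real.exp 1 * Real.exp (2 * ω * s) * Real.exp (-(2 * y + 1))) *
        (ω ^ (-(b - c)) * ω ^ (b - c)) * s ^ (b - c) := by rw [e1, e3, e4]; ring
    _ = Real.exp 1 * s ^ (c - 1) * Real.exp (2 * ω * s) * ω ^ (-(b - c)) *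
        (y ^ (b - c) * Real.exp (-(2 * y + 1))) := by rw [e2]; ring
    _ ≤ _ := by gcongr

end Kernel

/-! ### Fractional integrals of functions with a weak singularity -/

section FracInt

variable {M : Type*} [NormedAddCommGroup M] [NormedSpace ℂ M]

theorem fracInt_zero (v : ℝ → M) (t : ℝ) : fracInt 0 v t = v t := if_pos rfl

/-- Since the kernel vanishes at nonpositive times, the domain of integration no longer depends on
`t`. -/
theorem fracInt_eq {b : ℝ} (hb : 0 < b) (v : ℝ → M) {t : ℝ} (ht : 0 ≤ t) :
    fracInt b v t = ∫ s in Ioi 0, rlKer b (t - s) • v s := by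
  rw [fracInt, if_neg hb.ne', intervalIntegral.integral_of_le ht, ← integral_smul,
    integral_Ioc_eq_integral_Ioo,
    setIntegral_eq_of_subset_of_forall_sdiff_eq_zero measurableSet_Ioi
      (fun x (hx : x ∈ Ioo 0 t) => hx.1) fun x hx => ?_]
  · refine setIntegral_congr_fun measurableSet_Ioo fun s hs => ?_
    rw [rlKer_of_pos (sub_pos.2 hs.2), smul_smul, one_div, mul_comm]
  · rw [rlKer_of_nonpos, zero_smul]
    by_contra h
    exact hx.2 ⟨hx.1, by linarith⟩

theorem fracInt_apply_zero {b : ℝ} (hb : 0 < b) (v : ℝ → M) : fracInt b v 0 = 0 := by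
  rw [fracInt, if_neg hb.ne', intervalIntegral.integral_same, smul_zero]

theorem fracInt_congr {b t : ℝ} {v w : ℝ → M} (ht : 0 < t) (h : ∀ s ∈ Ioc 0 t, v s = w s) :
    fracInt b v t = fracInt b w t := by
  rw [fracInt, fracInt, h t ⟨ht, le_rfl⟩]
  congr 2
  refine intervalIntegral.integral_congr_ae (Eventually.of_forall fun s hs => ?_)
  rw [uIoc_of_le ht.le] at hs
  rw [h s hs]

/-- The semigroup property of the fractional integral. -/
theorem fracInt_fracInt [CompleteSpace M] {x y t : ℝ} (hx : 0 ≤ x) (hy : 0 ≤ y) (ht : 0 ≤ t) {v : ℝ → M}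
    (hm : AEStronglyMeasurable v (volume.restrict (Ioi 0)))
    (hi : IntegrableOn (fun s => rlKer (x + y) (t - s) * ‖v s‖) (Ioi 0)) :
    fracInt x (fracInt y v) t = fracInt (x + y) v t := by
  rcases hx.eq_or_lt with rfl | hx
  · rw [fracInt_zero, zero_add]
  rcases hy.eq_or_lt with rfl | hy
  · have : fracInt 0 v = v := funext (fracInt_zero v)
    rw [this, add_zero]
  rw [fracInt_eq hx _ ht, fracInt_eq (add_pos hx hy) _ ht]
  have hkm : ∀ r, Integrable (fun s => rlKer x (t - s) * rlKer y (s - r)) ∧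
      ∫ s, rlKer x (t - s) * rlKer y (s - r) = rlKer (x + y) (t - r) := fun r => by
    obtain ⟨h1, h2⟩ := integral_rlKer_mul_rlKer hx hy (t - r)
    have e : (fun s => rlKer x (t - s) * rlKer y (s - r)) =
      fun s => (fun s => rlKer x (t - r - s) * rlKer y s) (s - r) := by
      funext s; simp only; congr 2; ring
    rw [e, integral_sub_right_eq_self (fun s => rlKer x (t - r - s) * rlKer y s)]
    exact ⟨h1.comp_sub_right r, h2⟩
  have hpos : ∀ r > (0 : ℝ), ∫ s in Ioi 0, rlKer x (t - s) * rlKer y (s - r) =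
      rlKer (x + y) (t - r) := fun r hr => by
    rw [← (hkm r).2]
    refine setIntegral_eq_integral_of_forall_compl_eq_zero fun s hs => ?_
    have hs : s ≤ 0 := not_lt.1 hs
    rw [rlKer_of_nonpos (s := s - r) (by linarith), mul_zero]
  -- Integrating the norms over `s` first yields the kernel of order `x + y`, so absolute
  -- convergence is exactly the hypothesis `hi`.
  have hp : Integrable (Function.uncurry fun s r => (rlKer x (t - s) * rlKer y (s - r)) • v r)
      ((volume.restrict (Ioi 0)).prod (volume.restrict (Ioi 0))) := by
    have hk : Measurable fun p : ℝ × ℝ => rlKer x (t - p.1) * rlKer y (p.1 - p.2) :=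
      (measurable_rlKer_comp measurable_const (measurable_const.sub measurable_fst)).mul
        (measurable_rlKer_comp measurable_const (measurable_fst.sub measurable_snd))
    refine (integrable_prod_iff' (hk.aestronglyMeasurable.smul hm.comp_snd)).2
      ⟨Eventually.of_forall fun r => ((hkm r).1.smul_const (v r)).restrict, ?_⟩
    refine hi.congr ?_
    filter_upwards [ae_restrict_mem measurableSet_Ioi] with r hr
    rw [← hpos r hr, ← integral_mul_const]
    refine integral_congr_ae (Eventually.of_forall fun s => ?_)
    change _ = ‖(rlKer x (t - s) * rlKer y (s - r)) • v r‖
    rw [norm_smul, Real.norm_of_nonneg (mul_nonneg (rlKer_nonneg hx _) (rlKer_nonneg hy _))]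
  calc ∫ s in Ioi 0, rlKer x (t - s) • fracInt y v s
      = ∫ s in Ioi 0, ∫ r in Ioi 0, (rlKer x (t - s) * rlKer y (s - r)) • v r := by
        refine setIntegral_congr_fun measurableSet_Ioi fun s hs => ?_
        rw [fracInt_eq hy _ (le_of_lt hs), ← integral_smul]
        simp_rw [smul_smul]
    _ = ∫ r in Ioi 0, ∫ s in Ioi 0, (rlKer x (t - s) * rlKer y (s - r)) • v r :=
        integral_integral_swap hp
    _ = _ := by
        refine setIntegral_congr_fun measurableSet_Ioi fun r hr => ?_
        rw [integral_smul_const, hpos r hr]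

/-- `v` is measurable and bounded by `C t ^ (c - 1) e ^ (η t)` on `[0, ∞)`. -/
structure HasGrowth (c η C : ℝ) (v : ℝ → M) : Prop where
  meas : StronglyMeasurable v
  c_pos : 0 < c
  c_le : c ≤ 1
  η_nonneg : 0 ≤ η
  C_nonneg : 0 ≤ C
  bound : ∀ t, 0 ≤ t → ‖v t‖ ≤ C * t ^ (c - 1) * Real.exp (η * t)

variable {c η C : ℝ} {v : ℝ → M}

-- Since `s ^ (c - 1) = Γ(c) · rlKer c s`, a function of class `HasGrowth c` is treated as a
-- multiple of the kernel of order `c`, and the estimates reduce to the semigroup property.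
omit [NormedSpace ℂ M] in
theorem HasGrowth.norm_rlKer_le (hv : HasGrowth c η C v) {b t : ℝ} (hb : 0 < b) {s : ℝ}
    (hs : 0 < s) : rlKer b (t - s) * ‖v s‖ ≤
      C * Real.Gamma c * Real.exp (η * t) * (rlKer b (t - s) * rlKer c s) := by
  rcases le_or_gt t s with hst | hst
  · rw [rlKer_of_nonpos (s := t - s) (by linarith)]; simp
  have h1 := rlKer_nonneg hb (t - s)
  have h2 := hv.bound s hs.le
  have hΓ := Real.Gamma_pos_of_pos hv.c_pos
  have hC := hv.C_nonneg
  have h3 : s ^ (c - 1) = Real.Gamma c * rlKer c s := by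
    rw [rlKer_of_pos hs]; field_simp
  rw [h3] at h2
  have h4 := rlKer_nonneg hv.c_pos s
  calc _ ≤ rlKer b (t - s) * (C * (Real.Gamma c * rlKer c s) * Real.exp (η * s)) := by gcongr
    _ ≤ rlKer b (t - s) * (C * (Real.Gamma c * rlKer c s) * Real.exp (η * t)) := by
      gcongr
      exact hv.η_nonneg
    _ = _ := by ring

theorem HasGrowth.integrableOn (hv : HasGrowth c η C v) {b : ℝ} (hb : 0 < b) (t : ℝ) :
    IntegrableOn (fun s => rlKer b (t - s) • v s) (Ioi 0) := by
  refine Integrable.mono' (((integral_rlKer_mul_rlKer hb hv.c_pos t).1.const_mul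
    (C * Real.Gamma c * Real.exp (η * t))).restrict) ?_ ?_
  · exact (((measurable_rlKer_comp measurable_const
      (measurable_const.sub measurable_id)).stronglyMeasurable).smul hv.meas).aestronglyMeasurable
  · filter_upwards [ae_restrict_mem measurableSet_Ioi] with s hs
    rw [norm_smul, Real.norm_of_nonneg (rlKer_nonneg hb _)]
    exact hv.norm_rlKer_le hb hs

theorem HasGrowth.integrableOn_norm (hv : HasGrowth c η C v) {b : ℝ} (hb : 0 < b) (t : ℝ) :
    IntegrableOn (fun s => rlKer b (t - s) * ‖v s‖) (Ioi 0) := by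
  refine (hv.integrableOn hb t).norm.congr (Eventually.of_forall fun s => ?_)
  simp only
  rw [norm_smul, Real.norm_of_nonneg (rlKer_nonneg hb _)]

theorem HasGrowth.fracInt_fracInt [CompleteSpace M] (hv : HasGrowth c η C v) {x y t : ℝ} (hx : 0 ≤ x) (hy : 0 ≤ y)
    (ht : 0 ≤ t) : fracInt x (fracInt y v) t = fracInt (x + y) v t := by
  rcases hx.eq_or_lt with rfl | hx
  · rw [fracInt_zero, zero_add]
  exact FracDuhamel.fracInt_fracInt hx.le hy ht hv.meas.aestronglyMeasurable
    (hv.integrableOn_norm (by positivity) t)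

theorem HasGrowth.norm_fracInt_le_rlKer (hv : HasGrowth c η C v) {b t : ℝ} (hb : 0 ≤ b)
    (ht : 0 < t) :
    ‖fracInt b v t‖ ≤ C * Real.Gamma c * Real.exp (η * t) * rlKer (b + c) t := by
  have hΓ := Real.Gamma_pos_of_pos hv.c_pos
  have hC := hv.C_nonneg
  rcases hb.eq_or_lt with rfl | hb
  · rw [fracInt_zero, zero_add, rlKer_of_pos ht]
    refine (hv.bound t ht.le).trans_eq ?_
    field_simp
  · rw [fracInt_eq hb _ ht.le]
    obtain ⟨h1, h2⟩ := integral_rlKer_mul_rlKer hb hv.c_pos t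
    rw [← h2, ← integral_const_mul]
    refine (norm_integral_le_of_norm_le (h1.const_mul (C * Real.Gamma c * Real.exp (η * t))).restrict ?_).trans ?_
    · filter_upwards [ae_restrict_mem measurableSet_Ioi] with s hs
      rw [norm_smul, Real.norm_of_nonneg (rlKer_nonneg hb _)]
      exact hv.norm_rlKer_le hb hs
    · refine setIntegral_le_integral (h1.const_mul _) (Eventually.of_forall fun s => ?_)
      have := rlKer_nonneg hb (t - s)
      have := rlKer_nonneg hv.c_pos s
      simp only [Pi.zero_apply]
      positivity

theorem HasGrowth.norm_fracInt_le (hv : HasGrowth c η C v) {b t ω : ℝ} (hb : 0 ≤ b) (ht : 0 ≤ t)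
    (hω : 0 < ω) : ‖fracInt b v t‖ ≤ C * Real.Gamma c * Real.exp 1 * t ^ (c - 1) *
      Real.exp ((η + 2 * ω) * t) * ω ^ (-b) := by
  have hΓ := Real.Gamma_pos_of_pos hv.c_pos
  have hC := hv.C_nonneg
  -- At `t = 0` the real power `0 ^ (c - 1)` is 0 for `c < 1` and 1 for `c = 1`; in the first case
  -- the growth bound forces `v 0 = 0`.
  rcases ht.eq_or_lt with rfl | ht
  · rcases hb.eq_or_lt with rfl | hb
    · rw [fracInt_zero]
      rcases hv.c_le.eq_or_lt with rfl | hc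
      · refine (hv.bound 0 le_rfl).trans ?_
        have := Real.one_le_exp (zero_le_one)
        simp only [sub_self, Real.rpow_zero, mul_one, mul_zero, Real.exp_zero, Real.Gamma_one,
          neg_zero]
        nlinarith
      · have := hv.bound 0 le_rfl
        rw [Real.zero_rpow (by linarith)] at this ⊢
        simpa using this
    · rw [fracInt_apply_zero hb, norm_zero]
      positivity
  · refine (hv.norm_fracInt_le_rlKer hb ht).trans ?_
    have h1 := rlKer_le hv.c_pos hv.c_le (show c ≤ b + c by linarith) hω ht
    rw [add_sub_cancel_right] at h1
    calc _ ≤ C * Real.Gamma c * Real.exp (η * t) *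
          (Real.exp 1 * t ^ (c - 1) * Real.exp (2 * ω * t) * ω ^ (-b)) := by gcongr
      _ = C * Real.Gamma c * Real.exp 1 * t ^ (c - 1) *
          (Real.exp (η * t) * Real.exp (2 * ω * t)) * ω ^ (-b) := by ring
      _ = _ := by rw [← Real.exp_add]; ring_nf

end FracInt

/-! ### Parameters in a set, and linearity of the solution map -/

section DelaySet

variable {M : Type*} [NormedAddCommGroup M] [NormedSpace ℂ M] [CompleteSpace M]
  {lam : Measure ℝ} [IsFiniteMeasure lam] {μ B δ ω : ℝ} {a : ℝ → M →L[ℂ] M}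

theorem IsDelay.setIntegral_delaySol (h : IsDelay lam μ B δ ω a) {S : Type*} [MeasurableSpace S]
    {ν : Measure S} [SFinite ν] {D : Set S} (hD : MeasurableSet D) {G : S → ℝ → M}
    (hGm : StronglyMeasurable (Function.uncurry G))
    {w : S → ℝ} (hw0 : ∀ s ∈ D, 0 ≤ w s) (hw : IntegrableOn w D ν)
    (hG : ∀ s ∈ D, ∀ b, ‖G s b‖ ≤ w s * ω ^ (-b)) (hδ : 0 ≤ δ) (b : ℝ) :
    ∫ s in D, delaySol lam μ a (G s) b ∂ν = delaySol lam μ a (fun b => ∫ s in D, G s b ∂ν) b := by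
  classical
  have h1 : (fun b => ∫ s in D, G s b ∂ν) = fun b => ∫ s in D, D.indicator G s b ∂ν := by
    funext b
    refine setIntegral_congr_fun hD fun s hs => ?_
    simp only [indicator_of_mem hs]
  have h2 : ∫ s in D, delaySol lam μ a (G s) b ∂ν =
      ∫ s in D, delaySol lam μ a (D.indicator G s) b ∂ν := by
    refine setIntegral_congr_fun hD fun s hs => ?_
    simp only [indicator_of_mem hs]
  rw [h1, h2]
  have hω : 0 < ω := zero_lt_one.trans_le h.one_le
  refine h.integral_delaySol (w := D.indicator w) ?_ (fun s => indicator_nonneg hw0 s)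
    (hw.congr ?_) (fun s b => ?_) hδ b
  · have : Function.uncurry (D.indicator G) = (Prod.fst ⁻¹' D).indicator (Function.uncurry G) := by
      funext ⟨s, b⟩
      by_cases hs : s ∈ D
      · simp [Function.uncurry, hs]
      · simp [Function.uncurry, hs]
    rw [this]
    exact hGm.indicator (measurable_fst hD)
  · filter_upwards [ae_restrict_mem hD] with s hs
    rw [indicator_of_mem hs]
  · by_cases hs : s ∈ D
    · simpa only [indicator_of_mem hs] using hG s hs b
    · simp [hs]

theorem IsDelay.delaySol_clm (h : IsDelay lam μ B δ ω a) (T : M →L[ℂ] M)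
    (hT : ∀ᵐ α ∂lam, ∀ x, T (a α x) = a α (T x)) {G : ℝ → M} (hGm : StronglyMeasurable G) {C : ℝ}
    (hC : 0 ≤ C) (hG : ∀ b, ‖G b‖ ≤ C * ω ^ (-b)) (hδ : 0 ≤ δ) (b : ℝ) :
    delaySol lam μ a (fun b => T (G b)) b = T (delaySol lam μ a G b) :=
  (h.map_delaySol h T hT hGm hC hG hδ b).symm

theorem IsDelay.delaySol_smul (h : IsDelay lam μ B δ ω a) (r : ℝ) {G : ℝ → M}
    (hGm : StronglyMeasurable G) {C : ℝ}
    (hC : 0 ≤ C) (hG : ∀ b, ‖G b‖ ≤ C * ω ^ (-b)) (hδ : 0 ≤ δ) (b : ℝ) :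
    delaySol lam μ a (fun b => r • G b) b = r • delaySol lam μ a G b := by
  have := h.delaySol_clm ((r : ℂ) • (1 : M →L[ℂ] M))
    (Eventually.of_forall fun α x => by simp) hGm hC hG hδ b
  simpa using this

end DelaySet

/-! ### The equation with fractional integrals as source -/

section DelayFrac

variable {M : Type*} [NormedAddCommGroup M] [NormedSpace ℂ M]

open Classical in
/-- The fractional integral, as a function of the order, cut off at negative orders and times. -/
def fracCut (v : ℝ → M) (t b : ℝ) : M := if 0 ≤ t ∧ 0 ≤ b then fracInt b v t else 0

theorem fracCut_of_nonneg (v : ℝ → M) {t b : ℝ} (ht : 0 ≤ t) (hb : 0 ≤ b) :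
    fracCut v t b = fracInt b v t := if_pos ⟨ht, hb⟩

/-- A bound for the fractional integrals of a function of class `HasGrowth c η C`. -/
def growthWeight (c η C ω t : ℝ) : ℝ :=
  C * Real.Gamma c * Real.exp 1 * |t| ^ (c - 1) * Real.exp ((η + 2 * ω) * |t|)

variable {c η C : ℝ} {v : ℝ → M}

omit [NormedSpace ℂ M] in
theorem HasGrowth.growthWeight_nonneg (hv : HasGrowth c η C v) (ω t : ℝ) :
    0 ≤ growthWeight c η C ω t := by
  have hΓ := Real.Gamma_pos_of_pos hv.c_pos
  have hC := hv.C_nonneg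
  rw [growthWeight]
  positivity

/-- The decay in the order is exactly the weight for which the delay operator contracts; large `ω`
is paid for by the growth in time hidden in `growthWeight`. -/
theorem HasGrowth.norm_fracCut_le (hv : HasGrowth c η C v) {ω : ℝ} (hω : 0 < ω) (t b : ℝ) :
    ‖fracCut v t b‖ ≤ growthWeight c η C ω t * ω ^ (-b) := by
  rw [fracCut]
  split_ifs with h
  · have := hv.norm_fracInt_le h.2 h.1 hω
    rwa [growthWeight, abs_of_nonneg h.1]
  · rw [norm_zero]
    have := hv.growthWeight_nonneg ω t
    positivity

theorem HasGrowth.stronglyMeasurable_fracCut (hv : HasGrowth c η C v) :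
    StronglyMeasurable (Function.uncurry (fracCut v)) := by
  classical
  have h : Function.uncurry (fracCut v) = fun p : ℝ × ℝ => if 0 ≤ p.1 ∧ 0 ≤ p.2 then
      (if p.2 = 0 then v p.1 else ∫ s in Ioi 0, rlKer p.2 (p.1 - s) • v s) else 0 := by
    funext ⟨t, b⟩
    simp only [Function.uncurry, fracCut]
    split_ifs with h1 h2
    · rw [h2, fracInt_zero]
    · exact fracInt_eq (h1.2.lt_of_ne (Ne.symm h2)) v h1.1
    · rfl
  rw [h]
  have h2 : StronglyMeasurable fun p : (ℝ × ℝ) × ℝ => rlKer p.1.2 (p.1.1 - p.2) • v p.2 :=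
    (measurable_rlKer_comp measurable_fst.snd
      (measurable_fst.fst.sub measurable_snd)).stronglyMeasurable.smul
      (hv.meas.comp_measurable measurable_snd)
  refine StronglyMeasurable.ite ((measurableSet_le measurable_const measurable_fst).inter
    (measurableSet_le measurable_const measurable_snd)) (StronglyMeasurable.ite
    (measurableSet_eq_fun measurable_snd measurable_const)
    (hv.meas.comp_measurable measurable_fst) h2.integral_prod_right') stronglyMeasurable_const

theorem HasGrowth.stronglyMeasurable_fracCut_apply (hv : HasGrowth c η C v) (t : ℝ) :
    StronglyMeasurable (fracCut v t) :=
  hv.stronglyMeasurable_fracCut.comp_measurable (measurable_const.prodMk measurable_id)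

theorem HasGrowth.fracInt (hv : HasGrowth c η C v) {b : ℝ} (hb : 0 ≤ b) :
    HasGrowth c (η + 2) (C * Real.Gamma c * Real.exp 1) (fun t => fracCut v t b) where
  meas := hv.stronglyMeasurable_fracCut.comp_measurable (measurable_id.prodMk measurable_const)
  c_pos := hv.c_pos
  c_le := hv.c_le
  η_nonneg := by have := hv.η_nonneg; positivity
  C_nonneg := by
    have := hv.C_nonneg
    have := Real.Gamma_pos_of_pos hv.c_pos
    positivity
  bound t ht := by
    have := hv.norm_fracInt_le hb ht one_pos
    rwa [mul_one, Real.one_rpow, mul_one, ← fracCut_of_nonneg v ht hb] at this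

/-- Rescaling by `s` moves the time dependence from the singular kernel into the argument of `v`.
For times in `(t/2, 2t)` the integrand is then dominated by a multiple of `rlKer b (1 - x) * rlKer c
x`. -/
theorem HasGrowth.tendsto_fracInt (hv : HasGrowth c η C v) (hc : ContinuousOn v (Ioi 0)) {b t : ℝ}
    (hb : 0 ≤ b) (ht : 0 < t) : Tendsto (fun s => FracDuhamel.fracInt b v s) (𝓝 t)
      (𝓝 (FracDuhamel.fracInt b v t)) := by
  rcases hb.eq_or_lt with rfl | hb
  · simp only [fracInt_zero]
    exact hc.continuousAt (Ioi_mem_nhds ht)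
  have hscale : ∀ s, 0 < s → FracDuhamel.fracInt b v s =
      s ^ b • ∫ x in Ioi 0, rlKer b (1 - x) • v (s * x) := fun s hs => by
    have h1 := integral_comp_mul_left_Ioi (fun y => rlKer b (s - y) • v y) 0 hs
    rw [mul_zero] at h1
    rw [fracInt_eq hb v hs.le]
    have h2 : ∫ y in Ioi 0, rlKer b (s - y) • v y =
        s • ∫ x in Ioi 0, rlKer b (s - s * x) • v (s * x) := by
      rw [h1, smul_smul, mul_inv_cancel₀ hs.ne', one_smul]
    have h3 : ∀ x, rlKer b (s - s * x) • v (s * x) =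
        s ^ (b - 1) • (rlKer b (1 - x) • v (s * x)) := fun x => by
      rw [smul_smul, ← rlKer_mul hs, mul_sub, mul_one]
    simp_rw [h2, h3]
    rw [integral_smul, smul_smul]
    congr 1
    rw [mul_comm, ← Real.rpow_add_one hs.ne', sub_add_cancel]
  have hev : ∀ᶠ s in 𝓝 t, t / 2 < s ∧ s < 2 * t :=
    (lt_mem_nhds (by linarith)).and (gt_mem_nhds (by linarith))
  rw [hscale t ht]
  refine Tendsto.congr' (f₁ := fun s => s ^ b • ∫ x in Ioi 0, rlKer b (1 - x) • v (s * x)) ?_ ?_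
  · filter_upwards [hev] with s hs
    exact (hscale s (by linarith)).symm
  refine ((Real.continuousAt_rpow_const t b (Or.inl ht.ne')).tendsto).smul ?_
  have hΓ := Real.Gamma_pos_of_pos hv.c_pos
  have hC := hv.C_nonneg
  refine tendsto_integral_filter_of_dominated_convergence
    (fun x => C * (t / 2) ^ (c - 1) * Real.Gamma c * Real.exp (η * (2 * t)) *
      (rlKer b (1 - x) * rlKer c x)) ?_ ?_
    ((integral_rlKer_mul_rlKer hb hv.c_pos 1).1.const_mul _).restrict ?_
  · refine Eventually.of_forall fun s => ?_
    exact ((measurable_rlKer_comp measurable_const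
      (measurable_const.sub measurable_id)).stronglyMeasurable.smul
      (hv.meas.comp_measurable (measurable_const_mul s))).aestronglyMeasurable
  · filter_upwards [hev] with s hs
    filter_upwards [ae_restrict_mem measurableSet_Ioi] with x hx
    have hx0 : (0 : ℝ) < x := hx
    have hs0 : 0 < s := by linarith
    rw [norm_smul, Real.norm_of_nonneg (rlKer_nonneg hb _)]
    rcases le_or_gt 1 x with h1 | h1
    · rw [rlKer_of_nonpos (s := 1 - x) (by linarith)]; simp
    have h2 := hv.bound (s * x) (by positivity)
    have h3 : (s * x) ^ (c - 1) ≤ (t / 2) ^ (c - 1) * (Real.Gamma c * rlKer c x) := by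
      rw [Real.mul_rpow hs0.le hx0.le, rlKer_of_pos hx0]
      have : Real.Gamma c * (x ^ (c - 1) * (Real.Gamma c)⁻¹) = x ^ (c - 1) := by field_simp
      rw [this]
      gcongr ?_ * _
      exact Real.rpow_le_rpow_of_nonpos (by linarith) hs.1.le (by linarith [hv.c_le])
    have h4 : Real.exp (η * (s * x)) ≤ Real.exp (η * (2 * t)) := by
      have := hv.η_nonneg
      have h2 : s * x ≤ 2 * t := by nlinarith [hs.2]
      gcongr
    have h5 := rlKer_nonneg hv.c_pos x
    have h6 := rlKer_nonneg hb (1 - x)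
    calc _ ≤ rlKer b (1 - x) * (C * ((t / 2) ^ (c - 1) * (Real.Gamma c * rlKer c x)) *
          Real.exp (η * (2 * t))) := by gcongr; exact h2.trans (by gcongr)
      _ = _ := by ring
  · filter_upwards [ae_restrict_mem measurableSet_Ioi] with x hx
    have hx0 : (0 : ℝ) < x := hx
    refine Tendsto.const_smul ?_ _
    exact (hc.continuousAt (Ioi_mem_nhds (by positivity : 0 < t * x))).tendsto.comp
      ((continuous_mul_const x).tendsto t)

theorem HasGrowth.tendsto_fracInt_zero (hv : HasGrowth 1 η C v) (hc : ContinuousOn v (Ici 0))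
    {b : ℝ} (hb : 0 ≤ b) : Tendsto (fun s => FracDuhamel.fracInt b v s) (𝓝[Ici 0] 0)
      (𝓝 (FracDuhamel.fracInt b v 0)) := by
  rcases hb.eq_or_lt with rfl | hb
  · simp only [fracInt_zero]
    exact hc 0 self_mem_Ici
  rw [fracInt_apply_zero hb]
  have h1 : ContinuousAt (fun s : ℝ => C * Real.Gamma 1 * Real.exp (η * s) *
      (s ^ (b + 1 - 1) * (Real.Gamma (b + 1))⁻¹)) 0 := by
    have := Real.continuousAt_rpow_const 0 (b + 1 - 1) (Or.inr (by linarith))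
    fun_prop
  have h2 := h1.tendsto
  rw [Real.zero_rpow (by linarith), zero_mul, mul_zero] at h2
  refine squeeze_zero_norm' ?_ (h2.mono_left nhdsWithin_le_nhds)
  filter_upwards [self_mem_nhdsWithin] with s hs
  rcases (show (0 : ℝ) ≤ s from hs).eq_or_lt with rfl | hs
  · rw [fracInt_apply_zero hb, Real.zero_rpow (by linarith)]; simp
  · have := hv.norm_fracInt_le_rlKer hb.le hs
    rwa [rlKer_of_pos hs] at this

variable [CompleteSpace M]

theorem HasGrowth.hasDerivAt_fracInt_one (hv : HasGrowth c η C v) {t : ℝ} (ht : 0 < t)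
    (hc : ContinuousAt v t) : HasDerivAt (FracDuhamel.fracInt 1 v) (v t) t := by
  have h1 : FracDuhamel.fracInt 1 v = fun t => ∫ s in (0 : ℝ)..t, v s := by
    funext t
    rw [FracDuhamel.fracInt, if_neg one_ne_zero]
    simp
  rw [h1]
  refine intervalIntegral.integral_hasDerivAt_right ?_
    hv.meas.stronglyMeasurableAtFilter hc
  rw [intervalIntegrable_iff_integrableOn_Ioc_of_le ht.le]
  have h2 := hv.integrableOn one_pos (t + 1)
  refine (h2.mono_set (show Ioc 0 t ⊆ Ioi 0 from fun x hx => hx.1)).congr_fun (fun s hs => ?_)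
    measurableSet_Ioc
  have : 0 < t + 1 - s := by linarith [hs.2]
  simp [rlKer_of_pos this]

theorem HasGrowth.hasDerivWithinAt_fracInt_one (hv : HasGrowth c η C v)
    (hc : ContinuousOn v (Ici 0)) :
    HasDerivWithinAt (FracDuhamel.fracInt 1 v) (v 0) (Ici 0) 0 := by
  have h1 : FracDuhamel.fracInt 1 v = fun t => ∫ s in (0 : ℝ)..t, v s := by
    funext t
    rw [FracDuhamel.fracInt, if_neg one_ne_zero]
    simp
  rw [h1]
  refine intervalIntegral.integral_hasDerivWithinAt_right ?_ (t := Ioi 0)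
    (hv.meas.stronglyMeasurableAtFilter) ((hc 0 self_mem_Ici).mono Ioi_subset_Ici_self)
  simp

end DelayFrac

section DelayFrac

variable {M : Type*} [NormedAddCommGroup M] [NormedSpace ℂ M] [CompleteSpace M]

/-- The solution at order `b` for the source `b ↦ fracInt b v t`. -/
def delayFrac (lam : Measure ℝ) (μ : ℝ) (a : ℝ → M →L[ℂ] M) (v : ℝ → M) (b t : ℝ) : M :=
  delaySol lam μ a (fracCut v t) b

variable {lam : Measure ℝ} [IsFiniteMeasure lam] {μ B δ ω : ℝ} {a : ℝ → M →L[ℂ] M}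
  {c η C : ℝ} {v : ℝ → M}

omit [CompleteSpace M] [IsFiniteMeasure lam] in
theorem IsDelay.pos (h : IsDelay lam μ B δ ω a) : 0 < ω := zero_lt_one.trans_le h.one_le

omit [CompleteSpace M] in
theorem IsDelay.norm_delayFrac_le (h : IsDelay lam μ B δ ω a) (hδ : 0 ≤ δ)
    (hv : HasGrowth c η C v) (b t : ℝ) :
    ‖delayFrac lam μ a v b t‖ ≤ 2 * growthWeight c η C ω t * ω ^ (-b) :=
  h.norm_delaySol_le (hv.growthWeight_nonneg ω t) (fun b _ => hv.norm_fracCut_le h.pos t b) hδ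
    le_rfl

theorem IsDelay.stronglyMeasurable_delayFrac (h : IsDelay lam μ B δ ω a) (hδ : 0 ≤ δ)
    (hv : HasGrowth c η C v) :
    StronglyMeasurable fun p : ℝ × ℝ => delayFrac lam μ a v p.2 p.1 :=
  h.stronglyMeasurable_delaySol hv.stronglyMeasurable_fracCut (hv.growthWeight_nonneg ω)
    (hv.norm_fracCut_le h.pos) hδ

theorem IsDelay.hasGrowth_delayFrac (h : IsDelay lam μ B δ ω a) (hδ : 0 ≤ δ)
    (hv : HasGrowth c η C v) {b : ℝ} (hb : 0 ≤ b) :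
    HasGrowth c (η + 2 * ω) (2 * (C * Real.Gamma c * Real.exp 1)) (delayFrac lam μ a v b) where
  meas := (h.stronglyMeasurable_delayFrac hδ hv).comp_measurable
    (measurable_id.prodMk measurable_const)
  c_pos := hv.c_pos
  c_le := hv.c_le
  η_nonneg := by have := hv.η_nonneg; have := h.pos; positivity
  C_nonneg := by
    have := hv.C_nonneg
    have := Real.Gamma_pos_of_pos hv.c_pos
    positivity
  bound t ht := by
    refine (h.norm_delayFrac_le hδ hv b t).trans ?_
    have h1 : ω ^ (-b) ≤ 1 := Real.rpow_le_one_of_one_le_of_nonpos h.one_le (by linarith)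
    have h2 := hv.growthWeight_nonneg ω t
    refine (mul_le_of_le_one_right (by positivity) h1).trans_eq ?_
    rw [growthWeight, abs_of_nonneg ht]
    ring

theorem IsDelay.delayFrac_add (h : IsDelay lam μ B δ ω a) (hδ : 0 ≤ δ)
    (hv : HasGrowth c η C v) {b t : ℝ} (hb : 0 ≤ b) (ht : 0 ≤ t) :
    delayFrac lam μ a v b t + ∫ α, a α (delayFrac lam μ a v (b + μ - α) t) ∂lam =
      fracInt b v t := by
  rw [← fracCut_of_nonneg v ht hb]
  exact h.delaySol_add_delayOp (hv.stronglyMeasurable_fracCut_apply t)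
    (hv.growthWeight_nonneg ω t) (hv.norm_fracCut_le h.pos t) hδ b

theorem IsDelay.integrable_delayFrac (h : IsDelay lam μ B δ ω a) (hδ : 0 ≤ δ)
    (hv : HasGrowth c η C v) (b t : ℝ) :
    Integrable (fun α => a α (delayFrac lam μ a v (b + μ - α) t)) lam :=
  h.integrable (h.stronglyMeasurable_delaySol_const (hv.stronglyMeasurable_fracCut_apply t)
    (hv.growthWeight_nonneg ω t) (hv.norm_fracCut_le h.pos t) hδ)
    (mul_nonneg zero_le_two (hv.growthWeight_nonneg ω t))
    (fun b _ => h.norm_delayFrac_le hδ hv b t) hδ (le_refl b)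

/-- Apply the kernel of order `x` in time under the solution map. By the semigroup property the
source `J^b v` becomes `J^(x+b) v`, which is the original source shifted by `x` in the order. -/
theorem IsDelay.fracInt_delayFrac (h : IsDelay lam μ B δ ω a) (hδ : 0 ≤ δ)
    (hv : HasGrowth c η C v) {x y t : ℝ} (hx : 0 ≤ x) (hy : 0 ≤ y) (ht : 0 ≤ t) :
    fracInt x (delayFrac lam μ a v y) t = delayFrac lam μ a v (x + y) t := by
  rcases hx.eq_or_lt with rfl | hx
  · rw [fracInt_zero, zero_add]
  have hω := h.pos
  rw [fracInt_eq hx _ ht]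
  have h1 : ∀ s, rlKer x (t - s) • delayFrac lam μ a v y s =
      delaySol lam μ a (fun b => rlKer x (t - s) • fracCut v s b) y := fun s =>
    (h.delaySol_smul _ (hv.stronglyMeasurable_fracCut_apply s) (hv.growthWeight_nonneg ω s)
      (hv.norm_fracCut_le hω s) hδ y).symm
  simp_rw [h1]
  have hkm : Measurable fun p : ℝ × ℝ => rlKer x (t - p.1) :=
    measurable_rlKer_comp measurable_const (measurable_const.sub measurable_fst)
  have hGm : StronglyMeasurable
      (Function.uncurry fun s b => rlKer x (t - s) • fracCut v s b) :=
    hkm.stronglyMeasurable.smul hv.stronglyMeasurable_fracCut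
  -- The weight, viewed as a complex function, is itself of class `HasGrowth c`, so its
  -- integrability against the kernel is already known.
  have hwg : HasGrowth c (η + 2 * ω) (C * Real.Gamma c * Real.exp 1)
      (fun s => (growthWeight c η C ω s : ℂ)) :=
    { meas := by
        refine (Complex.measurable_ofReal.comp ?_).stronglyMeasurable
        unfold growthWeight
        fun_prop
      c_pos := hv.c_pos
      c_le := hv.c_le
      η_nonneg := by have := hv.η_nonneg; positivity
      C_nonneg := by
        have := hv.C_nonneg
        have := Real.Gamma_pos_of_pos hv.c_pos
        positivity
      bound := fun s hs => by
        rw [Complex.norm_real, Real.norm_of_nonneg (hv.growthWeight_nonneg ω s), growthWeight,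
          abs_of_nonneg hs] }
  have hw : IntegrableOn (fun s => rlKer x (t - s) * growthWeight c η C ω s) (Ioi 0) := by
    refine (hwg.integrableOn_norm hx t).congr (Eventually.of_forall fun s => ?_)
    simp only
    rw [Complex.norm_real, Real.norm_of_nonneg (hv.growthWeight_nonneg ω s)]
  have hb : ∀ s b, ‖rlKer x (t - s) • fracCut v s b‖ ≤
      rlKer x (t - s) * growthWeight c η C ω s * ω ^ (-b) := fun s b => by
    have := rlKer_nonneg hx (t - s)
    rw [norm_smul, Real.norm_of_nonneg this, mul_assoc]
    gcongr
    exact hv.norm_fracCut_le hω s b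
  have hw0 : ∀ s, 0 ≤ rlKer x (t - s) * growthWeight c η C ω s := fun s =>
    mul_nonneg (rlKer_nonneg hx _) (hv.growthWeight_nonneg ω s)
  rw [h.integral_delaySol hGm hw0 hw hb hδ y, delayFrac, add_comm x y]
  refine (h.delaySol_shift (b₁ := 0)
    (C' := ∫ s in Ioi 0, rlKer x (t - s) * growthWeight c η C ω s) (hv.stronglyMeasurable_fracCut_apply t)
    (hGm.comp_measurable measurable_swap).integral_prod_right' (hv.growthWeight_nonneg ω t)
    (integral_nonneg hw0) (hv.norm_fracCut_le hω t) (fun b => ?_) hδ (fun b hb0 => ?_) hy).symm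
  · rw [← integral_mul_const]
    exact norm_integral_le_of_norm_le (hw.mul_const _) (Eventually.of_forall fun s => hb s b)
  · rw [fracCut_of_nonneg v ht (by linarith), add_comm b x, ← hv.fracInt_fracInt hx.le hb0 ht,
      fracInt_eq hx _ ht]
    refine setIntegral_congr_fun measurableSet_Ioi fun s hs => ?_
    rw [← fracCut_of_nonneg v (le_of_lt hs) hb0]
    rfl

theorem IsDelay.tendsto_delayFrac (h : IsDelay lam μ B δ ω a) (hδ : 0 ≤ δ)
    (hv : HasGrowth c η C v) (hc : ContinuousOn v (Ioi 0)) {b t : ℝ}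
    (ht : 0 < t) : ContinuousAt (delayFrac lam μ a v b) t := by
  have hcont : ContinuousAt (growthWeight c η C ω) t := by
    have : ContinuousAt (fun s : ℝ => |s| ^ (c - 1)) t :=
      (continuous_abs.continuousAt).rpow_const (Or.inl (by positivity))
    unfold growthWeight
    fun_prop
  refine h.tendsto_delaySol (fun s => hv.stronglyMeasurable_fracCut_apply s)
    (C := growthWeight c η C ω t + 1) (by have := hv.growthWeight_nonneg ω t; positivity) ?_ hδ
    (fun b => ?_) b
  · filter_upwards [hcont.eventually (gt_mem_nhds (lt_add_one _))] with s hs b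
    have := h.pos
    exact (hv.norm_fracCut_le h.pos s b).trans (by gcongr)
  · by_cases hb : 0 ≤ b
    · rw [fracCut_of_nonneg v ht.le hb]
      refine (hv.tendsto_fracInt hc hb ht).congr' ?_
      filter_upwards [lt_mem_nhds ht] with s hs
      rw [fracCut_of_nonneg v hs.le hb]
    · simp [fracCut, hb]

theorem IsDelay.tendsto_delayFrac_zero (h : IsDelay lam μ B δ ω a) (hδ : 0 ≤ δ)
    (hv : HasGrowth 1 η C v) (hc : ContinuousOn v (Ici 0)) (b : ℝ) :
    ContinuousWithinAt (delayFrac lam μ a v b) (Ici 0) 0 := by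
  have hcont : ContinuousAt (growthWeight 1 η C ω) 0 := by
    unfold growthWeight
    simp only [sub_self, Real.rpow_zero]
    fun_prop
  refine h.tendsto_delaySol (fun s => hv.stronglyMeasurable_fracCut_apply s)
    (C := growthWeight 1 η C ω 0 + 1) (by have := hv.growthWeight_nonneg ω 0; positivity) ?_ hδ
    (fun b => ?_) b
  · filter_upwards [nhdsWithin_le_nhds (hcont.eventually (gt_mem_nhds (lt_add_one _)))] with s hs b
    have := h.pos
    exact (hv.norm_fracCut_le h.pos s b).trans (by gcongr)
  · by_cases hb : 0 ≤ b
    · rw [fracCut_of_nonneg v le_rfl hb]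
      refine (hv.tendsto_fracInt_zero hc hb).congr' ?_
      filter_upwards [self_mem_nhdsWithin] with s hs
      rw [fracCut_of_nonneg v hs hb]
    · simp [fracCut, hb]

theorem IsDelay.map_delayFrac {M' : Type*} [NormedAddCommGroup M'] [NormedSpace ℂ M']
    [CompleteSpace M'] {B' : ℝ} {a' : ℝ → M' →L[ℂ] M'} (h : IsDelay lam μ B δ ω a)
    (h' : IsDelay lam μ B' δ ω a') (hδ : 0 ≤ δ) (j : M →L[ℂ] M')
    (hj : ∀ᵐ α ∂lam, ∀ x, j (a α x) = a' α (j x)) (hv : HasGrowth c η C v) (b t : ℝ) :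
    j (delayFrac lam μ a v b t) = delayFrac lam μ a' (fun s => j (v s)) b t := by
  rw [delayFrac, h.map_delaySol h' j hj (hv.stronglyMeasurable_fracCut_apply t)
    (hv.growthWeight_nonneg ω t) (hv.norm_fracCut_le h.pos t) hδ b, delayFrac]
  congr 1
  funext b
  by_cases hb : 0 ≤ t ∧ 0 ≤ b
  · rw [fracCut_of_nonneg _ hb.1 hb.2, fracCut_of_nonneg _ hb.1 hb.2]
    rcases hb.2.eq_or_lt with rfl | hb0
    · rw [fracInt_zero, fracInt_zero]
    · rw [fracInt_eq hb0 _ hb.1, fracInt_eq hb0 _ hb.1,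
        ← j.integral_comp_comm (hv.integrableOn hb0 t)]
      refine integral_congr_ae (Eventually.of_forall fun s => ?_)
      simp only
      rw [← Complex.coe_smul, ← Complex.coe_smul, map_smul]
  · rw [fracCut, fracCut, if_neg hb, if_neg hb, map_zero]

omit [NormedSpace ℂ M] [CompleteSpace M] in
theorem hasGrowth_const (x : M) : HasGrowth 1 0 ‖x‖ (fun _ => x) where
  meas := stronglyMeasurable_const
  c_pos := one_pos
  c_le := le_rfl
  η_nonneg := le_rfl
  C_nonneg := norm_nonneg x
  bound t _ := by simp

theorem fracInt_const {b t : ℝ} (hb : 0 ≤ b) (ht : 0 < t) (x : M) :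
    fracInt b (fun _ => x) t = rlKer (b + 1) t • x := by
  rcases hb.eq_or_lt with rfl | hb
  · rw [fracInt_zero, zero_add, rlKer_of_pos ht]; simp
  · obtain ⟨h1, h2⟩ := integral_rlKer_mul_rlKer hb one_pos t
    have h3 : ∫ s in Ioi 0, rlKer b (t - s) * rlKer 1 s =
        ∫ s, rlKer b (t - s) * rlKer 1 s :=
      setIntegral_eq_integral_of_forall_compl_eq_zero fun s (hs : ¬0 < s) => by
        rw [rlKer_of_nonpos (b := 1) (not_lt.1 hs), mul_zero]
    rw [fracInt_eq hb _ ht.le, integral_smul_const, ← h2, ← h3]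
    congr 1
    refine setIntegral_congr_fun measurableSet_Ioi fun s hs => ?_
    rw [rlKer_of_pos (b := 1) hs]; simp

end DelayFrac

/-! ### Inverse Laplace transforms -/

section Laplace

theorem integrableOn_exp_neg_mul {c : ℝ → ℂ} (hc : ContinuousOn c (Ici 0))
    {C γ : ℝ} (hb : ∀ t : ℝ, 0 ≤ t → ‖c t‖ ≤ C * Real.exp (γ * t)) {s : ℂ} (hs : γ < s.re) :
    IntegrableOn (fun t : ℝ => Complex.exp (-(s * t)) * c t) (Ioi 0) := by
  have h1 : IntegrableOn (fun t : ℝ => C * Real.exp (-(s.re - γ) * t)) (Ioi 0) :=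
    (exp_neg_integrableOn_Ioi 0 (sub_pos.2 hs)).const_mul C
  refine h1.mono' ?_ ?_
  · refine AEStronglyMeasurable.mul (Continuous.aestronglyMeasurable (by fun_prop)) ?_
    exact (hc.mono Ioi_subset_Ici_self).aestronglyMeasurable measurableSet_Ioi
  · filter_upwards [ae_restrict_mem measurableSet_Ioi] with t ht
    rw [norm_mul, Complex.norm_exp]
    have h2 := hb t (le_of_lt ht)
    have h3 : (-(s * t)).re = -s.re * t := by simp
    rw [h3]
    calc _ ≤ Real.exp (-s.re * t) * (C * Real.exp (γ * t)) := by gcongr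
      _ = C * (Real.exp (-s.re * t) * Real.exp (γ * t)) := by ring
      _ = _ := by rw [← Real.exp_add]; ring_nf

/-- On the line `Re s = γ + 1` the Laplace transform is the Fourier transform of an integrable
function, and Fourier inversion holds at its points of continuity. The value at 0 follows by
continuity from the right. -/
theorem eqOn_zero_of_laplace_eq_zero {c : ℝ → ℂ} (hc : ContinuousOn c (Ici 0)) {C γ : ℝ}
    (hb : ∀ t : ℝ, 0 ≤ t → ‖c t‖ ≤ C * Real.exp (γ * t))
    (hL : ∀ s : ℂ, γ < s.re → ∫ t in Ioi (0 : ℝ), Complex.exp (-(s * t)) * c t = 0) :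
    EqOn c 0 (Ici 0) := by
  set g : ℝ → ℂ := (Ioi (0 : ℝ)).indicator
    fun t => Complex.exp (-(((γ + 1 : ℝ) : ℂ) * t)) * c t with hg
  have hgi : Integrable g := (integrable_indicator_iff measurableSet_Ioi).2
    (integrableOn_exp_neg_mul hc hb (by simp))
  have hF : FourierTransform.fourier g = 0 := by
    funext ξ
    rw [Real.fourier_real_eq_integral_exp_smul]
    have h1 := hL (((γ + 1 : ℝ) : ℂ) + 2 * Real.pi * ξ * Complex.I) (by simp)
    rw [Pi.zero_apply, ← h1, ← integral_indicator measurableSet_Ioi]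
    congr 1
    funext t
    by_cases ht : t ∈ Ioi (0 : ℝ)
    · rw [hg, indicator_of_mem ht, indicator_of_mem ht, smul_eq_mul, ← mul_assoc, ← Complex.exp_add]
      congr 2
      push_cast
      ring
    · rw [hg, indicator_of_notMem ht, indicator_of_notMem ht, smul_zero]
  have hpos : ∀ t, 0 < t → c t = 0 := fun t ht => by
    have hcg : ContinuousAt g t := by
      have h1 : ContinuousAt (fun t : ℝ => Complex.exp (-(((γ + 1 : ℝ) : ℂ) * t)) * c t) t :=
        ContinuousAt.mul (by fun_prop) (hc.continuousAt (Ici_mem_nhds ht))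
      refine h1.congr ?_
      filter_upwards [lt_mem_nhds ht] with s hs
      rw [hg, indicator_of_mem (show s ∈ Ioi (0 : ℝ) from hs)]
    have h2 := hgi.fourierInv_fourier_eq (by rw [hF]; exact integrable_zero _ _ _) hcg
    rw [hF] at h2
    have h3 : g t = 0 := by
      rw [← h2, Real.fourierInv_eq']
      simp
    rw [hg, indicator_of_mem (show t ∈ Ioi (0 : ℝ) from ht)] at h3
    exact (mul_eq_zero.1 h3).resolve_left (Complex.exp_ne_zero _)
  intro t ht
  rcases (show (0 : ℝ) ≤ t from ht).eq_or_lt with rfl | ht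
  · have h1 : Tendsto c (𝓝[>] 0) (𝓝 (c 0)) := (hc 0 self_mem_Ici).mono Ioi_subset_Ici_self
    refine tendsto_nhds_unique h1 ?_
    refine tendsto_const_nhds.congr' ?_
    filter_upwards [self_mem_nhdsWithin] with s hs
    rw [hpos s hs]; rfl
  · exact hpos t ht

theorem IsInverseLaplace.eqOn {F : ℂ → ℂ} {c c' : ℝ → ℂ} (h : IsInverseLaplace F c)
    (h' : IsInverseLaplace F c') : EqOn c c' (Ici 0) := by
  obtain ⟨hc, C, γ, hb, hL⟩ := h
  obtain ⟨hc', C', γ', hb', hL'⟩ := h'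
  have hC : 0 ≤ C := by simpa using (norm_nonneg _).trans (hb 0 le_rfl)
  have hC' : 0 ≤ C' := by simpa using (norm_nonneg _).trans (hb' 0 le_rfl)
  have key := eqOn_zero_of_laplace_eq_zero (c := fun t => c t - c' t) (C := C + C')
    (γ := max γ γ') (hc.sub hc') (fun t ht => ?_) (fun s hs => ?_)
  · intro t ht
    exact sub_eq_zero.1 (key ht)
  · refine (norm_sub_le _ _).trans ((add_le_add (hb t ht) (hb' t ht)).trans ?_)
    rw [add_mul]
    gcongr
    · exact le_max_left _ _
    · exact le_max_right _ _
  · have h1 := (le_max_left γ γ').trans_lt hs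
    have h2 := (le_max_right γ γ').trans_lt hs
    simp_rw [mul_sub]
    rw [integral_sub (integrableOn_exp_neg_mul hc hb h1)
      (integrableOn_exp_neg_mul hc' hb' h2), hL s h1, hL' s h2, sub_self]

theorem IsInverseLaplace.inverseLaplace_eq {F : ℂ → ℂ} {c : ℝ → ℂ} (h : IsInverseLaplace F c)
    {t : ℝ} (ht : 0 ≤ t) : inverseLaplace F t = c t := by
  have h' : ∃ c, IsInverseLaplace F c := ⟨c, h⟩
  rw [inverseLaplace, dif_pos h']
  exact h'.choose_spec.eqOn h ht

end Laplace

/-! ### The resolvent functions -/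

section Resolvent

theorem eventually_isDelay {M : Type*} [NormedAddCommGroup M] [NormedSpace ℂ M] {lam : Measure ℝ}
    {μ B δ : ℝ} (hδ : 0 < δ) {a : ℝ → M →L[ℂ] M} (ha : StronglyMeasurable a)
    (hB : ∀ α, ‖a α‖ ≤ B) (hdelay : ∀ᵐ α ∂lam, δ ≤ μ - α) :
    ∀ᶠ ω in atTop, IsDelay lam μ B δ ω a := by
  have h1 : Tendsto (fun ω : ℝ => B * lam.real univ * ω ^ (-δ)) atTop (𝓝 0) := by
    simpa using (tendsto_rpow_neg_atTop hδ).const_mul (B * lam.real univ)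
  filter_upwards [h1.eventually (gt_mem_nhds (show (0 : ℝ) < 1 / 2 by norm_num)),
    eventually_ge_atTop 1] with ω h2 h3
  exact ⟨ha, hB, hdelay, h3, h2.le⟩

/-- Multiplication by the values of `κ`. -/
def mulCoef {R : Type*} [NormedRing R] [NormedAlgebra ℂ R] (κ : ℝ → R) (α : ℝ) : R →L[ℂ] R :=
  ContinuousLinearMap.mul ℂ R (κ α)

theorem mulCoef_apply {R : Type*} [NormedRing R] [NormedAlgebra ℂ R] (κ : ℝ → R) (α : ℝ) (x : R) :
    mulCoef κ α x = κ α * x := rfl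

theorem norm_mulCoef_le {R : Type*} [NormedRing R] [NormedAlgebra ℂ R] (κ : ℝ → R) (α : ℝ) :
    ‖mulCoef κ α‖ ≤ ‖κ α‖ := ContinuousLinearMap.opNorm_mul_apply_le ℂ R (κ α)

theorem stronglyMeasurable_mulCoef {R : Type*} [NormedRing R] [NormedAlgebra ℂ R] {κ : ℝ → R}
    (hκ : StronglyMeasurable κ) : StronglyMeasurable (mulCoef κ) :=
  (ContinuousLinearMap.mul ℂ R).continuous.comp_stronglyMeasurable hκ

/-- Both sides are holomorphic for `Re s > 0`, the left one as a complex moment generating function.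
They agree on a sequence of real points tending to 1 by Euler's integral, hence everywhere. -/
theorem integral_cpow_mul_exp_neg_mul {a : ℝ} (ha : 0 < a) {s : ℂ} (hs : 0 < s.re) :
    ∫ t in Ioi (0 : ℝ), (t : ℂ) ^ ((a : ℂ) - 1) * Complex.exp (-(s * t)) =
      (1 / s) ^ (a : ℂ) * Complex.Gamma a := by
  set ν : Measure ℝ := (volume.restrict (Ioi 0)).withDensity fun t => ENNReal.ofReal (t ^ (a - 1))
    with hν
  have hm : Measurable fun t : ℝ => ENNReal.ofReal (t ^ (a - 1)) := by fun_prop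
  have hlt : ∀ᵐ t ∂volume.restrict (Ioi (0 : ℝ)), ENNReal.ofReal (t ^ (a - 1)) < ⊤ :=
    Eventually.of_forall fun t => ENNReal.ofReal_lt_top
  have hset : Iio 0 ⊆ ProbabilityTheory.integrableExpSet (fun t : ℝ => t) ν := by
    intro r hr
    have hr' : 0 < -r := neg_pos.2 hr
    change Integrable (fun t : ℝ => Real.exp (r * t)) ν
    rw [hν, integrable_withDensity_iff_integrable_smul' hm hlt]
    have h1 := integrableOn_rpow_mul_exp_neg_mul_rpow (s := a - 1) (p := 1) (b := -r)
      (by linarith) zero_lt_one hr'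
    refine h1.congr_fun (fun t ht => ?_) measurableSet_Ioi
    have ht0 : (0 : ℝ) < t := ht
    simp only [neg_neg, Real.rpow_one, smul_eq_mul]
    rw [ENNReal.toReal_ofReal (by positivity)]
  have hd : DifferentiableOn ℂ (fun s => ProbabilityTheory.complexMGF (fun t : ℝ => t) ν (-s))
      {s : ℂ | 0 < s.re} := by
    refine (ProbabilityTheory.differentiableOn_complexMGF).comp differentiable_neg.differentiableOn
      fun s hs => ?_
    refine interior_mono hset ?_
    rw [interior_Iio]
    simpa using hs
  have ho : IsOpen {s : ℂ | 0 < s.re} := isOpen_lt continuous_const Complex.continuous_re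
  have hmgf : ∀ s : ℂ, ProbabilityTheory.complexMGF (fun t : ℝ => t) ν (-s) =
      ∫ t in Ioi (0 : ℝ), (t : ℂ) ^ ((a : ℂ) - 1) * Complex.exp (-(s * t)) := fun s => by
    rw [ProbabilityTheory.complexMGF, hν, integral_withDensity_eq_integral_toReal_smul hm hlt]
    refine setIntegral_congr_fun measurableSet_Ioi fun t ht => ?_
    have ht0 : (0 : ℝ) < t := ht
    rw [ENNReal.toReal_ofReal (by positivity), Complex.real_smul, Complex.ofReal_cpow ht0.le,
      neg_mul]
    push_cast
    rfl
  have hd2 : DifferentiableOn ℂ (fun s : ℂ => (1 / s) ^ (a : ℂ) * Complex.Gamma a)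
      {s : ℂ | 0 < s.re} := by
    intro s hs
    have hs' : 0 < s.re := hs
    have hsne : s ≠ 0 := fun h => by simp [h] at hs'
    refine (DifferentiableAt.mul_const ?_ _).differentiableWithinAt
    refine DifferentiableAt.cpow_const ?_ ?_
    · exact (differentiableAt_const _).div differentiableAt_id hsne
    · left
      rw [one_div, Complex.inv_re]
      exact div_pos hs' (Complex.normSq_pos.2 hsne)
  have hpre : IsPreconnected {s : ℂ | 0 < s.re} :=
    (convex_halfSpace_re_gt 0).isPreconnected
  have key := (hd.analyticOnNhd ho).eqOn_of_preconnected_of_frequently_eq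
    (hd2.analyticOnNhd ho) hpre (z₀ := 1) (by simp) ?_
  · rw [← hmgf]; exact key hs
  · have hseq : Tendsto (fun n : ℕ => ((1 + 1 / ((n : ℝ) + 1) : ℝ) : ℂ)) atTop (𝓝[≠] 1) := by
      refine tendsto_nhdsWithin_iff.2 ⟨?_, Eventually.of_forall fun n => ?_⟩
      · have := (tendsto_one_div_add_atTop_nhds_zero_nat (𝕜 := ℝ)).const_add 1
        rw [add_zero] at this
        exact (Complex.continuous_ofReal.tendsto 1).comp this
      · have : (0 : ℝ) < 1 / ((n : ℝ) + 1) := by positivity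
        simp only [mem_compl_iff, mem_singleton_iff]
        rw [← Complex.ofReal_one, Complex.ofReal_inj]
        linarith
    refine hseq.frequently (Eventually.frequently (Eventually.of_forall fun n => ?_))
    rw [hmgf, Complex.integral_cpow_mul_exp_neg_mul_Ioi (by simpa using ha) (by positivity)]

theorem laplace_fracCut {s : ℂ} (hs : 0 < s.re) {b : ℝ} (hb : 0 ≤ b) :
    ∫ t in Ioi (0 : ℝ), Complex.exp (-(s * t)) * fracCut (fun _ => (1 : ℂ)) t b =
      s ^ (-(b : ℂ) - 1) := by
  have h1 := integral_cpow_mul_exp_neg_mul (a := b + 1) (by linarith) hs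
  rw [Complex.ofReal_add, Complex.ofReal_one] at h1
  have hΓ : Complex.Gamma ((b : ℂ) + 1) ≠ 0 := Complex.Gamma_ne_zero_of_re_pos (by simp; linarith)
  have hs0 : s ≠ 0 := fun h => by simp [h] at hs
  have h2 : ∀ t ∈ Ioi (0 : ℝ), Complex.exp (-(s * t)) * fracCut (fun _ => (1 : ℂ)) t b =
      (Complex.Gamma ((b : ℂ) + 1))⁻¹ * ((t : ℂ) ^ ((b : ℂ) + 1 - 1) * Complex.exp (-(s * t))) := by
    intro t ht
    have ht0 : (0 : ℝ) < t := ht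
    rw [fracCut_of_nonneg _ ht0.le hb, fracInt_const hb ht0, rlKer_of_pos ht0, Complex.real_smul,
      mul_one, Complex.ofReal_mul, Complex.ofReal_inv, ← Complex.Gamma_ofReal,
      Complex.ofReal_cpow ht0.le]
    push_cast
    ring
  rw [setIntegral_congr_fun measurableSet_Ioi h2, integral_const_mul, h1, mul_comm,
    mul_assoc, mul_inv_cancel₀ hΓ, mul_one, one_div, Complex.inv_cpow, ← Complex.cpow_neg]
  · congr 1; ring
  · intro h
    have := Complex.arg_eq_pi_iff.1 h
    linarith [this.1]

variable {lam : Measure ℝ} [IsFiniteMeasure lam] {μ B δ ω : ℝ} {κ : ℝ → ℂ}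

/-- The Laplace integral passes through the solution map and turns the source into `s ^ (-b - 1)`.
For that source `b ↦ s ^ (μ - b - 1) / Δ` is a solution by inspection, and it has the required decay
since `ω ≤ ‖s‖`. -/
theorem IsDelay.laplace_delayFrac (h : IsDelay lam μ B δ ω (mulCoef κ)) (hδ : 0 < δ)
    (hκ : StronglyMeasurable κ) (hκB : ∀ α, ‖κ α‖ ≤ B)
    {x : ℝ} (hx : 0 ≤ x) {s : ℂ} (hs : 2 * ω < s.re) :
    ∫ t in Ioi (0 : ℝ), Complex.exp (-(s * t)) *
      delayFrac lam μ (mulCoef κ) (fun _ => (1 : ℂ)) x t =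
      s ^ ((μ : ℂ) - x - 1) / (s ^ (μ : ℂ) + ∫ α, κ α * s ^ (α : ℂ) ∂lam) := by
  have hω := h.pos
  have hs0 : 0 < s.re := by linarith
  have hsne : s ≠ 0 := fun h => by simp [h] at hs0
  have hsn : ω ≤ ‖s‖ := by
    have := Complex.re_le_norm s
    linarith
  have hs1 : 1 ≤ ‖s‖ := h.one_le.trans hsn
  have hnp : ∀ y : ℝ, ‖s ^ (y : ℂ)‖ = ‖s‖ ^ y := fun y => Complex.norm_cpow_real s y
  have hclm : ∀ᵐ α ∂lam, ∀ x y : ℂ, x * mulCoef κ α y = mulCoef κ α (x * y) :=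
    Eventually.of_forall fun α x y => by rw [mulCoef_apply, mulCoef_apply]; ring
  have hv := hasGrowth_const (1 : ℂ)
  have hcm := hv.stronglyMeasurable_fracCut
  set w : ℝ → ℝ := fun t => ‖Complex.exp (-(s * t))‖ * growthWeight 1 0 ‖(1 : ℂ)‖ ω t with hw
  have hGb : ∀ t b : ℝ, ‖Complex.exp (-(s * t)) * fracCut (fun _ => (1 : ℂ)) t b‖ ≤
      w t * ω ^ (-b) := fun t b => by
    rw [norm_mul, hw, mul_assoc]
    gcongr
    exact hv.norm_fracCut_le hω t b
  have hw0 : ∀ t, 0 ≤ w t := fun t => mul_nonneg (norm_nonneg _) (hv.growthWeight_nonneg ω t)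
  have hGm : StronglyMeasurable (Function.uncurry fun (t : ℝ) b =>
      Complex.exp (-(s * t)) * fracCut (fun _ => (1 : ℂ)) t b) := by
    refine StronglyMeasurable.mul ?_ hcm
    exact Continuous.stronglyMeasurable (by fun_prop)
  have hwi : IntegrableOn w (Ioi 0) := by
    have h1 : IntegrableOn (fun t : ℝ => Real.exp 1 * Real.exp (-(s.re - 2 * ω) * t)) (Ioi 0) :=
      (exp_neg_integrableOn_Ioi 0 (by linarith)).const_mul _
    refine h1.congr_fun (fun t ht => ?_) measurableSet_Ioi
    have ht0 : (0 : ℝ) < t := ht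
    simp only [hw]
    rw [growthWeight, Complex.norm_exp, abs_of_pos ht0, norm_one, Real.Gamma_one, sub_self,
      Real.rpow_zero]
    have : (-(s * t)).re = -s.re * t := by simp
    rw [this]
    have e : Real.exp (-(s.re - 2 * ω) * t) =
        Real.exp (-s.re * t) * Real.exp ((0 + 2 * ω) * t) := by
      rw [← Real.exp_add]; congr 1; ring
    rw [e]; ring
  have h1 : ∀ t : ℝ, Complex.exp (-(s * t)) * delayFrac lam μ (mulCoef κ) (fun _ => (1 : ℂ)) x t =
      delaySol lam μ (mulCoef κ) (fun b => Complex.exp (-(s * t)) *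
        fracCut (fun _ => (1 : ℂ)) t b) x := fun t => by
    refine (h.delaySol_clm (ContinuousLinearMap.mul ℂ ℂ (Complex.exp (-(s * t)))) ?_
      (hv.stronglyMeasurable_fracCut_apply t) (hv.growthWeight_nonneg ω t)
      (hv.norm_fracCut_le hω t) hδ.le x).symm
    filter_upwards [hclm] with α hα y
    exact hα _ y
  simp_rw [h1]
  rw [h.integral_delaySol hGm hw0 hwi hGb hδ.le x]
  set D : ℂ := s ^ (μ : ℂ) + ∫ α, κ α * s ^ (α : ℂ) ∂lam with hD
  have hκs : ∀ᵐ α ∂lam, ‖κ α * s ^ (α : ℂ)‖ ≤ B * ω ^ (-δ) * ‖s‖ ^ μ := by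
    filter_upwards [h.delay] with α hα
    rw [norm_mul, hnp]
    have hB : 0 ≤ B := (norm_nonneg _).trans (hκB α)
    have h2 : ‖s‖ ^ α ≤ ω ^ (-δ) * ‖s‖ ^ μ := by
      have h3 : ‖s‖ ^ α ≤ ‖s‖ ^ (-δ + μ) := Real.rpow_le_rpow_of_exponent_le hs1 (by linarith)
      rw [Real.rpow_add (by linarith)] at h3
      refine h3.trans ?_
      gcongr ?_ * _
      exact Real.rpow_le_rpow_of_nonpos hω hsn (by linarith)
    rw [mul_assoc]
    exact mul_le_mul (hκB α) h2 (by positivity) hB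
  -- The lower order terms are at most half of `‖s‖ ^ μ`, by the same smallness condition that makes
  -- the Neumann series converge.
  have hD0 : D ≠ 0 := by
    intro h0
    have h2 := norm_integral_le_of_norm_le_const hκs
    have h3 : ‖s‖ ^ μ = ‖∫ α, κ α * s ^ (α : ℂ) ∂lam‖ := by
      rw [← hnp, ← norm_neg (∫ α, κ α * s ^ (α : ℂ) ∂lam)]
      congr 1
      exact eq_neg_of_add_eq_zero_left h0
    have h4 : 0 < ‖s‖ ^ μ := by positivity
    have h5 := h.small
    nlinarith
  have hsm : Measurable fun α : ℝ => s ^ (α : ℂ) := by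
    have : Continuous fun α : ℝ => s ^ (α : ℂ) :=
      continuous_const.cpow Complex.continuous_ofReal fun α => Or.inl hs0
    exact this.measurable
  have hκi : Integrable (fun α => κ α * s ^ (α : ℂ)) lam :=
    Integrable.of_bound (hκ.mul hsm.stronglyMeasurable).aestronglyMeasurable _ hκs
  set F : ℝ → ℂ := fun b => s ^ ((μ : ℂ) - b - 1) / D with hF
  have hFm : StronglyMeasurable F := by
    have : Continuous F := by
      refine Continuous.div_const (continuous_const.cpow ?_ fun _ => Or.inl hs0) _
      fun_prop
    exact this.stronglyMeasurable
  have hspow : ∀ b : ℝ, 0 ≤ b → ‖s‖ ^ (-b) ≤ ω ^ (-b) := fun b hb =>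
    Real.rpow_le_rpow_of_nonpos hω hsn (by linarith)
  refine (h.eq_delaySol (F := F) (C := ‖s‖ ^ (μ - 1) / ‖D‖) (C' := ∫ t in Ioi 0, w t) (b₁ := 0)
    hFm (hGm.comp_measurable measurable_swap).integral_prod_right' (by positivity)
    (integral_nonneg hw0) (fun b hb => ?_) (fun b => ?_) hδ.le (fun b hb => ?_) hx).symm
  · simp only [hF]
    have h2 : (μ : ℂ) - b - 1 = ((μ - 1 + -b : ℝ) : ℂ) := by push_cast; ring
    rw [norm_div, h2, hnp, Real.rpow_add (by linarith), mul_div_right_comm]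
    exact mul_le_mul_of_nonneg_left (hspow b hb) (by positivity)
  · rw [← integral_mul_const]
    exact norm_integral_le_of_norm_le (hwi.mul_const _) (Eventually.of_forall fun t => hGb t b)
  · change F b + delayOp lam μ (mulCoef κ) F b =
      ∫ t in Ioi (0 : ℝ), Complex.exp (-(s * t)) * fracCut (fun _ => (1 : ℂ)) t b
    rw [laplace_fracCut hs0 hb, delayOp]
    have h2 : ∀ α : ℝ, mulCoef κ α (F (b + μ - α)) =
        s ^ (-(b : ℂ) - 1) / D * (κ α * s ^ (α : ℂ)) := fun α => by
      rw [mulCoef_apply]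
      simp only [hF]
      have h3 : (μ : ℂ) - ((b + μ - α : ℝ) : ℂ) - 1 = (-(b : ℂ) - 1) + α := by push_cast; ring
      rw [h3, Complex.cpow_add _ _ hsne]
      ring
    simp_rw [h2]
    rw [integral_const_mul]
    simp only [hF]
    have h3 : (μ : ℂ) - b - 1 = (-(b : ℂ) - 1) + μ := by ring
    rw [h3, Complex.cpow_add _ _ hsne]
    have h4 : s ^ (-(b : ℂ) - 1) * s ^ (μ : ℂ) / D + s ^ (-(b : ℂ) - 1) / D *
        ∫ α, κ α * s ^ (α : ℂ) ∂lam = s ^ (-(b : ℂ) - 1) * D / D := by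
      rw [hD]; ring
    rw [h4, mul_div_assoc, div_self hD0, mul_one]

theorem IsDelay.isInverseLaplace (h : IsDelay lam μ B δ ω (mulCoef κ)) (hδ : 0 < δ)
    (hκ : StronglyMeasurable κ) (hκB : ∀ α, ‖κ α‖ ≤ B) {x : ℝ} (hx : 0 ≤ x) :
    IsInverseLaplace (fun s => s ^ ((μ : ℂ) - x - 1) / (s ^ (μ : ℂ) + ∫ α, κ α * s ^ (α : ℂ) ∂lam))
      (delayFrac lam μ (mulCoef κ) (fun _ => (1 : ℂ)) x) := by
  have hv := hasGrowth_const (1 : ℂ)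
  refine ⟨fun t ht => ?_, 2 * Real.exp 1, 2 * ω, fun t ht => ?_, fun s hs =>
    h.laplace_delayFrac hδ hκ hκB hx hs⟩
  · rcases (show (0 : ℝ) ≤ t from ht).eq_or_lt with rfl | ht
    · exact h.tendsto_delayFrac_zero hδ.le hv continuousOn_const x
    · exact (h.tendsto_delayFrac hδ.le hv continuousOn_const ht).continuousWithinAt
  · have := (h.hasGrowth_delayFrac hδ.le hv hx).bound t ht
    simpa using this

end Resolvent

/-! ### The solution symbols -/

section SymVec

variable {M : Type*} [NormedAddCommGroup M] [NormedSpace ℂ M] [CompleteSpace M]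

/-- The vector `S_k(t) e`, for the coefficients `a`. -/
def solVec (lam : Measure ℝ) (μ : ℝ) (a : ℝ → M →L[ℂ] M) (e : M) (k : ℕ) (t : ℝ) : M :=
  fracInt k (fun _ => e) t -
    ∫ α in Icc (0 : ℝ) k, a α (delayFrac lam μ a (fun _ => e) (k + μ - α) t) ∂lam

variable {lam : Measure ℝ} [IsFiniteMeasure lam] {μ B δ ω : ℝ} {a : ℝ → M →L[ℂ] M}

theorem map_fracInt_const {M' : Type*} [NormedAddCommGroup M'] [NormedSpace ℂ M']
    [CompleteSpace M'] (j : M →L[ℂ] M') {b t : ℝ} (hb : 0 ≤ b) (ht : 0 ≤ t) (e : M) :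
    j (fracInt b (fun _ => e) t) = fracInt b (fun _ => j e) t := by
  rcases ht.eq_or_lt with rfl | ht
  · rcases hb.eq_or_lt with rfl | hb
    · rw [fracInt_zero, fracInt_zero]
    · rw [fracInt_apply_zero hb, fracInt_apply_zero hb, map_zero]
  · rw [fracInt_const hb ht, fracInt_const hb ht, ← Complex.coe_smul, ← Complex.coe_smul, map_smul]

theorem IsDelay.map_solVec {M' : Type*} [NormedAddCommGroup M'] [NormedSpace ℂ M']
    [CompleteSpace M'] {B' : ℝ} {a' : ℝ → M' →L[ℂ] M'} (h : IsDelay lam μ B δ ω a)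
    (h' : IsDelay lam μ B' δ ω a') (hδ : 0 ≤ δ) (j : M →L[ℂ] M')
    (hj : ∀ α, ∀ x, j (a α x) = a' α (j x)) (e : M) (k : ℕ) {t : ℝ} (ht : 0 ≤ t) :
    j (solVec lam μ a e k t) = solVec lam μ a' (j e) k t := by
  rw [solVec, map_sub, map_fracInt_const j k.cast_nonneg ht, solVec,
    ← j.integral_comp_comm (h.integrable_delayFrac hδ (hasGrowth_const e) k t).integrableOn]
  congr 1
  refine integral_congr_ae (Eventually.of_forall fun α => ?_)
  simp only
  rw [hj, h.map_delayFrac h' hδ j (Eventually.of_forall hj) (hasGrowth_const e)]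

end SymVec

/-- The hypotheses on the equation. -/
structure IsEquation (G : Set ℂ) (m : ℕ) (μ : ℝ) (lam : Measure ℝ) (f : ℝ → ℂ → ℂ) : Prop where
  isOpen : IsOpen G
  one_le : 1 ≤ m
  lt : (m : ℝ) - 1 < μ
  le : μ ≤ m
  supp : lam (Icc 0 ((m : ℝ) - 1))ᶜ = 0
  cont : ContinuousOn (fun p : ℝ × ℂ => f p.1 p.2) (Icc 0 ((m : ℝ) - 1) ×ˢ G)
  an : ∀ α ∈ Icc (0 : ℝ) ((m : ℝ) - 1), AnalyticOnNhd ℂ (f α) G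

/-- The coefficients, extended from `[0, m - 1]` to all orders by constants. -/
def clampCoef (m : ℕ) (f : ℝ → ℂ → ℂ) (α : ℝ) : ℂ → ℂ := f (max 0 (min α ((m : ℝ) - 1)))

section Coef

variable {G : Set ℂ} {m : ℕ} {μ : ℝ} {lam : Measure ℝ} {f : ℝ → ℂ → ℂ}

theorem IsEquation.nonneg (h : IsEquation G m μ lam f) : (0 : ℝ) ≤ (m : ℝ) - 1 := by
  have : (1 : ℝ) ≤ m := by exact_mod_cast h.one_le
  linarith

theorem IsEquation.clamp_mem (h : IsEquation G m μ lam f) (α : ℝ) :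
    max 0 (min α ((m : ℝ) - 1)) ∈ Icc (0 : ℝ) ((m : ℝ) - 1) :=
  ⟨le_max_left _ _, max_le h.nonneg (min_le_right _ _)⟩

theorem clampCoef_of_mem {α : ℝ} (hα : α ∈ Icc (0 : ℝ) ((m : ℝ) - 1)) : clampCoef m f α = f α := by
  rw [clampCoef, min_eq_left hα.2, max_eq_right hα.1]

theorem IsEquation.ae_mem (h : IsEquation G m μ lam f) :
    ∀ᵐ α ∂lam, α ∈ Icc (0 : ℝ) ((m : ℝ) - 1) := h.supp

theorem IsEquation.delay (h : IsEquation G m μ lam f) :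
    ∀ᵐ α ∂lam, μ - ((m : ℝ) - 1) ≤ μ - α := by
  filter_upwards [h.ae_mem] with α hα
  linarith [hα.2]

theorem IsEquation.delay_pos (h : IsEquation G m μ lam f) : 0 < μ - ((m : ℝ) - 1) := by
  linarith [h.lt]

theorem IsEquation.differentiableOn (h : IsEquation G m μ lam f) (α : ℝ) :
    DifferentiableOn ℂ (clampCoef m f α) G := (h.an _ (h.clamp_mem α)).differentiableOn

/-- Currying turns joint continuity into continuity in `α` that is uniform over the compact set `K`.
-/
theorem IsEquation.continuous_curry (h : IsEquation G m μ lam f) {K : Set ℂ} (hK : IsCompact K)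
    (hKG : K ⊆ G) : ∃ F : ℝ → C(K, ℂ), Continuous F ∧ (∀ α (z : K), F α z = clampCoef m f α z) ∧
      ∃ B, 0 ≤ B ∧ ∀ α, ∀ z ∈ K, ‖clampCoef m f α z‖ ≤ B := by
  have hKc : CompactSpace K := isCompact_iff_compactSpace.1 hK
  have hc : Continuous fun p : ℝ × K => clampCoef m f p.1 p.2 := by
    refine h.cont.comp_continuous (f := fun p : ℝ × K => (max 0 (min p.1 ((m : ℝ) - 1)), (p.2 : ℂ)))
      (by fun_prop) fun p => ⟨h.clamp_mem p.1, hKG p.2.2⟩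
  set F : C(ℝ, C(K, ℂ)) := (⟨_, hc⟩ : C(ℝ × K, ℂ)).curry with hF
  have hFa : ∀ α (z : K), F α z = clampCoef m f α z := fun α z => rfl
  obtain ⟨B, hB⟩ := (isCompact_Icc.image F.continuous).isBounded.exists_norm_le
    (s := F '' Icc (0 : ℝ) ((m : ℝ) - 1))
  refine ⟨F, F.continuous, hFa, max B 0, le_max_right _ _, fun α z hz => ?_⟩
  have h1 := hB _ (mem_image_of_mem F (h.clamp_mem α))
  have h2 := (F (max 0 (min α ((m : ℝ) - 1)))).norm_coe_le_norm ⟨z, hz⟩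
  rw [hFa, clampCoef_of_mem (h.clamp_mem α)] at h2
  exact h2.trans (h1.trans (le_max_left _ _))

theorem IsEquation.eventually_dist (h : IsEquation G m μ lam f) {K : Set ℂ} (hK : IsCompact K)
    (hKG : K ⊆ G) (α₀ : ℝ) {ε : ℝ} (hε : 0 < ε) :
    ∀ᶠ α in 𝓝 α₀, ∀ z ∈ K, ‖clampCoef m f α z - clampCoef m f α₀ z‖ ≤ ε := by
  have hKc : CompactSpace K := isCompact_iff_compactSpace.1 hK
  obtain ⟨F, hF, hFa, -⟩ := h.continuous_curry hK hKG
  filter_upwards [Metric.tendsto_nhds.1 (hF.tendsto α₀) ε hε] with α hα z hz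
  rw [← hFa α ⟨z, hz⟩, ← hFa α₀ ⟨z, hz⟩, ← dist_eq_norm]
  exact (ContinuousMap.dist_apply_le_dist _).trans hα.le

/-- The coefficients as elements of the disc algebra. -/
def discCoef (h : IsEquation G m μ lam f) {ζ : ℂ} {ρ : ℝ} (hsub : Metric.closedBall ζ ρ ⊆ G)
    (α : ℝ) : discAlg ζ ρ := discRestr hsub (h.differentiableOn α)

theorem continuous_discCoef (h : IsEquation G m μ lam f) {ζ : ℂ} {ρ : ℝ}
    (hsub : Metric.closedBall ζ ρ ⊆ G) : Continuous (discCoef h hsub) := by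
  rw [continuous_iff_continuousAt]
  intro α₀
  refine Metric.tendsto_nhds.2 fun ε hε => ?_
  filter_upwards [h.eventually_dist (isCompact_closedBall ζ ρ) hsub α₀ (half_pos hε)] with α hα
  refine lt_of_le_of_lt ?_ (half_lt_self hε)
  rw [Subtype.dist_eq, ContinuousMap.dist_le (half_pos hε).le]
  intro z
  rw [dist_eq_norm]
  exact hα z z.2

theorem exists_norm_discCoef_le (h : IsEquation G m μ lam f) {ζ : ℂ} {ρ : ℝ}
    (hsub : Metric.closedBall ζ ρ ⊆ G) : ∃ B, 0 ≤ B ∧ ∀ α, ‖discCoef h hsub α‖ ≤ B := by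
  obtain ⟨-, -, -, B, hB0, hB⟩ := h.continuous_curry (isCompact_closedBall ζ ρ) hsub
  refine ⟨B, hB0, fun α => ?_⟩
  change ‖(discCoef h hsub α).1‖ ≤ B
  rw [ContinuousMap.norm_le _ hB0]
  exact fun z => hB α z z.2

theorem IsEquation.continuous_apply (h : IsEquation G m μ lam f) {z : ℂ} (hz : z ∈ G) :
    Continuous fun α => clampCoef m f α z := by
  obtain ⟨F, hF, hFa, -⟩ := h.continuous_curry isCompact_singleton (singleton_subset_iff.2 hz)
  have : (fun α => clampCoef m f α z) = fun α => F α ⟨z, rfl⟩ := by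
    funext α; rw [hFa]
  rw [this]
  fun_prop

theorem IsEquation.exists_norm_apply_le (h : IsEquation G m μ lam f) {z : ℂ} (hz : z ∈ G) :
    ∃ B, 0 ≤ B ∧ ∀ α, ‖clampCoef m f α z‖ ≤ B := by
  obtain ⟨-, -, -, B, hB0, hB⟩ := h.continuous_curry isCompact_singleton (singleton_subset_iff.2 hz)
  exact ⟨B, hB0, fun α => hB α z rfl⟩

variable [IsFiniteMeasure lam]

omit [IsFiniteMeasure lam] in
theorem IsEquation.isDelay_apply (h : IsEquation G m μ lam f) {z : ℂ} (hz : z ∈ G) :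
    ∃ B, (∀ α, ‖clampCoef m f α z‖ ≤ B) ∧ ∀ᶠ ω in atTop,
      IsDelay lam μ B (μ - ((m : ℝ) - 1)) ω (mulCoef fun α => clampCoef m f α z) := by
  obtain ⟨B, -, hB⟩ := h.exists_norm_apply_le hz
  exact ⟨B, hB, eventually_isDelay h.delay_pos
    (stronglyMeasurable_mulCoef (h.continuous_apply hz).stronglyMeasurable)
    (fun α => (norm_mulCoef_le _ α).trans (hB α)) h.delay⟩

/-- The function `c_{μ-x-1}(t, z)`. -/
def resFun (m : ℕ) (μ : ℝ) (lam : Measure ℝ) (f : ℝ → ℂ → ℂ) (x t : ℝ) (z : ℂ) : ℂ :=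
  delayFrac lam μ (mulCoef fun α => clampCoef m f α z) (fun _ => (1 : ℂ)) x t

theorem IsEquation.isInverseLaplace (h : IsEquation G m μ lam f) {z : ℂ} (hz : z ∈ G) {x : ℝ}
    (hx : 0 ≤ x) : IsInverseLaplace (resolventSymbol μ lam f (μ - x - 1) z)
      (fun t => resFun m μ lam f x t z) := by
  obtain ⟨B, hB, hev⟩ := h.isDelay_apply hz
  obtain ⟨ω, hω⟩ := hev.exists
  have key := hω.isInverseLaplace h.delay_pos (h.continuous_apply hz).stronglyMeasurable hB hx
  have hs : resolventSymbol μ lam f (μ - x - 1) z = fun s => s ^ ((μ : ℂ) - x - 1) /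
      (s ^ (μ : ℂ) + ∫ α, clampCoef m f α z * s ^ (α : ℂ) ∂lam) := by
    funext s
    rw [resolventSymbol, charSymbol]
    push_cast
    congr 2
    refine integral_congr_ae ?_
    filter_upwards [h.ae_mem] with α hα
    rw [clampCoef_of_mem hα]
  rw [hs]
  exact key

theorem IsEquation.cSymbol_eq (h : IsEquation G m μ lam f) {z : ℂ} (hz : z ∈ G) {x t β : ℝ}
    (hx : 0 ≤ x) (hβ : β = μ - x - 1) (ht : 0 ≤ t) :
    cSymbol μ lam f β t z = resFun m μ lam f x t z := by
  rw [cSymbol, hβ]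
  exact (h.isInverseLaplace hz hx).inverseLaplace_eq ht

theorem IsEquation.integrable_resFun (h : IsEquation G m μ lam f) {z : ℂ} (hz : z ∈ G) (k : ℕ)
    (t : ℝ) : Integrable (fun α => clampCoef m f α z * resFun m μ lam f (k + μ - α) t z) lam := by
  obtain ⟨B, hB, hev⟩ := h.isDelay_apply hz
  obtain ⟨ω, hω⟩ := hev.exists
  exact hω.integrable_delayFrac h.delay_pos.le (hasGrowth_const 1) k t

theorem IsEquation.cSymbol_eqOn (h : IsEquation G m μ lam f) {z : ℂ} (hz : z ∈ G) (k : ℕ) {t : ℝ}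
    (ht : 0 ≤ t) : EqOn (fun α => f α z * cSymbol μ lam f (α - k - 1) t z)
      (fun α => clampCoef m f α z * resFun m μ lam f (k + μ - α) t z)
      (Ioc (k : ℝ) ((m : ℝ) - 1)) := by
  intro α hα
  have hk : (0 : ℝ) ≤ k := k.cast_nonneg
  simp only
  rw [clampCoef_of_mem ⟨hk.trans hα.1.le, hα.2⟩,
    h.cSymbol_eq hz (x := k + μ - α) (by linarith [hα.2, h.lt]) (by ring) ht]

theorem IsEquation.integrableOn_cSymbol (h : IsEquation G m μ lam f) {z : ℂ} (hz : z ∈ G) (k : ℕ)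
    {t : ℝ} (ht : 0 ≤ t) : IntegrableOn (fun α => f α z * cSymbol μ lam f (α - k - 1) t z)
      (Ioc (k : ℝ) ((m : ℝ) - 1)) lam :=
  ((h.integrable_resFun hz k t).integrableOn).congr_fun (h.cSymbol_eqOn hz k ht).symm
    measurableSet_Ioc

/-- The delay equation at order `k` says that `c_{μ-k-1}` plus the integral of `f c_{α-k-1}` over
all orders equals `t^k/k!`. Hence the integral over `(k, m - 1]` in `S_k` can be traded for one over
`[0, k]`, the form in which the memory of the initial value appears. -/
theorem IsEquation.solSymbol_eq (h : IsEquation G m μ lam f) {z : ℂ} (hz : z ∈ G) {k : ℕ}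
    (hk : k < m) {t : ℝ} (ht : 0 ≤ t) : solSymbol m μ lam f k t z =
      solVec lam μ (mulCoef fun α => clampCoef m f α z) 1 k t := by
  obtain ⟨B, hB, hev⟩ := h.isDelay_apply hz
  obtain ⟨ω, hω⟩ := hev.exists
  have hk0 : (0 : ℝ) ≤ k := k.cast_nonneg
  have hkm : (k : ℝ) ≤ (m : ℝ) - 1 := by
    have : ((k + 1 : ℕ) : ℝ) ≤ m := by exact_mod_cast hk
    push_cast at this
    linarith
  have hi := h.integrable_resFun hz k t
  rw [solSymbol, h.cSymbol_eq hz hk0 (by ring) ht,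
    setIntegral_congr_fun measurableSet_Ioc (h.cSymbol_eqOn hz k ht), solVec,
    ← hω.delayFrac_add h.delay_pos.le (hasGrowth_const 1) hk0 ht]
  have h1 : ∫ α, clampCoef m f α z * resFun m μ lam f (k + μ - α) t z ∂lam =
      (∫ α in Icc (0 : ℝ) k, clampCoef m f α z * resFun m μ lam f (k + μ - α) t z ∂lam) +
      ∫ α in Ioc (k : ℝ) ((m : ℝ) - 1),
        clampCoef m f α z * resFun m μ lam f (k + μ - α) t z ∂lam := by
    rw [← setIntegral_union (disjoint_left.2 fun x hx hx' => hx'.1.not_ge hx.2) measurableSet_Ioc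
      hi.integrableOn hi.integrableOn, Icc_union_Ioc_eq_Icc hk0 hkm,
      Measure.restrict_eq_self_of_ae_mem h.ae_mem]
  have h2 : ∫ α, mulCoef (fun α => clampCoef m f α z) α
      (delayFrac lam μ (mulCoef fun α => clampCoef m f α z) (fun _ => (1 : ℂ)) (k + μ - α) t) ∂lam =
      ∫ α, clampCoef m f α z * resFun m μ lam f (k + μ - α) t z ∂lam := rfl
  rw [h2, h1, resFun]
  simp only [mulCoef_apply, resFun]
  ring

variable {ι : Type*} [Fintype ι] {ζ : ι → ℂ} {ρ : ι → ℝ}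

/-- The coefficients as elements of a product of disc algebras. -/
def prodCoef (h : IsEquation G m μ lam f) (hsub : ∀ i, Metric.closedBall (ζ i) (ρ i) ⊆ G) (α : ℝ) :
    ∀ i, discAlg (ζ i) (ρ i) := fun i => discCoef h (hsub i) α

omit [IsFiniteMeasure lam] in
theorem isDelay_prodCoef (h : IsEquation G m μ lam f)
    (hsub : ∀ i, Metric.closedBall (ζ i) (ρ i) ⊆ G) : ∃ B, ∀ᶠ ω in atTop,
      IsDelay lam μ B (μ - ((m : ℝ) - 1)) ω (mulCoef (prodCoef h hsub)) := by
  choose B hB0 hB using fun i => exists_norm_discCoef_le h (hsub i)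
  refine ⟨∑ i, B i, eventually_isDelay h.delay_pos (stronglyMeasurable_mulCoef
    (continuous_pi fun i => continuous_discCoef h (hsub i)).stronglyMeasurable)
    (fun α => (norm_mulCoef_le _ α).trans ?_) h.delay⟩
  refine (pi_norm_le_iff_of_nonneg (Finset.sum_nonneg fun i _ => hB0 i)).2 fun i => ?_
  exact (hB i α).trans (Finset.single_le_sum (fun i _ => hB0 i) (Finset.mem_univ i))

/-- The solution symbol as an element of a product of disc algebras. -/
def prodSol (h : IsEquation G m μ lam f) (hsub : ∀ i, Metric.closedBall (ζ i) (ρ i) ⊆ G)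
    (k : ℕ) (t : ℝ) : ∀ i, discAlg (ζ i) (ρ i) :=
  solVec lam μ (mulCoef (prodCoef h hsub)) 1 k t

/-- Evaluation at a point of the disc intertwines multiplication by the coefficients in the disc
algebra with multiplication by their values. -/
theorem discExt_prodSol (h : IsEquation G m μ lam f)
    (hsub : ∀ i, Metric.closedBall (ζ i) (ρ i) ⊆ G) {k : ℕ} (hk : k < m) {t : ℝ} (ht : 0 ≤ t)
    (i : ι) {z : ℂ} (hz : z ∈ Metric.closedBall (ζ i) (ρ i)) :
    discExt (prodSol h hsub k t i).1 z = solSymbol m μ lam f k t z := by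
  obtain ⟨B, hev⟩ := isDelay_prodCoef h hsub
  obtain ⟨B', -, hev'⟩ := h.isDelay_apply (hsub i hz)
  obtain ⟨ω, hω, hω'⟩ := (hev.and hev').exists
  have key := hω.map_solVec hω' h.delay_pos.le
    ((discEval hz).comp (ContinuousLinearMap.proj (R := ℂ) (φ := fun i => discAlg (ζ i) (ρ i)) i))
    (fun α x => rfl) 1 k ht
  rw [h.solSymbol_eq (hsub i hz) hk ht, ← discEval_apply hz]
  exact key

/-- Near each point the symbol consists of the values of one element of a disc algebra, so no
estimate of its dependence on `z` is needed. -/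
theorem IsEquation.analyticOnNhd_solSymbol (h : IsEquation G m μ lam f) {k : ℕ} (hk : k < m)
    {t : ℝ} (ht : 0 ≤ t) : AnalyticOnNhd ℂ (solSymbol m μ lam f k t) G := by
  intro z hz
  obtain ⟨r, hr, hsub⟩ := Metric.nhds_basis_closedBall.mem_iff.1 (h.isOpen.mem_nhds hz)
  have h1 := (prodSol h (ι := Unit) (ζ := fun _ => z) (ρ := fun _ => r) (fun _ => hsub) k t ()).2
  have h2 : DifferentiableOn ℂ (solSymbol m μ lam f k t) (Metric.ball z r) :=
    DifferentiableOn.congr h1 fun w hw => (discExt_prodSol h (ι := Unit) (ζ := fun _ => z)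
      (ρ := fun _ => r) (fun _ => hsub) hk ht () (Metric.ball_subset_closedBall hw)).symm
  exact h2.analyticAt (Metric.ball_mem_nhds z hr)

end Coef

section StepCoef

variable {X : Type*} [NormedAddCommGroup X] [NormedSpace ℂ X] [CompleteSpace X] {A : X →ₗ.[ℂ] X}
  {G : Set ℂ} {m : ℕ} {μ : ℝ} {lam : Measure ℝ} [IsFiniteMeasure lam] {f : ℝ → ℂ → ℂ}
  {σ : Finset (ℂ × ℝ)}

/-- The operators `f(α, A)` on `E_σ`. -/
def stepCoef (A : X →ₗ.[ℂ] X) (σ : Finset (ℂ × ℝ)) (m : ℕ) (f : ℝ → ℂ → ℂ) (α : ℝ) :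
    StepQuot A σ →L[ℂ] StepQuot A σ := stepCalc A σ (clampCoef m f α)

omit [IsFiniteMeasure lam] in
theorem continuous_stepCoef (h : IsEquation G m μ lam f) (hA : A.IsClosed)
    (hAG : NoEigenfieldOnHoles A G) (hσ : ∀ p ∈ σ, Admissible G p) :
    Continuous (stepCoef A σ m f) := by
  obtain ⟨K, hKG, hK, B, hB0, hB⟩ := exists_norm_stepCalc_le (A := A) hσ
  rw [continuous_iff_continuousAt]
  intro α₀
  refine Metric.tendsto_nhds.2 fun ε hε => ?_
  have hε' : 0 < ε / (B + 1) := by positivity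
  filter_upwards [h.eventually_dist hK hKG α₀ hε'] with α hα
  rw [dist_eq_norm, stepCoef, stepCoef, ← stepCalc_sub hA h.isOpen hAG hσ (h.differentiableOn α)
    (h.differentiableOn α₀)]
  refine (hB _ ((h.differentiableOn α).sub (h.differentiableOn α₀)) _ hε'.le hα).trans_lt ?_
  rw [mul_div_assoc', div_lt_iff₀ (by positivity)]
  nlinarith

omit [IsFiniteMeasure lam] in
theorem isDelay_stepCoef (h : IsEquation G m μ lam f) (hA : A.IsClosed)
    (hAG : NoEigenfieldOnHoles A G) (hσ : ∀ p ∈ σ, Admissible G p) : ∃ B, ∀ᶠ ω in atTop,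
      IsDelay lam μ B (μ - ((m : ℝ) - 1)) ω (stepCoef A σ m f) := by
  obtain ⟨K, hKG, hK, B, hB0, hB⟩ := exists_norm_stepCalc_le (A := A) hσ
  obtain ⟨-, -, -, C, hC0, hC⟩ := h.continuous_curry hK hKG
  exact ⟨B * C, eventually_isDelay h.delay_pos
    (continuous_stepCoef h hA hAG hσ).stronglyMeasurable
    (fun α => hB _ (h.differentiableOn α) C hC0 (hC α)) h.delay⟩

/-- Fix a vector `e`. The map `T : g ↦ g(A) e` from a product of disc algebras to `E_σ` is bounded,
sends 1 to `e`, and turns multiplication by `f(α, ·)` into `f(α, A)`. It therefore sends the symbol,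
built in the disc algebras, to the vector built from the operators. -/
theorem stepCalc_solSymbol (h : IsEquation G m μ lam f) (hA : A.IsClosed)
    (hAG : NoEigenfieldOnHoles A G) (hσ : ∀ p ∈ σ, Admissible G p) [CompleteSpace (StepQuot A σ)]
    {k : ℕ} (hk : k < m) {t : ℝ} (ht : 0 ≤ t) (e : StepQuot A σ) :
    stepCalc A σ (solSymbol m μ lam f k t) e = solVec lam μ (stepCoef A σ m f) e k t := by
  obtain ⟨y, rfl⟩ := stepMk_surjective A σ e
  have hc : ∀ p : σ, CompleteSpace (expSeq A p.1) := fun p => completeSpace_expSeq hA p.1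
  choose ρ h1 h2 using fun p : σ => (hσ p.1 p.2).exists_closedBall
  have hN : ∀ p : σ, ‖expShift A p.1‖ ≤ p.1.2 := fun p => norm_expShift_le A (hσ p.1 p.2).2.1
  set T : (∀ p : σ, discAlg p.1.1 (ρ p)) →L[ℂ] StepQuot A σ :=
    (stepMk A σ).comp (ContinuousLinearMap.pi fun p : σ =>
      ((ContinuousLinearMap.apply ℂ (expSeq A p.1) (y p)).comp (discCalc (hN p) (h1 p))).comp
        (ContinuousLinearMap.proj p)) with hT
  have hTa : ∀ g, T g = stepMk A σ fun p => powerCalc (expShift A p.1) p.1.1 (discExt (g p).1) (y p) :=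
    fun g => rfl
  have hnear : ∀ p : σ, Metric.closedBall p.1.1 (ρ p) ∈ 𝓝 p.1.1 := fun p =>
    Metric.closedBall_mem_nhds _ ((hσ p.1 p.2).2.1.trans (h1 p))
  have hT1 : T 1 = stepMk A σ y := by
    rw [hTa]
    congr 1
    funext p
    have : powerCalc (expShift A p.1) p.1.1 (discExt ((1 : ∀ p : σ, discAlg p.1.1 (ρ p)) p).1) =
        powerCalc (expShift A p.1) p.1.1 fun _ => 1 := by
      refine powerCalc_congr ?_
      filter_upwards [hnear p] with z hz
      rw [discExt_of_mem _ hz]; rfl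
    rw [this, powerCalc_one]; rfl
  have hTm : ∀ α g, T (mulCoef (prodCoef h h2) α g) = stepCoef A σ m f α (T g) := fun α g => by
    rw [hTa g, stepCoef, stepCalc_stepMk hA h.isOpen hAG hσ (h.differentiableOn α), hTa]
    congr 1
    funext p
    rw [prodCalc_apply]
    have e1 : powerCalc (expShift A p.1) p.1.1
        (discExt (mulCoef (prodCoef h h2) α g p).1) =
        powerCalc (expShift A p.1) p.1.1 (clampCoef m f α) *
          powerCalc (expShift A p.1) p.1.1 (discExt (g p).1) := by
      rw [← powerCalc_mul (hN p) (h1 p)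
        (diffContOnCl_of_closedBall_subset (h2 p) (h.differentiableOn α))
        (diffContOnCl_discExt (g p))]
      refine powerCalc_congr ?_
      filter_upwards [hnear p] with z hz
      rw [discExt_of_mem _ hz, discExt_of_mem _ hz]; rfl
    rw [e1]; rfl
  obtain ⟨B, hev⟩ := isDelay_prodCoef h h2
  obtain ⟨B', hev'⟩ := isDelay_stepCoef h hA hAG hσ
  obtain ⟨ω, hω, hω'⟩ := (hev.and hev').exists
  rw [← hT1, ← hω.map_solVec hω' h.delay_pos.le T hTm 1 k ht, hT1,
    stepCalc_stepMk hA h.isOpen hAG hσ (h.analyticOnNhd_solSymbol hk ht).differentiableOn, hTa]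
  congr 1
  funext p
  rw [prodCalc_apply]
  congr 1
  refine powerCalc_congr ?_
  filter_upwards [hnear p] with z hz
  exact (discExt_prodSol h h2 hk ht p hz).symm

theorem solOp_stepEmb (h : IsEquation G m μ lam f) (hA : A.IsClosed)
    (hAG : NoEigenfieldOnHoles A G) (hσ : ∀ p ∈ σ, Admissible G p) [CompleteSpace (StepQuot A σ)]
    {k : ℕ} (hk : k < m) {t : ℝ} (ht : 0 ≤ t) (e : StepQuot A σ) :
    solOp A G m μ lam f k t (stepEmb A σ e) =
      stepEmb A σ (solVec lam μ (stepCoef A σ m f) e k t) := by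
  rw [solOp, funCalc_stepEmb hA h.isOpen hAG hσ (h.analyticOnNhd_solSymbol hk ht).differentiableOn,
    stepCalc_solSymbol h hA hAG hσ hk ht]

omit [IsFiniteMeasure lam] in
theorem funCalc_clampCoef (h : IsEquation G m μ lam f) (hA : A.IsClosed)
    (hAG : NoEigenfieldOnHoles A G) (hσ : ∀ p ∈ σ, Admissible G p) {α : ℝ}
    (hα : α ∈ Icc (0 : ℝ) ((m : ℝ) - 1)) (e : StepQuot A σ) :
    funCalc A G (f α) (stepEmb A σ e) = stepEmb A σ (stepCoef A σ m f α e) := by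
  rw [stepCoef, ← funCalc_stepEmb hA h.isOpen hAG hσ (h.differentiableOn α), clampCoef_of_mem hα]

omit [IsFiniteMeasure lam] in
theorem stepCoef_commute (h : IsEquation G m μ lam f) (hA : A.IsClosed)
    (hAG : NoEigenfieldOnHoles A G) (hσ : ∀ p ∈ σ, Admissible G p) (α β : ℝ) (e : StepQuot A σ) :
    stepCoef A σ m f α (stepCoef A σ m f β e) = stepCoef A σ m f β (stepCoef A σ m f α e) :=
  stepCalc_commute hA h.isOpen hAG hσ (h.differentiableOn α) (h.differentiableOn β) e

end StepCoef

/-! ### Sources with memory of the initial data -/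

section MemSrc

variable {M : Type*} [NormedAddCommGroup M] [NormedSpace ℂ M]

/-- The source produced by the initial value `e` of the derivative of order `k`. -/
def memSrc (lam : Measure ℝ) (δ : ℝ) (a : ℝ → M →L[ℂ] M) (k : ℕ) (e : M) (s : ℝ) : M :=
  ∫ α in Icc (0 : ℝ) k, rlKer (δ + (k - α)) s • a α e ∂lam

variable {lam : Measure ℝ} [IsFiniteMeasure lam] {μ B δ ω : ℝ} {a : ℝ → M →L[ℂ] M}

omit [IsFiniteMeasure lam] in
theorem IsDelay.stronglyMeasurable_memSrc_integrand (h : IsDelay lam μ B δ ω a) (k : ℕ) (e : M) :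
    StronglyMeasurable fun p : ℝ × ℝ => rlKer (δ + (k - p.2)) p.1 • a p.2 e :=
  (measurable_rlKer_comp (measurable_const.add (measurable_const.sub measurable_snd))
    measurable_fst).stronglyMeasurable.smul
    (stronglyMeasurable_clm_apply (h.meas.comp_measurable measurable_snd) stronglyMeasurable_const)

omit [IsFiniteMeasure lam] in
theorem IsDelay.norm_memSrc_integrand_le (h : IsDelay lam μ B δ ω a) (hδ : 0 < δ) (hδ1 : δ ≤ 1)
    {k : ℕ} (e : M) {α s : ℝ} (hα : α ∈ Icc (0 : ℝ) k) (hs : 0 < s) :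
    ‖rlKer (δ + (k - α)) s • a α e‖ ≤
      Real.exp 1 * s ^ (δ - 1) * Real.exp (2 * s) * (B * ‖e‖) := by
  have h1 := rlKer_le hδ hδ1 (show δ ≤ δ + (k - α) by linarith [hα.2]) one_pos hs
  rw [Real.one_rpow, mul_one, mul_one] at h1
  have h2 := rlKer_nonneg (show 0 < δ + (k - α) by linarith [hα.2]) s
  rw [norm_smul, Real.norm_of_nonneg h2]
  gcongr
  exact (a α).le_of_opNorm_le (h.bound α) e

theorem IsDelay.hasGrowth_memSrc (h : IsDelay lam μ B δ ω a) (hδ : 0 < δ) (hδ1 : δ ≤ 1) (k : ℕ)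
    (e : M) : HasGrowth δ 2 (Real.exp 1 * (B * ‖e‖) * lam.real univ) (memSrc lam δ a k e) where
  meas := (h.stronglyMeasurable_memSrc_integrand k e).integral_prod_right
  c_pos := hδ
  c_le := hδ1
  η_nonneg := zero_le_two
  C_nonneg := by
    have : 0 ≤ B := (norm_nonneg _).trans (h.bound 0)
    positivity
  bound s hs := by
    have hB : 0 ≤ B := (norm_nonneg _).trans (h.bound 0)
    rcases hs.eq_or_lt with rfl | hs
    · rw [memSrc]
      simp only [rlKer_of_nonpos le_rfl, zero_smul, integral_zero, norm_zero]
      positivity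
    · refine (norm_integral_le_of_norm_le_const (C := Real.exp 1 * s ^ (δ - 1) * Real.exp (2 * s) *
        (B * ‖e‖)) ?_).trans ?_
      · filter_upwards [ae_restrict_mem measurableSet_Icc] with α hα
        exact h.norm_memSrc_integrand_le hδ hδ1 e hα hs
      · have : (lam.restrict (Icc (0 : ℝ) k)).real univ ≤ lam.real univ := by
          rw [measureReal_restrict_apply_univ]
          exact measureReal_mono (subset_univ _)
        calc _ ≤ Real.exp 1 * s ^ (δ - 1) * Real.exp (2 * s) * (B * ‖e‖) * lam.real univ := by gcongr
          _ = _ := by ring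

theorem continuousAt_rlKer {b s : ℝ} (hs : 0 < s) : ContinuousAt (rlKer b) s := by
  have h1 : ContinuousAt (fun s => s ^ (b - 1) * (Real.Gamma b)⁻¹) s :=
    (Real.continuousAt_rpow_const s _ (Or.inl hs.ne')).mul_const _
  refine h1.congr ?_
  filter_upwards [lt_mem_nhds hs] with r hr
  exact (rlKer_of_pos hr).symm

theorem IsDelay.continuousOn_memSrc (h : IsDelay lam μ B δ ω a) (hδ : 0 < δ) (hδ1 : δ ≤ 1) (k : ℕ)
    (e : M) : ContinuousOn (memSrc lam δ a k e) (Ioi 0) := by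
  intro t ht
  have ht : 0 < t := ht
  have hc : ContinuousAt (fun s : ℝ => Real.exp 1 * s ^ (δ - 1) * Real.exp (2 * s) * (B * ‖e‖)) t := by
    have := Real.continuousAt_rpow_const t (δ - 1) (Or.inl ht.ne')
    fun_prop
  refine ContinuousAt.continuousWithinAt ?_
  refine continuousAt_of_dominated (bound := fun _ => Real.exp 1 * t ^ (δ - 1) * Real.exp (2 * t) *
    (B * ‖e‖) + 1) (Eventually.of_forall fun s => ?_) ?_ (integrable_const _)
    (Eventually.of_forall fun α => (continuousAt_rlKer ht).smul continuousAt_const)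
  · exact ((h.stronglyMeasurable_memSrc_integrand k e).comp_measurable
      (measurable_const.prodMk measurable_id : Measurable fun α : ℝ => (s, α))).aestronglyMeasurable
  · filter_upwards [lt_mem_nhds ht, hc.eventually (gt_mem_nhds (lt_add_one _))] with s hs hs'
    filter_upwards [ae_restrict_mem measurableSet_Icc] with α hα
    exact (h.norm_memSrc_integrand_le hδ hδ1 e hα hs).trans hs'.le

/-- By Fubini the kernel orders add. With `δ = μ - (m - 1)`, taking `b = m - μ` gives order `k - α +
1`, that is `J^(k-α) e`: the source is designed so that `J^(m-μ)` returns the lower order terms of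
`t^k/k! · e`. -/
theorem IsDelay.fracInt_memSrc [CompleteSpace M] (h : IsDelay lam μ B δ ω a) (hδ : 0 < δ) (hδ1 : δ ≤ 1) (k : ℕ)
    (e : M) {b t : ℝ} (hb : 0 ≤ b) (ht : 0 < t) : fracInt b (memSrc lam δ a k e) t =
      ∫ α in Icc (0 : ℝ) k, rlKer (b + (δ + (k - α))) t • a α e ∂lam := by
  rcases hb.eq_or_lt with rfl | hb
  · simp only [fracInt_zero, zero_add, memSrc]
  have hp : Integrable (Function.uncurry fun s α => rlKer b (t - s) • rlKer (δ + (k - α)) s • a α e)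
      ((volume.restrict (Ioi 0)).prod (lam.restrict (Icc (0 : ℝ) k))) := by
    refine Integrable.mono' ((((integral_rlKer_mul_rlKer hb hδ t).1.const_mul
      (Real.exp 1 * Real.Gamma δ * Real.exp (2 * t) * (B * ‖e‖))).restrict
        (s := Ioi 0)).comp_fst (lam.restrict (Icc (0 : ℝ) k))) ?_ ?_
    · exact ((measurable_rlKer_comp measurable_const
        (measurable_const.sub measurable_fst)).stronglyMeasurable.smul
        (h.stronglyMeasurable_memSrc_integrand k e)).aestronglyMeasurable
    · rw [Measure.prod_restrict]
      filter_upwards [ae_restrict_mem (measurableSet_Ioi.prod measurableSet_Icc)] with p hp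
      obtain ⟨hs, hα⟩ := hp
      have hs : 0 < p.1 := hs
      have h2 := rlKer_nonneg hb (t - p.1)
      have hB : 0 ≤ B := (norm_nonneg _).trans (h.bound 0)
      have h3 := rlKer_nonneg hδ p.1
      have hΓ := Real.Gamma_pos_of_pos hδ
      simp only [Function.uncurry]
      rw [norm_smul, Real.norm_of_nonneg h2]
      rcases le_or_gt t p.1 with hst | hst
      · rw [rlKer_of_nonpos (s := t - p.1) (by linarith)]; simp
      have h4 : p.1 ^ (δ - 1) = Real.Gamma δ * rlKer δ p.1 := by
        rw [rlKer_of_pos hs]; field_simp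
      calc _ ≤ rlKer b (t - p.1) *
            (Real.exp 1 * p.1 ^ (δ - 1) * Real.exp (2 * p.1) * (B * ‖e‖)) := by
            gcongr
            exact h.norm_memSrc_integrand_le hδ hδ1 e hα hs
        _ ≤ rlKer b (t - p.1) *
            (Real.exp 1 * (Real.Gamma δ * rlKer δ p.1) * Real.exp (2 * t) * (B * ‖e‖)) := by
            rw [h4]; gcongr
        _ = _ := by ring
  rw [fracInt_eq hb _ ht.le]
  calc ∫ s in Ioi 0, rlKer b (t - s) • memSrc lam δ a k e s
      = ∫ s in Ioi 0, ∫ α in Icc (0 : ℝ) k,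
          rlKer b (t - s) • rlKer (δ + (k - α)) s • a α e ∂lam := by
        simp only [memSrc, integral_smul]
    _ = ∫ α in Icc (0 : ℝ) k, (∫ s in Ioi 0,
          rlKer b (t - s) • rlKer (δ + (k - α)) s • a α e) ∂lam := integral_integral_swap hp
    _ = _ := by
        refine setIntegral_congr_fun measurableSet_Icc fun α hα => ?_
        have hβ : 0 < δ + (k - α) := by linarith [hα.2]
        simp only [smul_smul]
        rw [integral_smul_const, ← (integral_rlKer_mul_rlKer hb hβ t).2,
          setIntegral_eq_integral_of_forall_compl_eq_zero fun s hs => ?_]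
        rw [rlKer_of_nonpos (b := δ + (k - α)) (not_lt.1 hs), mul_zero]

end MemSrc

/-! ### Time derivatives of solutions of the delay equation -/

section DelayDeriv

variable {M : Type*} [NormedAddCommGroup M] [NormedSpace ℂ M] [CompleteSpace M]
  {lam : Measure ℝ} [IsFiniteMeasure lam] {μ B δ ω c η C : ℝ} {a : ℝ → M →L[ℂ] M} {v : ℝ → M}

-- At time 0 the source vanishes for all orders from `b > 0` on, so the weighted bound holds with
-- constant 0.
omit [CompleteSpace M] in
theorem IsDelay.delayFrac_apply_zero (h : IsDelay lam μ B δ ω a) (hδ : 0 ≤ δ) {b : ℝ}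
    (hb : 0 < b) : delayFrac lam μ a v b 0 = 0 := by
  have := h.norm_delaySol_le (G := fracCut v 0) (C := 0) (b₁ := b) le_rfl (fun b' hb' => by
    rw [fracCut_of_nonneg v le_rfl (hb.le.trans hb'), fracInt_apply_zero (hb.trans_le hb')]
    simp) hδ le_rfl
  simpa [delayFrac] using this

theorem IsDelay.eqOn_fracInt_one (h : IsDelay lam μ B δ ω a) (hδ : 0 ≤ δ)
    (hv : HasGrowth c η C v) {b : ℝ} (hb : 0 ≤ b) :
    EqOn (delayFrac lam μ a v (b + 1)) (fracInt 1 (delayFrac lam μ a v b)) (Ici 0) := fun t ht => by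
  rw [h.fracInt_delayFrac hδ hv zero_le_one hb ht, add_comm]

/-- One order of integration turns the possible singularity `t ^ (c - 1)` at 0 into `t ^ c`; this is
why `b ≥ 1` is required. -/
theorem IsDelay.continuousOn_delayFrac (h : IsDelay lam μ B δ ω a) (hδ : 0 ≤ δ)
    (hv : HasGrowth c η C v) (hc : ContinuousOn v (Ioi 0)) {b : ℝ} (hb : 1 ≤ b) :
    ContinuousOn (delayFrac lam μ a v b) (Ici 0) := by
  intro t ht
  rcases (show (0 : ℝ) ≤ t from ht).eq_or_lt with rfl | ht
  · have hb' : b = (b - 1) + 1 := by ring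
    have hg := h.hasGrowth_delayFrac hδ hv (b := b - 1) (by linarith)
    have heq := h.eqOn_fracInt_one hδ hv (b := b - 1) (by linarith)
    rw [← hb'] at heq
    set C' := 2 * (C * Real.Gamma c * Real.exp 1)
    have h1 : ContinuousAt (fun s : ℝ => C' * Real.Gamma c * Real.exp ((η + 2 * ω) * s) *
        (s ^ (1 + c - 1) * (Real.Gamma (1 + c))⁻¹)) 0 := by
      have := Real.continuousAt_rpow_const 0 (1 + c - 1) (Or.inr (by linarith [hv.c_pos]))
      fun_prop
    have h2 := h1.tendsto
    rw [Real.zero_rpow (by linarith [hv.c_pos]), zero_mul, mul_zero] at h2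
    rw [ContinuousWithinAt, h.delayFrac_apply_zero hδ (by linarith)]
    refine squeeze_zero_norm' ?_ (h2.mono_left nhdsWithin_le_nhds)
    filter_upwards [self_mem_nhdsWithin] with s hs
    rcases (show (0 : ℝ) ≤ s from hs).eq_or_lt with rfl | hs
    · rw [h.delayFrac_apply_zero hδ (by linarith), Real.zero_rpow (by linarith [hv.c_pos])]; simp
    · have := hg.norm_fracInt_le_rlKer zero_le_one hs
      rwa [rlKer_of_pos hs, ← heq hs.le] at this
  · exact (h.tendsto_delayFrac hδ hv hc ht).continuousWithinAt

/-- Raising the order by 1 is ordinary integration in time. At `t = 0` the integrand is known to be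
continuous only for `b ≥ 1`. -/
theorem IsDelay.hasDerivWithinAt_delayFrac (h : IsDelay lam μ B δ ω a) (hδ : 0 ≤ δ)
    (hv : HasGrowth c η C v) (hc : ContinuousOn v (Ioi 0)) {b t : ℝ} (hb : 0 ≤ b) (ht : 0 ≤ t)
    (hbt : 0 < t ∨ 1 ≤ b) :
    HasDerivWithinAt (delayFrac lam μ a v (b + 1)) (delayFrac lam μ a v b t) (Ici 0) t := by
  have hg := h.hasGrowth_delayFrac hδ hv hb
  have heq := h.eqOn_fracInt_one hδ hv hb
  refine HasDerivWithinAt.congr ?_ heq (heq ht)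
  rcases ht.eq_or_lt with rfl | ht
  · exact hg.hasDerivWithinAt_fracInt_one (h.continuousOn_delayFrac hδ hv hc
      (hbt.resolve_left (lt_irrefl _)))
  · exact (hg.hasDerivAt_fracInt_one ht (h.tendsto_delayFrac hδ hv hc ht)).hasDerivWithinAt

theorem fracInt_const_nat (n : ℕ) {t : ℝ} (ht : 0 ≤ t) (x : M) :
    fracInt n (fun _ => x) t = (t ^ n / n.factorial : ℝ) • x := by
  rcases n.eq_zero_or_pos with rfl | hn
  · simp [fracInt_zero]
  have hn' : (0 : ℝ) < n := by exact_mod_cast hn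
  rcases ht.eq_or_lt with rfl | ht
  · rw [fracInt_apply_zero hn', zero_pow hn.ne', zero_div, zero_smul]
  · rw [fracInt_const hn'.le ht, rlKer_of_pos ht, add_sub_cancel_right, Real.rpow_natCast,
      Real.Gamma_nat_eq_factorial, div_eq_mul_inv]

theorem hasDerivWithinAt_fracInt_const (n : ℕ) {t : ℝ} (ht : 0 ≤ t) (x : M) :
    HasDerivWithinAt (fracInt (n + 1 : ℕ) fun _ => x) (fracInt n (fun _ => x) t) (Ici 0) t := by
  refine HasDerivWithinAt.congr (f := fun t : ℝ => (t ^ (n + 1) / (n + 1).factorial : ℝ) • x) ?_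
    (fun s hs => fracInt_const_nat (n + 1) hs x) (fracInt_const_nat (n + 1) ht x)
  rw [fracInt_const_nat n ht]
  refine HasDerivWithinAt.smul_const ?_ x
  have h1 := ((hasDerivAt_pow (n + 1) t).div_const ((n + 1).factorial : ℝ)).hasDerivWithinAt
    (s := Ici 0)
  refine h1.congr_deriv ?_
  rw [Nat.factorial_succ]
  have : (n.factorial : ℝ) ≠ 0 := by exact_mod_cast n.factorial_ne_zero
  push_cast
  field_simp

end DelayDeriv

/-! ### Additivity of the fractional integral -/

section FracIntegrable

variable {M : Type*} [NormedAddCommGroup M] [NormedSpace ℂ M]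

/-- All fractional integrals of `v` converge absolutely. -/
def FracIntegrable (v : ℝ → M) : Prop :=
  ∀ b t : ℝ, 0 < b → IntegrableOn (fun s => rlKer b (t - s) • v s) (Ioi 0)

variable {v w : ℝ → M}

theorem HasGrowth.fracIntegrable {c η C : ℝ} (hv : HasGrowth c η C v) : FracIntegrable v :=
  fun _ t hb => hv.integrableOn hb t

theorem fracIntegrable_zero : FracIntegrable fun _ => (0 : M) := fun b t _ => by
  simp only [smul_zero]
  exact integrableOn_zero

theorem FracIntegrable.add (hv : FracIntegrable v) (hw : FracIntegrable w) :
    FracIntegrable fun s => v s + w s := fun b t hb => by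
  simp only [smul_add]
  exact (hv b t hb).add (hw b t hb)

theorem FracIntegrable.sub (hv : FracIntegrable v) (hw : FracIntegrable w) :
    FracIntegrable fun s => v s - w s := fun b t hb => by
  simp only [smul_sub]
  exact (hv b t hb).sub (hw b t hb)

theorem FracIntegrable.sum {ι : Type*} {s : Finset ι} {v : ι → ℝ → M}
    (hv : ∀ i ∈ s, FracIntegrable (v i)) : FracIntegrable fun t => ∑ i ∈ s, v i t := fun b t hb => by
  simp only [Finset.smul_sum]
  exact integrable_finsetSum _ fun i hi => hv i hi b t hb

theorem FracIntegrable.fracInt_add (hv : FracIntegrable v) (hw : FracIntegrable w) {b t : ℝ}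
    (hb : 0 ≤ b) (ht : 0 ≤ t) :
    fracInt b (fun s => v s + w s) t = fracInt b v t + fracInt b w t := by
  rcases hb.eq_or_lt with rfl | hb
  · simp only [fracInt_zero]
  · simp only [fracInt_eq hb _ ht, smul_add]
    exact integral_add (hv b t hb) (hw b t hb)

theorem FracIntegrable.fracInt_sub (hv : FracIntegrable v) (hw : FracIntegrable w) {b t : ℝ}
    (hb : 0 ≤ b) (ht : 0 ≤ t) :
    fracInt b (fun s => v s - w s) t = fracInt b v t - fracInt b w t := by
  rcases hb.eq_or_lt with rfl | hb
  · simp only [fracInt_zero]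
  · simp only [fracInt_eq hb _ ht, smul_sub]
    exact integral_sub (hv b t hb) (hw b t hb)

theorem FracIntegrable.fracInt_sum {ι : Type*} {s : Finset ι} {v : ι → ℝ → M}
    (hv : ∀ i ∈ s, FracIntegrable (v i)) {b t : ℝ} (hb : 0 ≤ b) (ht : 0 ≤ t) :
    fracInt b (fun r => ∑ i ∈ s, v i r) t = ∑ i ∈ s, fracInt b (v i) t := by
  rcases hb.eq_or_lt with rfl | hb
  · simp only [fracInt_zero]
  · simp only [fracInt_eq hb _ ht, Finset.smul_sum]
    exact integral_finsetSum _ fun i hi => hv i hi b t hb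

theorem FracIntegrable.intervalIntegrable (hv : FracIntegrable v) {b t : ℝ} (hb : 0 < b)
    (ht : 0 ≤ t) : IntervalIntegrable (fun s => (t - s) ^ (b - 1) • v s) volume 0 t := by
  rw [intervalIntegrable_iff_integrableOn_Ioc_of_le ht, integrableOn_Ioc_iff_integrableOn_Ioo]
  have h1 : IntegrableOn (fun s => Real.Gamma b • (rlKer b (t - s) • v s)) (Ioo 0 t) :=
    IntegrableOn.mono_set ((hv b t hb).smul (Real.Gamma b)) fun x hx => hx.1
  refine h1.congr_fun (fun s hs => ?_) measurableSet_Ioo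
  have := (Real.Gamma_pos_of_pos hb).ne'
  simp only
  rw [rlKer_of_pos (sub_pos.2 hs.2), smul_smul]
  congr 1
  field_simp

theorem map_fracInt {M' : Type*} [NormedAddCommGroup M'] [NormedSpace ℂ M'] [CompleteSpace M]
    [CompleteSpace M'] (j : M →L[ℂ] M') (hv : FracIntegrable v) {b t : ℝ} (hb : 0 ≤ b)
    (ht : 0 ≤ t) : j (fracInt b v t) = fracInt b (fun s => j (v s)) t := by
  rcases hb.eq_or_lt with rfl | hb
  · rw [fracInt_zero, fracInt_zero]
  · rw [fracInt_eq hb _ ht, fracInt_eq hb _ ht, ← j.integral_comp_comm (hv b t hb)]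
    refine integral_congr_ae (Eventually.of_forall fun s => ?_)
    simp only
    rw [← Complex.coe_smul, ← Complex.coe_smul, map_smul]

end FracIntegrable

/-! ### The solution in a Banach space with bounded coefficients -/

section Model

variable {M : Type*} [NormedAddCommGroup M] [NormedSpace ℂ M]

/-- The equation with commuting bounded coefficients `a`. -/
structure IsBoundedModel (m : ℕ) (μ : ℝ) (lam : Measure ℝ) (B ω : ℝ) (a : ℝ → M →L[ℂ] M) :
    Prop where
  isDelay : IsDelay lam μ B (μ - ((m : ℝ) - 1)) ω a
  one_le : 1 ≤ m
  lt : (m : ℝ) - 1 < μ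
  le : μ ≤ m
  supp : lam (Icc 0 ((m : ℝ) - 1))ᶜ = 0
  comm : ∀ α β e, a α (a β e) = a β (a α e)

/-- The part of the derivative of order `β` that comes from the initial value `e` of the
derivative of order `k`. -/
def homTerm (m : ℕ) (μ : ℝ) (lam : Measure ℝ) (a : ℝ → M →L[ℂ] M) (k : ℕ) (e : M) (β t : ℝ) : M :=
  (if β ≤ k then fracInt (k - β) (fun _ => e) t else 0) -
    delayFrac lam μ a (memSrc lam (μ - ((m : ℝ) - 1)) a k e) (m - β) t

variable {m : ℕ} {μ B ω : ℝ} {lam : Measure ℝ} [IsFiniteMeasure lam] {a : ℝ → M →L[ℂ] M} {k : ℕ}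

omit [IsFiniteMeasure lam] in
theorem IsBoundedModel.delay_pos (h : IsBoundedModel m μ lam B ω a) : 0 < μ - ((m : ℝ) - 1) := by
  linarith [h.lt]

omit [IsFiniteMeasure lam] in
theorem IsBoundedModel.nonneg (h : IsBoundedModel m μ lam B ω a) : (0 : ℝ) ≤ (m : ℝ) - 1 := by
  have : (1 : ℝ) ≤ m := by exact_mod_cast h.one_le
  linarith

omit [IsFiniteMeasure lam] in
theorem IsBoundedModel.ae_mem (h : IsBoundedModel m μ lam B ω a) :
    ∀ᵐ α ∂lam, α ∈ Icc (0 : ℝ) ((m : ℝ) - 1) := h.supp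

theorem IsBoundedModel.hasGrowth_memSrc (h : IsBoundedModel m μ lam B ω a) (k : ℕ) (e : M) :
    HasGrowth (μ - ((m : ℝ) - 1)) 2 (Real.exp 1 * (B * ‖e‖) * lam.real univ)
      (memSrc lam (μ - ((m : ℝ) - 1)) a k e) :=
  h.isDelay.hasGrowth_memSrc h.delay_pos (by linarith [h.le]) k e

theorem IsBoundedModel.continuousOn_memSrc (h : IsBoundedModel m μ lam B ω a) (k : ℕ) (e : M) :
    ContinuousOn (memSrc lam (μ - ((m : ℝ) - 1)) a k e) (Ioi 0) :=
  h.isDelay.continuousOn_memSrc h.delay_pos (by linarith [h.le]) k e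

variable [CompleteSpace M]

theorem hasDerivWithinAt_ite_fracInt (j k : ℕ) (e : M) {t : ℝ} (ht : 0 ≤ t) :
    HasDerivWithinAt (fun s => if (j : ℝ) ≤ k then fracInt (k - j) (fun _ => e) s else 0)
      (if ((j + 1 : ℕ) : ℝ) ≤ k then fracInt (k - (j + 1 : ℕ)) (fun _ => e) t else 0) (Ici 0) t := by
  rcases lt_trichotomy j k with hjk | rfl | hjk
  · obtain ⟨n, rfl⟩ : ∃ n, k = j + 1 + n := Nat.exists_eq_add_of_lt hjk |>.imp fun n hn => by omega
    have h1 : (((j + 1 : ℕ) : ℝ) ≤ ((j + 1 + n : ℕ) : ℝ)) := by exact_mod_cast (by omega)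
    have h2 : ((j : ℝ) ≤ ((j + 1 + n : ℕ) : ℝ)) := by exact_mod_cast (by omega)
    have h3 : ((j + 1 + n : ℕ) : ℝ) - (j + 1 : ℕ) = n := by push_cast; ring
    have h4 : ((j + 1 + n : ℕ) : ℝ) - j = (n + 1 : ℕ) := by push_cast; ring
    simp only [if_pos h1, if_pos h2, h3, h4]
    exact hasDerivWithinAt_fracInt_const n ht e
  · have h1 : ¬ (((j + 1 : ℕ) : ℝ) ≤ j) := by push_cast; linarith
    simp only [if_neg h1, le_refl, if_true, sub_self, fracInt_zero]
    exact hasDerivWithinAt_const _ _ _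
  · have h1 : ¬ (((j + 1 : ℕ) : ℝ) ≤ k) := by
      have : (k : ℝ) < j := by exact_mod_cast hjk
      push_cast; linarith
    have h2 : ¬ ((j : ℝ) ≤ k) := by simpa using hjk
    simp only [if_neg h1, if_neg h2]
    exact hasDerivWithinAt_const _ _ _

theorem IsBoundedModel.hasDerivWithinAt_delayFrac (h : IsBoundedModel m μ lam B ω a)
    {c η C : ℝ} {v : ℝ → M} (hv : HasGrowth c η C v) (hc : ContinuousOn v (Ioi 0)) {j : ℕ}
    (hj : j + 1 ≤ m) {t : ℝ} (ht : 0 ≤ t) (hjt : 0 < t ∨ j + 1 < m) :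
    HasDerivWithinAt (delayFrac lam μ a v (m - j)) (delayFrac lam μ a v (m - (j + 1 : ℕ)) t)
      (Ici 0) t := by
  have hj' : ((j : ℝ) + 1) ≤ m := by exact_mod_cast hj
  have h1 := h.isDelay.hasDerivWithinAt_delayFrac h.delay_pos.le hv hc
    (b := m - (j + 1 : ℕ)) (t := t) (by push_cast; linarith) ht (hjt.imp_right fun hj => by
      have : ((j : ℝ) + 1 + 1) ≤ m := by exact_mod_cast hj
      push_cast; linarith)
  have h2 : (m : ℝ) - (j + 1 : ℕ) + 1 = m - j := by push_cast; ring
  rwa [h2] at h1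

theorem IsBoundedModel.hasDerivWithinAt_homTerm (h : IsBoundedModel m μ lam B ω a) (k : ℕ) (e : M)
    {j : ℕ} (hj : j + 1 ≤ m) {t : ℝ} (ht : 0 ≤ t) (hjt : 0 < t ∨ j + 1 < m) :
    HasDerivWithinAt (homTerm m μ lam a k e j) (homTerm m μ lam a k e (j + 1 : ℕ) t) (Ici 0) t :=
  (hasDerivWithinAt_ite_fracInt j k e ht).sub
    (h.hasDerivWithinAt_delayFrac (h.hasGrowth_memSrc k e) (h.continuousOn_memSrc k e) hj ht hjt)

theorem IsBoundedModel.continuousOn_homTerm (h : IsBoundedModel m μ lam B ω a) (k : ℕ) (e : M)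
    {j : ℕ} (hj : j < m) : ContinuousOn (homTerm m μ lam a k e j) (Ici 0) := by
  have h1 : ContinuousOn (fun s => if (j : ℝ) ≤ k then fracInt (k - j) (fun _ => e) s else 0)
    (Ici 0) := fun t ht => (hasDerivWithinAt_ite_fracInt j k e ht).continuousWithinAt
  have hj' : (j : ℝ) + 1 ≤ m := by exact_mod_cast hj
  exact h1.sub (h.isDelay.continuousOn_delayFrac h.delay_pos.le (h.hasGrowth_memSrc k e)
    (h.continuousOn_memSrc k e) (by linarith))

theorem IsBoundedModel.continuousOn_homTerm_top (h : IsBoundedModel m μ lam B ω a) (k : ℕ) (e : M)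
    {j : ℕ} : ContinuousOn (homTerm m μ lam a k e j) (Ioi 0) := by
  have h1 : ContinuousOn (fun s => if (j : ℝ) ≤ k then fracInt (k - j) (fun _ => e) s else 0)
    (Ici 0) := fun t ht => (hasDerivWithinAt_ite_fracInt j k e ht).continuousWithinAt
  exact (h1.mono Ioi_subset_Ici_self).sub fun t ht => (h.isDelay.tendsto_delayFrac h.delay_pos.le
    (h.hasGrowth_memSrc k e) (h.continuousOn_memSrc k e) ht).continuousWithinAt

omit [CompleteSpace M] in
theorem IsBoundedModel.homTerm_apply_zero (h : IsBoundedModel m μ lam B ω a) (k : ℕ) (e : M)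
    {j : ℕ} (hj : j < m) : homTerm m μ lam a k e j 0 = if j = k then e else 0 := by
  have hj' : (j : ℝ) + 1 ≤ m := by exact_mod_cast hj
  rw [homTerm, h.isDelay.delayFrac_apply_zero h.delay_pos.le (by linarith), sub_zero]
  rcases lt_trichotomy j k with hjk | rfl | hjk
  · have : (j : ℝ) < k := by exact_mod_cast hjk
    rw [if_pos this.le, if_neg hjk.ne, fracInt_apply_zero (by linarith)]
  · simp [fracInt_zero]
  · have : ¬ ((j : ℝ) ≤ k) := by simpa using hjk
    rw [if_neg this, if_neg hjk.ne']

theorem IsBoundedModel.fracIntegrable_delayFrac (h : IsBoundedModel m μ lam B ω a)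
    {c η C : ℝ} {v : ℝ → M} (hv : HasGrowth c η C v) {b : ℝ} (hb : 0 ≤ b) :
    FracIntegrable (delayFrac lam μ a v b) :=
  (h.isDelay.hasGrowth_delayFrac h.delay_pos.le hv hb).fracIntegrable

omit [CompleteSpace M] in
theorem fracIntegrable_ite_fracInt (β : ℝ) (k : ℕ) (e : M) :
    FracIntegrable fun s => if β ≤ k then fracInt (k - β) (fun _ => e) s else 0 := by
  by_cases hβ : β ≤ k
  · have h1 := ((hasGrowth_const e).fracInt (b := k - β) (by linarith)).fracIntegrable
    intro b t hb
    refine (h1 b t hb).congr_fun (fun s hs => ?_) measurableSet_Ioi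
    simp only [if_pos hβ]
    rw [fracCut_of_nonneg _ (le_of_lt hs) (by linarith)]
  · simp only [if_neg hβ]
    exact fracIntegrable_zero

theorem IsBoundedModel.fracIntegrable_homTerm (h : IsBoundedModel m μ lam B ω a) (k : ℕ) (e : M)
    {β : ℝ} (hβ : β ≤ m) : FracIntegrable (homTerm m μ lam a k e β) :=
  (fracIntegrable_ite_fracInt β k e).sub
    (h.fracIntegrable_delayFrac (h.hasGrowth_memSrc k e) (by linarith))

/-- For a Caputo order `β = n - x` with `n = ⌈β⌉`: the monomial of degree `k` survives `n`
derivatives exactly when `β ≤ k`. -/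
theorem natCast_le_iff_of_lt {n k : ℕ} {x : ℝ} (hx : 0 ≤ x) (hx1 : x < 1) :
    (n : ℝ) ≤ k ↔ (n : ℝ) - x ≤ k := by
  refine ⟨fun h => by linarith, fun h => ?_⟩
  have h1 : (n : ℝ) < (k + 1 : ℕ) := by push_cast; linarith
  have h2 : n < k + 1 := by exact_mod_cast h1
  exact_mod_cast Nat.lt_succ_iff.1 h2

theorem IsBoundedModel.fracInt_homTerm (h : IsBoundedModel m μ lam B ω a) (k : ℕ) (e : M)
    {n : ℕ} (hn : n ≤ m) {x t : ℝ} (hx : 0 ≤ x) (hx1 : x < 1) (ht : 0 ≤ t) :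
    fracInt x (homTerm m μ lam a k e n) t = homTerm m μ lam a k e (n - x) t := by
  have hn' : (n : ℝ) ≤ m := by exact_mod_cast hn
  have h1 : fracInt x (homTerm m μ lam a k e n) t = fracInt x
      (fun s => if (n : ℝ) ≤ k then fracInt (k - n) (fun _ => e) s else 0) t - fracInt x
      (delayFrac lam μ a (memSrc lam (μ - ((m : ℝ) - 1)) a k e) (m - n)) t :=
    (fracIntegrable_ite_fracInt n k e).fracInt_sub
      (h.fracIntegrable_delayFrac (h.hasGrowth_memSrc k e) (by linarith)) hx ht
  rw [h1, h.isDelay.fracInt_delayFrac h.delay_pos.le (h.hasGrowth_memSrc k e) hx (by linarith) ht,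
    homTerm]
  congr 1
  · by_cases hnk : (n : ℝ) ≤ k
    · simp only [if_pos hnk, if_pos ((natCast_le_iff_of_lt hx hx1).1 hnk)]
      rw [(hasGrowth_const e).fracInt_fracInt hx (by linarith) ht]
      congr 1; ring
    · have : ¬ ((n : ℝ) - x ≤ k) := fun h => hnk ((natCast_le_iff_of_lt hx hx1).2 h)
      simp only [if_neg hnk, if_neg this]
      rcases hx.eq_or_lt with rfl | hx
      · rw [fracInt_zero]
      · rw [fracInt_eq hx _ ht]; simp
  · congr 1; ring

theorem IsBoundedModel.integrable_ite (h : IsBoundedModel m μ lam B ω a) (k : ℕ) (e : M) {t : ℝ}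
    (ht : 0 < t) :
    Integrable (fun α => a α (if α ≤ k then fracInt (k - α) (fun _ => e) t else 0)) lam ∧
      ∫ α, a α (if α ≤ k then fracInt (k - α) (fun _ => e) t else 0) ∂lam =
        ∫ α in Icc (0 : ℝ) k, rlKer (k - α + 1) t • a α e ∂lam := by
  have h1 : (fun α => a α (if α ≤ k then fracInt (k - α) (fun _ => e) t else 0)) =ᵐ[lam]
      (Icc (0 : ℝ) k).indicator fun α => rlKer (k - α + 1) t • a α e := by
    filter_upwards [h.ae_mem] with α hα
    by_cases hk : α ≤ k
    · rw [if_pos hk, indicator_of_mem (show α ∈ Icc (0 : ℝ) k from ⟨hα.1, hk⟩),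
        fracInt_const (by linarith) ht, ← Complex.coe_smul, ← Complex.coe_smul, map_smul]
    · rw [if_neg hk, indicator_of_notMem (fun h => hk h.2), map_zero]
  have hb : IntegrableOn (fun α => rlKer (k - α + 1) t • a α e) (Icc (0 : ℝ) k) lam := by
    refine Integrable.of_bound (C := Real.exp 1 * t ^ ((1 : ℝ) - 1) * Real.exp (2 * t) * (B * ‖e‖)) ?_ ?_
    · exact ((measurable_rlKer_comp ((measurable_const.sub measurable_id).add_const 1)
        measurable_const).stronglyMeasurable.smul
        (stronglyMeasurable_clm_apply h.isDelay.meas stronglyMeasurable_const)).aestronglyMeasurable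
    · filter_upwards [ae_restrict_mem measurableSet_Icc] with α hα
      have h1 := rlKer_le one_pos le_rfl (show 1 ≤ k - α + 1 by linarith [hα.2]) one_pos ht
      rw [Real.one_rpow, mul_one, mul_one] at h1
      have h2 := rlKer_nonneg (show 0 < k - α + 1 by linarith [hα.2]) t
      rw [norm_smul, Real.norm_of_nonneg h2]
      gcongr
      exact (a α).le_of_opNorm_le (h.isDelay.bound α) e
  refine ⟨((integrable_indicator_iff measurableSet_Icc).2 hb).congr h1.symm, ?_⟩
  rw [integral_congr_ae h1, integral_indicator measurableSet_Icc]

theorem IsBoundedModel.integrable_delayFrac (h : IsBoundedModel m μ lam B ω a) {c η C : ℝ}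
    {v : ℝ → M} (hv : HasGrowth c η C v) (t : ℝ) :
    Integrable (fun α => a α (delayFrac lam μ a v (m - α) t)) lam := by
  have := h.isDelay.integrable_delayFrac h.delay_pos.le hv (m - μ) t
  simpa only [sub_add_cancel] using this

theorem IsBoundedModel.delayFrac_add (h : IsBoundedModel m μ lam B ω a) {c η C : ℝ}
    {v : ℝ → M} (hv : HasGrowth c η C v) {t : ℝ} (ht : 0 ≤ t) :
    delayFrac lam μ a v (m - μ) t + ∫ α, a α (delayFrac lam μ a v (m - α) t) ∂lam =
      fracInt (m - μ) v t := by
  have := h.isDelay.delayFrac_add h.delay_pos.le hv (b := m - μ) (by linarith [h.le]) ht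
  simpa only [sub_add_cancel] using this

theorem IsBoundedModel.integrable_homTerm (h : IsBoundedModel m μ lam B ω a) (k : ℕ) (e : M)
    {t : ℝ} (ht : 0 < t) : Integrable (fun α => a α (homTerm m μ lam a k e α t)) lam := by
  simp only [homTerm, map_sub]
  exact (h.integrable_ite k e ht).1.sub (h.integrable_delayFrac (h.hasGrowth_memSrc k e) t)

/-- The monomial has no term of order `μ`, since `k ≤ m - 1 < μ`. Its lower order terms, those with
`α ≤ k`, are cancelled by the solution for the memory source. -/
theorem IsBoundedModel.homTerm_add (h : IsBoundedModel m μ lam B ω a) (hk : k < m) (e : M)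
    {t : ℝ} (ht : 0 < t) :
    homTerm m μ lam a k e μ t + ∫ α, a α (homTerm m μ lam a k e α t) ∂lam = 0 := by
  have hk' : (k : ℝ) + 1 ≤ m := by exact_mod_cast hk
  have h1 := h.integrable_ite k e ht
  have h2 := h.delayFrac_add (h.hasGrowth_memSrc k e) ht.le
  rw [h.isDelay.fracInt_memSrc h.delay_pos (by linarith [h.le]) k e (by linarith [h.le]) ht] at h2
  have h3 : ∀ α : ℝ, m - μ + (μ - ((m : ℝ) - 1) + (k - α)) = k - α + 1 := fun α => by ring
  simp only [h3] at h2
  rw [← h1.2] at h2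
  simp only [homTerm, map_sub]
  rw [if_neg (by linarith [h.lt]),
    integral_sub h1.1 (h.integrable_delayFrac (h.hasGrowth_memSrc k e) t), ← h2]
  abel

/-- The source is a superposition over `α` of vectors `a α e` with kernels of shifted order. The
solution map commutes with superposition, with the operators `a α` (here `comm` enters), and with
shifts of the order. -/
theorem IsBoundedModel.delayFrac_memSrc (h : IsBoundedModel m μ lam B ω a) (k : ℕ) (e : M)
    {t : ℝ} (ht : 0 < t) : delayFrac lam μ a (memSrc lam (μ - ((m : ℝ) - 1)) a k e) m t =
      ∫ α in Icc (0 : ℝ) k, a α (delayFrac lam μ a (fun _ => e) (k + μ - α) t) ∂lam := by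
  have hD := h.isDelay
  have hδ := h.delay_pos.le
  have hω := hD.pos
  have hμ : 0 ≤ μ := by linarith [h.lt, h.nonneg]
  have hB : 0 ≤ B := (norm_nonneg _).trans (hD.bound 0)
  have he := hasGrowth_const e
  have hw := he.growthWeight_nonneg ω t
  have hem := he.stronglyMeasurable_fracCut_apply t
  have hGm : StronglyMeasurable (Function.uncurry fun α b : ℝ =>
      a α (fracCut (fun _ => e) t (b + (k + μ - α)))) :=
    stronglyMeasurable_clm_apply (hD.meas.comp_measurable measurable_fst)
      (hem.comp_measurable (measurable_snd.add (measurable_const.sub measurable_fst)))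
  set w : ℝ := B * growthWeight 1 0 ‖e‖ ω t with hwdef
  have hG : ∀ α ∈ Icc (0 : ℝ) k, ∀ b, ‖a α (fracCut (fun _ => e) t (b + (k + μ - α)))‖ ≤
      w * ω ^ (-b) := fun α hα b => by
    refine ((a α).le_of_opNorm_le_of_le (hD.bound α)
      (he.norm_fracCut_le hω t (b + (k + μ - α)))).trans ?_
    rw [hwdef, mul_assoc]
    gcongr
    · exact hD.one_le
    · linarith [hα.2]
  have h1 : ∀ α, delaySol lam μ a (fun b => a α (fracCut (fun _ => e) t (b + (k + μ - α)))) 0 =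
      a α (delayFrac lam μ a (fun _ => e) (k + μ - α) t) := fun α => by
    have hsm : StronglyMeasurable fun b => fracCut (fun _ => e) t (b + (k + μ - α)) :=
      hem.comp_measurable (measurable_id.add_const _)
    have hbd : ∀ b, ‖fracCut (fun _ => e) t (b + (k + μ - α))‖ ≤
        growthWeight 1 0 ‖e‖ ω t * ω ^ (-(k + μ - α)) * ω ^ (-b) := fun b => by
      refine (he.norm_fracCut_le hω t _).trans_eq ?_
      rw [neg_add, Real.rpow_add hω]; ring
    rw [hD.delaySol_clm (a α) (Eventually.of_forall fun β x => h.comm α β x) hsm (by positivity)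
      hbd hδ, ← hD.delaySol_shift (b₁ := 0) hem hsm hw (by positivity) (he.norm_fracCut_le hω t) hbd
      hδ (fun b _ => rfl) le_rfl, zero_add]
    rfl
  have hmS := h.hasGrowth_memSrc k e
  rw [← integral_congr_ae (Eventually.of_forall h1), hD.setIntegral_delaySol measurableSet_Icc hGm
    (w := fun _ => w) (fun _ _ => by positivity) (integrable_const w) hG hδ 0, delayFrac]
  -- Shifted by `m` in the order, the source `J^b` of `memSrc` becomes the superposition over `α` of
  -- the constants `a α e` integrated to order `b + k + μ - α`.
  have key := hD.delaySol_shift (b₁ := 0) (b := 0) (x := m)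
    (G' := fun b => ∫ α in Icc (0 : ℝ) k, a α (fracCut (fun _ => e) t (b + (k + μ - α))) ∂lam)
    (hmS.stronglyMeasurable_fracCut_apply t)
    (StronglyMeasurable.integral_prod_right' (ν := lam.restrict (Icc (0 : ℝ) k))
      (hGm.comp_measurable measurable_swap)) (hmS.growthWeight_nonneg ω t)
    (C' := w * (lam.restrict (Icc (0 : ℝ) k)).real univ) (by positivity)
    (hmS.norm_fracCut_le hω t) (fun b => ?_) hδ (fun b hb => ?_) le_rfl
  · rwa [zero_add] at key
  · refine (norm_integral_le_of_norm_le_const (C := w * ω ^ (-b)) ?_).trans_eq (by ring)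
    filter_upwards [ae_restrict_mem measurableSet_Icc] with α hα
    exact hG α hα b
  · rw [fracCut_of_nonneg _ ht.le (by linarith [h.nonneg]),
      hD.fracInt_memSrc h.delay_pos (by linarith [h.le]) k e (by linarith [h.nonneg]) ht]
    refine setIntegral_congr_fun measurableSet_Icc fun α hα => ?_
    rw [fracCut_of_nonneg _ ht.le (by linarith [hα.2]), fracInt_const (by linarith [hα.2]) ht,
      ← Complex.coe_smul, ← Complex.coe_smul, map_smul]
    congr 3
    ring

theorem IsBoundedModel.homTerm_zero (h : IsBoundedModel m μ lam B ω a) (k : ℕ) (e : M)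
    {t : ℝ} (ht : 0 ≤ t) : homTerm m μ lam a k e 0 t = solVec lam μ a e k t := by
  have hμ : 0 < μ := by linarith [h.lt, h.nonneg]
  have hm : (0 : ℝ) < m := by linarith [h.nonneg]
  rw [homTerm, if_pos k.cast_nonneg, sub_zero, sub_zero, solVec]
  congr 1
  rcases ht.eq_or_lt with rfl | ht
  · rw [h.isDelay.delayFrac_apply_zero h.delay_pos.le hm]
    symm
    refine setIntegral_eq_zero_of_forall_eq_zero fun α hα => ?_
    rw [h.isDelay.delayFrac_apply_zero h.delay_pos.le (by linarith [hα.2]), map_zero]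
  · exact h.delayFrac_memSrc k e ht

/-- Duhamel's formula in `M`. -/
theorem IsBoundedModel.delayFrac_eq_integral (h : IsBoundedModel m μ lam B ω a) {H : ℝ → M}
    {c η C : ℝ} (hc : Continuous H) (hH : HasGrowth c η C H) {t : ℝ} (ht : 0 ≤ t) :
    IntervalIntegrable (fun s => solVec lam μ a (H s) (m - 1) (t - s)) volume 0 t ∧
    delayFrac lam μ a H m t = ∫ s in (0 : ℝ)..t, solVec lam μ a (H s) (m - 1) (t - s) := by
  have hD := h.isDelay
  have hδ := h.delay_pos.le
  have hω := hD.pos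
  have hm1 : ((m - 1 : ℕ) : ℝ) = (m : ℝ) - 1 := by
    rw [Nat.cast_sub h.one_le, Nat.cast_one]
  -- For `k = m - 1` the integral in `solVec` runs over the whole support of `lam`, so the delay
  -- equation leaves a single term.
  have hsol : ∀ s ≤ t, solVec lam μ a (H s) (m - 1) (t - s) =
      delayFrac lam μ a (fun _ => H s) ((m : ℝ) - 1) (t - s) := fun s hs => by
    rw [solVec, hm1, Measure.restrict_eq_self_of_ae_mem h.ae_mem, ← hD.delayFrac_add hδ
      (hasGrowth_const (H s)) h.nonneg (sub_nonneg.2 hs), add_sub_cancel_right]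
  -- The source for the constant `H s`, written with the kernel so that joint measurability in `(s,
  -- b)` is visible. It agrees with `fracCut` only for `s < t`.
  set G : ℝ → ℝ → M := fun s b => if 0 ≤ b then rlKer (b + 1) (t - s) • H s else 0 with hGdef
  have hGcut : ∀ s < t, G s = fracCut (fun _ => H s) (t - s) := fun s hs => by
    funext b
    simp only [hGdef]
    split_ifs with hb
    · rw [fracCut_of_nonneg _ (by linarith) hb, fracInt_const hb (by linarith)]
    · rw [fracCut, if_neg fun h => hb h.2]
  have hGm : StronglyMeasurable (Function.uncurry G) :=
    StronglyMeasurable.ite (measurableSet_le measurable_const measurable_snd)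
      ((measurable_rlKer_comp (measurable_snd.add_const 1)
        (measurable_const.sub measurable_fst)).stronglyMeasurable.smul
        (hc.stronglyMeasurable.comp_measurable measurable_fst)) stronglyMeasurable_const
  set w : ℝ → ℝ := fun s => growthWeight 1 0 ‖H s‖ ω (t - s) with hwdef
  have hw0 : ∀ s, 0 ≤ w s := fun s => (hasGrowth_const (H s)).growthWeight_nonneg ω (t - s)
  have hwc : Continuous w := by
    simp only [hwdef, growthWeight, sub_self, Real.rpow_zero]
    fun_prop
  have hwi : IntegrableOn w (Ioo 0 t) := (hwc.integrableOn_Icc).mono_set Ioo_subset_Icc_self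
  have hG : ∀ s ∈ Ioo 0 t, ∀ b, ‖G s b‖ ≤ w s * ω ^ (-b) := fun s hs b => by
    rw [hGcut s hs.2]
    exact (hasGrowth_const (H s)).norm_fracCut_le hω _ b
  have hcongr : EqOn (fun s => delaySol lam μ a (G s) ((m : ℝ) - 1))
      (fun s => solVec lam μ a (H s) (m - 1) (t - s)) (Ioo 0 t) := fun s hs => by
    simp only
    rw [hsol s hs.2.le, hGcut s hs.2]
    rfl
  constructor
  · rw [intervalIntegrable_iff_integrableOn_Ioc_of_le ht, integrableOn_Ioc_iff_integrableOn_Ioo]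
    refine IntegrableOn.congr_fun ?_ hcongr measurableSet_Ioo
    have hGm' : StronglyMeasurable (Function.uncurry ((Ioo 0 t).indicator G)) := by
      have : Function.uncurry ((Ioo 0 t).indicator G) =
          (Prod.fst ⁻¹' (Ioo 0 t)).indicator (Function.uncurry G) := by
        funext ⟨s, b⟩
        by_cases hs : s ∈ Ioo 0 t
        · simp only [Function.uncurry, indicator_of_mem hs]
          rw [indicator_of_mem (show (s, b) ∈ Prod.fst ⁻¹' (Ioo 0 t) from hs)]
          rfl
        · simp only [Function.uncurry, indicator_of_notMem hs]
          rw [indicator_of_notMem (show (s, b) ∉ Prod.fst ⁻¹' (Ioo 0 t) from hs)]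
          rfl
      rw [this]
      exact hGm.indicator (measurable_fst measurableSet_Ioo)
    have hsm := (hD.stronglyMeasurable_delaySol hGm' (C := w) hw0 (fun s b => by
      by_cases hs : s ∈ Ioo 0 t
      · rw [indicator_of_mem hs]; exact hG s hs b
      · rw [indicator_of_notMem hs]
        have := hw0 s
        simp only [Pi.zero_apply, norm_zero]
        positivity) hδ).comp_measurable
        (measurable_id.prodMk measurable_const : Measurable fun s : ℝ => (s, (m : ℝ) - 1))
    have hsm' : AEStronglyMeasurable (fun s => delaySol lam μ a (G s) ((m : ℝ) - 1))
        (volume.restrict (Ioo 0 t)) := by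
      refine hsm.aestronglyMeasurable.congr ?_
      filter_upwards [ae_restrict_mem measurableSet_Ioo] with s hs
      simp only [Function.comp, Function.uncurry, id]
      rw [indicator_of_mem hs]
    refine Integrable.mono' ((hwi.const_mul 2).mul_const (ω ^ (-((m : ℝ) - 1)))) hsm' ?_
    filter_upwards [ae_restrict_mem measurableSet_Ioo] with s hs
    exact hD.norm_delaySol_le (hw0 s) (fun b _ => hG s hs b) hδ le_rfl
  · rw [intervalIntegral.integral_of_le ht, integral_Ioc_eq_integral_Ioo,
      ← setIntegral_congr_fun measurableSet_Ioo hcongr,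
      hD.setIntegral_delaySol measurableSet_Ioo hGm (fun s _ => hw0 s) hwi hG hδ, delayFrac]
    have hm : (m : ℝ) = (m : ℝ) - 1 + 1 := by ring
    rw [hm]
    have := hD.delaySol_shift (b₁ := 0) (x := 1) (G := fracCut H t) (b := (m : ℝ) - 1)
      (hH.stronglyMeasurable_fracCut_apply t)
      (hGm.comp_measurable measurable_swap).integral_prod_right' (hH.growthWeight_nonneg ω t)
      (C' := ∫ s in Ioo 0 t, w s) (integral_nonneg hw0)
      (hH.norm_fracCut_le hω t) (G' := fun b => ∫ s in Ioo 0 t, G s b)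
      (fun b => ?_) hδ (fun b hb => ?_) h.nonneg
    · rw [this, sub_add_cancel]
    · rw [← integral_mul_const]
      refine norm_integral_le_of_norm_le (hwi.mul_const _) ?_
      filter_upwards [ae_restrict_mem measurableSet_Ioo] with s hs
      exact hG s hs b
    · rw [fracCut_of_nonneg _ ht (by linarith), fracInt_eq (by linarith) _ ht]
      simp only [hGdef, if_pos hb]
      refine setIntegral_eq_of_subset_of_forall_sdiff_eq_zero measurableSet_Ioi
        (fun x (hx : x ∈ Ioo 0 t) => hx.1) fun x hx => ?_
      rw [rlKer_of_nonpos, zero_smul]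
      by_contra h
      exact hx.2 ⟨hx.1, by linarith⟩

end Model

/-! ### Extension of data from a bounded time interval -/

section Extension

variable {M : Type*} [NormedAddCommGroup M]

theorem hasGrowth_of_bounded {v : ℝ → M} (hv : StronglyMeasurable v) {C : ℝ}
    (hC : ∀ t, ‖v t‖ ≤ C) : HasGrowth 1 0 C v where
  meas := hv
  c_pos := one_pos
  c_le := le_rfl
  η_nonneg := le_rfl
  C_nonneg := (norm_nonneg _).trans (hC 0)
  bound t _ := by simpa using hC t

/-- Growth classes are global in time, whereas data lie in one `E_σ` only on bounded intervals. The
constant extension bridges this, as fractional integrals at times up to `T` only see `[0, T]`. -/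
theorem exists_continuous_extension {v : ℝ → M} {T : ℝ} (hT : 0 ≤ T)
    (hv : ContinuousOn v (Icc 0 T)) : ∃ (w : ℝ → M) (C : ℝ), Continuous w ∧
      (∀ s ∈ Icc 0 T, w s = v s) ∧ HasGrowth 1 0 C w := by
  have hc : Continuous (IccExtend hT fun x : Icc 0 T => v x) :=
    (continuousOn_iff_continuous_domRestrict.1 hv).Icc_extend'
  obtain ⟨C, hC⟩ := isCompact_Icc.exists_bound_of_continuousOn hv
  exact ⟨_, C, hc, fun s hs => IccExtend_of_mem hT _ hs,
    hasGrowth_of_bounded hc.stronglyMeasurable fun t => hC _ (projIcc 0 T hT t).2⟩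

end Extension

/-! ### The solution in one Banach space and its derivatives of all orders -/

section DerivTerm

variable {M : Type*} [NormedAddCommGroup M] [NormedSpace ℂ M]

/-- The derivative of order `β` of the solution with initial values `φ` and source `J^(m-μ) H`. -/
def derivTerm {m : ℕ} (μ : ℝ) (lam : Measure ℝ) (a : ℝ → M →L[ℂ] M) (φ : Fin m → M) (H : ℝ → M)
    (β t : ℝ) : M :=
  ∑ k : Fin m, homTerm m μ lam a k (φ k) β t + delayFrac lam μ a H (m - β) t

variable {m : ℕ} {μ B ω : ℝ} {lam : Measure ℝ} [IsFiniteMeasure lam] {a : ℝ → M →L[ℂ] M}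
  {φ : Fin m → M} {H : ℝ → M} {c η C : ℝ}

theorem IsBoundedModel.derivTerm_apply_zero (h : IsBoundedModel m μ lam B ω a) (k : Fin m) :
    derivTerm μ lam a φ H k 0 = φ k := by
  have hk : ((k : ℕ) : ℝ) + 1 ≤ m := by exact_mod_cast k.2
  rw [derivTerm, h.isDelay.delayFrac_apply_zero h.delay_pos.le (by linarith), add_zero,
    Finset.sum_eq_single k]
  · rw [h.homTerm_apply_zero _ _ k.2, if_pos rfl]
  · intro i _ hi
    rw [h.homTerm_apply_zero _ _ k.2, if_neg fun h => hi (Fin.ext h.symm)]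
  · simp

variable [CompleteSpace M]

theorem IsBoundedModel.hasDerivWithinAt_derivTerm (h : IsBoundedModel m μ lam B ω a)
    (hH : HasGrowth c η C H) (hc : ContinuousOn H (Ioi 0)) {j : ℕ} (hj : j + 1 ≤ m) {t : ℝ}
    (ht : 0 ≤ t) (hjt : 0 < t ∨ j + 1 < m) :
    HasDerivWithinAt (derivTerm μ lam a φ H j) (derivTerm μ lam a φ H (j + 1 : ℕ) t) (Ici 0) t :=
  (HasDerivWithinAt.fun_sum fun (k : Fin m) _ => h.hasDerivWithinAt_homTerm k (φ k) hj ht hjt).add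
    (h.hasDerivWithinAt_delayFrac hH hc hj ht hjt)

theorem IsBoundedModel.continuousOn_derivTerm (h : IsBoundedModel m μ lam B ω a)
    (hH : HasGrowth c η C H) (hc : ContinuousOn H (Ioi 0)) {j : ℕ} (hj : j < m) :
    ContinuousOn (derivTerm μ lam a φ H j) (Ici 0) := by
  have hj' : (j : ℝ) + 1 ≤ m := by exact_mod_cast hj
  exact (continuousOn_finsetSum _ fun (k : Fin m) _ => h.continuousOn_homTerm k (φ k) hj).add
    (h.isDelay.continuousOn_delayFrac h.delay_pos.le hH hc (by linarith))

theorem IsBoundedModel.continuousOn_derivTerm_top (h : IsBoundedModel m μ lam B ω a)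
    (hH : HasGrowth c η C H) (hc : ContinuousOn H (Ioi 0)) (j : ℕ) :
    ContinuousOn (derivTerm μ lam a φ H j) (Ioi 0) :=
  (continuousOn_finsetSum _ fun (k : Fin m) _ => h.continuousOn_homTerm_top k (φ k)).add
    fun _ ht => (h.isDelay.tendsto_delayFrac h.delay_pos.le hH hc ht).continuousWithinAt

theorem IsBoundedModel.fracIntegrable_derivTerm (h : IsBoundedModel m μ lam B ω a)
    (hH : HasGrowth c η C H) {β : ℝ} (hβ : β ≤ m) : FracIntegrable (derivTerm μ lam a φ H β) :=
  (FracIntegrable.sum fun (k : Fin m) _ => h.fracIntegrable_homTerm k (φ k) hβ).add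
    (h.fracIntegrable_delayFrac hH (by linarith))

theorem IsBoundedModel.fracInt_derivTerm (h : IsBoundedModel m μ lam B ω a)
    (hH : HasGrowth c η C H) {n : ℕ} (hn : n ≤ m) {x t : ℝ} (hx : 0 ≤ x) (hx1 : x < 1)
    (ht : 0 ≤ t) :
    fracInt x (derivTerm μ lam a φ H n) t = derivTerm μ lam a φ H (n - x) t := by
  have hn' : (n : ℝ) ≤ m := by exact_mod_cast hn
  have h0 := fun k : Fin m => h.fracIntegrable_homTerm k (φ k) hn'
  have h1 : fracInt x (derivTerm μ lam a φ H n) t =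
      fracInt x (fun s => ∑ k : Fin m, homTerm m μ lam a k (φ k) n s) t +
        fracInt x (delayFrac lam μ a H (m - n)) t :=
    (FracIntegrable.sum fun k _ => h0 k).fracInt_add
      (h.fracIntegrable_delayFrac hH (by linarith)) hx ht
  rw [h1, FracIntegrable.fracInt_sum (fun k _ => h0 k) hx ht,
    h.isDelay.fracInt_delayFrac h.delay_pos.le hH hx (by linarith) ht, derivTerm]
  congr 1
  · exact Finset.sum_congr rfl fun k _ => h.fracInt_homTerm k (φ k) hn hx hx1 ht
  · congr 1; ring

theorem IsBoundedModel.integrable_derivTerm (h : IsBoundedModel m μ lam B ω a)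
    (hH : HasGrowth c η C H) {t : ℝ} (ht : 0 < t) :
    Integrable (fun α => a α (derivTerm μ lam a φ H α t)) lam := by
  simp only [derivTerm, map_add, map_sum]
  exact (integrable_finsetSum _ fun (k : Fin m) _ => h.integrable_homTerm k (φ k) ht).add
    (h.integrable_delayFrac hH t)

/-- The homogeneous parts contribute zero, and the source part is the delay equation at order `m -
μ`. -/
theorem IsBoundedModel.derivTerm_add (h : IsBoundedModel m μ lam B ω a) (hH : HasGrowth c η C H)
    {t : ℝ} (ht : 0 < t) : derivTerm μ lam a φ H μ t +
      ∫ α, a α (derivTerm μ lam a φ H α t) ∂lam = fracInt (m - μ) H t := by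
  have h1 : ∀ k : Fin m, _ := fun k => h.integrable_homTerm k (φ k) ht
  have h2 : ∑ k : Fin m, (homTerm m μ lam a k (φ k) μ t +
      ∫ α, a α (homTerm m μ lam a k (φ k) α t) ∂lam) = 0 :=
    Finset.sum_eq_zero fun k _ => h.homTerm_add k.2 (φ k) ht
  simp only [derivTerm, map_add, map_sum]
  rw [integral_add (integrable_finsetSum _ fun k _ => h1 k) (h.integrable_delayFrac hH t),
    integral_finsetSum _ fun k _ => h1 k, ← h.delayFrac_add hH ht.le, ← zero_add (delayFrac lam μ a H (m - μ) t + _),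
    ← h2, Finset.sum_add_distrib]
  abel

theorem IsBoundedModel.derivTerm_zero (h : IsBoundedModel m μ lam B ω a)
    (hH : HasGrowth c η C H) (hc : Continuous H) {t : ℝ} (ht : 0 ≤ t) :
    derivTerm μ lam a φ H 0 t = ∑ k : Fin m, solVec lam μ a (φ k) k t +
      ∫ s in (0 : ℝ)..t, solVec lam μ a (H s) (m - 1) (t - s) := by
  rw [derivTerm, sub_zero, (h.delayFrac_eq_integral hc hH ht).2]
  congr 1
  exact Finset.sum_congr rfl fun k _ => h.homTerm_zero k (φ k) ht

end DerivTerm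

/-! ### One-sided derivatives, and recovery of the source from its fractional derivative -/

section Source

variable {X : Type*} [NormedAddCommGroup X] [NormedSpace ℂ X]

theorem nthDeriv_zero (u : ℝ → X) : nthDeriv 0 u = u := iteratedDerivWithin_zero

theorem nthDeriv_succ (j : ℕ) (u : ℝ → X) (t : ℝ) :
    nthDeriv (j + 1) u t = derivWithin (nthDeriv j u) (Ici 0) t :=
  congrFun iteratedDerivWithin_succ t

theorem Ico_mem_nhdsWithin_Ici {t T : ℝ} (hT : t < T) : Ico 0 T ∈ 𝓝[Ici 0] t := by
  filter_upwards [self_mem_nhdsWithin, nhdsWithin_le_nhds (Iio_mem_nhds hT)] with s hs hs'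
  exact ⟨hs, hs'⟩

/-- The right endpoint is excluded so that `[0, T)` is a neighbourhood of `t` within the half-line.
At `t = 0` only orders below `m` are claimed. -/
theorem nthDeriv_eq_of_hasDerivWithinAt {m : ℕ} {T : ℝ} {u : ℝ → X} {w : ℕ → ℝ → X}
    (hu : ∀ t ∈ Ico 0 T, u t = w 0 t)
    (hw : ∀ j t, j + 1 ≤ m → 0 ≤ t → (0 < t ∨ j + 1 < m) →
      HasDerivWithinAt (w j) (w (j + 1) t) (Ici 0) t) :
    ∀ j ≤ m, ∀ t ∈ Ico 0 T, (0 < t ∨ j < m) → nthDeriv j u t = w j t := by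
  intro j
  induction j with
  | zero => intro _ t ht _; rw [nthDeriv_zero, hu t ht]
  | succ j ih =>
    intro hj t ht hjt
    have hev : nthDeriv j u =ᶠ[𝓝[Ici 0] t] w j := by
      filter_upwards [Ico_mem_nhdsWithin_Ici ht.2] with s hs
      exact ih (by omega) s hs (Or.inr hj)
    rw [nthDeriv_succ]
    exact ((hw j t hj ht.1 hjt).congr_of_eventuallyEq hev
      (ih (by omega) t ht (Or.inr hj))).derivWithin (uniqueDiffOn_Ici 0 t ht.1)

variable [CompleteSpace X]

theorem eq_of_fracInt_one_eq {T c c' η η' C C' : ℝ} {v w : ℝ → X}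
    (hv : HasGrowth c η C v) (hw : HasGrowth c' η' C' w) (hvc : ContinuousOn v (Ioi 0))
    (hwc : ContinuousOn w (Ioi 0))
    (heq : ∀ t ∈ Ioo 0 T, fracInt 1 v t = fracInt 1 w t) {t : ℝ} (ht : t ∈ Ioo 0 T) :
    v t = w t := by
  have h1 := hv.hasDerivAt_fracInt_one ht.1 (hvc.continuousAt (Ioi_mem_nhds ht.1))
  have h2 := hw.hasDerivAt_fracInt_one ht.1 (hwc.continuousAt (Ioi_mem_nhds ht.1))
  refine h1.unique (h2.congr_of_eventuallyEq ?_)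
  filter_upwards [Ioo_mem_nhds ht.1 ht.2] with s hs
  exact heq s hs

/-- `v = J^γ w` if `w` is the derivative of `J^(1-γ) v`. -/
theorem eq_fracInt_of_hasDerivAt {T γ C C' : ℝ} {v w : ℝ → X} (hv : HasGrowth 1 0 C v)
    (hw : HasGrowth 1 0 C' w) (hvc : Continuous v) (hwc : Continuous w) (hγ : 0 < γ) (hγ1 : γ < 1)
    (hd : ∀ t ∈ Ioo 0 T, HasDerivAt (fracInt (1 - γ) v) (w t) t) {t : ℝ} (ht : t ∈ Ioo 0 T) :
    v t = fracInt γ w t := by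
  have hγ' : 0 ≤ 1 - γ := by linarith
  have hpc : ContinuousOn (fracInt (1 - γ) v) (Ici 0) := fun s hs => by
    rcases (show (0 : ℝ) ≤ s from hs).eq_or_lt with rfl | hs
    · exact hv.tendsto_fracInt_zero hvc.continuousOn hγ'
    · exact ContinuousAt.continuousWithinAt (hv.tendsto_fracInt hvc.continuousOn hγ' hs)
  -- The integral `J^(1-γ) v` vanishes at 0 and has derivative `w`, so it is the ordinary primitive
  -- of `w`.
  have hp : ∀ s ∈ Ico 0 T, fracInt (1 - γ) v s = fracInt 1 w s := fun s hs => by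
    have h1 := intervalIntegral.integral_eq_sub_of_hasDerivAt_of_le hs.1
      (hpc.mono fun x hx => hx.1) (fun x hx => hd x ⟨hx.1, hx.2.trans hs.2⟩)
      (hwc.intervalIntegrable 0 s)
    rw [fracInt_apply_zero (by linarith), sub_zero] at h1
    rw [← h1, fracInt, if_neg one_ne_zero]
    simp
  have hg := hw.fracInt hγ.le
  have hcut : ∀ s ∈ Ioo 0 T, fracCut w s γ = fracInt γ w s := fun s hs =>
    fracCut_of_nonneg w hs.1.le hγ.le
  rw [← hcut t ht]
  refine eq_of_fracInt_one_eq hv hg hvc.continuousOn (fun s hs => ?_) (fun s hs => ?_) ht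
  · refine ContinuousAt.continuousWithinAt ?_
    refine ContinuousAt.congr (f := fun s => fracInt γ w s)
      (hw.tendsto_fracInt hwc.continuousOn hγ.le hs) ?_
    filter_upwards [lt_mem_nhds (show (0 : ℝ) < s from hs)] with r hr
    exact (fracCut_of_nonneg w hr.le hγ.le).symm
  -- Applying `J^γ` to this identity gives `J^1 v = J^1 J^γ w`, and `J^1` is cancelled by
  -- differentiation.
  · have h1 := hv.fracInt_fracInt hγ.le hγ' hs.1.le
    have h2 : fracInt γ (fracInt (1 - γ) v) s = fracInt γ (fracInt 1 w) s :=
      fracInt_congr hs.1 fun r hr => hp r ⟨hr.1.le, hr.2.trans_lt hs.2⟩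
    have h3 : fracInt 1 (fun s => fracCut w s γ) s = fracInt 1 (fracInt γ w) s :=
      fracInt_congr hs.1 fun r hr => fracCut_of_nonneg w hr.1.le hγ.le
    rw [h3, hw.fracInt_fracInt zero_le_one hγ.le hs.1.le, add_comm 1 γ,
      ← hw.fracInt_fracInt hγ.le zero_le_one hs.1.le, ← h2, h1]
    congr 1; ring

variable {A : X →ₗ.[ℂ] X} {G : Set ℂ}

omit [CompleteSpace X] in
theorem StepContinuousOn.continuousOn {σ : Finset (ℂ × ℝ)} (hσ : ∀ p ∈ σ, 0 < p.2) {J : Set ℝ}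
    {u : ℝ → X} (hu : StepContinuousOn A σ J u) : ContinuousOn u J := by
  obtain ⟨û, hc, hû⟩ := (stepModel_stepEmb A hσ).exists_lift hu
  exact ((stepEmb A σ).continuous.comp_continuousOn hc).congr hû

-- A single interval in the definition gives uniform continuity in the norm of `E_σ`, and the
-- embedding in `X` is bounded.
omit [CompleteSpace X] in
theorem ExpAbsContOn.continuousOn {T : ℝ} {u : ℝ → X} (hu : ExpAbsContOn A G T u) :
    ContinuousOn u (Icc 0 T) := by
  obtain ⟨σ, hσ, hmem, hac⟩ := hu
  have hσ' : ∀ p ∈ σ, 0 < p.2 := fun p hp => (hσ p hp).2.1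
  have hι := stepModel_stepEmb A hσ'
  have hn : ∀ s ∈ Icc 0 T, ∀ t ∈ Icc 0 T, ‖u s - u t‖ ≤
      ‖stepEmb A σ‖ * stepNorm A σ (u s - u t) := fun s hs t ht => by
    obtain ⟨e, he⟩ := hι.exists_eq (hmem s hs)
    obtain ⟨e', he'⟩ := hι.exists_eq (hmem t ht)
    rw [← he, ← he', ← map_sub]
    exact ((stepEmb A σ).le_opNorm _).trans (by gcongr; exact hι.norm_le _)
  rw [Metric.continuousOn_iff]
  intro t ht ε hε
  obtain ⟨δ, hδ, hac⟩ := hac (ε / (‖stepEmb A σ‖ + 1)) (by positivity)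
  have key : ∀ x ∈ Icc 0 T, ∀ y ∈ Icc 0 T, x ≤ y → y - x < δ → ‖u y - u x‖ < ε := by
    intro x hx y hy hxy hd
    have h1 := hac 1 (fun _ => x) (fun _ => y) (fun _ => ⟨hx.1, hxy, hy.2⟩)
      (fun i j hij => (hij (Subsingleton.elim i j)).elim) (by simpa using hd)
    simp only [Finset.univ_unique, Finset.sum_singleton] at h1
    rw [lt_div_iff₀ (by positivity)] at h1
    have h2 := stepNorm_nonneg (A := A) hσ' (u y - u x)
    refine (hn y hy x hx).trans_lt ?_
    nlinarith
  refine ⟨δ, hδ, fun s hs hst => ?_⟩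
  rw [Real.dist_eq] at hst
  rcases le_total s t with h | h
  · rw [dist_comm, dist_eq_norm]
    exact key s hs t ht h (by rw [abs_sub_comm] at hst; exact (le_abs_self _).trans_lt hst)
  · rw [dist_eq_norm]
    exact key t ht s hs h ((le_abs_self _).trans_lt hst)

/-- The source of the equation is the fractional integral of its Riemann-Liouville derivative. -/
theorem fracInt_riemannLiouville {γ : ℝ} (hγ : 0 ≤ γ) (hγ1 : γ < 1) {h : ℝ → X}
    (hh : ∀ T : ℝ, 0 < T → ExpAbsContOn A G T h)
    (hd : 0 < γ → DifferentiableOn ℝ (fracInt (1 - γ) h) (Ioi 0))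
    (hc : ExpContDiffOn A G 0 (Ici 0) (riemannLiouville γ h)) {t : ℝ} (ht : 0 < t) :
    fracInt γ (riemannLiouville γ h) t = h t := by
  rcases hγ.eq_or_lt with rfl | hγ
  · simp [riemannLiouville, fracInt_zero, nthDeriv_zero]
  have hceil : ⌈γ⌉₊ = 1 := by
    rw [Nat.ceil_eq_iff one_ne_zero]
    simpa using ⟨hγ, hγ1.le⟩
  have hT : (0 : ℝ) ≤ t + 1 := by linarith
  obtain ⟨σ, hσ, hcσ, -⟩ := hc 0 (t + 1) hT fun x hx => hx.1
  have hcX := (hcσ 0 le_rfl).continuousOn fun p hp => (hσ p hp).2.1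
  rw [nthDeriv_zero] at hcX
  obtain ⟨w, C', hwc, hw, hwg⟩ := exists_continuous_extension hT hcX
  obtain ⟨v, C, hvc, hv, hvg⟩ := exists_continuous_extension hT (hh (t + 1) (by linarith)).continuousOn
  have ht' : t ∈ Ioo 0 (t + 1) := ⟨ht, by linarith⟩
  have hvf : ∀ s ∈ Ioo 0 (t + 1), fracInt (1 - γ) v s = fracInt (1 - γ) h s := fun s hs =>
    fracInt_congr hs.1 fun r hr => hv r ⟨hr.1.le, hr.2.trans hs.2.le⟩
  rw [fracInt_congr (w := w) ht fun s hs => (hw s ⟨hs.1.le, by linarith [hs.2]⟩).symm,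
    ← hv t ⟨ht.le, by linarith⟩]
  refine (eq_fracInt_of_hasDerivAt hvg hwg hvc hwc hγ hγ1 (fun s hs => ?_) ht').symm
  -- A derivative that does not exist has the value 0 here, so differentiability has to be supplied
  -- for the fractional derivative to be a true one.
  have h1 := ((hd hγ) s hs.1).differentiableAt (Ioi_mem_nhds hs.1)
  have h2 : w s = deriv (fracInt (1 - γ) h) s := by
    rw [hw s ⟨hs.1.le, hs.2.le⟩, riemannLiouville, hceil, nthDeriv_succ, nthDeriv_zero, Nat.cast_one]
    exact derivWithin_of_mem_nhds (Ici_mem_nhds hs.1)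
  rw [h2]
  refine h1.hasDerivAt.congr_of_eventuallyEq ?_
  filter_upwards [Ioo_mem_nhds hs.1 hs.2] with r hr
  exact hvf r hr

end Source

/-! ### Existence -/

section Existence

variable {X : Type*} [NormedAddCommGroup X] [NormedSpace ℂ X] {A : X →ₗ.[ℂ] X}
  {G : Set ℂ} {m : ℕ} {μ : ℝ} {lam : Measure ℝ} {f : ℝ → ℂ → ℂ} {σ : Finset (ℂ × ℝ)}

theorem exists_finset_forall_mem_stepSpace {ι : Type*} [Fintype ι] {φ : ι → X}
    (hφ : ∀ k, φ k ∈ ExpSpace A G) {σ₀ : Finset (ℂ × ℝ)} (hσ₀ : ∀ p ∈ σ₀, Admissible G p) :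
    ∃ σ : Finset (ℂ × ℝ), σ₀ ⊆ σ ∧ (∀ p ∈ σ, Admissible G p) ∧ ∀ k, φ k ∈ stepSpace A σ := by
  classical
  choose τ hτ hφτ using fun k => exists_stepSpace_of_mem_ExpSpace (hφ k)
  have hσ : ∀ p ∈ σ₀ ∪ Finset.univ.biUnion τ, Admissible G p := fun p hp => by
    rcases Finset.mem_union.1 hp with hp | hp
    · exact hσ₀ p hp
    · obtain ⟨k, -, hk⟩ := Finset.mem_biUnion.1 hp
      exact hτ k p hk
  exact ⟨_, Finset.subset_union_left, hσ, fun k => stepSpace_mono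
    ((Finset.subset_biUnion_of_mem τ (Finset.mem_univ k)).trans Finset.subset_union_right)
    (fun p hp => (hσ p hp).2.1) (hφτ k)⟩

variable [CompleteSpace X]

theorem IsEquation.exists_isBoundedModel (h : IsEquation G m μ lam f) (hA : A.IsClosed)
    (hAG : NoEigenfieldOnHoles A G) (hσ : ∀ p ∈ σ, Admissible G p) :
    ∃ B ω, IsBoundedModel m μ lam B ω (stepCoef A σ m f) := by
  obtain ⟨B, hB⟩ := isDelay_stepCoef h hA hAG hσ
  obtain ⟨ω, hω⟩ := hB.exists
  exact ⟨B, ω, hω, h.one_le, h.lt, h.le, h.supp, stepCoef_commute h hA hAG hσ⟩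

/-- The data of the Cauchy problem on `[0, T]`, as elements of one step `E_σ`. -/
structure IsLocalData (A : X →ₗ.[ℂ] X) (G : Set ℂ) (m : ℕ) (μ : ℝ) (lam : Measure ℝ)
    (f : ℝ → ℂ → ℂ) (φ : Fin m → X) (H : ℝ → X) (T : ℝ) (σ : Finset (ℂ × ℝ)) (B ω C : ℝ)
    (φ' : Fin m → StepQuot A σ) (H' : ℝ → StepQuot A σ) : Prop where
  isEquation : IsEquation G m μ lam f
  isClosed : A.IsClosed
  noEigenfield : NoEigenfieldOnHoles A G
  admissible : ∀ p ∈ σ, Admissible G p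
  model : IsBoundedModel m μ lam B ω (stepCoef A σ m f)
  continuous : Continuous H'
  growth : HasGrowth 1 0 C H'
  initial : ∀ k, stepEmb A σ (φ' k) = φ k
  source : ∀ s ∈ Icc 0 T, stepEmb A σ (H' s) = H s

theorem IsEquation.exists_isLocalData (h : IsEquation G m μ lam f) (hA : A.IsClosed)
    (hAG : NoEigenfieldOnHoles A G) {φ : Fin m → X} (hφ : ∀ k, φ k ∈ ExpSpace A G) {H : ℝ → X}
    (hH : ExpContDiffOn A G 0 (Ici 0) H) {T : ℝ} (hT : 0 ≤ T) :
    ∃ σ B ω C φ' H', IsLocalData A G m μ lam f φ H T σ B ω C φ' H' := by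
  obtain ⟨σ₀, hσ₀, hc, -⟩ := hH 0 T hT fun x hx => hx.1
  obtain ⟨σ, hσσ, hσ, hφσ⟩ := exists_finset_forall_mem_stepSpace hφ hσ₀
  have hσ' : ∀ p ∈ σ, 0 < p.2 := fun p hp => (hσ p hp).2.1
  have hι := stepModel_stepEmb A hσ'
  obtain ⟨v, hv, hv'⟩ := hι.exists_lift ((hc 0 le_rfl).mono hσσ hσ')
  obtain ⟨w, C, hwc, hw, hwg⟩ := exists_continuous_extension hT hv
  choose φ' hφ' using fun k => hι.exists_eq (hφσ k)
  obtain ⟨B, ω, hM⟩ := h.exists_isBoundedModel hA hAG hσ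
  refine ⟨σ, B, ω, C, φ', w, h, hA, hAG, hσ, hM, hwc, hwg, hφ', fun s hs => ?_⟩
  rw [hw s hs, ← hv' s hs, nthDeriv_zero]

variable [IsFiniteMeasure lam] {φ : Fin m → X} {s : ℝ → X} {T B ω C : ℝ}
  {φ' : Fin m → StepQuot A σ} {H' : ℝ → StepQuot A σ}

namespace IsLocalData

theorem duhamelSol_eq
    (D : IsLocalData A G m μ lam f φ (riemannLiouville ((m : ℝ) - μ) s) T σ B ω C φ' H') {t : ℝ}
    (ht : t ∈ Icc 0 T) :
    IntervalIntegrable (fun τ => solOp A G m μ lam f (m - 1) (t - τ)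
      (riemannLiouville ((m : ℝ) - μ) s τ)) volume 0 t ∧
    duhamelSol A G m μ lam f φ s t =
      stepEmb A σ (derivTerm μ lam (stepCoef A σ m f) φ' H' 0 t) := by
  have := completeSpace_stepQuot D.isClosed σ
  have h := D.isEquation
  obtain ⟨hi, -⟩ := D.model.delayFrac_eq_integral D.continuous D.growth ht.1
  have hm : m - 1 < m := by have := h.one_le; omega
  have heq : EqOn (fun τ => stepEmb A σ (solVec lam μ (stepCoef A σ m f) (H' τ) (m - 1) (t - τ)))
      (fun τ => solOp A G m μ lam f (m - 1) (t - τ) (riemannLiouville ((m : ℝ) - μ) s τ))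
      (uIcc 0 t) := fun τ hτ => by
    rw [uIcc_of_le ht.1] at hτ
    simp only
    rw [← D.source τ ⟨hτ.1, hτ.2.trans ht.2⟩, solOp_stepEmb h D.isClosed D.noEigenfield D.admissible hm
      (sub_nonneg.2 hτ.2)]
  constructor
  · have h1 : IntervalIntegrable (fun τ => stepEmb A σ
        (solVec lam μ (stepCoef A σ m f) (H' τ) (m - 1) (t - τ))) volume 0 t :=
      ⟨(stepEmb A σ).integrable_comp hi.1, (stepEmb A σ).integrable_comp hi.2⟩
    exact h1.congr (fun τ hτ => heq (uIoc_subset_uIcc hτ))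
  · rw [duhamelSol, D.model.derivTerm_zero D.growth D.continuous ht.1, map_add, map_sum,
      ← ContinuousLinearMap.intervalIntegral_comp_comm _ hi, intervalIntegral.integral_congr heq]
    congr 1
    refine Finset.sum_congr rfl fun k _ => ?_
    rw [← D.initial k, solOp_stepEmb h D.isClosed D.noEigenfield D.admissible k.2 ht.1]

theorem hasDerivWithinAt {H : ℝ → X}
    (D : IsLocalData A G m μ lam f φ H T σ B ω C φ' H') {j : ℕ} (hj : j + 1 ≤ m) {t : ℝ}
    (ht : 0 ≤ t) (hjt : 0 < t ∨ j + 1 < m) :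
    HasDerivWithinAt (derivTerm μ lam (stepCoef A σ m f) φ' H' j)
      (derivTerm μ lam (stepCoef A σ m f) φ' H' (j + 1 : ℕ) t) (Ici 0) t := by
  have := completeSpace_stepQuot D.isClosed σ
  exact D.model.hasDerivWithinAt_derivTerm D.growth D.continuous.continuousOn hj ht hjt

theorem nthDeriv_eq {H : ℝ → X} (D : IsLocalData A G m μ lam f φ H T σ B ω C φ' H') {u : ℝ → X}
    (hu : ∀ t ∈ Ico 0 T, u t = stepEmb A σ (derivTerm μ lam (stepCoef A σ m f) φ' H' 0 t)) {j : ℕ}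
    (hj : j ≤ m) {t : ℝ} (ht : t ∈ Ico 0 T) (hjt : 0 < t ∨ j < m) :
    nthDeriv j u t = stepEmb A σ (derivTerm μ lam (stepCoef A σ m f) φ' H' j t) := by
  refine nthDeriv_eq_of_hasDerivWithinAt (m := m) (T := T)
    (w := fun j t => stepEmb A σ (derivTerm μ lam (stepCoef A σ m f) φ' H' j t))
    (fun t ht => by simpa using hu t ht) (fun j t hj ht hjt => ?_) j hj t ht hjt
  have h1 := (((stepEmb A σ).restrictScalars ℝ).hasFDerivAt (x :=
    derivTerm μ lam (stepCoef A σ m f) φ' H' j t)).comp_hasDerivWithinAt t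
      (D.hasDerivWithinAt hj ht hjt)
  exact h1

/-- Fractional integration of order `⌈β⌉ - β` takes `derivTerm` of order `⌈β⌉` to order `β`; the
embedding of `E_σ` commutes with it. -/
theorem caputo_eq {H : ℝ → X} (D : IsLocalData A G m μ lam f φ H T σ B ω C φ' H') {u : ℝ → X}
    (hu : ∀ t ∈ Ico 0 T, u t = stepEmb A σ (derivTerm μ lam (stepCoef A σ m f) φ' H' 0 t)) {β : ℝ}
    (hβ : 0 ≤ β) (hβm : β ≤ m) {t : ℝ} (ht : t ∈ Ioo 0 T) :
    caputo β u t = stepEmb A σ (derivTerm μ lam (stepCoef A σ m f) φ' H' β t) := by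
  have := completeSpace_stepQuot D.isClosed σ
  have hn : ⌈β⌉₊ ≤ m := Nat.ceil_le.2 hβm
  have hx : 0 ≤ (⌈β⌉₊ : ℝ) - β := sub_nonneg.2 (Nat.le_ceil β)
  rw [caputo, fracInt_congr ht.1 (w := fun r => stepEmb A σ
      (derivTerm μ lam (stepCoef A σ m f) φ' H' ⌈β⌉₊ r)) fun r hr =>
        D.nthDeriv_eq hu hn ⟨hr.1.le, hr.2.trans_lt ht.2⟩ (Or.inl hr.1),
    ← map_fracInt _ (D.model.fracIntegrable_derivTerm D.growth (by exact_mod_cast hn)) hx ht.1.le,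
    D.model.fracInt_derivTerm D.growth hn hx (by linarith [Nat.ceil_lt_add_one hβ]) ht.1.le,
    sub_sub_cancel]

theorem stepContinuousOn {H : ℝ → X} (D : IsLocalData A G m μ lam f φ H T σ B ω C φ' H')
    {u : ℝ → X}
    (hu : ∀ t ∈ Ico 0 T, u t = stepEmb A σ (derivTerm μ lam (stepCoef A σ m f) φ' H' 0 t)) {j : ℕ}
    (hj : j ≤ m) {J : Set ℝ} (hJ : J ⊆ Ico 0 T) (hjJ : J ⊆ Ioi 0 ∨ j < m) :
    StepContinuousOn A σ J (nthDeriv j u) := by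
  have := completeSpace_stepQuot D.isClosed σ
  have hσ' : ∀ p ∈ σ, 0 < p.2 := fun p hp => (D.admissible p hp).2.1
  refine (stepModel_stepEmb A hσ').stepContinuousOn hσ'
    (û := derivTerm μ lam (stepCoef A σ m f) φ' H' j) ?_
    fun t ht => D.nthDeriv_eq hu hj (hJ ht) (hjJ.imp_left fun h => h ht)
  rcases hjJ with h | h
  · exact (D.model.continuousOn_derivTerm_top D.growth D.continuous.continuousOn j).mono h
  · exact (D.model.continuousOn_derivTerm D.growth D.continuous.continuousOn h).mono
      fun t ht => (hJ ht).1

theorem stepHasDerivOn {H : ℝ → X} (D : IsLocalData A G m μ lam f φ H T σ B ω C φ' H')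
    {u : ℝ → X}
    (hu : ∀ t ∈ Ico 0 T, u t = stepEmb A σ (derivTerm μ lam (stepCoef A σ m f) φ' H' 0 t)) {j : ℕ}
    (hj : j + 1 ≤ m) {J : Set ℝ} (hJ : J ⊆ Ico 0 T) (hjJ : J ⊆ Ioi 0 ∨ j + 1 < m) :
    StepHasDerivOn A σ J (nthDeriv j u) (nthDeriv (j + 1) u) := by
  have hσ' : ∀ p ∈ σ, 0 < p.2 := fun p hp => (D.admissible p hp).2.1
  refine (stepModel_stepEmb A hσ').stepHasDerivOn hσ'
    (û := derivTerm μ lam (stepCoef A σ m f) φ' H' j)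
    (û' := derivTerm μ lam (stepCoef A σ m f) φ' H' (j + 1 : ℕ))
    (fun t ht => D.nthDeriv_eq hu (by omega) (hJ ht) (Or.inr (by omega)))
    (fun t ht => D.nthDeriv_eq hu hj (hJ ht) (hjJ.imp_left fun h => h ht)) fun t ht => ?_
  exact (D.hasDerivWithinAt hj (hJ ht).1 (hjJ.imp_left fun h => h ht)).mono fun t ht => (hJ ht).1

end IsLocalData

theorem IsEquation.isSolution_duhamelSol (h : IsEquation G m μ lam f) (hA : A.IsClosed)
    (hAG : NoEigenfieldOnHoles A G) (hφ : ∀ k, φ k ∈ ExpSpace A G)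
    (hH : ExpContDiffOn A G 0 (Ici 0) (riemannLiouville ((m : ℝ) - μ) s))
    (hs : ∀ t, 0 < t → fracInt ((m : ℝ) - μ) (riemannLiouville ((m : ℝ) - μ) s) t = s t) :
    IsSolution A G m μ lam f φ s (duhamelSol A G m μ lam f φ s) := by
  -- The space `E_σ` depends on `T`. Each requirement concerns bounded times only and is checked
  -- with `T` beyond them, as the identification holds on the half-open `[0, T)`.
  have key : ∀ T : ℝ, 0 ≤ T → ∃ σ B ω C φ' H', ∃ _ : IsLocalData A G m μ lam f φ
      (riemannLiouville ((m : ℝ) - μ) s) T σ B ω C φ' H', ∀ t ∈ Ico 0 T,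
      duhamelSol A G m μ lam f φ s t =
        stepEmb A σ (derivTerm μ lam (stepCoef A σ m f) φ' H' 0 t) := fun T hT => by
    obtain ⟨σ, B, ω, C, φ', H', D⟩ := h.exists_isLocalData hA hAG hφ hH hT
    exact ⟨σ, B, ω, C, φ', H', D, fun t ht => (D.duhamelSol_eq ⟨ht.1, ht.2.le⟩).2⟩
  have hm : (0 : ℝ) ≤ μ := by linarith [h.nonneg, h.lt]
  refine ⟨?_, ?_, ?_, ?_, ?_, ?_, ?_⟩
  · intro a b hab hI
    have ha : 0 < a := hI ⟨le_rfl, hab⟩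
    obtain ⟨σ, B, ω, C, φ', H', D, hu⟩ := key (b + 1) (by linarith)
    have hJ : Icc a b ⊆ Ico 0 (b + 1) := fun x hx => ⟨ha.le.trans hx.1, by linarith [hx.2]⟩
    exact ⟨σ, D.admissible, fun j hj => D.stepContinuousOn hu hj hJ (Or.inl hI),
      fun j hj => D.stepHasDerivOn hu hj hJ (Or.inl hI)⟩
  · intro a b hab hI
    have ha : 0 ≤ a := hI ⟨le_rfl, hab⟩
    have h1 := h.one_le
    obtain ⟨σ, B, ω, C, φ', H', D, hu⟩ := key (b + 1) (by linarith)
    have hJ : Icc a b ⊆ Ico 0 (b + 1) := fun x hx => ⟨ha.trans hx.1, by linarith [hx.2]⟩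
    exact ⟨σ, D.admissible, fun j hj => D.stepContinuousOn hu (by omega) hJ (Or.inr (by omega)),
      fun j hj => D.stepHasDerivOn hu (by omega) hJ (Or.inr (by omega))⟩
  · intro hμm t ht
    obtain ⟨σ, B, ω, C, φ', H', D, hu⟩ := key (t + 1) (by linarith)
    have := completeSpace_stepQuot hA σ
    have h1 := (D.model.fracIntegrable_derivTerm (φ := φ') D.growth (le_refl (m : ℝ))).intervalIntegrable
      (sub_pos.2 hμm) ht.le
    have h2 : IntervalIntegrable (fun r => stepEmb A σ ((t - r) ^ ((m : ℝ) - μ - 1) •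
        derivTerm μ lam (stepCoef A σ m f) φ' H' m r)) volume 0 t :=
      ⟨(stepEmb A σ).integrable_comp h1.1, (stepEmb A σ).integrable_comp h1.2⟩
    refine h2.congr fun r hr => ?_
    rw [uIoc_of_le ht.le] at hr
    rw [D.nthDeriv_eq hu le_rfl ⟨hr.1.le, by linarith [hr.2]⟩ (Or.inl hr.1), ← Complex.coe_smul,
      ← Complex.coe_smul, map_smul]
  · intro t ht α hα
    obtain ⟨σ, B, ω, C, φ', H', D, hu⟩ := key (t + 1) (by linarith)
    rw [D.caputo_eq hu hα.1 (by linarith [hα.2]) ⟨ht, by linarith⟩]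
    exact stepSpace_subset_ExpSpace D.admissible
      ((stepModel_stepEmb A fun p hp => (D.admissible p hp).2.1).mem _)
  · intro t ht
    obtain ⟨σ, B, ω, C, φ', H', D, hu⟩ := key (t + 1) (by linarith)
    have := completeSpace_stepQuot hA σ
    refine ((stepEmb A σ).integrable_comp
      (D.model.integrable_derivTerm (φ := φ') D.growth ht)).congr ?_
    filter_upwards [h.ae_mem] with α hα
    rw [D.caputo_eq hu hα.1 (by linarith [hα.2]) ⟨ht, by linarith⟩,
      funCalc_clampCoef h hA hAG D.admissible hα]
  · intro t ht
    obtain ⟨σ, B, ω, C, φ', H', D, hu⟩ := key (t + 1) (by linarith)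
    have := completeSpace_stepQuot hA σ
    have h1 : ∫ α, funCalc A G (f α) (caputo α (duhamelSol A G m μ lam f φ s) t) ∂lam =
        stepEmb A σ (∫ α, stepCoef A σ m f α
          (derivTerm μ lam (stepCoef A σ m f) φ' H' α t) ∂lam) := by
      rw [← (stepEmb A σ).integral_comp_comm
        (D.model.integrable_derivTerm (φ := φ') D.growth ht)]
      refine integral_congr_ae ?_
      filter_upwards [h.ae_mem] with α hα
      rw [D.caputo_eq hu hα.1 (by linarith [hα.2]) ⟨ht, by linarith⟩,
        funCalc_clampCoef h hA hAG D.admissible hα]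
    rw [h1, D.caputo_eq hu hm h.le ⟨ht, by linarith⟩, ← map_add,
      D.model.derivTerm_add D.growth ht, map_fracInt _ D.growth.fracIntegrable (by linarith [h.le]) ht.le,
      ← hs t ht]
    exact fracInt_congr ht fun r hr => D.source r ⟨hr.1.le, by linarith [hr.2]⟩
  · intro k
    obtain ⟨σ, B, ω, C, φ', H', D, hu⟩ := key 1 zero_le_one
    rw [D.nthDeriv_eq hu k.2.le ⟨le_rfl, one_pos⟩ (Or.inr k.2), D.model.derivTerm_apply_zero,
      D.initial]

end Existence

/-! ### Uniqueness -/

section Volterra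

variable {M : Type*} [NormedAddCommGroup M] [NormedSpace ℂ M]

theorem integral_rlKer_mul_exp {b ω : ℝ} (hb : 0 < b) (hω : 0 < ω) :
    Integrable (fun r => rlKer b r * Real.exp (-(ω * r))) ∧
      ∫ r, rlKer b r * Real.exp (-(ω * r)) = ω ^ (-b) := by
  have hΓ := Real.Gamma_pos_of_pos hb
  have h0 : ∀ r ∉ Ioi (0 : ℝ), rlKer b r * Real.exp (-(ω * r)) = 0 := fun r hr => by
    rw [rlKer_of_nonpos (not_lt.1 hr), zero_mul]
  have h1 : ∫ r, rlKer b r * Real.exp (-(ω * r)) = ω ^ (-b) := by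
    rw [← setIntegral_eq_integral_of_forall_compl_eq_zero h0]
    have h2 := Real.integral_rpow_mul_exp_neg_mul_Ioi hb hω
    rw [one_div, Real.inv_rpow hω.le, ← Real.rpow_neg hω.le] at h2
    have h3 : ω ^ (-b) = (Real.Gamma b)⁻¹ *
        ∫ r in Ioi (0 : ℝ), r ^ (b - 1) * Real.exp (-(ω * r)) := by
      rw [h2]; field_simp
    rw [h3, ← integral_const_mul]
    refine setIntegral_congr_fun measurableSet_Ioi fun r hr => ?_
    rw [rlKer_of_pos hr]; ring
  -- Integrability is read off from the value: a divergent integral would be 0, and `ω ^ (-b)` is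
  -- not.
  refine ⟨not_imp_comm.1 integral_undef ?_, h1⟩
  rw [h1]
  positivity

/-- In the weight `e^(ωt)` an integration of order `b` gains `ω ^ (-b)`, the Laplace transform of
the kernel at `ω`. -/
theorem norm_fracInt_le_exp {v : ℝ → M} {b ω C t : ℝ} (hb : 0 ≤ b) (hω : 0 < ω) (ht : 0 < t)
    (hC : 0 ≤ C) (h : ∀ s ∈ Ioc 0 t, ‖v s‖ ≤ C * Real.exp (ω * s)) :
    ‖fracInt b v t‖ ≤ C * Real.exp (ω * t) * ω ^ (-b) := by
  rcases hb.eq_or_lt with rfl | hb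
  · rw [fracInt_zero, neg_zero, Real.rpow_zero, mul_one]
    exact h t ⟨ht, le_rfl⟩
  obtain ⟨h1, h2⟩ := integral_rlKer_mul_exp hb hω
  have h3 := (h1.comp_sub_left t).const_mul (C * Real.exp (ω * t))
  rw [fracInt_eq hb _ ht.le, ← h2,
    ← integral_sub_left_eq_self (fun r => rlKer b r * Real.exp (-(ω * r))) volume t,
    ← integral_const_mul]
  refine (norm_integral_le_of_norm_le h3.restrict ?_).trans
    (setIntegral_le_integral h3 (Eventually.of_forall fun s => ?_))
  · filter_upwards [ae_restrict_mem measurableSet_Ioi] with s hs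
    have h4 := rlKer_nonneg hb (t - s)
    rw [norm_smul, Real.norm_of_nonneg h4]
    rcases le_or_gt t s with hst | hst
    · rw [rlKer_of_nonpos (s := t - s) (by linarith)]; simp
    calc _ ≤ rlKer b (t - s) * (C * Real.exp (ω * s)) := by gcongr; exact h s ⟨hs, hst.le⟩
      _ = rlKer b (t - s) * (C * (Real.exp (ω * t) * Real.exp (-(ω * (t - s))))) := by
        rw [← Real.exp_add]; ring_nf
      _ = _ := by ring
  · have h4 := rlKer_nonneg hb (t - s)
    simp only [Pi.zero_apply]
    positivity

variable {m : ℕ} {μ B ω : ℝ} {lam : Measure ℝ} [IsFiniteMeasure lam] {a : ℝ → M →L[ℂ] M}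

/-- The lower order terms of the equation, for a function with vanishing initial values and with
derivative `v` of order `m - 1`. -/
def lowerTerm (m : ℕ) (lam : Measure ℝ) (a : ℝ → M →L[ℂ] M) (v : ℝ → M) (t : ℝ) : M :=
  ∫ α, a α (fracCut v t ((m : ℝ) - 1 - α)) ∂lam

theorem IsBoundedModel.norm_lowerTerm_le (h : IsBoundedModel m μ lam B ω a) {v : ℝ → M} {t C : ℝ}
    (hC : ∀ b, 0 ≤ b → ‖fracCut v t b‖ ≤ C) :
    ‖lowerTerm m lam a v t‖ ≤ B * C * lam.real univ := by
  refine norm_integral_le_of_norm_le_const ?_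
  filter_upwards [h.ae_mem] with α hα
  exact (a α).le_of_opNorm_le_of_le (h.isDelay.bound α) (hC _ (by linarith [hα.2]))

theorem IsBoundedModel.hasGrowth_lowerTerm (h : IsBoundedModel m μ lam B ω a) {v : ℝ → M} {C : ℝ}
    (hv : HasGrowth 1 0 C v) :
    HasGrowth 1 2 (B * (C * Real.Gamma 1 * Real.exp 1) * lam.real univ) (lowerTerm m lam a v) where
  meas := by
    refine StronglyMeasurable.integral_prod_right
      (f := fun t α => a α (fracCut v t ((m : ℝ) - 1 - α))) ?_
    exact stronglyMeasurable_clm_apply (h.isDelay.meas.comp_measurable measurable_snd)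
      (hv.stronglyMeasurable_fracCut.comp_measurable
        (measurable_fst.prodMk (measurable_const.sub measurable_snd)))
  c_pos := one_pos
  c_le := le_rfl
  η_nonneg := zero_le_two
  C_nonneg := by
    have : 0 ≤ B := (norm_nonneg _).trans (h.isDelay.bound 0)
    have := hv.C_nonneg
    have := Real.Gamma_pos_of_pos one_pos
    positivity
  bound t ht := by
    have h1 : ∀ b, 0 ≤ b → ‖fracCut v t b‖ ≤ growthWeight 1 0 C 1 t := fun b _ => by
      simpa using hv.norm_fracCut_le one_pos t b
    refine (h.norm_lowerTerm_le h1).trans_eq ?_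
    rw [growthWeight, abs_of_nonneg ht]
    ring_nf

/-- The integrations of order `m - 1 - α` cost nothing since `ω ≥ 1`, and the outer one gains `ω ^
(-δ)`. By the smallness condition on `ω` every pass halves the bound. -/
theorem IsBoundedModel.eq_zero (h : IsBoundedModel m μ lam B ω a) {v : ℝ → M} {C T : ℝ}
    (hv : HasGrowth 1 0 C v)
    (heq : ∀ t ∈ Ioc 0 T, v t = -fracInt (μ - ((m : ℝ) - 1)) (lowerTerm m lam a v) t) {t : ℝ}
    (ht : t ∈ Ioc 0 T) : v t = 0 := by
  have hω := h.isDelay.pos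
  have hC := hv.C_nonneg
  have hB : 0 ≤ B := (norm_nonneg _).trans (h.isDelay.bound 0)
  have key : ∀ n : ℕ, ∀ t ∈ Ioc 0 T, ‖v t‖ ≤ (1 / 2) ^ n * C * Real.exp (ω * t) := by
    intro n
    induction n with
    | zero =>
      intro t ht
      have h1 := hv.bound t ht.1.le
      rw [sub_self, Real.rpow_zero, zero_mul, Real.exp_zero, mul_one, mul_one] at h1
      have h2 : 1 ≤ Real.exp (ω * t) := Real.one_le_exp (by have := ht.1; positivity)
      rw [pow_zero, one_mul]
      nlinarith
    | succ n ih =>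
      intro t ht
      have h1 : ∀ s ∈ Ioc 0 t, ‖lowerTerm m lam a v s‖ ≤
          B * lam.real univ * ((1 / 2) ^ n * C) * Real.exp (ω * s) := fun s hs => by
        have h2 : ∀ b, 0 ≤ b → ‖fracCut v s b‖ ≤ (1 / 2) ^ n * C * Real.exp (ω * s) := by
          intro b hb
          rw [fracCut_of_nonneg v hs.1.le hb]
          refine (norm_fracInt_le_exp hb hω hs.1 (by positivity)
            fun r hr => ih r ⟨hr.1, hr.2.trans (hs.2.trans ht.2)⟩).trans ?_
          exact mul_le_of_le_one_right (by positivity)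
            (Real.rpow_le_one_of_one_le_of_nonpos h.isDelay.one_le (by linarith))
        exact (h.norm_lowerTerm_le h2).trans_eq (by ring)
      rw [heq t ht, norm_neg]
      refine (norm_fracInt_le_exp h.delay_pos.le hω ht.1 (by positivity) h1).trans ?_
      calc _ = B * lam.real univ * ω ^ (-(μ - ((m : ℝ) - 1))) *
            ((1 / 2) ^ n * C * Real.exp (ω * t)) := by ring
        _ ≤ 1 / 2 * ((1 / 2) ^ n * C * Real.exp (ω * t)) := by
          gcongr
          exact h.isDelay.small
        _ = _ := by rw [pow_succ]; ring
  have h2 : Tendsto (fun n : ℕ => (1 / 2 : ℝ) ^ n * C * Real.exp (ω * t)) atTop (𝓝 0) := by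
    have := ((tendsto_pow_atTop_nhds_zero_of_lt_one (r := (1 / 2 : ℝ)) (by norm_num)
      (by norm_num)).mul_const C).mul_const (Real.exp (ω * t))
    simpa using this
  exact norm_le_zero_iff.1 (ge_of_tendsto' h2 fun n => key n t ht)

end Volterra

/-! ### Inverting a fractional integral of a derivative -/

section Primitive

variable {X : Type*} [NormedAddCommGroup X] [NormedSpace ℂ X] [CompleteSpace X]

omit [CompleteSpace X] in
theorem HasGrowth.integrableOn_Ioc {c η C t : ℝ} {v : ℝ → X} (hv : HasGrowth c η C v) :
    IntegrableOn v (Ioc 0 t) := by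
  have h2 := hv.integrableOn one_pos (t + 1)
  refine (h2.mono_set (show Ioc 0 t ⊆ Ioi 0 from fun x hx => hx.1)).congr_fun (fun s hs => ?_)
    measurableSet_Ioc
  have : 0 < t + 1 - s := by linarith [hs.2]
  simp [rlKer_of_pos this]

theorem rlKer_one {s : ℝ} (hs : 0 < s) : rlKer 1 s = 1 := by simp [rlKer_of_pos hs]

/-- A primitive `p` of `w` with `J^γ w = z` satisfies `p = J^(1-γ) z`. -/
theorem eq_fracInt_of_fracInt_eq {p w z : ℝ → X} {T γ c η C : ℝ} (hp : ContinuousOn p (Icc 0 T))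
    (hp0 : p 0 = 0) (hd : ∀ t ∈ Ioo 0 T, HasDerivAt p (w t) t) (hw : ContinuousOn w (Ioi 0))
    (hγ : 0 ≤ γ) (hγ1 : γ < 1)
    (hi : 0 < γ → ∀ t, 0 < t → IntervalIntegrable (fun s => (t - s) ^ (γ - 1) • w s) volume 0 t)
    (hz : HasGrowth c η C z) (heq : ∀ t ∈ Ioc 0 T, fracInt γ w t = z t) {t : ℝ}
    (ht : t ∈ Ioc 0 T) : p t = fracInt (1 - γ) z t := by
  -- Integrability of `w` up to 0 is not given directly. For `γ > 0` it follows from convergence of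
  -- the fractional integral, since `(t - s) ^ (γ - 1)` is bounded below by `t ^ (γ - 1)`; for `γ =
  -- 0` the function `w` is `z`.
  have hwi : IntegrableOn w (Ioo 0 t) := by
    rcases hγ.eq_or_lt with rfl | hγ
    · refine IntegrableOn.congr_fun (hz.integrableOn_Ioc.mono_set Ioo_subset_Ioc_self)
        (fun s hs => ?_) measurableSet_Ioo
      rw [← heq s ⟨hs.1, hs.2.le.trans ht.2⟩, fracInt_zero]
    · have h1 := hi hγ t ht.1
      rw [intervalIntegrable_iff_integrableOn_Ioc_of_le ht.1.le,
        integrableOn_Ioc_iff_integrableOn_Ioo] at h1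
      refine Integrable.mono' (h1.norm.const_mul (t ^ (1 - γ)))
        ((hw.mono fun x hx => hx.1).aestronglyMeasurable measurableSet_Ioo) ?_
      filter_upwards [ae_restrict_mem measurableSet_Ioo] with s hs
      have hs' : 0 < t - s := sub_pos.2 hs.2
      rw [norm_smul, Real.norm_of_nonneg (by positivity), ← mul_assoc]
      refine le_mul_of_one_le_left (norm_nonneg _) ?_
      calc (1 : ℝ) = (t - s) ^ (1 - γ) * (t - s) ^ (γ - 1) := by
            rw [← Real.rpow_add hs']; simp
        _ ≤ _ := by
          gcongr
          linarith [hs.1]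
  have hwI : IntervalIntegrable w volume 0 t := by
    rwa [intervalIntegrable_iff_integrableOn_Ioc_of_le ht.1.le,
      integrableOn_Ioc_iff_integrableOn_Ioo]
  have h1 := intervalIntegral.integral_eq_sub_of_hasDerivAt_of_le ht.1.le
    (hp.mono fun x hx => ⟨hx.1, hx.2.trans ht.2⟩)
    (fun x hx => hd x ⟨hx.1, hx.2.trans_le ht.2⟩) hwI
  have h2 : p t = fracInt 1 w t := by
    rw [hp0, sub_zero] at h1
    rw [← h1, fracInt, if_neg one_ne_zero]
    simp
  have h3 := fracInt_fracInt (x := 1 - γ) (y := γ) (t := t) (v := w) (by linarith) hγ ht.1.le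
    (hw.aestronglyMeasurable measurableSet_Ioi) (by
      rw [sub_add_cancel]
      refine ((integrable_indicator_iff measurableSet_Ioo).2 hwi.norm).restrict.congr ?_
      filter_upwards [ae_restrict_mem measurableSet_Ioi] with s hs
      by_cases hst : s < t
      · rw [indicator_of_mem (show s ∈ Ioo 0 t from ⟨hs, hst⟩), rlKer_one (sub_pos.2 hst), one_mul]
      · rw [indicator_of_notMem fun h => hst h.2, rlKer_of_nonpos (by linarith), zero_mul])
  rw [h2, ← sub_add_cancel 1 γ, ← h3, sub_add_cancel]
  exact fracInt_congr ht.1 fun s hs => heq s ⟨hs.1, hs.2.trans ht.2⟩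

end Primitive

/-! ### Lifting the regularity of a solution to the spaces `E_σ` -/

section Uniqueness

variable {X : Type*} [NormedAddCommGroup X] [NormedSpace ℂ X] {A : X →ₗ.[ℂ] X}
  {G : Set ℂ} {k : ℕ} {u : ℝ → X}

theorem ExpContDiffOn.continuousOn_pos (hu : ExpContDiffOn A G k (Ioi 0) u) {j : ℕ} (hj : j ≤ k) :
    ContinuousOn (nthDeriv j u) (Ioi 0) := fun t ht => by
  have ht : 0 < t := ht
  obtain ⟨σ, hσ, hc, -⟩ := hu (t / 2) (2 * t) (by linarith) fun x hx => by
    have := hx.1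
    exact (by linarith : 0 < x)
  exact (((hc j hj).continuousOn fun p hp => (hσ p hp).2.1).continuousAt
    (Icc_mem_nhds (by linarith) (by linarith))).continuousWithinAt

theorem ExpContDiffOn.hasDerivAt (hu : ExpContDiffOn A G k (Ioi 0) u) {j : ℕ} (hj : j < k)
    {t : ℝ} (ht : 0 < t) : HasDerivAt (nthDeriv j u) (nthDeriv (j + 1) u t) t := by
  obtain ⟨σ, hσ, hc, hd⟩ := hu (t / 2) (2 * t) (by linarith) fun x hx => by
    have := hx.1
    exact (by linarith : 0 < x)
  have hσ' : ∀ p ∈ σ, 0 < p.2 := fun p hp => (hσ p hp).2.1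
  have hι := stepModel_stepEmb A hσ'
  obtain ⟨v, -, hv⟩ := hι.exists_lift (hc j hj.le)
  obtain ⟨v', -, hv'⟩ := hι.exists_lift (hc (j + 1) hj)
  have htJ : t ∈ Icc (t / 2) (2 * t) := ⟨by linarith, by linarith⟩
  have h1 := hι.hasDerivWithinAt hv hv' (hd j hj) htJ
  have h2 := (((stepEmb A σ).restrictScalars ℝ).hasFDerivAt (x := v t)).comp_hasDerivWithinAt t h1
  have h3 : HasDerivWithinAt (nthDeriv j u) (nthDeriv (j + 1) u t) (Icc (t / 2) (2 * t)) t := by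
    rw [hv' t htJ]
    exact h2.congr hv (hv t htJ)
  exact h3.hasDerivAt (Icc_mem_nhds (by linarith) (by linarith))

/-- Stated for every larger `σ'` so that two solutions can be lifted to a common space. -/
theorem ExpContDiffOn.exists_lift (hu : ExpContDiffOn A G k (Ici 0) u) {T : ℝ} (hT : 0 ≤ T) :
    ∃ σ : Finset (ℂ × ℝ), (∀ p ∈ σ, Admissible G p) ∧ ∀ σ', σ ⊆ σ' → (∀ p ∈ σ', Admissible G p) →
      ∃ U : ℕ → ℝ → StepQuot A σ', (∀ j ≤ k, Continuous (U j) ∧ (∃ C, HasGrowth 1 0 C (U j)) ∧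
        ∀ t ∈ Icc 0 T, nthDeriv j u t = stepEmb A σ' (U j t)) ∧
        ∀ j < k, ∀ t ∈ Icc 0 T, HasDerivWithinAt (U j) (U (j + 1) t) (Icc 0 T) t := by
  obtain ⟨σ, hσ, hc, hd⟩ := hu 0 T hT fun x hx => hx.1
  refine ⟨σ, hσ, fun σ' hσσ hσ' => ?_⟩
  have hpos : ∀ p ∈ σ', 0 < p.2 := fun p hp => (hσ' p hp).2.1
  have hι := stepModel_stepEmb A hpos
  have h1 : ∀ j, ∃ U : ℝ → StepQuot A σ', j ≤ k → (Continuous U ∧ (∃ C, HasGrowth 1 0 C U) ∧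
      ∀ t ∈ Icc 0 T, nthDeriv j u t = stepEmb A σ' (U t)) := fun j => by
    by_cases hj : j ≤ k
    · obtain ⟨v, hv, hv'⟩ := hι.exists_lift ((hc j hj).mono hσσ hpos)
      obtain ⟨w, C, hwc, hw, hwg⟩ := exists_continuous_extension hT hv
      exact ⟨w, fun _ => ⟨hwc, ⟨C, hwg⟩, fun t ht => by rw [hv' t ht, hw t ht]⟩⟩
    · exact ⟨0, fun h => absurd h hj⟩
  choose U hU using h1
  exact ⟨U, hU, fun j hj t ht => hι.hasDerivWithinAt (hU j hj.le).2.2 (hU (j + 1) hj).2.2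
    ((hd j hj).mono hσσ hpos (hc j hj.le) (hc (j + 1) hj)) ht⟩

end Uniqueness

/-! ### Uniqueness of the solution -/

section UniqueSolution

variable {X : Type*} [NormedAddCommGroup X] [NormedSpace ℂ X] [CompleteSpace X] {A : X →ₗ.[ℂ] X}
  {G : Set ℂ} {m : ℕ} {μ : ℝ} {lam : Measure ℝ} [IsFiniteMeasure lam] {f : ℝ → ℂ → ℂ}
  {φ : Fin m → X} {s u₁ u₂ : ℝ → X}

theorem ceil_order (hμ : (m : ℝ) - 1 < μ) (hm : 1 ≤ m) (hμm : μ ≤ m) : ⌈μ⌉₊ = m := by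
  rw [Nat.ceil_eq_iff (by omega), Nat.cast_sub hm, Nat.cast_one]
  exact ⟨hμ, hμm⟩

omit [NormedSpace ℂ X] [CompleteSpace X] in
theorem hasGrowth_sub {v w : ℝ → X} {C C' : ℝ} (hv : HasGrowth 1 0 C v) (hw : HasGrowth 1 0 C' w) :
    HasGrowth 1 0 (C + C') fun t => v t - w t where
  meas := hv.meas.sub hw.meas
  c_pos := one_pos
  c_le := le_rfl
  η_nonneg := le_rfl
  C_nonneg := add_nonneg hv.C_nonneg hw.C_nonneg
  bound t ht := (norm_sub_le _ _).trans ((add_le_add (hv.bound t ht) (hw.bound t ht)).trans_eq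
    (by ring))

omit [CompleteSpace X] in
theorem HasGrowth.map {M : Type*} [NormedAddCommGroup M] [NormedSpace ℂ M] {c η C : ℝ} {v : ℝ → M}
    (hv : HasGrowth c η C v) (j : M →L[ℂ] X) : HasGrowth c η (‖j‖ * C) fun t => j (v t) where
  meas := j.continuous.comp_stronglyMeasurable hv.meas
  c_pos := hv.c_pos
  c_le := hv.c_le
  η_nonneg := hv.η_nonneg
  C_nonneg := mul_nonneg (norm_nonneg _) hv.C_nonneg
  bound t ht := by
    rw [mul_assoc, mul_assoc, ← mul_assoc C]
    exact j.le_opNorm_of_le (hv.bound t ht)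

/-- With vanishing initial values the lower derivatives are the iterated integrals of the highest
one. -/
theorem fracInt_eq_of_hasDerivWithinAt {v : ℝ → X} {T : ℝ} {V : ℕ → ℝ → X} {n : ℕ} {C : ℝ}
    (hv : HasGrowth 1 0 C v) (hn : V n = v) (hc : ∀ j ≤ n, Continuous (V j))
    (hV0 : ∀ j ≤ n, V j 0 = 0)
    (hd : ∀ j < n, ∀ t ∈ Icc 0 T, HasDerivWithinAt (V j) (V (j + 1) t) (Icc 0 T) t) :
    ∀ i ≤ n, ∀ t ∈ Icc 0 T, V (n - i) t = fracInt i v t := by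
  intro i
  induction i with
  | zero => intro _ t _; rw [Nat.sub_zero, hn, Nat.cast_zero, fracInt_zero]
  | succ i ih =>
    intro hi t ht
    have hi' : (0 : ℝ) < (i + 1 : ℕ) := by positivity
    rcases ht.1.eq_or_lt with rfl | ht0
    · rw [hV0 _ (Nat.sub_le _ _), fracInt_apply_zero hi']
    have e : n - (i + 1) + 1 = n - i := by omega
    have h1 := intervalIntegral.integral_eq_sub_of_hasDerivAt_of_le ht.1
      (hc (n - (i + 1)) (Nat.sub_le _ _)).continuousOn (f' := V (n - i)) (fun x hx => by
        have := hd (n - (i + 1)) (by omega) x ⟨hx.1.le, hx.2.le.trans ht.2⟩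
        rw [e] at this
        exact this.hasDerivAt (Icc_mem_nhds hx.1 (hx.2.trans_le ht.2)))
      ((hc (n - i) (Nat.sub_le _ _)).intervalIntegrable 0 t)
    rw [hV0 _ (Nat.sub_le _ _), sub_zero] at h1
    have h2 : V (n - (i + 1)) t = fracInt 1 (V (n - i)) t := by
      rw [← h1, fracInt, if_neg one_ne_zero]
      simp
    rw [h2, fracInt_congr (w := fracInt i v) ht0 fun r hr => ih (by omega) r
      ⟨hr.1.le, hr.2.trans ht.2⟩, hv.fracInt_fracInt zero_le_one i.cast_nonneg ht.1]
    congr 1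
    push_cast; ring

-- Subtracting the top order terms needs convergence of both integrals, which `caputo_top` provides,
-- because a divergent integral would count as 0.
omit [CompleteSpace X] [IsFiniteMeasure lam] in
theorem IsSolution.fracInt_sub (h : IsEquation G m μ lam f)
    (h₁ : IsSolution A G m μ lam f φ s u₁) (h₂ : IsSolution A G m μ lam f φ s u₂) {t : ℝ}
    (ht : 0 < t) : fracInt ((m : ℝ) - μ) (fun r => nthDeriv m u₁ r - nthDeriv m u₂ r) t =
      caputo μ u₁ t - caputo μ u₂ t := by
  rw [caputo, caputo, ceil_order h.lt h.one_le h.le]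
  rcases h.le.eq_or_lt with hμ | hμ
  · rw [hμ, sub_self, fracInt_zero, fracInt_zero, fracInt_zero]
  · rw [fracInt, fracInt, fracInt, if_neg (sub_pos.2 hμ).ne', if_neg (sub_pos.2 hμ).ne',
      if_neg (sub_pos.2 hμ).ne', ← smul_sub,
      ← intervalIntegral.integral_sub (h₁.caputo_top hμ t ht) (h₂.caputo_top hμ t ht)]
    simp only [smul_sub]

/-- With `n = m - 1`, the derivative of order `α` of a difference with zero initial values is
`J^(n-α)` of its `n`-th derivative. -/
theorem caputo_sub {σ : Finset (ℂ × ℝ)} [CompleteSpace (StepQuot A σ)] {T : ℝ} {n : ℕ}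
    {U₁ U₂ : ℕ → ℝ → StepQuot A σ} {v : ℝ → StepQuot A σ} {C : ℝ} (hv : HasGrowth 1 0 C v)
    (hU₁ : ∀ j ≤ n, Continuous (U₁ j) ∧ (∃ C, HasGrowth 1 0 C (U₁ j)) ∧
      ∀ t ∈ Icc 0 T, nthDeriv j u₁ t = stepEmb A σ (U₁ j t))
    (hU₂ : ∀ j ≤ n, Continuous (U₂ j) ∧ (∃ C, HasGrowth 1 0 C (U₂ j)) ∧
      ∀ t ∈ Icc 0 T, nthDeriv j u₂ t = stepEmb A σ (U₂ j t))
    (hJ : ∀ i ≤ n, ∀ t ∈ Icc 0 T, U₁ (n - i) t - U₂ (n - i) t = fracInt i v t)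
    {α : ℝ} (hα : α ∈ Icc (0 : ℝ) n) {t : ℝ} (ht : t ∈ Ioc 0 T) :
    ∃ e₁ e₂ : StepQuot A σ, caputo α u₁ t = stepEmb A σ e₁ ∧ caputo α u₂ t = stepEmb A σ e₂ ∧
      e₁ - e₂ = fracCut v t (n - α) := by
  have hn : ⌈α⌉₊ ≤ n := Nat.ceil_le.2 hα.2
  have hx : 0 ≤ (⌈α⌉₊ : ℝ) - α := sub_nonneg.2 (Nat.le_ceil α)
  obtain ⟨-, ⟨C₁, hg₁⟩, hu₁⟩ := hU₁ _ hn
  obtain ⟨-, ⟨C₂, hg₂⟩, hu₂⟩ := hU₂ _ hn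
  refine ⟨fracInt (⌈α⌉₊ - α) (U₁ ⌈α⌉₊) t, fracInt (⌈α⌉₊ - α) (U₂ ⌈α⌉₊) t, ?_, ?_, ?_⟩
  · rw [caputo, map_fracInt _ hg₁.fracIntegrable hx ht.1.le]
    exact fracInt_congr ht.1 fun r hr => hu₁ r ⟨hr.1.le, hr.2.trans ht.2⟩
  · rw [caputo, map_fracInt _ hg₂.fracIntegrable hx ht.1.le]
    exact fracInt_congr ht.1 fun r hr => hu₂ r ⟨hr.1.le, hr.2.trans ht.2⟩
  · have e : n - (n - ⌈α⌉₊) = ⌈α⌉₊ := by omega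
    rw [← hg₁.fracIntegrable.fracInt_sub hg₂.fracIntegrable hx ht.1.le,
      fracCut_of_nonneg v ht.1.le (sub_nonneg.2 hα.2),
      fracInt_congr (w := fracInt (n - ⌈α⌉₊ : ℕ) v) ht.1 fun r hr => by
        have := hJ (n - ⌈α⌉₊) (Nat.sub_le _ _) r ⟨hr.1.le, hr.2.trans ht.2⟩
        rwa [e] at this,
      hv.fracInt_fracInt hx (Nat.cast_nonneg _) ht.1.le, Nat.cast_sub hn]
    congr 1; ring

theorem IsSolution.eqOn (h : IsEquation G m μ lam f) (hA : A.IsClosed)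
    (hAG : NoEigenfieldOnHoles A G) (h₁ : IsSolution A G m μ lam f φ s u₁)
    (h₂ : IsSolution A G m μ lam f φ s u₂) : EqOn u₁ u₂ (Ici 0) := by
  classical
  intro T hT
  have hT : 0 ≤ T := hT
  have hm := h.one_le
  have hm1 : ((m - 1 : ℕ) : ℝ) = (m : ℝ) - 1 := by rw [Nat.cast_sub hm, Nat.cast_one]
  obtain ⟨σ₁, hσ₁, hl₁⟩ := h₁.contDiff_nonneg.exists_lift hT
  obtain ⟨σ₂, hσ₂, hl₂⟩ := h₂.contDiff_nonneg.exists_lift hT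
  obtain ⟨σ, hσ12⟩ : ∃ σ, σ = σ₁ ∪ σ₂ := ⟨_, rfl⟩
  have hσ : ∀ p ∈ σ, Admissible G p := fun p hp => by
    rw [hσ12] at hp
    exact (Finset.mem_union.1 hp).elim (hσ₁ p) (hσ₂ p)
  obtain ⟨U₁, hU₁, hd₁⟩ := hl₁ σ (hσ12 ▸ Finset.subset_union_left) hσ
  obtain ⟨U₂, hU₂, hd₂⟩ := hl₂ σ (hσ12 ▸ Finset.subset_union_right) hσ
  have := completeSpace_stepQuot hA σ
  obtain ⟨B, ω, hM⟩ := h.exists_isBoundedModel hA hAG hσ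
  have h0T : (0 : ℝ) ∈ Icc 0 T := ⟨le_rfl, hT⟩
  set V : ℕ → ℝ → StepQuot A σ := fun j r => U₁ j r - U₂ j r with hVdef
  have hV0 : ∀ j ≤ m - 1, V j 0 = 0 := fun j hj => by
    refine stepEmb_injective A σ ?_
    have hjm : j < m := by omega
    rw [map_zero, map_sub, ← (hU₁ j hj).2.2 0 h0T, ← (hU₂ j hj).2.2 0 h0T,
      h₁.initial ⟨j, hjm⟩, h₂.initial ⟨j, hjm⟩, sub_self]
  obtain ⟨C₁, hg₁⟩ := (hU₁ (m - 1) le_rfl).2.1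
  obtain ⟨C₂, hg₂⟩ := (hU₂ (m - 1) le_rfl).2.1
  have hv : HasGrowth 1 0 (C₁ + C₂) (V (m - 1)) := hasGrowth_sub hg₁ hg₂
  have hJ := fracInt_eq_of_hasDerivWithinAt (T := T) hv rfl
    (fun j hj => (hU₁ j hj).1.sub (hU₂ j hj).1) hV0
    fun j hj t ht => (hd₁ j hj t ht).sub (hd₂ j hj t ht)
  set v := V (m - 1) with hvdef
  have hy := hM.hasGrowth_lowerTerm hv
  -- Subtracting the two equations removes the source and leaves the lower order terms, expressed
  -- through `v`.
  have heq : ∀ t ∈ Ioc 0 T,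
      fracInt ((m : ℝ) - μ) (fun r => nthDeriv m u₁ r - nthDeriv m u₂ r) t =
        (-stepEmb A σ) (lowerTerm m lam (stepCoef A σ m f) v t) := fun t ht => by
    rw [IsSolution.fracInt_sub h h₁ h₂ ht.1, eq_sub_of_add_eq (h₁.equation t ht.1),
      eq_sub_of_add_eq (h₂.equation t ht.1), sub_sub_sub_cancel_left,
      ← integral_sub (h₂.integrable t ht.1) (h₁.integrable t ht.1)]
    have hi : Integrable (fun α => stepCoef A σ m f α (fracCut v t ((m : ℝ) - 1 - α))) lam := by
      refine Integrable.of_bound (C := B * growthWeight 1 0 (C₁ + C₂) 1 t)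
        (stronglyMeasurable_clm_apply hM.isDelay.meas ((hv.stronglyMeasurable_fracCut_apply
          t).comp_measurable (measurable_const.sub measurable_id))).aestronglyMeasurable
        (Eventually.of_forall fun α => ?_)
      have := hv.norm_fracCut_le one_pos t ((m : ℝ) - 1 - α)
      rw [Real.one_rpow, mul_one] at this
      exact ContinuousLinearMap.le_of_opNorm_le_of_le _ (hM.isDelay.bound α) this
    rw [lowerTerm, ← (-stepEmb A σ).integral_comp_comm hi]
    refine integral_congr_ae ?_
    filter_upwards [h.ae_mem] with α hα
    rw [← hm1] at hα
    obtain ⟨e₁, e₂, he₁, he₂, he⟩ := caputo_sub hv hU₁ hU₂ hJ hα ht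
    rw [hm1] at hα he
    rw [he₁, he₂, funCalc_clampCoef h hA hAG hσ hα, funCalc_clampCoef h hA hAG hσ hα, ← he,
      neg_apply, map_sub, map_sub, neg_sub]
  have hzero : ∀ t ∈ Ioc 0 T, v t = 0 := fun t ht => by
    refine hM.eq_zero hv (fun t ht => stepEmb_injective A σ ?_) ht
    have hδ : 1 - ((m : ℝ) - μ) = μ - ((m : ℝ) - 1) := by ring
    have hu : ∀ r ∈ Icc 0 T, stepEmb A σ (v r) = nthDeriv (m - 1) u₁ r - nthDeriv (m - 1) u₂ r :=
      fun r hr => by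
        rw [(hU₁ _ le_rfl).2.2 r hr, (hU₂ _ le_rfl).2.2 r hr, ← map_sub]
    have hm' : m - 1 < m := by omega
    have e : m - 1 + 1 = m := by omega
    have hvc : Continuous v := (hU₁ _ le_rfl).1.sub (hU₂ _ le_rfl).1
    -- The `m`-th derivatives are controlled only for `t > 0`, so this step works in `X` with `v` as
    -- their primitive. It turns the equation into `v = -J^δ (lowerTerm v)`, which is pulled back to
    -- `E_σ` by injectivity of the embedding.
    have key := eq_fracInt_of_fracInt_eq (p := fun r => stepEmb A σ (v r)) (T := T)
      (w := fun r => nthDeriv m u₁ r - nthDeriv m u₂ r) (γ := (m : ℝ) - μ)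
      ((stepEmb A σ).continuous.comp hvc).continuousOn (by rw [hvdef, hV0 _ le_rfl, map_zero])
      (fun r hr => ?_)
      ((h₁.contDiff_pos.continuousOn_pos le_rfl).sub (h₂.contDiff_pos.continuousOn_pos le_rfl))
      (by linarith [h.le]) (by linarith [h.lt])
      (fun hγ r hr => ?_) (hy.map (-stepEmb A σ)) heq ht
    · rw [map_neg, key, ← map_fracInt _ hy.fracIntegrable (by linarith [h.lt]) ht.1.le, hδ]
      rfl
    · have d₁ := h₁.contDiff_pos.hasDerivAt hm' hr.1
      have d₂ := h₂.contDiff_pos.hasDerivAt hm' hr.1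
      rw [e] at d₁ d₂
      refine (d₁.sub d₂).congr_of_eventuallyEq ?_
      filter_upwards [Ioo_mem_nhds hr.1 hr.2] with q hq
      exact hu q ⟨hq.1.le, hq.2.le⟩
    · have i₁ := h₁.caputo_top (sub_pos.1 hγ) r hr
      have i₂ := h₂.caputo_top (sub_pos.1 hγ) r hr
      simp only [smul_sub]
      exact i₁.sub i₂
  have hfin : V 0 T = 0 := by
    rcases hT.eq_or_lt with rfl | hT
    · exact hV0 0 (Nat.zero_le _)
    · have h3 := hJ (m - 1) le_rfl T ⟨hT.le, le_rfl⟩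
      rw [Nat.sub_self] at h3
      have h4 : fracInt ((m - 1 : ℕ) : ℝ) v T = fracInt ((m - 1 : ℕ) : ℝ) (fun _ => 0) T :=
        fracInt_congr hT fun r hr => hzero r hr
      rw [h3, h4, fracInt_const (Nat.cast_nonneg _) hT, smul_zero]
  have h6 : u₁ T - u₂ T = 0 := by
    have a₁ := (hU₁ 0 (Nat.zero_le _)).2.2 T ⟨hT, le_rfl⟩
    have a₂ := (hU₂ 0 (Nat.zero_le _)).2.2 T ⟨hT, le_rfl⟩
    rw [nthDeriv_zero] at a₁ a₂
    rw [a₁, a₂, ← map_sub, show U₁ 0 T - U₂ 0 T = V 0 T from rfl, hfin, map_zero]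
  exact sub_eq_zero.1 h6

end UniqueSolution

end FracDuhamel

end

theorem mainTheorem2 {X : Type*} [NormedAddCommGroup X] [NormedSpace ℂ X] [CompleteSpace X]
    (A : X →ₗ.[ℂ] X) (hA : A.IsClosed)
    (G : Set ℂ) (hG : IsOpen G) (hAG : FracDuhamel.NoEigenfieldOnHoles A G)
    (m : ℕ) (hm : 1 ≤ m) (μ : ℝ) (hμ : (m : ℝ) - 1 < μ) (hμm : μ ≤ m)
    (lam : Measure ℝ) [IsFiniteMeasure lam] (hlam : lam (Icc 0 ((m : ℝ) - 1))ᶜ = 0)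
    (f : ℝ → ℂ → ℂ)
    (hf_cont : ContinuousOn (fun p : ℝ × ℂ => f p.1 p.2) (Icc 0 ((m : ℝ) - 1) ×ˢ G))
    (hf_an : ∀ α ∈ Icc (0 : ℝ) ((m : ℝ) - 1), AnalyticOnNhd ℂ (f α) G)
    (φ : Fin m → X) (hφ : ∀ k, φ k ∈ FracDuhamel.ExpSpace A G)
    (h : ℝ → X) (hh : ∀ T : ℝ, 0 < T → FracDuhamel.ExpAbsContOn A G T h)
    (hh_diff : μ < m →
      DifferentiableOn ℝ (FracDuhamel.fracInt (1 - ((m : ℝ) - μ)) h) (Ioi 0))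
    (hh_cont : FracDuhamel.ExpContDiffOn A G 0 (Ici 0)
      (FracDuhamel.riemannLiouville ((m : ℝ) - μ) h)) :
    -- the symbols are well defined and analytic
    (∀ k : Fin m, ∀ z ∈ G,
      (∃ c, FracDuhamel.IsInverseLaplace
        (FracDuhamel.resolventSymbol μ lam f (μ - k - 1) z) c) ∧
      (∀ α ∈ Ioc (k : ℝ) ((m : ℝ) - 1), ∃ c, FracDuhamel.IsInverseLaplace
        (FracDuhamel.resolventSymbol μ lam f (α - k - 1) z) c) ∧
      (∀ t : ℝ, 0 ≤ t → IntegrableOn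
        (fun α => f α z * FracDuhamel.cSymbol μ lam f (α - k - 1) t z)
        (Ioc (k : ℝ) ((m : ℝ) - 1)) lam)) ∧
    (∀ k : Fin m, ∀ t : ℝ, 0 ≤ t →
      AnalyticOnNhd ℂ (FracDuhamel.solSymbol m μ lam f k t) G) ∧
    -- the integral in the representation formula converges
    (∀ t : ℝ, 0 ≤ t → IntervalIntegrable
      (fun τ => FracDuhamel.solOp A G m μ lam f (m - 1) (t - τ)
        (FracDuhamel.riemannLiouville ((m : ℝ) - μ) h τ)) volume 0 t) ∧
    -- the representation formula gives a solution, and it is the only one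
    FracDuhamel.IsSolution A G m μ lam f φ h (FracDuhamel.duhamelSol A G m μ lam f φ h) ∧
    ∀ u : ℝ → X, FracDuhamel.IsSolution A G m μ lam f φ h u →
      EqOn u (FracDuhamel.duhamelSol A G m μ lam f φ h) (Ici 0) := by
  have heq : FracDuhamel.IsEquation G m μ lam f := ⟨hG, hm, hμ, hμm, hlam, hf_cont, hf_an⟩
  have hsol := heq.isSolution_duhamelSol hA hAG hφ hh_cont fun t ht =>
    FracDuhamel.fracInt_riemannLiouville (by linarith) (by linarith) hh
      (fun hγ => hh_diff (sub_pos.1 hγ)) hh_cont ht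
  refine ⟨fun k z hz => ⟨⟨_, heq.isInverseLaplace hz k.1.cast_nonneg⟩, fun α hα => ?_,
    fun t ht => heq.integrableOn_cSymbol hz k ht⟩,
    fun k t ht => heq.analyticOnNhd_solSymbol k.2 ht, fun t ht => ?_, hsol,
    fun u hu => hu.eqOn heq hA hAG hsol⟩
  -- The symbol with index `α - k - 1` is the resolvent function of order `x = k + μ - α`, which is
  -- nonnegative since `α ≤ m - 1 < μ`.
  · have hx : (0 : ℝ) ≤ k + μ - α := by
      have : (0 : ℝ) ≤ (k : ℕ) := Nat.cast_nonneg _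
      linarith [hα.2]
    have he : α - k - 1 = μ - (k + μ - α) - 1 := by ring
    rw [he]
    exact ⟨_, heq.isInverseLaplace hz hx⟩
  · obtain ⟨σ, B, ω, C, φ', H', D⟩ := heq.exists_isLocalData hA hAG hφ hh_cont ht
    exact (D.duhamelSol_eq ⟨ht, le_rfl⟩).1
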